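/- **Lemma 2.3 (blow-up criterion in the $w$ variable).** Let $N\ge 1$ be an integer, $1<p$, with $p<1+\frac4{N-1}$ if $N\ge2$, $0\le q<p$ and $M>0$. Let $B$ be the open unit ball of $\mathbb R^N$, $\alpha=\frac2{p-1}-\frac{N-1}2>0$, $\rho(y)=(1-|y|^2)^\alpha$, $\gamma=\min(\frac12,\frac{p-q}{p-1})$, and $$\mathcal H=\Big\{(w_1,w_2):\ \int_B\big(w_2^2+|\nabla w_1|^2(1-|y|^2)+w_1^2\big)\rho\,dy<\infty\Big\}.$$ For locally Lipschitz $f,g:\mathbb R\to\mathbb R$ with $|f(x)|\le M(1+|x|^q)$ and $|g(x)|\le M(1+|x|)$, consider on $B$ the equation $$w_{ss}=\tfrac1\rho\operatorname{div}\big(\rho\nabla w-\rho(y\cdot\nabla w)y\big)-\tfrac{2p+2}{(p-1)^2}w+|w|^{p-1}w-\tfrac{p+3}{p-1}w_s-2y\cdot\nabla w_s+e^{-\frac{2ps}{p-1}}f\big(e^{\frac{2s}{p-1}}w\big)+e^{-\frac{2ps}{p-1}}g\Big(e^{\frac{(p+1)s}{p-1}}\big(w_s+y\cdot\nabla w+\tfrac2{p-1}w\big)\Big).\tag{1.8}$$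 A solution of (1.8) on $[s_0,T)$ is a $w$ with $(w,w_s)\in C([s_0,T),\mathcal H)$ which satisfies (1.8) in the weak sense (tested against $\rho\psi$, $\psi\in C_c^\infty(B)$, and integrated over arbitrary time intervals $[a,b]\subset[s_0,T)$) and for which $|w|^p\in L^1([s_0,b],L^2(\{|y|<r\}))$ for all $b<T$, $r<1$. With $F(x)=\int_0^xf$ and $\theta\in\mathbb R$ put $$H(w(s))=\big(E_0(w)+I(w)+J(w)\big)\,e^{\frac{p+3}{2\gamma}e^{-\gamma s}}+\theta e^{-2\gamma s},$$ $$E_0(w)=\int_B\Big(\tfrac12w_s^2+\tfrac12|\nabla w|^2-\tfrac12(y\cdot\nabla w)^2+\tfrac{p+1}{(p-1)^2}w^2-\tfrac1{p+1}|w|^{p+1}\Big)\rho\,dy,$$ $$I(w)=-e^{-\frac{2(p+1)s}{p-1}}\int_BF\big(e^{\frac{2s}{p-1}}w\big)\rho\,dy,\qquad J(w)=-e^{-\gamma s}\int_Bww_s\,\rho\,dy.$$ There is $\theta_0=\theta_0(N,p,q,M)$ such that for every $S_0\in\mathbb R$ there is $S_3=S_3(N,p,q,M,S_0)\ge S_0$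 with the following property, for every $\theta\ge\theta_0$ and all $f,g$ as above. Let $s_0<T$ be real and let $w$ be a solution of (1.8) on $[s_0,T)$ such that $\|w(s)\|_{L^{p+1}(B)}$ is locally bounded on $[s_0,T)$. If for some $s_3\in[\max(S_3,s_0),T)$ the integral $E_0(w(s_3))$ converges and $H(w(s_3))<0$, then $w$ blows up in some finite time $S>s_3$: the supremum $S$ of all $T'\ge T$ such that $w$ extends to a solution of (1.8) on $[s_0,T')$ with locally bounded $L^{p+1}(B)$ norm is finite, and $S>s_3$. (In particular, no such solution with $H(w(s_3))<0$ is defined on all of $[s_0,\infty)$.) -/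

import Mathlib

open MeasureTheory Set Filter Topology
open scoped ContDiff

noncomputable section

/-- The space `ℝ^N` with its Euclidean norm. -/
abbrev Eucl (N : ℕ) : Type := EuclideanSpace ℝ (Fin N)

/-- The open unit ball `B` of `ℝ^N`. -/
def unitBall (N : ℕ) : Set (Eucl N) := Metric.ball 0 1

/-- `α = 2/(p-1) - (N-1)/2`. -/
def wAlpha (N : ℕ) (p : ℝ) : ℝ := 2 / (p - 1) - ((N : ℝ) - 1) / 2

/-- The weight `ρ(y) = (1 - |y|²)^α`. -/
def wRho (N : ℕ) (p : ℝ) (y : Eucl N) : ℝ := (1 - ‖y‖ ^ 2) ^ wAlpha N p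

/-- `γ = min(1/2, (p-q)/(p-1))`. -/
def wGamma (p q : ℝ) : ℝ := min (1 / 2) ((p - q) / (p - 1))

/-- Test functions: smooth, with compact support contained in the open unit ball. -/
def IsTestFun (N : ℕ) (ψ : Eucl N → ℝ) : Prop :=
  ContDiff ℝ ∞ ψ ∧ HasCompactSupport ψ ∧ tsupport ψ ⊆ unitBall N

/-- `G` is the weak (distributional) gradient of `u` in the unit ball. -/
def HasWeakGrad (N : ℕ) (u : Eucl N → ℝ) (G : Eucl N → Eucl N) : Prop :=
  LocallyIntegrableOn u (unitBall N) ∧ LocallyIntegrableOn G (unitBall N) ∧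
    ∀ ψ : Eucl N → ℝ, IsTestFun N ψ →
      ∫ y in unitBall N, u y • gradient ψ y = -∫ y in unitBall N, ψ y • G y

open Classical in
/-- The weak gradient `∇u` in the unit ball (unique up to null sets; `0` if there is none). -/
def weakGrad (N : ℕ) (u : Eucl N → ℝ) : Eucl N → Eucl N :=
  if h : ∃ G, HasWeakGrad N u G then h.choose else 0

/-- The integrand `(w₂² + |∇w₁|² (1 - |y|²) + w₁²) ρ` of the squared norm of `ℋ`. -/
def hDensity (N : ℕ) (p : ℝ) (w₁ w₂ : Eucl N → ℝ) (y : Eucl N) : ℝ :=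
  (w₂ y ^ 2 + ‖weakGrad N w₁ y‖ ^ 2 * (1 - ‖y‖ ^ 2) + w₁ y ^ 2) * wRho N p y

/-- `(w₁, w₂) ∈ ℋ`. -/
def MemH (N : ℕ) (p : ℝ) (w₁ w₂ : Eucl N → ℝ) : Prop :=
  AEStronglyMeasurable w₁ (volume.restrict (unitBall N)) ∧
  AEStronglyMeasurable w₂ (volume.restrict (unitBall N)) ∧
  (∃ G, HasWeakGrad N w₁ G) ∧
  IntegrableOn (hDensity N p w₁ w₂) (unitBall N)

/-- The squared norm of `ℋ`. -/
def hNormSq (N : ℕ) (p : ℝ) (w₁ w₂ : Eucl N → ℝ) : ℝ :=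
  ∫ y in unitBall N, hDensity N p w₁ w₂ y

/-- `(w, v) ∈ C([s₀, T), ℋ)`. -/
def ContInH (N : ℕ) (p s₀ T : ℝ) (w v : ℝ → Eucl N → ℝ) : Prop :=
  ∀ s ∈ Ico s₀ T, MemH N p (w s) (v s) ∧
    Tendsto (fun s' => hNormSq N p (w s' - w s) (v s' - v s)) (𝓝[Ico s₀ T] s) (𝓝 0)

/-- The perturbation terms
`e^{-2ps/(p-1)} f(e^{2s/(p-1)} w) + e^{-2ps/(p-1)} g(e^{(p+1)s/(p-1)} (w_s + y·∇w + 2w/(p-1)))`,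
with `v` in the role of `w_s`. -/
def perturbation (N : ℕ) (p : ℝ) (f g : ℝ → ℝ) (s : ℝ) (w v : Eucl N → ℝ) (y : Eucl N) : ℝ :=
  Real.exp (-(2 * p * s / (p - 1))) * f (Real.exp (2 * s / (p - 1)) * w y) +
  Real.exp (-(2 * p * s / (p - 1))) *
    g (Real.exp ((p + 1) * s / (p - 1)) *
      (v y + inner ℝ y (weakGrad N w y) + 2 / (p - 1) * w y))

/-- The right-hand side of the equation for `w_ss`, multiplied by `ρ ψ` and integrated over `B`.
The two terms with derivatives, `(1/ρ) div(ρ∇w - ρ(y·∇w)y)` and `-2 y·∇v`, are integrated by parts: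
`∫ -2 (y·∇v) ρψ = 2 ∫ v div(ρψ y) = 2 ∫ v (N ρψ + y·∇(ρψ))`. -/
def weakRHS (N : ℕ) (p : ℝ) (f g : ℝ → ℝ) (s : ℝ) (w v ψ : Eucl N → ℝ) : ℝ :=
  ∫ y in unitBall N,
    (-(wRho N p y * (inner ℝ (weakGrad N w y) (gradient ψ y)
        - inner ℝ y (weakGrad N w y) * inner ℝ y (gradient ψ y)))
      + (-((2 * p + 2) / (p - 1) ^ 2) * w y + |w y| ^ (p - 1) * w y
          - (p + 3) / (p - 1) * v y + perturbation N p f g s w v y) * wRho N p y * ψ y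
      + 2 * v y * ((N : ℝ) * (wRho N p y * ψ y)
          + inner ℝ y (gradient (fun z => wRho N p z * ψ z) y)))

/-- `w`, with `v = w_s`, is a (weak, finite energy) solution on `B × [s₀, T)`. -/
structure IsSolution (N : ℕ) (p : ℝ) (f g : ℝ → ℝ) (s₀ T : ℝ) (w v : ℝ → Eucl N → ℝ) :
    Prop where
  /-- `(w, w_s) ∈ C([s₀, T), ℋ)` -/
  cont : ContInH N p s₀ T w v
  /-- the nonlinear term `|w|^p` is locally in `L¹_s L²_y` -/
  nonlin : ∀ b < T, ∀ r < (1 : ℝ),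
    ∫⁻ s in Icc s₀ b, eLpNorm (fun y => |w s y| ^ p) 2
      (volume.restrict (Metric.ball (0 : Eucl N) r)) < ⊤
  /-- `w_s = v` weakly -/
  deriv_eq : ∀ ψ, IsTestFun N ψ → ∀ a b, s₀ ≤ a → a ≤ b → b < T →
    (∫ y in unitBall N, w b y * ψ y) - (∫ y in unitBall N, w a y * ψ y) =
      ∫ s in a..b, ∫ y in unitBall N, v s y * ψ y
  /-- the equation holds weakly -/
  eqn : ∀ ψ, IsTestFun N ψ → ∀ a b, s₀ ≤ a → a ≤ b → b < T →
    (∫ y in unitBall N, v b y * wRho N p y * ψ y)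
        - (∫ y in unitBall N, v a y * wRho N p y * ψ y) =
      ∫ s in a..b, weakRHS N p f g s (w s) (v s) ψ

/-- `‖w(s)‖_{L^{p+1}(B)}` is locally bounded on `[s₀, T)`. -/
def LocBddLp (N : ℕ) (p s₀ T : ℝ) (w : ℝ → Eucl N → ℝ) : Prop :=
  ∀ b < T, ∃ C : NNReal, ∀ s ∈ Icc s₀ b,
    eLpNorm (w s) (ENNReal.ofReal (p + 1)) (volume.restrict (unitBall N)) ≤ C

/-- The integrand of `E₀`. -/
def e0Density (N : ℕ) (p : ℝ) (w v : Eucl N → ℝ) (y : Eucl N) : ℝ :=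
  (1 / 2 * v y ^ 2 + 1 / 2 * ‖weakGrad N w y‖ ^ 2 - 1 / 2 * (inner ℝ y (weakGrad N w y)) ^ 2
    + (p + 1) / (p - 1) ^ 2 * w y ^ 2 - 1 / (p + 1) * |w y| ^ (p + 1)) * wRho N p y

/-- The unperturbed energy `E₀(w)`, with `v = w_s`. -/
def E0 (N : ℕ) (p : ℝ) (w v : Eucl N → ℝ) : ℝ :=
  ∫ y in unitBall N, e0Density N p w v y

/-- `I(w) = -e^{-2(p+1)s/(p-1)} ∫_B F(e^{2s/(p-1)} w) ρ`, where `F(x) = ∫_0^x f`. -/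
def energyI (N : ℕ) (p : ℝ) (f : ℝ → ℝ) (s : ℝ) (w : Eucl N → ℝ) : ℝ :=
  -Real.exp (-(2 * (p + 1) * s / (p - 1))) *
    ∫ y in unitBall N, (∫ x in (0 : ℝ)..(Real.exp (2 * s / (p - 1)) * w y), f x) * wRho N p y

/-- `J(w) = -e^{-γs} ∫_B w w_s ρ`. -/
def energyJ (N : ℕ) (p q : ℝ) (s : ℝ) (w v : Eucl N → ℝ) : ℝ :=
  -Real.exp (-(wGamma p q * s)) * ∫ y in unitBall N, w y * v y * wRho N p y

/-- `H(w) = (E₀ + I + J) exp((p+3)/(2γ) e^{-γs}) + θ e^{-2γs}`, with `v = w_s`. -/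
def lyapunovH (N : ℕ) (p q : ℝ) (f : ℝ → ℝ) (θ s : ℝ) (w v : Eucl N → ℝ) : ℝ :=
  (E0 N p w v + energyI N p f s w + energyJ N p q s w v) *
      Real.exp ((p + 3) / (2 * wGamma p q) * Real.exp (-(wGamma p q * s)))
    + θ * Real.exp (-(2 * wGamma p q * s))

/-- The finite number `S` is the maximal existence time of the solution `(w, v)` given on `[s₀, T)`:
it is the supremum of all `T' ≥ T` such that `(w, v)` extends to `[s₀, T')` as a solution with
locally bounded `L^{p+1}(B)` norm. -/
def BlowsUpAt (N : ℕ) (p : ℝ) (f g : ℝ → ℝ) (s₀ T : ℝ) (w v : ℝ → Eucl N → ℝ) (S : ℝ) : Prop :=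
  IsLUB {T' : ℝ | T ≤ T' ∧ ∃ w' v' : ℝ → Eucl N → ℝ,
    IsSolution N p f g s₀ T' w' v' ∧ LocBddLp N p s₀ T' w' ∧
    ∀ s ∈ Ico s₀ T, w' s =ᵐ[volume.restrict (unitBall N)] w s ∧
      v' s =ᵐ[volume.restrict (unitBall N)] v s} S

end

/-! Put `k = 2/(p-1)`. In the variables `x = e^{-s} y`, `t = -e^{-s}`, the function `u = e^{ks} w`
solves a perturbed semilinear wave equation in the backward cone `|x| < -t`, and `A = w_s + k w +
y·∇w` is `e^{-(k+1)s} u_t`. Blow-up is proved by moving the vertex of the cone down to `t = -δ` for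
a small `δ > 0`. With `c = e^{-s} - δ` and `λ = 1 - δ e^s = c / e^{-s}`, the function `λ^k w(s, λ
y)` is the self-similar profile of the same `u` about the new vertex, at the self-similar time `s' =
-log c`. It solves the same equation in `s'`, and it uses `w` only in the ball of radius `λ < 1`, so
no regularity of `w` up to the boundary of the unit ball is needed.

The energy of this profile, with the weight `exp((p+3)/(2γ) c^γ)` and the correction `θ c^{2γ}`, is
nonincreasing (`NonlinWave.lyapunov_le`, `IsSolution.coneEnergy_le`). The dissipation comes from
`-2α ∫ v² ρ/(1-|y|²)` and, through the multiplier `η w` with `η = c^γ`, from `-η` times the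
remaining energy quantities. The number `(p+3)/2` in the exponential weight is the midpoint of `2`
and `p+1`: it exceeds `2`, which gives the quadratic terms a sign, and it is below `p+1`, which
gives the power term a sign. The perturbations leave an error of size `η²`, which is paid by `θ
c^{2γ}`; this fixes `θ₀`.

As `δ → 0` the cone energy at `s₃` tends to `H(w(s₃)) < 0` (`rescEnergy_tendsto`), so some `δ` makes
it negative, and then it stays below a negative constant along the cone. If an extension of the
solution lived beyond `-log δ`, its `L^{p+1}` norm would be bounded up to that time, and the
potential energy in the shrinking ball would be at most a multiple of `λ^{2(k+1)-N}`, up to terms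
that also vanish with `c`. Since `α > 0` makes this exponent positive, the cone energy would have a
lower bound tending to `0` (`IsSolution.not_coneEnergy_le`), a contradiction. Hence every extension
stops by `-log δ`.

The work lies in justifying the energy inequality for weak solutions. The equation is written as a
first order system for `w`, `A` and `∇w` (`IsSolution.exists_nonlinWave`). It is smoothed with a
kernel that is fixed in the unscaled variable `x`, so the smoothed profile solves the linear
equation exactly, with smoothed source and no commutator (`WaveSystem.isPrim_mollV`). For smooth
functions the inequality is a pointwise quadratic estimate plus a divergence of integral zero
(`static_energy_inequality`). The smoothing is removed first with a truncated nonlinearity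
(`WaveSystem.energy_le`), then the truncation is removed with the help of `|w|^p ∈ L¹_s L²_y`
(`NonlinWave.energy_le`). Only then does the source match the derivative of the potential, and
`dissDensity_le` gives the sign. -/

/-! ### Absolutely continuous functions and their almost everywhere derivatives. -/

/-- `f` is absolutely continuous on `[a, b]` with almost everywhere derivative `f'`. -/
def IsPrim (f f' : ℝ → ℝ) (a b : ℝ) : Prop :=
  AbsolutelyContinuousOnInterval f a b ∧ ∀ᵐ x, x ∈ uIcc a b → HasDerivAt f (f' x) x

namespace IsPrim

variable {f f' g g' : ℝ → ℝ} {a b : ℝ}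

lemma intervalIntegrable (h : IsPrim f f' a b) : IntervalIntegrable f' volume a b := by
  refine h.1.intervalIntegrable_deriv.congr_ae ?_
  rw [Filter.EventuallyEq, ae_restrict_iff' measurableSet_uIoc]
  filter_upwards [h.2] with x hx hx'
  exact (hx (uIoc_subset_uIcc hx')).deriv

lemma integral_eq (h : IsPrim f f' a b) : ∫ x in a..b, f' x = f b - f a := by
  rw [← h.1.integral_deriv_eq_sub]
  refine intervalIntegral.integral_congr_ae ?_
  filter_upwards [h.2] with x hx hx'
  exact (hx (uIoc_subset_uIcc hx')).deriv.symm

lemma add (hf : IsPrim f f' a b) (hg : IsPrim g g' a b) :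
    IsPrim (fun x => f x + g x) (fun x => f' x + g' x) a b := by
  refine ⟨hf.1.add hg.1, ?_⟩
  filter_upwards [hf.2, hg.2] with x h1 h2 hx
  exact (h1 hx).add (h2 hx)

lemma sub (hf : IsPrim f f' a b) (hg : IsPrim g g' a b) :
    IsPrim (fun x => f x - g x) (fun x => f' x - g' x) a b := by
  refine ⟨hf.1.sub hg.1, ?_⟩
  filter_upwards [hf.2, hg.2] with x h1 h2 hx
  exact (h1 hx).sub (h2 hx)

lemma mul (hf : IsPrim f f' a b) (hg : IsPrim g g' a b) :
    IsPrim (fun x => f x * g x) (fun x => f' x * g x + f x * g' x) a b := by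
  refine ⟨hf.1.fun_mul hg.1, ?_⟩
  filter_upwards [hf.2, hg.2] with x h1 h2 hx
  exact (h1 hx).mul (h2 hx)

lemma congr_deriv (hf : IsPrim f f' a b) (h : ∀ x ∈ uIcc a b, f' x = g' x) :
    IsPrim f g' a b := by
  refine ⟨hf.1, ?_⟩
  filter_upwards [hf.2] with x h1 hx
  exact h x hx ▸ h1 hx

lemma of_primitive (hab : a ≤ b) (hi : IntervalIntegrable f' volume a b)
    (h : ∀ t ∈ Icc a b, f t - f a = ∫ s in a..t, f' s) : IsPrim f f' a b := by
  have key : ∀ t ∈ Icc a b, f t = f a + ∫ s in a..t, f' s := fun t ht => by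
    rw [← h t ht]; ring
  constructor
  · have h1 := hi.absolutelyContinuousOnInterval_intervalIntegral (c := a) (by simp)
    have h2 : AbsolutelyContinuousOnInterval (fun _ : ℝ => f a) a b :=
      (LipschitzWith.const (f a)).lipschitzOnWith.absolutelyContinuousOnInterval (K := 0)
    have h3 := h2.add h1
    rw [absolutelyContinuousOnInterval_iff] at h3 ⊢
    intro ε hε
    obtain ⟨δ, hδ, H⟩ := h3 ε hε
    refine ⟨δ, hδ, fun E hE hl => ?_⟩
    have h4 := H E hE hl
    refine lt_of_le_of_lt (le_of_eq (Finset.sum_congr rfl fun i hi' => ?_)) h4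
    have h5 : (E.2 i).1 ∈ uIcc a b ∧ (E.2 i).2 ∈ uIcc a b := hE.1 i hi'
    rw [uIcc_of_le hab] at h5
    simp only [Pi.add_apply]
    rw [key _ h5.1, key _ h5.2]
  · have e1 : ∀ᵐ x : ℝ, x ≠ a := by simp [ae_iff]
    have e2 : ∀ᵐ x : ℝ, x ≠ b := by simp [ae_iff]
    filter_upwards [hi.ae_hasDerivAt_integral, e1, e2] with x hx hxa hxb hx'
    have h1 := (hx hx' a (by simp)).const_add (f a)
    rw [uIcc_of_le hab] at hx'
    refine h1.congr_of_eventuallyEq ?_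
    have : Ioo a b ∈ 𝓝 x :=
      Ioo_mem_nhds (lt_of_le_of_ne hx'.1 hxa.symm) (lt_of_le_of_ne hx'.2 hxb)
    filter_upwards [this] with t ht using key t (Ioo_subset_Icc_self ht)

lemma of_hasDerivAt (hab : a ≤ b) (h : ∀ t ∈ Icc a b, HasDerivAt f (f' t) t)
    (hc : ContinuousOn f' (Icc a b)) : IsPrim f f' a b := by
  have hi : IntervalIntegrable f' volume a b := by
    apply ContinuousOn.intervalIntegrable; rwa [uIcc_of_le hab]
  refine of_primitive hab hi fun t ht => ?_
  rw [intervalIntegral.integral_eq_sub_of_hasDerivAt]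
  · intro x hx
    rw [uIcc_of_le ht.1] at hx
    exact h x ⟨hx.1, hx.2.trans ht.2⟩
  · exact hi.mono_set (by rw [uIcc_of_le ht.1, uIcc_of_le hab]; exact Icc_subset_Icc_right ht.2)

lemma const (c : ℝ) : IsPrim (fun _ => c) (fun _ => 0) a b := by
  refine ⟨(LipschitzWith.const c).lipschitzOnWith.absolutelyContinuousOnInterval (K := 0), ?_⟩
  filter_upwards with x _ using hasDerivAt_const x c

lemma const_mul (c : ℝ) (hf : IsPrim f f' a b) :
    IsPrim (fun x => c * f x) (fun x => c * f' x) a b := by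
  refine ⟨hf.1.const_mul c, ?_⟩
  filter_upwards [hf.2] with x hx hx' using (hx hx').const_mul c

lemma sum {ι : Type*} (s : Finset ι) {F F' : ι → ℝ → ℝ} (h : ∀ i ∈ s, IsPrim (F i) (F' i) a b) :
    IsPrim (fun x => ∑ i ∈ s, F i x) (fun x => ∑ i ∈ s, F' i x) a b := by
  classical
  induction s using Finset.induction_on with
  | empty => simpa using const 0
  | insert i s hi ih =>
    simp only [Finset.sum_insert hi]
    exact (h i (by simp)).add (ih fun j hj => h j (by simp [hj]))

/-- Local domination of increments on small intervals implies global domination. -/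
lemma _root_.abs_sub_le_of_local {φ v : ℝ → ℝ} {a b δ : ℝ} (hab : a ≤ b) (hδ : 0 < δ)
    (h : ∀ x y, a ≤ x → x ≤ y → y ≤ b → y - x < δ → |φ y - φ x| ≤ v y - v x) :
    |φ b - φ a| ≤ v b - v a := by
  obtain ⟨n, hn⟩ := exists_nat_gt ((b - a) / δ)
  have hn0 : (0 : ℝ) < n := lt_of_le_of_lt (div_nonneg (by linarith) hδ.le) hn
  have hstep : (b - a) / n < δ := by
    rw [div_lt_iff₀ hn0]; rw [div_lt_iff₀ hδ] at hn; linarith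
  have hs0 : 0 ≤ (b - a) / n := div_nonneg (by linarith) hn0.le
  have key : ∀ i : ℕ, i ≤ n →
      |φ (a + i * ((b - a) / n)) - φ a| ≤ v (a + i * ((b - a) / n)) - v a := by
    intro i
    induction i with
    | zero => intro _; simp
    | succ i ih =>
      intro hi
      have h1 := ih (by omega)
      have hle : a + ((i + 1 : ℕ) : ℝ) * ((b - a) / n) ≤ b := by
        have : ((i + 1 : ℕ) : ℝ) * ((b - a) / n) ≤ n * ((b - a) / n) := by
          apply mul_le_mul_of_nonneg_right _ hs0; exact_mod_cast hi
        rw [mul_div_cancel₀ _ hn0.ne'] at this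
        linarith
      have h2 := h (a + i * ((b - a) / n)) (a + ((i + 1 : ℕ) : ℝ) * ((b - a) / n))
        (by have : 0 ≤ (i : ℝ) * ((b - a) / n) := by positivity
            linarith) (by push_cast; nlinarith) hle
        (by push_cast; nlinarith)
      have h3 := abs_sub_le (φ (a + ((i + 1 : ℕ) : ℝ) * ((b - a) / n)))
        (φ (a + i * ((b - a) / n))) (φ a)
      linarith
  have := key n le_rfl
  rwa [mul_div_cancel₀ _ hn0.ne', add_sub_cancel] at this

/-- Differentiation along the diagonal of a function of two variables which is absolutely
continuous in the first one and continuously differentiable in the second one. -/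
lemma diag {Ψ r q : ℝ → ℝ → ℝ} {ℓ : ℝ → ℝ} (hab : a ≤ b)
    (h1 : ∀ μ ∈ Icc a b, ∀ t₁ t₂, a ≤ t₁ → t₁ ≤ t₂ → t₂ ≤ b →
      Ψ t₂ μ - Ψ t₁ μ = ∫ s in t₁..t₂, r s μ)
    (hr : ∀ μ ∈ Icc a b, IntervalIntegrable (fun s => r s μ) volume a b)
    (h2 : ∀ t ∈ Icc a b, ∀ μ ∈ Icc a b, HasDerivAt (Ψ t) (q t μ) μ)
    (h3 : ContinuousOn (Function.uncurry q) (Icc a b ×ˢ Icc a b))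
    (hℓ : IntervalIntegrable ℓ volume a b)
    (h4 : IntervalIntegrable (fun s => r s s) volume a b)
    (h5 : ∀ ε > 0, ∃ δ > 0, ∀ x ∈ Icc a b, ∀ᵐ s, s ∈ Icc a b → |x - s| < δ →
      |r s x - r s s| ≤ ε * ℓ s) :
    IsPrim (fun t => Ψ t t) (fun s => r s s + q s s) a b := by
  have hqd : ContinuousOn (fun s => q s s) (Icc a b) :=
    h3.comp (continuous_id.prodMk continuous_id).continuousOn fun s hs => ⟨hs, hs⟩
  have hqi : IntervalIntegrable (fun s => q s s) volume a b := by
    apply ContinuousOn.intervalIntegrable; rwa [uIcc_of_le hab]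
  have hsub : ∀ {F : ℝ → ℝ} {x y : ℝ}, IntervalIntegrable F volume a b → a ≤ x → x ≤ y → y ≤ b →
      IntervalIntegrable F volume x y := fun hF h1 h2 h3 =>
    hF.mono_set (by rw [uIcc_of_le h2, uIcc_of_le hab]; exact Icc_subset_Icc h1 h3)
  refine of_primitive hab (h4.add hqi) fun t ht => ?_
  set φ : ℝ → ℝ := fun t => Ψ t t - ∫ s in a..t, (r s s + q s s) with hφ
  suffices h : φ t - φ a = 0 by
    simp only [hφ, intervalIntegral.integral_same, sub_zero] at h; linarith
  have main : ∀ ε > 0, |φ t - φ a| ≤ ε * ((t - a) + ∫ s in a..t, ℓ s) := by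
    intro ε hε
    have huc := (isCompact_Icc.prod isCompact_Icc).uniformContinuousOn_of_continuous h3
    rw [Metric.uniformContinuousOn_iff] at huc
    obtain ⟨δ₁, hδ₁, H1⟩ := huc ε hε
    obtain ⟨δ₂, hδ₂, H2⟩ := h5 ε hε
    have := abs_sub_le_of_local (φ := φ) (v := fun t => ε * ((t - a) + ∫ s in a..t, ℓ s))
      ht.1 (lt_min hδ₁ hδ₂) ?_
    · simpa using this
    intro x y hax hxy hyt hd
    have hyb := hyt.trans ht.2
    have hx : x ∈ Icc a b := ⟨hax, hxy.trans hyb⟩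
    have hy : y ∈ Icc a b := ⟨hax.trans hxy, hyb⟩
    -- The increment along the diagonal is split at the corner `(y, x)`: first the time moves with
    -- the parameter frozen at `x`, then the parameter moves with the time frozen at `y`.
    have e1 : Ψ y y - Ψ x x = (∫ s in x..y, r s x) + ∫ s in x..y, q y s := by
      rw [← h1 x hx x y hax hxy hyb, intervalIntegral.integral_eq_sub_of_hasDerivAt
        (f := Ψ y) (fun μ hμ => h2 y hy μ (by
          rw [uIcc_of_le hxy] at hμ; exact ⟨hax.trans hμ.1, hμ.2.trans hyb⟩)) ?_]
      · ring
      · apply ContinuousOn.intervalIntegrable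
        rw [uIcc_of_le hxy]
        exact h3.comp (by fun_prop : Continuous fun s : ℝ => (y, s)).continuousOn
          fun s hs => ⟨hy, hax.trans hs.1, hs.2.trans hyb⟩
    have iq : IntervalIntegrable (fun s => q y s) volume x y := by
      apply ContinuousOn.intervalIntegrable
      rw [uIcc_of_le hxy]
      exact h3.comp (by fun_prop : Continuous fun s : ℝ => (y, s)).continuousOn
          fun s hs => ⟨hy, hax.trans hs.1, hs.2.trans hyb⟩
    have e2 : φ y - φ x = ∫ s in x..y, ((r s x - r s s) + (q y s - q s s)) := by
      have h7 : (∫ s in a..y, (r s s + q s s)) = (∫ s in a..x, (r s s + q s s)) +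
          ∫ s in x..y, (r s s + q s s) :=
        (intervalIntegral.integral_add_adjacent_intervals
          (hsub (h4.add hqi) le_rfl hax hx.2) (hsub (h4.add hqi) hax hxy hyb)).symm
      rw [intervalIntegral.integral_add (((hsub (hr x hx) hax hxy hyb)).sub (hsub h4 hax hxy hyb))
        (iq.sub (hsub hqi hax hxy hyb)), intervalIntegral.integral_sub
          (hsub (hr x hx) hax hxy hyb) (hsub h4 hax hxy hyb),
        intervalIntegral.integral_sub iq (hsub hqi hax hxy hyb)]
      simp only [hφ]
      rw [h7, intervalIntegral.integral_add (hsub h4 hax hxy hyb) (hsub hqi hax hxy hyb)]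
      linarith
    have e3 : |φ y - φ x| ≤ ∫ s in x..y, (ε * ℓ s + ε) := by
      rw [e2, ← Real.norm_eq_abs]
      refine intervalIntegral.norm_integral_le_of_norm_le hxy ?_
        (((hsub hℓ hax hxy hyb).const_mul ε).add intervalIntegrable_const)
      filter_upwards [H2 x hx] with s hs hs'
      have hsI : s ∈ Icc a b := ⟨hax.trans hs'.1.le, hs'.2.trans hyb⟩
      have hd' : |x - s| < min δ₁ δ₂ := by
        rw [abs_sub_comm, abs_of_pos (by linarith [hs'.1])]; linarith [hs'.2]
      have h8 := hs hsI (hd'.trans_le (min_le_right _ _))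
      have h9 := H1 (y, s) ⟨hy, hsI⟩ (s, s) ⟨hsI, hsI⟩ (by
        rw [Prod.dist_eq]; simp only [dist_self]
        rw [max_eq_left dist_nonneg, Real.dist_eq, abs_of_nonneg (by linarith [hs'.2])]
        have := min_le_left δ₁ δ₂
        linarith [hs'.1])
      rw [Real.dist_eq] at h9
      simp only [Function.uncurry] at h9
      rw [Real.norm_eq_abs]
      calc _ ≤ |r s x - r s s| + |q y s - q s s| := abs_add_le _ _
        _ ≤ _ := by linarith
    refine e3.trans (le_of_eq ?_)
    rw [intervalIntegral.integral_add ((hsub hℓ hax hxy hyb).const_mul ε) intervalIntegrable_const,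
      intervalIntegral.integral_const_mul, intervalIntegral.integral_const]
    have h7 : (∫ s in a..y, ℓ s) = (∫ s in a..x, ℓ s) + ∫ s in x..y, ℓ s :=
        (intervalIntegral.integral_add_adjacent_intervals
          (hsub hℓ le_rfl hax hx.2) (hsub hℓ hax hxy hyb)).symm
    rw [h7, smul_eq_mul]; ring
  -- The increment of `φ` is at most `ε` times a fixed number for every `ε > 0`, so it vanishes.
  by_contra hne
  have hpos : 0 < |φ t - φ a| := abs_pos.mpr hne
  set c := (t - a) + ∫ s in a..t, ℓ s
  have h1' := main 1 one_pos
  have hc : 0 < c := by linarith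
  have := main (|φ t - φ a| / (2 * c)) (by positivity)
  rw [div_mul_eq_mul_div, le_div_iff₀ (by positivity)] at this
  nlinarith

end IsPrim

/-! ### Convergence in `L²` and jointly measurable versions of `L²`-continuous families. -/

/-- Convergence in `L²(μ)` of real functions, including membership. -/
def L2Tendsto {α ι : Type*} [MeasurableSpace α] (μ : Measure α) (F : ι → α → ℝ) (f : α → ℝ)
    (l : Filter ι) : Prop :=
  (∀ i, MemLp (F i) 2 μ) ∧ MemLp f 2 μ ∧ Tendsto (fun i => eLpNorm (F i - f) 2 μ) l (𝓝 0)

namespace L2Tendsto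

variable {α ι : Type*} [MeasurableSpace α] {μ ν : Measure α} {F G : ι → α → ℝ} {f g : α → ℝ}
  {l : Filter ι}

lemma of_le (hF : ∀ i, MemLp (F i) 2 μ) (hf : MemLp f 2 μ) {b : ι → ENNReal}
    (hb : Tendsto b l (𝓝 0)) (h : ∀ i, eLpNorm (F i - f) 2 μ ≤ b i) : L2Tendsto μ F f l :=
  ⟨hF, hf, tendsto_of_tendsto_of_tendsto_of_le_of_le tendsto_const_nhds hb (fun _ => zero_le) h⟩

lemma add (hF : L2Tendsto μ F f l) (hG : L2Tendsto μ G g l) :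
    L2Tendsto μ (fun i x => F i x + G i x) (fun x => f x + g x) l := by
  refine of_le (fun i => (hF.1 i).add (hG.1 i)) (hF.2.1.add hG.2.1)
    (by simpa using hF.2.2.add hG.2.2) fun i => ?_
  have : (fun x => F i x + G i x) - (fun x => f x + g x) = (F i - f) + (G i - g) := by
    ext x; simp; ring
  rw [this]
  exact eLpNorm_add_le ((hF.1 i).sub hF.2.1).1 ((hG.1 i).sub hG.2.1).1 (by norm_num)

lemma mul_bdd (hF : L2Tendsto μ F f l) {om : α → ℝ} (hom : AEStronglyMeasurable om μ) {C : ℝ}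
    (hC : ∀ᵐ x ∂μ, |om x| ≤ C) :
    L2Tendsto μ (fun i x => om x * F i x) (fun x => om x * f x) l := by
  have hm : ∀ {h : α → ℝ}, MemLp h 2 μ → MemLp (fun x => om x * h x) 2 μ := fun hh => by
    refine MemLp.of_le_mul hh (hom.mul hh.1) (c := C) ?_
    filter_upwards [hC] with x hx
    rw [norm_mul]; exact mul_le_mul_of_nonneg_right hx (norm_nonneg _)
  refine of_le (fun i => hm (hF.1 i)) (hm hF.2.1) (b := fun i => ENNReal.ofReal C *
    eLpNorm (F i - f) 2 μ) ?_ fun i => ?_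
  · simpa using ENNReal.Tendsto.const_mul hF.2.2 (Or.inr ENNReal.ofReal_ne_top)
  · refine eLpNorm_le_mul_eLpNorm_of_ae_le_mul ?_ 2
    filter_upwards [hC] with x hx
    simp only [Pi.sub_apply]
    rw [← mul_sub, norm_mul]; exact mul_le_mul_of_nonneg_right hx (norm_nonneg _)

lemma const_mul (hF : L2Tendsto μ F f l) (c : ℝ) :
    L2Tendsto μ (fun i x => c * F i x) (fun x => c * f x) l :=
  hF.mul_bdd aestronglyMeasurable_const (C := |c|) (by simp)

lemma sub (hF : L2Tendsto μ F f l) (hG : L2Tendsto μ G g l) :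
    L2Tendsto μ (fun i x => F i x - G i x) (fun x => f x - g x) l := by
  simpa [sub_eq_add_neg] using hF.add (hG.const_mul (-1))

lemma zero : L2Tendsto μ (fun (_ : ι) (_ : α) => (0 : ℝ)) (fun _ => 0) l := by
  refine ⟨fun i => MemLp.zero, MemLp.zero, ?_⟩
  simpa using tendsto_const_nhds

lemma sum {κ : Type*} (s : Finset κ) {F : κ → ι → α → ℝ} {f : κ → α → ℝ}
    (h : ∀ k ∈ s, L2Tendsto μ (F k) (f k) l) :
    L2Tendsto μ (fun i x => ∑ k ∈ s, F k i x) (fun x => ∑ k ∈ s, f k x) l := by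
  classical
  induction s using Finset.induction_on with
  | empty => simpa using zero
  | insert i s hi ih =>
    simp only [Finset.sum_insert hi]
    exact (h i (by simp)).add (ih fun j hj => h j (by simp [hj]))

lemma mono_measure (hF : L2Tendsto μ F f l) (h : ν ≤ μ) : L2Tendsto ν F f l :=
  of_le (fun i => (hF.1 i).mono_measure h) (hF.2.1.mono_measure h) hF.2.2
    fun _ => eLpNorm_mono_measure _ h

lemma congr (hF : L2Tendsto μ F f l) (h : ∀ i, F i =ᵐ[μ] G i) (h' : f =ᵐ[μ] g) :
    L2Tendsto μ G g l := by
  refine ⟨fun i => (memLp_congr_ae (h i)).1 (hF.1 i), (memLp_congr_ae h').1 hF.2.1, ?_⟩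
  refine hF.2.2.congr fun i => eLpNorm_congr_ae ?_
  filter_upwards [h i, h'] with x h1 h2
  simp [h1, h2]

lemma lipschitz_comp [IsFiniteMeasure μ] (hF : L2Tendsto μ F f l) {φ : ℝ → ℝ} {K : NNReal}
    (hφ : LipschitzWith K φ) :
    L2Tendsto μ (fun i x => φ (F i x)) (fun x => φ (f x)) l := by
  have hm : ∀ {h : α → ℝ}, MemLp h 2 μ → MemLp (fun x => φ (h x)) 2 μ := fun {h} hh => by
    have h1 : LipschitzWith K (fun x => φ x - φ 0) := by
      intro x y; simpa [edist_sub_right] using hφ x y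
    have h2 := (h1.comp_memLp (by simp) hh).add (memLp_const (φ 0))
    refine (memLp_congr_ae (.of_forall fun x => ?_)).1 h2
    simp
  refine of_le (fun i => hm (hF.1 i)) (hm hF.2.1) (b := fun i => ENNReal.ofReal K *
    eLpNorm (F i - f) 2 μ) ?_ fun i => ?_
  · have := ENNReal.Tendsto.const_mul hF.2.2 (a := ENNReal.ofReal K) (Or.inr ENNReal.ofReal_ne_top)
    rwa [mul_zero] at this
  · refine eLpNorm_le_mul_eLpNorm_of_ae_le_mul (.of_forall fun x => ?_) 2
    simpa [Real.dist_eq] using hφ.dist_le_mul (F i x) (f x)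

lemma tendsto_toLp (hF : L2Tendsto μ F f l) :
    Tendsto (fun i => (hF.1 i).toLp (F i)) l (𝓝 (hF.2.1.toLp f)) :=
  (Lp.tendsto_Lp_iff_tendsto_eLpNorm'' F hF.1 f hF.2.1).2 hF.2.2

lemma tendsto_integral_mul (hF : L2Tendsto μ F f l) (hG : L2Tendsto μ G g l) :
    Tendsto (fun i => ∫ x, F i x * G i x ∂μ) l (𝓝 (∫ x, f x * g x ∂μ)) := by
  have key : ∀ {a b : α → ℝ} (ha : MemLp a 2 μ) (hb : MemLp b 2 μ),
      inner ℝ (ha.toLp a) (hb.toLp b) = ∫ x, a x * b x ∂μ := by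
    intro a b ha hb
    rw [L2.inner_def]
    refine integral_congr_ae ?_
    filter_upwards [ha.coeFn_toLp, hb.coeFn_toLp] with x h1 h2
    rw [h1, h2]; simp [mul_comm]
  have := hF.tendsto_toLp.inner (𝕜 := ℝ) hG.tendsto_toLp
  simpa only [key] using this

lemma integrable_mul (hF : MemLp f 2 μ) (hG : MemLp g 2 μ) : Integrable (fun x => f x * g x) μ :=
  MemLp.integrable_mul hF hG

lemma tendsto_integral [IsFiniteMeasure μ] (hF : L2Tendsto μ F f l) :
    Tendsto (fun i => ∫ x, F i x ∂μ) l (𝓝 (∫ x, f x ∂μ)) := by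
  have h1 : L2Tendsto μ (fun (_ : ι) (_ : α) => (1 : ℝ)) (fun _ => 1) l := by
    refine ⟨fun _ => memLp_const _, memLp_const _, ?_⟩
    simpa using tendsto_const_nhds
  simpa using hF.tendsto_integral_mul h1

lemma comp_tendsto (hF : L2Tendsto μ F f l) {κ : Type*} {l' : Filter κ} {φ : κ → ι}
    (h : Tendsto φ l' l) : L2Tendsto μ (fun i => F (φ i)) f l' :=
  ⟨fun _ => hF.1 _, hF.2.1, hF.2.2.comp h⟩

end L2Tendsto

/-- Continuity of a one-parameter family of functions in `L²(μ)`. -/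
def ContL2 {α : Type*} [MeasurableSpace α] (μ : Measure α) (u : ℝ → α → ℝ) : Prop :=
  ∀ s, L2Tendsto μ u (u s) (𝓝 s)

lemma integral_mul_le_sqrt {α : Type*} [MeasurableSpace α] {μ : Measure α} {f g : α → ℝ}
    (hf : MemLp f 2 μ) (hg : MemLp g 2 μ) :
    |∫ x, f x * g x ∂μ| ≤ (eLpNorm f 2 μ).toReal * (eLpNorm g 2 μ).toReal := by
  have h := abs_real_inner_le_norm (hf.toLp f) (hg.toLp g)
  rw [Lp.norm_toLp, Lp.norm_toLp, L2.inner_def] at h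
  refine le_trans (le_of_eq ?_) h
  congr 1
  refine integral_congr_ae ?_
  filter_upwards [hf.coeFn_toLp, hg.coeFn_toLp] with x h1 h2
  rw [h1, h2]; simp [mul_comm]

lemma integral_abs_mul_le_sqrt {α : Type*} [MeasurableSpace α] {μ : Measure α} {f g : α → ℝ}
    (hf : MemLp f 2 μ) (hg : MemLp g 2 μ) :
    ∫ x, |f x * g x| ∂μ ≤ (eLpNorm f 2 μ).toReal * (eLpNorm g 2 μ).toReal := by
  have := integral_mul_le_sqrt hf.norm hg.norm
  rw [eLpNorm_norm, eLpNorm_norm] at this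
  refine le_trans (le_of_eq ?_) ((le_abs_self _).trans this)
  simp [abs_mul]

lemma sq_eLpNorm_toReal {α : Type*} [MeasurableSpace α] {μ : Measure α} {f : α → ℝ}
    (hf : MemLp f 2 μ) : (eLpNorm f 2 μ).toReal ^ 2 = ∫ x, f x ^ 2 ∂μ := by
  have h := real_inner_self_eq_norm_sq (hf.toLp f)
  rw [Lp.norm_toLp, L2.inner_def] at h
  rw [← h]
  refine integral_congr_ae ?_
  filter_upwards [hf.coeFn_toLp] with x h1
  rw [h1]; simp [sq]

lemma sq_eLpNorm_eq_lintegral {α : Type*} [MeasurableSpace α] {μ : Measure α} (f : α → ℝ) :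
    eLpNorm f 2 μ ^ 2 = ∫⁻ x, ‖f x‖ₑ ^ 2 ∂μ := by
  have := eLpNorm_nnreal_pow_eq_lintegral (f := f) (μ := μ) (p := 2) (by norm_num)
  simpa using this

/-- An `L²`-continuous family which is constant outside a compact interval has a jointly
measurable version. -/
lemma ContL2.exists_measurable {α : Type*} [MeasurableSpace α] {μ : Measure α} {u : ℝ → α → ℝ}
    (hu : ContL2 μ u) {a b : ℝ} (hab : a ≤ b) (hc : ∀ s, u s = u (projIcc a b hab s)) :
    ∃ U : ℝ → α → ℝ, Measurable (Function.uncurry U) ∧ ∀ s, U s =ᵐ[μ] u s := by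
  have hm : ∀ s, MemLp (u s) 2 μ := fun s => (hu s).2.1
  set V : ℝ → Lp ℝ 2 μ := fun s => (hm s).toLp (u s) with hV
  have hVc : Continuous V := continuous_iff_continuousAt.2 fun s => (hu s).tendsto_toLp
  have huc := isCompact_Icc.uniformContinuousOn_of_continuous (hVc.continuousOn (s := Icc a b))
  rw [Metric.uniformContinuousOn_iff] at huc
  choose δ hδ H using fun n : ℕ => huc ((1 / 2) ^ n) (by positivity)
  have hVp : ∀ s, V s = V (projIcc a b hab s) := fun s => by
    simp only [hV]; congr 1; exact hc s
  -- Times are rounded down to a grid finer than the modulus of uniform continuity at level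
  -- `2^{-n}`. Each approximation uses countably many slices and is therefore jointly measurable.
  let π : ℕ → ℝ → ℝ := fun n s => (δ n / 2) * ⌊s / (δ n / 2)⌋
  have hπ : ∀ n s, dist (V (π n s)) (V s) ≤ (1 / 2) ^ n := by
    intro n s
    rw [hVp (π n s), hVp s]
    refine (H n _ (projIcc a b hab (π n s)).2 _ (projIcc a b hab s).2 ?_).le
    have h1 : dist ((projIcc a b hab (π n s) : ℝ)) (projIcc a b hab s) ≤ |π n s - s| := by
      rw [Real.dist_eq]; exact abs_projIcc_sub_projIcc hab
    refine h1.trans_lt ?_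
    have hd := hδ n
    have h2 := Int.floor_le (s / (δ n / 2))
    have h3 := Int.lt_floor_add_one (s / (δ n / 2))
    rw [le_div_iff₀ (by linarith)] at h2
    rw [div_lt_iff₀ (by linarith)] at h3
    simp only [π]
    rw [abs_lt]; constructor <;> nlinarith
  let W' : ℕ → ℤ × α → ℝ := fun n q => (hm ((δ n / 2) * q.1)).1.mk (u ((δ n / 2) * q.1)) q.2
  let W : ℕ → ℝ → α → ℝ := fun n s z => W' n (⌊s / (δ n / 2)⌋, z)
  have hW : ∀ n, Measurable (Function.uncurry (W n)) := by
    intro n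
    have h1 : Measurable (W' n) := measurable_from_prod_countable_right fun j =>
      (hm ((δ n / 2) * j)).1.stronglyMeasurable_mk.measurable
    have h2 : Measurable fun q : ℝ × α => ((⌊q.1 / (δ n / 2)⌋ : ℤ), q.2) :=
      (Int.measurable_floor.comp (measurable_fst.div_const _)).prodMk measurable_snd
    exact h1.comp h2
  -- The default value of `limUnder` off the set of convergence is harmless: the function is
  -- measurable everywhere, and only almost every `z` matters for each `s`.
  refine ⟨fun s z => limUnder atTop fun n => W n s z, ?_, fun s => ?_⟩
  · exact (StronglyMeasurable.limUnder (l := atTop) (f := fun n => Function.uncurry (W n))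
      fun n => (hW n).stronglyMeasurable).measurable
  · have h1 : ∀ n, ∫⁻ z, ‖u (π n s) z - u s z‖ₑ ^ 2 ∂μ ≤ ENNReal.ofReal ((1 / 4) ^ n) := by
      intro n
      have h2 := hπ n s
      simp only [hV] at h2
      rw [dist_eq_norm, ← MemLp.toLp_sub, Lp.norm_toLp] at h2
      have h3 := sq_eLpNorm_eq_lintegral (μ := μ) (u (π n s) - u s)
      simp only [Pi.sub_apply] at h3
      rw [← h3, ← ENNReal.ofReal_toReal ((hm (π n s)).sub (hm s)).2.ne, ← ENNReal.ofReal_pow (by positivity)]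
      apply ENNReal.ofReal_le_ofReal
      calc _ ≤ ((1 / 2 : ℝ) ^ n) ^ 2 := by gcongr
        _ = (1 / 4) ^ n := by rw [← pow_mul, mul_comm, pow_mul]; norm_num
    have hme : ∀ n, AEMeasurable (fun z => ‖u (π n s) z - u s z‖ₑ ^ 2) μ := fun n =>
      ((hm (π n s)).1.sub (hm s).1).enorm.pow_const 2
    -- The squared `L²` distances are summable, so for almost every `z` the series of squares
    -- converges and its terms tend to zero. This gives pointwise convergence of the whole sequence,
    -- without passing to a subsequence.
    have h2 : ∫⁻ z, ∑' n, ‖u (π n s) z - u s z‖ₑ ^ 2 ∂μ ≠ ⊤ := by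
      rw [lintegral_tsum hme]
      refine ne_top_of_le_ne_top ?_ (ENNReal.tsum_le_tsum h1)
      rw [← ENNReal.ofReal_tsum_of_nonneg (fun n => by positivity)
        (summable_geometric_of_lt_one (by norm_num) (by norm_num))]
      exact ENNReal.ofReal_ne_top
    have h3 := ae_lt_top' (AEMeasurable.tsum hme) h2
    have h4 : ∀ᵐ z ∂μ, ∀ n, W n s z = u (π n s) z :=
      ae_all_iff.2 fun n => (hm (π n s)).1.ae_eq_mk.symm
    filter_upwards [h3, h4] with z hz hz'
    refine Tendsto.limUnder_eq ?_
    have h5 := ENNReal.tendsto_atTop_zero_of_tsum_ne_top hz.ne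
    have h6 : Tendsto (fun n => u (π n s) z - u s z) atTop (𝓝 0) := by
      rw [tendsto_zero_iff_norm_tendsto_zero]
      have h7 : Tendsto (fun n => ‖u (π n s) z - u s z‖ₑ) atTop (𝓝 0) := by
        have := (ENNReal.continuous_rpow_const (y := 1 / 2)).tendsto 0 |>.comp h5
        rw [ENNReal.zero_rpow_of_pos (by norm_num)] at this
        refine this.congr fun n => ?_
        simp only [Function.comp]
        rw [← ENNReal.rpow_natCast, ← ENNReal.rpow_mul]; norm_num
      have := (ENNReal.continuousAt_toReal ENNReal.zero_ne_top).tendsto.comp h7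
      simpa [Function.comp_def] using this
    simp only [hz']
    simpa using h6.add_const (u s z)

/-! ### Mollification in `L²` on the whole space, combined with dilations. -/

section Mollify

variable {N : ℕ}

/-- Averages `y ↦ ∫ u (y - x) dP(x)` against a probability measure, compared with `u`. -/
lemma lintegral_average_sub_sq_le {P : Measure (Eucl N)} [IsProbabilityMeasure P]
    {u : Eucl N → ℝ} (hu : Measurable u) (c : ℝ)
    (hi : ∀ᵐ y, Integrable (fun x => u (y - x)) P) :
    ∫⁻ y, ‖(∫ x, u (y - x) ∂P) - c * u y‖ₑ ^ 2 ≤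
      ∫⁻ x, (∫⁻ y, ‖u (y - x) - c * u y‖ₑ ^ 2) ∂P := by
  have hm : Measurable (Function.uncurry fun (y x : Eucl N) => ‖u (y - x) - c * u y‖ₑ ^ 2) := by
    unfold Function.uncurry; fun_prop
  rw [lintegral_lintegral_swap (f := fun x y => ‖u (y - x) - c * u y‖ₑ ^ 2)
    (by unfold Function.uncurry; fun_prop)]
  refine lintegral_mono_ae ?_
  filter_upwards [hi] with y hy
  have e1 : (∫ x, u (y - x) ∂P) - c * u y = ∫ x, (u (y - x) - c * u y) ∂P := by
    rw [integral_sub hy (integrable_const _)]; simp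
  rw [e1, ← sq_eLpNorm_eq_lintegral]
  have h1 : ‖∫ x, (u (y - x) - c * u y) ∂P‖ₑ ≤ eLpNorm (fun x => u (y - x) - c * u y) 1 P := by
    rw [eLpNorm_one_eq_lintegral_enorm]; exact enorm_integral_le_lintegral_enorm _
  have h2 := eLpNorm_le_eLpNorm_of_exponent_le (μ := P) (p := 1) (q := 2) (by norm_num)
    (f := fun x => u (y - x) - c * u y)
    (Measurable.aestronglyMeasurable (by fun_prop))
  gcongr
  exact h1.trans h2

lemma memLp_comp_sub {u : Eucl N → ℝ} (hu : MemLp u 2 volume) (x : Eucl N) :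
    MemLp (fun y => u (y - x)) 2 volume :=
  hu.comp_measurePreserving (measurePreserving_sub_right volume x)

/-- Translations preserve the measure, and composition in `L²` depends continuously on a measure
preserving map. -/
lemma tendsto_eLpNorm_translate {u : Eucl N → ℝ} (hu : MemLp u 2 volume) :
    Tendsto (fun x : Eucl N => eLpNorm (fun y => u (y - x) - u y) 2 volume) (𝓝 0) (𝓝 0) := by
  let g : Eucl N → C(Eucl N, Eucl N) := fun x => ⟨fun y => y - x, by fun_prop⟩
  have hg : Continuous g := ContinuousMap.continuous_of_continuous_uncurry _ (by
    unfold Function.uncurry; simp only [g, ContinuousMap.coe_mk]; fun_prop)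
  have hp : ∀ x, MeasurePreserving (g x) volume volume := fun x =>
    measurePreserving_sub_right volume x
  have hc := Continuous.compMeasurePreservingLp (f := fun _ : Eucl N => hu.toLp u) (g := g)
    continuous_const hg hp (by norm_num)
  have e : ∀ x, Lp.compMeasurePreserving (g x) (hp x) (hu.toLp u) =
      (memLp_comp_sub hu x).toLp (fun y => u (y - x)) := fun x =>
    Lp.toLp_compMeasurePreserving hu (hp x)
  simp only [e] at hc
  have h0 := hc.tendsto 0
  have e0 : (memLp_comp_sub hu 0).toLp (fun y => u (y - 0)) = hu.toLp u := by simp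
  rw [e0, Lp.tendsto_Lp_iff_tendsto_eLpNorm''] at h0
  exact h0

lemma integral_withDensity_ofReal {α : Type*} [MeasurableSpace α] {μ : Measure α} {φ : α → ℝ}
    (hφ : Measurable φ) (h0 : ∀ x, 0 ≤ φ x) (g : α → ℝ) :
    ∫ x, g x ∂(μ.withDensity fun x => ENNReal.ofReal (φ x)) = ∫ x, φ x * g x ∂μ := by
  rw [integral_withDensity_eq_integral_toReal_smul hφ.ennreal_ofReal (by simp)]
  simp [ENNReal.toReal_ofReal, h0]

/-- The data of a mollifying kernel. -/
structure IsMollifier (φ : Eucl N → ℝ) (ε : ℝ) : Prop where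
  cont : Continuous φ
  nonneg : ∀ x, 0 ≤ φ x
  integral_eq : ∫ x, φ x = 1
  supp : ∀ x, ε ≤ ‖x‖ → φ x = 0

namespace IsMollifier

variable {φ : Eucl N → ℝ} {ε : ℝ}

lemma integrable (h : IsMollifier φ ε) : Integrable φ := by
  by_contra hc
  have := h.integral_eq
  rw [integral_undef hc] at this
  norm_num at this

lemma hasCompactSupport (h : IsMollifier φ ε) : HasCompactSupport φ :=
  HasCompactSupport.intro (isCompact_closedBall 0 ε) fun x hx => h.supp x (by
    simp only [Metric.mem_closedBall, dist_zero_right, not_le] at hx; exact hx.le)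

lemma isProbabilityMeasure (h : IsMollifier φ ε) :
    IsProbabilityMeasure ((volume : Measure (Eucl N)).withDensity fun x =>
      ENNReal.ofReal (φ x)) := by
  constructor
  rw [withDensity_apply _ MeasurableSet.univ, Measure.restrict_univ,
    ← ofReal_integral_eq_lintegral_ofReal h.integrable (.of_forall h.nonneg), h.integral_eq]
  simp

lemma conv_eq (h : IsMollifier φ ε) (u : Eucl N → ℝ) (y : Eucl N) :
    ∫ z, u z * φ (y - z) =
      ∫ x, u (y - x) ∂((volume : Measure (Eucl N)).withDensity fun x => ENNReal.ofReal (φ x)) := by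
  rw [integral_withDensity_ofReal h.cont.measurable h.nonneg,
    ← integral_sub_left_eq_self (fun z => u z * φ (y - z)) volume y]
  simp [mul_comm]

/-- Jensen's inequality for the probability measure of density `φ`. The parameter `c` serves two
purposes: `c = 0` gives the contraction property of convolution in `L²`, and `c = 1` gives the rate
of approximation. -/
lemma lintegral_sub_sq_le (h : IsMollifier φ ε) {u : Eucl N → ℝ} (hu : MemLp u 2 volume) (c : ℝ) :
    ∫⁻ y, ‖(∫ z, u z * φ (y - z)) - c * u y‖ₑ ^ 2 ≤
      ∫⁻ x, (∫⁻ y, ‖u (y - x) - c * u y‖ₑ ^ 2)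
        ∂((volume : Measure (Eucl N)).withDensity fun x => ENNReal.ofReal (φ x)) := by
  have := h.isProbabilityMeasure
  set u' := hu.1.mk u
  have hm : Measurable u' := hu.1.stronglyMeasurable_mk.measurable
  have hu' : MemLp u' 2 volume := (memLp_congr_ae hu.1.ae_eq_mk).1 hu
  have e : u =ᵐ[volume] u' := hu.1.ae_eq_mk
  have e1 : ∀ y, ∫ z, u z * φ (y - z) = ∫ z, u' z * φ (y - z) := fun y => by
    refine integral_congr_ae ?_
    filter_upwards [e] with z hz
    rw [hz]
  have e2 : ∫⁻ y, ‖(∫ z, u z * φ (y - z)) - c * u y‖ₑ ^ 2 =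
      ∫⁻ y, ‖(∫ z, u' z * φ (y - z)) - c * u' y‖ₑ ^ 2 := by
    refine lintegral_congr_ae ?_
    filter_upwards [e] with y hy
    rw [e1, hy]
  have e3 : ∀ x, ∫⁻ y, ‖u (y - x) - c * u y‖ₑ ^ 2 = ∫⁻ y, ‖u' (y - x) - c * u' y‖ₑ ^ 2 := by
    intro x
    refine lintegral_congr_ae ?_
    filter_upwards [e, (measurePreserving_sub_right volume x).quasiMeasurePreserving.ae e]
      with y h1 h2
    rw [h1, h2]
  rw [e2]
  simp_rw [e3, h.conv_eq u']
  refine lintegral_average_sub_sq_le hm c (.of_forall fun y => ?_)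
  rw [integrable_withDensity_iff_integrable_smul' h.cont.measurable.ennreal_ofReal (by simp)]
  simp only [ENNReal.toReal_ofReal (h.nonneg _), smul_eq_mul]
  have h1 : MemLp φ 2 volume := h.cont.memLp_of_hasCompactSupport h.hasCompactSupport
  have h2 : MemLp (fun x => u' (y - x)) 2 volume :=
    hu'.comp_measurePreserving (Measure.measurePreserving_sub_left volume y)
  exact MemLp.integrable_mul h1 h2

lemma aestronglyMeasurable_conv (h : IsMollifier φ ε) {u : Eucl N → ℝ} (hu : MemLp u 2 volume) :
    AEStronglyMeasurable (fun y => ∫ z, u z * φ (y - z)) volume := by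
  have e1 : ∀ y, ∫ z, u z * φ (y - z) = ∫ z, hu.1.mk u z * φ (y - z) := fun y => by
    refine integral_congr_ae ?_
    filter_upwards [hu.1.ae_eq_mk] with z hz
    rw [← hz]
  simp_rw [e1]
  refine (StronglyMeasurable.integral_prod_right (f := fun y z => hu.1.mk u z * φ (y - z))
    ?_).aestronglyMeasurable
  have := hu.1.stronglyMeasurable_mk.measurable
  have := h.cont.measurable
  apply Measurable.stronglyMeasurable
  unfold Function.uncurry; fun_prop

lemma eLpNorm_conv_le (h : IsMollifier φ ε) {u : Eucl N → ℝ} (hu : MemLp u 2 volume) :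
    eLpNorm (fun y => ∫ z, u z * φ (y - z)) 2 volume ≤ eLpNorm u 2 volume := by
  have := h.isProbabilityMeasure
  have h1 := h.lintegral_sub_sq_le hu 0
  simp only [zero_mul, sub_zero] at h1
  have e : ∀ x, ∫⁻ y, ‖u (y - x)‖ₑ ^ 2 = eLpNorm u 2 volume ^ 2 := fun x => by
    rw [sq_eLpNorm_eq_lintegral]
    exact lintegral_sub_right_eq_self (fun y => ‖u y‖ₑ ^ 2) x
  simp_rw [e] at h1
  rw [← sq_eLpNorm_eq_lintegral, lintegral_const, measure_univ, mul_one] at h1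
  exact (ENNReal.pow_le_pow_left_iff (by norm_num)).1 h1

lemma memLp_conv (h : IsMollifier φ ε) {u : Eucl N → ℝ} (hu : MemLp u 2 volume) :
    MemLp (fun y => ∫ z, u z * φ (y - z)) 2 volume :=
  ⟨h.aestronglyMeasurable_conv hu, (h.eLpNorm_conv_le hu).trans_lt hu.2⟩

lemma eLpNorm_conv_sub_le (h : IsMollifier φ ε) {u : Eucl N → ℝ} (hu : MemLp u 2 volume)
    {c : ENNReal} (hc : ∀ x, ‖x‖ < ε → eLpNorm (fun y => u (y - x) - u y) 2 volume ≤ c) :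
    eLpNorm ((fun y => ∫ z, u z * φ (y - z)) - u) 2 volume ≤ c := by
  have := h.isProbabilityMeasure
  have h1 := h.lintegral_sub_sq_le hu 1
  simp only [one_mul] at h1
  rw [← ENNReal.pow_le_pow_left_iff (n := 2) (by norm_num), sq_eLpNorm_eq_lintegral]
  refine h1.trans ?_
  have h2 : ∀ᵐ x ∂((volume : Measure (Eucl N)).withDensity fun x => ENNReal.ofReal (φ x)),
      ∫⁻ y, ‖u (y - x) - u y‖ₑ ^ 2 ≤ c ^ 2 := by
    rw [ae_withDensity_iff h.cont.measurable.ennreal_ofReal]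
    refine .of_forall fun x hx => ?_
    have hx' : ‖x‖ < ε := by
      by_contra hcon
      exact hx (by simp [h.supp x (not_lt.1 hcon)])
    have h3 := sq_eLpNorm_eq_lintegral (μ := volume) (fun y => u (y - x) - u y)
    rw [← h3]
    gcongr
    exact hc x hx'
  calc _ ≤ ∫⁻ x, c ^ 2 ∂((volume : Measure (Eucl N)).withDensity fun x => ENNReal.ofReal (φ x)) :=
        lintegral_mono_ae h2
    _ = c ^ 2 := by simp

end IsMollifier

lemma L2Tendsto.mollify {φ : ℕ → Eucl N → ℝ} {ε : ℕ → ℝ} (h : ∀ n, IsMollifier (φ n) (ε n))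
    (hε : Tendsto ε atTop (𝓝 0)) {u : Eucl N → ℝ} (hu : MemLp u 2 volume) :
    L2Tendsto volume (fun n y => ∫ z, u z * φ n (y - z)) u atTop := by
  refine ⟨fun n => (h n).memLp_conv hu, hu, ?_⟩
  rw [ENNReal.tendsto_nhds_zero]
  intro c hc
  have h1 := ENNReal.tendsto_nhds_zero.1 (tendsto_eLpNorm_translate hu) c hc
  obtain ⟨δ, hδ, H⟩ := Metric.eventually_nhds_iff_ball.1 h1
  filter_upwards [(tendsto_order.1 hε).2 δ hδ] with n hn
  refine (h n).eLpNorm_conv_sub_le hu fun x hx => H x ?_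
  simp only [Metric.mem_ball, dist_zero_right]
  exact hx.trans hn

lemma eLpNorm_comp_smul_sq {l : ℝ} (hl : 0 < l) {u : Eucl N → ℝ} :
    eLpNorm (fun y => u (l • y)) 2 volume ^ 2 =
      ENNReal.ofReal ((l ^ N)⁻¹) * eLpNorm u 2 volume ^ 2 := by
  rw [sq_eLpNorm_eq_lintegral, sq_eLpNorm_eq_lintegral]
  have h1 := Measure.map_addHaar_smul (volume : Measure (Eucl N)) hl.ne'
  have h2 : MeasurableEmbedding (fun y : Eucl N => l • y) :=
    (Homeomorph.smulOfNeZero l hl.ne').measurableEmbedding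
  rw [← h2.lintegral_map (fun y => ‖u y‖ₑ ^ 2), h1, lintegral_smul_measure]
  simp [abs_of_pos (inv_pos.2 (pow_pos hl N))]

lemma eLpNorm_comp_smul {l : ℝ} (hl : 0 < l) (u : Eucl N → ℝ) :
    eLpNorm (fun y => u (l • y)) 2 volume =
      ENNReal.ofReal √((l ^ N)⁻¹) * eLpNorm u 2 volume := by
  have h1 := eLpNorm_comp_smul_sq hl (u := u)
  refine (ENNReal.pow_right_strictMono (n := 2) two_ne_zero).injective ?_
  rw [h1, mul_pow, ← ENNReal.ofReal_pow (Real.sqrt_nonneg _), Real.sq_sqrt (by positivity)]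

lemma memLp_comp_smul {l : ℝ} (hl : 0 < l) {u : Eucl N → ℝ} (hu : MemLp u 2 volume) :
    MemLp (fun y => u (l • y)) 2 volume :=
  ⟨hu.1.comp_quasiMeasurePreserving (Measure.quasiMeasurePreserving_smul volume hl.ne'), by
    rw [eLpNorm_comp_smul hl]; exact ENNReal.mul_lt_top ENNReal.ofReal_lt_top hu.2⟩

lemma L2Tendsto.comp_smul {ι : Type*} {l : Filter ι} {F : ι → Eucl N → ℝ} {f : Eucl N → ℝ}
    (h : L2Tendsto volume F f l) {r : ℝ} (hr : 0 < r) :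
    L2Tendsto volume (fun i y => F i (r • y)) (fun y => f (r • y)) l := by
  refine ⟨fun i => memLp_comp_smul hr (h.1 i), memLp_comp_smul hr h.2.1, ?_⟩
  have h2 := ENNReal.Tendsto.const_mul h.2.2 (a := ENNReal.ofReal √((r ^ N)⁻¹))
    (Or.inr ENNReal.ofReal_ne_top)
  rw [mul_zero] at h2
  exact h2.congr fun i => (eLpNorm_comp_smul hr (F i - f)).symm

/-- The integral of `u` against the kernel `z ↦ κ (c y - τ z)`. -/
noncomputable def kerT (u κ : Eucl N → ℝ) (c τ : ℝ) (y : Eucl N) : ℝ := ∫ z, u z * κ (c • y - τ • z)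

lemma IsMollifier.scale {κ : Eucl N → ℝ} {ε τ : ℝ} (h : IsMollifier κ ε) (hτ : 0 < τ) :
    IsMollifier (fun x => τ ^ N * κ (τ • x)) (ε / τ) where
  cont := by have := h.cont; fun_prop
  nonneg x := mul_nonneg (by positivity) (h.nonneg _)
  integral_eq := by
    rw [integral_const_mul, Measure.integral_comp_smul, h.integral_eq]
    simp [abs_of_pos (pow_pos hτ N), (pow_pos hτ N).ne']
  supp x hx := by
    rw [h.supp, mul_zero]
    rw [norm_smul, Real.norm_of_nonneg hτ.le, mul_comm]
    rwa [div_le_iff₀ hτ] at hx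

/-- With `τ` factored out of its argument, the kernel `τ^N κ(τ ·)` is again a mollifier, and `kerT`
is the corresponding convolution evaluated at the dilated point `(c/τ) y`. All `L²` statements about
`kerT` reduce to convolutions and dilations in this way. -/
lemma kerT_eq_conv {u κ : Eucl N → ℝ} {c τ : ℝ} (hτ : 0 < τ) (y : Eucl N) :
    τ ^ N * kerT u κ c τ y = ∫ z, u z * (τ ^ N * κ (τ • ((c / τ) • y - z))) := by
  rw [kerT, ← integral_const_mul]
  congr 1; ext z
  rw [smul_sub, smul_smul, mul_div_cancel₀ _ hτ.ne']; ring

lemma L2Tendsto.kerT {κ : ℕ → Eucl N → ℝ} {ε : ℕ → ℝ} (h : ∀ n, IsMollifier (κ n) (ε n))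
    (hε : Tendsto ε atTop (𝓝 0)) {u : Eucl N → ℝ} (hu : MemLp u 2 volume) {c τ : ℝ} (hc : 0 < c)
    (hτ : 0 < τ) :
    L2Tendsto volume (fun n y => τ ^ N * kerT u (κ n) c τ y) (fun y => u ((c / τ) • y)) atTop := by
  simp_rw [kerT_eq_conv hτ]
  exact (L2Tendsto.mollify (fun n => (h n).scale hτ) (by simpa using hε.div_const τ) hu).comp_smul
    (div_pos hc hτ)

lemma eLpNorm_kerT_sq_le {κ : Eucl N → ℝ} {ε : ℝ} (h : IsMollifier κ ε)
    {u : Eucl N → ℝ} (hu : MemLp u 2 volume) {c τ : ℝ} (hc : 0 < c) (hτ : 0 < τ) :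
    eLpNorm (fun y => τ ^ N * kerT u κ c τ y) 2 volume ^ 2 ≤
      ENNReal.ofReal (((c / τ) ^ N)⁻¹) * eLpNorm u 2 volume ^ 2 := by
  simp_rw [kerT_eq_conv hτ]
  rw [eLpNorm_comp_smul_sq (div_pos hc hτ)
    (u := fun x => ∫ z, u z * (τ ^ N * κ (τ • (x - z))))]
  gcongr
  exact (h.scale hτ).eLpNorm_conv_le hu

lemma exists_mollifier_seq (N : ℕ) : ∃ (κ : ℕ → Eucl N → ℝ),
    (∀ n, ContDiff ℝ ∞ (κ n)) ∧ ∀ n : ℕ, IsMollifier (κ n) (1 / (n + 1)) := by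
  let b : ∀ n : ℕ, ContDiffBump (0 : Eucl N) := fun n =>
    ⟨1 / (2 * (n + 1)), 1 / (n + 1), by positivity, by
      rw [div_lt_div_iff₀ (by positivity) (by positivity)]
      nlinarith [(by positivity : (0 : ℝ) < (n : ℝ) + 1)]⟩
  refine ⟨fun n => (b n).normed volume, fun n => (b n).contDiff_normed, fun n => ?_⟩
  refine ⟨(b n).continuous_normed, fun x => (b n).nonneg_normed x, (b n).integral_normed,
    fun x hx => ?_⟩
  have : x ∉ Function.support ((b n).normed volume) := by
    rw [(b n).support_normed_eq]
    simpa [b] using hx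
  simpa using this

end Mollify

/-! ### The weighted measure on the ball and integration by parts against it. -/

section BallMeasure

variable {N : ℕ}

/-- The measure `(1 - |y|²)^α dy` on the open unit ball. -/
noncomputable def ballMeas (N : ℕ) (α : ℝ) : Measure (Eucl N) :=
  (volume.restrict (unitBall N)).withDensity fun y => ENNReal.ofReal ((1 - ‖y‖ ^ 2) ^ α)

lemma measurableSet_unitBall : MeasurableSet (unitBall N) := Metric.isOpen_ball.measurableSet

lemma mem_unitBall {y : Eucl N} : y ∈ unitBall N ↔ ‖y‖ < 1 := by simp [unitBall]

lemma one_sub_pos {y : Eucl N} (hy : y ∈ unitBall N) : 0 < 1 - ‖y‖ ^ 2 := by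
  rw [mem_unitBall] at hy
  nlinarith [norm_nonneg y]

lemma measurable_weight (α : ℝ) : Measurable fun y : Eucl N => (1 - ‖y‖ ^ 2) ^ α :=
  (by fun_prop : Measurable fun y : Eucl N => 1 - ‖y‖ ^ 2).pow_const α

lemma integral_ballMeas (α : ℝ) (F : Eucl N → ℝ) :
    ∫ y, F y ∂(ballMeas N α) = ∫ y in unitBall N, F y * (1 - ‖y‖ ^ 2) ^ α := by
  rw [ballMeas, integral_withDensity_eq_integral_toReal_smul
    (measurable_weight α).ennreal_ofReal (by simp)]
  refine setIntegral_congr_fun measurableSet_unitBall fun y hy => ?_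
  simp only [smul_eq_mul]
  rw [ENNReal.toReal_ofReal (Real.rpow_nonneg (one_sub_pos hy).le _), mul_comm]

lemma integrable_ballMeas_iff (α : ℝ) (F : Eucl N → ℝ) :
    Integrable F (ballMeas N α) ↔ IntegrableOn (fun y => F y * (1 - ‖y‖ ^ 2) ^ α) (unitBall N) := by
  rw [ballMeas, integrable_withDensity_iff_integrable_smul'
    (measurable_weight α).ennreal_ofReal (by simp)]
  refine integrableOn_congr_fun (fun y hy => ?_) measurableSet_unitBall
  simp only [smul_eq_mul]
  rw [ENNReal.toReal_ofReal (Real.rpow_nonneg (one_sub_pos hy).le _), mul_comm]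

lemma ballMeas_le {α : ℝ} (hα : 0 ≤ α) : ballMeas N α ≤ volume.restrict (unitBall N) := by
  refine Measure.le_iff.2 fun s hs => ?_
  rw [ballMeas, withDensity_apply _ hs, ← setLIntegral_one, Measure.restrict_restrict hs]
  refine setLIntegral_mono_ae measurable_const.aemeasurable ?_
  refine .of_forall fun y hy => ?_
  rw [← ENNReal.ofReal_one]
  apply ENNReal.ofReal_le_ofReal
  exact Real.rpow_le_one (one_sub_pos hy.2).le (by nlinarith [norm_nonneg y]) hα

lemma ballMeas_ac (α : ℝ) : ballMeas N α ≪ volume.restrict (unitBall N) :=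
  withDensity_absolutelyContinuous _ _

lemma ae_ballMeas_mem (α : ℝ) : ∀ᵐ y ∂(ballMeas N α), y ∈ unitBall N :=
  (ballMeas_ac α).ae_le (ae_restrict_mem measurableSet_unitBall)

lemma isFiniteMeasure_unitBall : IsFiniteMeasure (volume.restrict (unitBall N)) :=
  ⟨by
    rw [Measure.restrict_apply_univ]
    exact (measure_ball_lt_top : volume (Metric.ball (0 : Eucl N) 1) < ⊤)⟩

lemma isFiniteMeasure_ballMeas {α : ℝ} (hα : 0 ≤ α) : IsFiniteMeasure (ballMeas N α) := by
  have := isFiniteMeasure_unitBall (N := N)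
  exact ⟨(ballMeas_le hα univ).trans_lt (measure_lt_top _ _)⟩

/-- In polar coordinates `1 - r² = (1+r)(1-r)`, and only the factor `(1-r)^β` is singular. The case
needed is `β = α - 1`: integrals containing `1/(1-|y|²)` converge as soon as `α > 0`. -/
lemma integrableOn_weight (hN : 1 ≤ N) {β : ℝ} (hβ : -1 < β) :
    IntegrableOn (fun y : Eucl N => (1 - ‖y‖ ^ 2) ^ β) (unitBall N) := by
  have : Nonempty (Fin N) := ⟨⟨0, hN⟩⟩
  have : Nontrivial (Eucl N) := inferInstance
  have e : (unitBall N).indicator (fun y : Eucl N => (1 - ‖y‖ ^ 2) ^ β) =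
      fun y => (Iio (1 : ℝ)).indicator (fun r => (1 - r ^ 2) ^ β) ‖y‖ := by
    ext y
    by_cases hy : ‖y‖ < 1
    · rw [indicator_of_mem (mem_unitBall.2 hy), indicator_of_mem (show ‖y‖ ∈ Iio 1 from hy)]
    · rw [indicator_of_notMem (fun h => hy (mem_unitBall.1 h)),
        indicator_of_notMem (show ‖y‖ ∉ Iio 1 from hy)]
  rw [← integrable_indicator_iff measurableSet_unitBall, e, integrable_fun_norm_addHaar]
  have h1 : IntegrableOn (fun r : ℝ => (1 - r) ^ β) (Ioo 0 1) := by
    have h2 := intervalIntegral.intervalIntegrable_rpow' (a := 0) (b := 1) hβ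
    have h3 := h2.comp_sub_left 1
    simp only [sub_zero, sub_self] at h3
    have h4 := h3.symm
    rw [intervalIntegrable_iff_integrableOn_Ioo_of_le zero_le_one] at h4
    exact h4
  have h5 : IntegrableOn (fun r : ℝ => (2 : ℝ) ^ |β| * (1 - r) ^ β) (Ioo 0 1) := h1.const_mul _
  have h6 : IntegrableOn (fun r : ℝ => r ^ (Module.finrank ℝ (Eucl N) - 1) •
      (Iio (1 : ℝ)).indicator (fun r => (1 - r ^ 2) ^ β) r) (Ioo 0 1) := by
    refine Integrable.mono' h5 ?_ ?_
    · refine (Measurable.aestronglyMeasurable ?_)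
      refine (measurable_id.pow_const _).smul (Measurable.indicator ?_ measurableSet_Iio)
      exact (by fun_prop : Measurable fun r : ℝ => 1 - r ^ 2).pow_const β
    · filter_upwards [ae_restrict_mem measurableSet_Ioo] with r hr
      rw [indicator_of_mem (show r ∈ Iio 1 from hr.2), smul_eq_mul, norm_mul, norm_pow,
        Real.norm_of_nonneg hr.1.le, Real.norm_of_nonneg (Real.rpow_nonneg
          (by nlinarith [hr.1, hr.2]) _)]
      have e1 : (1 - r ^ 2) = (1 + r) * (1 - r) := by ring
      rw [e1, Real.mul_rpow (by linarith [hr.1]) (by linarith [hr.2])]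
      have h7 : (1 + r) ^ β ≤ 2 ^ |β| := by
        calc (1 + r) ^ β ≤ (1 + r) ^ |β| :=
              Real.rpow_le_rpow_of_exponent_le (by linarith [hr.1]) (le_abs_self β)
          _ ≤ 2 ^ |β| := Real.rpow_le_rpow (by linarith [hr.1]) (by linarith [hr.2]) (abs_nonneg _)
      have h8 : r ^ (Module.finrank ℝ (Eucl N) - 1) ≤ 1 := pow_le_one₀ hr.1.le hr.2.le
      have h9 : 0 ≤ (1 - r) ^ β := Real.rpow_nonneg (by linarith [hr.2]) _
      have h10 : 0 ≤ (1 + r) ^ β := Real.rpow_nonneg (by linarith [hr.1]) _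
      calc _ ≤ 1 * (2 ^ |β| * (1 - r) ^ β) := by gcongr
        _ = _ := one_mul _
  have h11 : Ioi (0 : ℝ) = Ioo 0 1 ∪ Ici 1 := by
    rw [Ioo_union_Ici_eq_Ioi zero_lt_one]
  rw [h11]
  refine h6.union ?_
  refine (integrableOn_zero).congr_fun (fun r hr => ?_) measurableSet_Ici
  rw [indicator_of_notMem (by simpa using hr), smul_zero]

lemma continuous_bound {F : Eucl N → ℝ} (hF : Continuous F) :
    ∃ C, 0 ≤ C ∧ ∀ y ∈ unitBall N, |F y| ≤ C := by
  obtain ⟨C, hC⟩ := (isCompact_closedBall (0 : Eucl N) 1).exists_bound_of_continuousOn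
    hF.continuousOn
  refine ⟨max C 0, le_max_right _ _, fun y hy => (hC y ?_).trans (le_max_left _ _)⟩
  simpa using (mem_unitBall.1 hy).le

lemma integrable_ballMeas {α : ℝ} (hα : 0 ≤ α) {F : Eucl N → ℝ} (hF : Continuous F) :
    Integrable F (ballMeas N α) := by
  have := isFiniteMeasure_ballMeas (N := N) hα
  obtain ⟨C, _, hC⟩ := continuous_bound hF
  refine Integrable.of_bound hF.aestronglyMeasurable C ?_
  filter_upwards [ae_ballMeas_mem α] with y hy using hC y hy

lemma integrable_ballMeas_div (hN : 1 ≤ N) {α : ℝ} (hα : 0 < α) {F : Eucl N → ℝ}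
    (hF : Continuous F) :
    Integrable (fun y => F y / (1 - ‖y‖ ^ 2)) (ballMeas N α) := by
  rw [integrable_ballMeas_iff]
  obtain ⟨C, _, hC⟩ := continuous_bound hF
  have h1 := (integrableOn_weight hN (β := α - 1) (by linarith)).const_mul C
  refine Integrable.mono' h1 ?_ ?_
  · refine Measurable.aestronglyMeasurable ?_
    have := hF.measurable
    exact (this.div (by fun_prop)).mul (measurable_weight α)
  · filter_upwards [ae_restrict_mem measurableSet_unitBall] with y hy
    have hp := one_sub_pos hy
    have h2 : F y / (1 - ‖y‖ ^ 2) * (1 - ‖y‖ ^ 2) ^ α = F y * (1 - ‖y‖ ^ 2) ^ (α - 1) := by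
      rw [Real.rpow_sub_one hp.ne']; field_simp
    rw [h2, norm_mul, Real.norm_of_nonneg (Real.rpow_nonneg hp.le _)]
    exact mul_le_mul_of_nonneg_right (hC y hy) (Real.rpow_nonneg hp.le _)

/-- `f` is continuously differentiable with partial derivatives `g i`. -/
structure HasGrad (f : Eucl N → ℝ) (g : Fin N → Eucl N → ℝ) : Prop where
  hasFDerivAt : ∀ y, HasFDerivAt f (∑ i, g i y • (EuclideanSpace.proj i : Eucl N →L[ℝ] ℝ)) y
  cont : ∀ i, Continuous (g i)

namespace HasGrad

variable {f f₁ : Eucl N → ℝ} {g g₁ : Fin N → Eucl N → ℝ}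

lemma continuous (h : HasGrad f g) : Continuous f :=
  continuous_iff_continuousAt.2 fun y => (h.hasFDerivAt y).continuousAt

lemma mul (h : HasGrad f g) (h₁ : HasGrad f₁ g₁) :
    HasGrad (fun y => f y * f₁ y) (fun i y => g i y * f₁ y + f y * g₁ i y) where
  hasFDerivAt y := by
    convert! (h.hasFDerivAt y).mul (h₁.hasFDerivAt y) using 1
    simp only [Finset.smul_sum, ← Finset.sum_add_distrib]
    refine Finset.sum_congr rfl fun i _ => ?_
    ext x
    simp only [add_apply, smul_apply, smul_eq_mul]
    ring
  cont i := by
    have := h.cont i; have := h₁.cont i; have := h.continuous; have := h₁.continuous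
    fun_prop

lemma add (h : HasGrad f g) (h₁ : HasGrad f₁ g₁) :
    HasGrad (fun y => f y + f₁ y) (fun i y => g i y + g₁ i y) where
  hasFDerivAt y := by
    convert! (h.hasFDerivAt y).add (h₁.hasFDerivAt y) using 1
    simp only [← Finset.sum_add_distrib, add_smul]
  cont i := by
    have := h.cont i; have := h₁.cont i
    fun_prop

lemma const_mul (c : ℝ) (h : HasGrad f g) :
    HasGrad (fun y => c * f y) (fun i y => c * g i y) where
  hasFDerivAt y := by
    convert! (h.hasFDerivAt y).const_mul c using 1
    simp only [Finset.smul_sum, smul_smul]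
  cont i := by
    have := h.cont i
    fun_prop

lemma coord (j : Fin N) : HasGrad (fun y => y j) (fun i _ => if i = j then 1 else 0) where
  hasFDerivAt y := by
    convert! (EuclideanSpace.proj j : Eucl N →L[ℝ] ℝ).hasFDerivAt using 1
    simp
  cont i := continuous_const

lemma sum {κ : Type*} (s : Finset κ) {f : κ → Eucl N → ℝ} {g : κ → Fin N → Eucl N → ℝ}
    (h : ∀ k ∈ s, HasGrad (f k) (g k)) :
    HasGrad (fun y => ∑ k ∈ s, f k y) (fun i y => ∑ k ∈ s, g k i y) where
  hasFDerivAt y := by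
    convert! HasFDerivAt.fun_sum fun k hk => (h k hk).hasFDerivAt y using 1
    rw [Finset.sum_comm]
    simp only [Finset.sum_smul]
  cont i := continuous_finsetSum _ fun k hk => (h k hk).cont i

lemma congr_grad (h : HasGrad f g) (e : ∀ i y, g i y = g₁ i y) : HasGrad f g₁ := by
  have : g = g₁ := by ext i y; exact e i y
  rwa [← this]

lemma fderiv_single (h : HasGrad f g) (y : Eucl N) (i : Fin N) :
    fderiv ℝ f y (EuclideanSpace.single i 1) = g i y := by
  rw [(h.hasFDerivAt y).fderiv]
  simp

end HasGrad

/-- The profile `t ↦ h(nt) t^α`, with a smooth cutoff `h` vanishing for `nt ≤ 1`. -/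
noncomputable def cutPow (α : ℝ) (n : ℕ) (t : ℝ) : ℝ :=
  Real.smoothTransition (((n : ℝ) + 1) * t - 1) * t ^ α

lemma cutPow_eq_zero {α : ℝ} {n : ℕ} {t : ℝ} (h : ((n : ℝ) + 1) * t ≤ 1) : cutPow α n t = 0 := by
  rw [cutPow, Real.smoothTransition.zero_of_nonpos (by linarith), zero_mul]

lemma cutPow_contDiff (α : ℝ) (n : ℕ) : ContDiff ℝ 1 (cutPow α n) := by
  rw [contDiff_iff_contDiffAt]
  intro t
  have hn : (0 : ℝ) < (n : ℝ) + 1 := by positivity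
  rcases lt_or_ge (((n : ℝ) + 1) * t) 1 with h | h
  · have : cutPow α n =ᶠ[𝓝 t] fun _ => 0 := by
      have h1 : ∀ᶠ x in 𝓝 t, ((n : ℝ) + 1) * x < 1 :=
        (by fun_prop : Continuous fun x : ℝ => ((n : ℝ) + 1) * x).continuousAt.eventually_lt
          continuousAt_const h
      filter_upwards [h1] with x hx using cutPow_eq_zero hx.le
    exact contDiffAt_const.congr_of_eventuallyEq this
  · have ht : 0 < t := by
      by_contra hc
      nlinarith
    refine ContDiffAt.mul ?_ (Real.contDiffAt_rpow_const_of_ne ht.ne')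
    exact Real.smoothTransition.contDiff.contDiffAt.comp t (by fun_prop)

lemma exists_smoothTransition_deriv_bound : ∃ C, 0 ≤ C ∧ ∀ x, |deriv Real.smoothTransition x| ≤ C := by
  have hc : Continuous (deriv Real.smoothTransition) :=
    (Real.smoothTransition.contDiff (n := 1)).continuous_deriv le_rfl
  obtain ⟨C, hC⟩ := (isCompact_Icc (a := (0 : ℝ)) (b := 1)).exists_bound_of_continuousOn
    hc.continuousOn
  refine ⟨max C 0, le_max_right _ _, fun x => ?_⟩
  by_cases hx : x ∈ Icc (0 : ℝ) 1
  · exact (hC x hx).trans (le_max_left _ _)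
  · have : deriv Real.smoothTransition x = 0 := by
      rw [mem_Icc, not_and_or, not_le, not_le] at hx
      rcases hx with hx | hx
      · have : Real.smoothTransition =ᶠ[𝓝 x] fun _ => 0 := by
          filter_upwards [Iio_mem_nhds hx] with z hz
          exact Real.smoothTransition.zero_of_nonpos (le_of_lt hz)
        rw [this.deriv_eq]; simp
      · have : Real.smoothTransition =ᶠ[𝓝 x] fun _ => 1 := by
          filter_upwards [Ioi_mem_nhds hx] with z hz
          exact Real.smoothTransition.one_of_one_le (le_of_lt hz)
        rw [this.deriv_eq]; simp
    rw [this]; simp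

lemma deriv_cutPow_of_pos (α : ℝ) (n : ℕ) {t : ℝ} (ht : 0 < t) :
    deriv (cutPow α n) t = deriv Real.smoothTransition (((n : ℝ) + 1) * t - 1) * ((n : ℝ) + 1) * t ^ α
      + Real.smoothTransition (((n : ℝ) + 1) * t - 1) * (α * t ^ (α - 1)) := by
  have h1 : HasDerivAt (fun t : ℝ => ((n : ℝ) + 1) * t - 1) ((n : ℝ) + 1) t := by
    simpa using ((hasDerivAt_id t).const_mul ((n : ℝ) + 1)).sub_const 1
  have h2 : HasDerivAt Real.smoothTransition
      (deriv Real.smoothTransition (((n : ℝ) + 1) * t - 1)) (((n : ℝ) + 1) * t - 1) :=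
    ((Real.smoothTransition.contDiff (n := 1)).differentiable one_ne_zero _).hasDerivAt
  exact ((h2.comp t h1).mul (Real.hasDerivAt_rpow_const (Or.inl ht.ne'))).deriv

lemma deriv_cutPow_of_le {α : ℝ} {n : ℕ} {t : ℝ} (ht : t ≤ 0) : deriv (cutPow α n) t = 0 := by
  have : cutPow α n =ᶠ[𝓝 t] fun _ => 0 := by
    have h1 : ∀ᶠ x in 𝓝 t, ((n : ℝ) + 1) * x < 1 :=
      (by fun_prop : Continuous fun x : ℝ => ((n : ℝ) + 1) * x).continuousAt.eventually_lt
        continuousAt_const (by nlinarith [(by positivity : (0 : ℝ) < (n : ℝ) + 1)])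
    filter_upwards [h1] with x hx using cutPow_eq_zero hx.le
  rw [this.deriv_eq]; simp

/-- The derivative of the cutoff is of size `n + 1`, but it is nonzero only where `(n+1) t ≤ 2`, so
it costs at most a factor `2/t`. The bound is uniform in `n` and has the integrable profile
`t^{α-1}`. -/
lemma abs_deriv_cutPow_le (α : ℝ) : ∃ C, 0 ≤ C ∧ ∀ n t, 0 < t → |deriv (cutPow α n) t| ≤ C * t ^ (α - 1) := by
  obtain ⟨C, hC0, hC⟩ := exists_smoothTransition_deriv_bound
  refine ⟨2 * C + |α|, by positivity, fun n t ht => ?_⟩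
  rw [deriv_cutPow_of_pos α n ht]
  have hp : 0 < t ^ (α - 1) := Real.rpow_pos_of_pos ht _
  have hn : (0 : ℝ) < (n : ℝ) + 1 := by positivity
  have e : t ^ α = t ^ (α - 1) * t := by rw [← Real.rpow_add_one ht.ne']; simp
  have h1 : |deriv Real.smoothTransition (((n : ℝ) + 1) * t - 1) * ((n : ℝ) + 1) * t ^ α| ≤
      2 * C * t ^ (α - 1) := by
    rcases le_or_gt (((n : ℝ) + 1) * t) 2 with h | h
    · rw [e, abs_mul, abs_mul, abs_mul, abs_of_pos hn, abs_of_pos hp, abs_of_pos ht]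
      calc _ = |deriv Real.smoothTransition (((n : ℝ) + 1) * t - 1)| * (((n : ℝ) + 1) * t) * t ^ (α - 1) := by ring
        _ ≤ C * 2 * t ^ (α - 1) := by gcongr; exact hC _
        _ = _ := by ring
    · have : Real.smoothTransition =ᶠ[𝓝 (((n : ℝ) + 1) * t - 1)] fun _ => 1 := by
        filter_upwards [Ioi_mem_nhds (show 1 < ((n : ℝ) + 1) * t - 1 by linarith)] with z hz
        exact Real.smoothTransition.one_of_one_le (le_of_lt hz)
      rw [this.deriv_eq]
      simp only [deriv_const, zero_mul, abs_zero]; positivity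
  have h2 : |Real.smoothTransition (((n : ℝ) + 1) * t - 1) * (α * t ^ (α - 1))| ≤ |α| * t ^ (α - 1) := by
    rw [abs_mul, abs_mul, abs_of_pos hp, abs_of_nonneg (Real.smoothTransition.nonneg _)]
    have := Real.smoothTransition.le_one (((n : ℝ) + 1) * t - 1)
    have h3 : 0 ≤ |α| * t ^ (α - 1) := by positivity
    nlinarith
  exact (abs_add_le _ _).trans (by linarith)

lemma tendsto_deriv_cutPow (α : ℝ) {t : ℝ} (ht : 0 < t) :
    Tendsto (fun n => deriv (cutPow α n) t) atTop (𝓝 (α * t ^ (α - 1))) := by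
  refine tendsto_const_nhds.congr' ?_
  obtain ⟨n₀, hn₀⟩ := exists_nat_gt (2 / t)
  filter_upwards [eventually_ge_atTop n₀] with n hn
  have h : 2 < ((n : ℝ) + 1) * t := by
    have : (n₀ : ℝ) ≤ n := by exact_mod_cast hn
    rw [div_lt_iff₀ ht] at hn₀
    nlinarith
  rw [deriv_cutPow_of_pos α n ht]
  have : Real.smoothTransition =ᶠ[𝓝 (((n : ℝ) + 1) * t - 1)] fun _ => 1 := by
    filter_upwards [Ioi_mem_nhds (show 1 < ((n : ℝ) + 1) * t - 1 by linarith)] with z hz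
    exact Real.smoothTransition.one_of_one_le (le_of_lt hz)
  rw [this.deriv_eq, Real.smoothTransition.one_of_one_le (by linarith)]
  simp

lemma tendsto_cutPow (α : ℝ) {t : ℝ} (ht : 0 < t) :
    Tendsto (fun n => cutPow α n t) atTop (𝓝 (t ^ α)) := by
  refine tendsto_const_nhds.congr' ?_
  obtain ⟨n₀, hn₀⟩ := exists_nat_gt (2 / t)
  filter_upwards [eventually_ge_atTop n₀] with n hn
  have h : 2 < ((n : ℝ) + 1) * t := by
    have : (n₀ : ℝ) ≤ n := by exact_mod_cast hn
    rw [div_lt_iff₀ ht] at hn₀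
    nlinarith
  rw [cutPow, Real.smoothTransition.one_of_one_le (by linarith), one_mul]

/-- Integration by parts against the weight `(1 - |y|²)^α` on the unit ball. -/
lemma HasGrad.integral_eq (hN : 1 ≤ N) {α : ℝ} (hα : 0 < α) {f : Eucl N → ℝ}
    {g : Fin N → Eucl N → ℝ} (h : HasGrad f g) (i : Fin N) :
    ∫ y, g i y ∂(ballMeas N α) = ∫ y, 2 * α * (f y * y i / (1 - ‖y‖ ^ 2)) ∂(ballMeas N α) := by
  rw [integral_ballMeas, integral_ballMeas]
  set Q : ℕ → Eucl N → ℝ := fun n y => cutPow α n (1 - ‖y‖ ^ 2) with hQ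
  have hsq : ∀ y : Eucl N, HasFDerivAt (fun y : Eucl N => 1 - ‖y‖ ^ 2)
      (-(2 • (innerSL ℝ y : Eucl N →L[ℝ] ℝ))) y := fun y => by
    simpa using (hasStrictFDerivAt_norm_sq y).hasFDerivAt.const_sub 1
  have hQd : ∀ n y, HasFDerivAt (Q n) (deriv (cutPow α n) (1 - ‖y‖ ^ 2) •
      (-(2 • (innerSL ℝ y : Eucl N →L[ℝ] ℝ)) : Eucl N →L[ℝ] ℝ)) y := fun n y =>
    (((cutPow_contDiff α n).differentiable one_ne_zero _).hasDerivAt).comp_hasFDerivAt y (hsq y)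
  have hQe : ∀ n y, fderiv ℝ (Q n) y (EuclideanSpace.single i 1) =
      -(2 * y i * deriv (cutPow α n) (1 - ‖y‖ ^ 2)) := fun n y => by
    rw [(hQd n y).fderiv]
    simp [EuclideanSpace.inner_single_right]
    ring
  have hQc : ∀ n, Continuous (Q n) := fun n =>
    continuous_iff_continuousAt.2 fun y => (hQd n y).continuousAt
  have hdc : ∀ n, Continuous fun y : Eucl N => deriv (cutPow α n) (1 - ‖y‖ ^ 2) := fun n =>
    ((cutPow_contDiff α n).continuous_deriv le_rfl).comp (by fun_prop)
  have hQ0 : ∀ n y, y ∉ unitBall N → Q n y = 0 := fun n y hy => by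
    rw [mem_unitBall, not_lt] at hy
    refine cutPow_eq_zero ?_
    have : 1 - ‖y‖ ^ 2 ≤ 0 := by nlinarith
    nlinarith [(by positivity : (0 : ℝ) < (n : ℝ) + 1)]
  have hdQ0 : ∀ n (y : Eucl N), y ∉ unitBall N → deriv (cutPow α n) (1 - ‖y‖ ^ 2) = 0 :=
    fun n y hy => by
    rw [mem_unitBall, not_lt] at hy
    exact deriv_cutPow_of_le (by nlinarith)
  have hcs : ∀ {F : Eucl N → ℝ}, Continuous F → (∀ y, y ∉ unitBall N → F y = 0) → Integrable F :=
    fun {F} hF h0 => hF.integrable_of_hasCompactSupport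
      (HasCompactSupport.intro (isCompact_closedBall 0 1) fun y hy => h0 y fun hy' => hy (by
        simpa using (mem_unitBall.1 hy').le))
  have hfc := h.continuous
  have hgc := h.cont i
  have hyc : Continuous fun y : Eucl N => y i := by fun_prop
  have hfe : ∀ y, fderiv ℝ f y (EuclideanSpace.single i 1) = g i y := fun y => h.fderiv_single y i
  -- For small `α` the weight is not differentiable up to the sphere. The integration by parts is
  -- done with the cut weight `Q n`, which is `C¹` on the whole space and vanishes outside the ball;
  -- the limit `n → ∞` follows by dominated convergence.
  have ibp : ∀ n, ∫ y in unitBall N, g i y * Q n y =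
      ∫ y in unitBall N, f y * (2 * y i * deriv (cutPow α n) (1 - ‖y‖ ^ 2)) := fun n => by
    have h1 := integral_mul_fderiv_eq_neg_fderiv_mul_of_integrable (μ := (volume : Measure (Eucl N)))
      (f := f) (g := Q n) (v := EuclideanSpace.single i 1) ?_ ?_ ?_
      (fun y _ => (h.hasFDerivAt y).differentiableAt) (fun y _ => (hQd n y).differentiableAt)
    · simp only [hfe, hQe] at h1
      rw [setIntegral_eq_integral_of_forall_compl_eq_zero (fun y hy => by rw [hQ0 n y hy, mul_zero]),
        setIntegral_eq_integral_of_forall_compl_eq_zero (fun y hy => by rw [hdQ0 n y hy]; ring)]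
      simp only [mul_neg, integral_neg, neg_inj] at h1
      exact h1.symm
    · simp only [hfe]
      exact hcs (hgc.mul (hQc n)) fun y hy => by rw [hQ0 n y hy, mul_zero]
    · simp only [hQe]
      have := hdc n
      refine hcs (by fun_prop) fun y hy => ?_
      rw [hdQ0 n y hy]; ring
    · exact hcs (hfc.mul (hQc n)) fun y hy => by rw [hQ0 n y hy, mul_zero]
  have lim1 : Tendsto (fun n => ∫ y in unitBall N, g i y * Q n y) atTop
      (𝓝 (∫ y in unitBall N, g i y * (1 - ‖y‖ ^ 2) ^ α)) := by
    refine tendsto_integral_of_dominated_convergence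
      (fun y => |g i y * (1 - ‖y‖ ^ 2) ^ α|)
      (fun n => (hgc.mul (hQc n)).aestronglyMeasurable) ?_ (fun n => ?_) ?_
    · exact ((integrable_ballMeas_iff α (g i)).1 (integrable_ballMeas hα.le hgc)).abs
    · filter_upwards [ae_restrict_mem measurableSet_unitBall] with y hy
      rw [Real.norm_eq_abs, abs_mul, abs_mul]
      have hp := one_sub_pos hy
      refine mul_le_mul_of_nonneg_left ?_ (abs_nonneg _)
      simp only [hQ, cutPow]
      rw [abs_mul, abs_of_nonneg (Real.smoothTransition.nonneg _)]
      exact mul_le_of_le_one_left (abs_nonneg _) (Real.smoothTransition.le_one _)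
    · filter_upwards [ae_restrict_mem measurableSet_unitBall] with y hy
      exact (tendsto_cutPow α (one_sub_pos hy)).const_mul _
  have lim2 : Tendsto (fun n => ∫ y in unitBall N, f y *
      (2 * y i * deriv (cutPow α n) (1 - ‖y‖ ^ 2))) atTop
      (𝓝 (∫ y in unitBall N, 2 * α * (f y * y i / (1 - ‖y‖ ^ 2)) * (1 - ‖y‖ ^ 2) ^ α)) := by
    obtain ⟨C, hC0, hC⟩ := abs_deriv_cutPow_le α
    obtain ⟨K, hK0, hK⟩ := continuous_bound (F := fun y : Eucl N => f y * (2 * y i)) (by fun_prop)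
    refine tendsto_integral_of_dominated_convergence
      (fun y => K * C * (1 - ‖y‖ ^ 2) ^ (α - 1)) (fun n => ?_) ?_ (fun n => ?_) ?_
    · have := hdc n
      exact Continuous.aestronglyMeasurable (by fun_prop)
    · exact (integrableOn_weight hN (by linarith)).const_mul _
    · filter_upwards [ae_restrict_mem measurableSet_unitBall] with y hy
      have hp := one_sub_pos hy
      have h1 := hC n _ hp
      have h2 := hK y hy
      rw [Real.norm_eq_abs, ← mul_assoc, abs_mul, mul_assoc]
      exact mul_le_mul h2 h1 (abs_nonneg _) hK0
    · filter_upwards [ae_restrict_mem measurableSet_unitBall] with y hy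
      have hp := one_sub_pos hy
      have h1 := ((tendsto_deriv_cutPow α hp).const_mul (2 * y i)).const_mul (f y)
      convert h1 using 2
      rw [Real.rpow_sub_one hp.ne']
      field_simp
  simp_rw [ibp] at lim1
  exact tendsto_nhds_unique lim1 lim2

/-- Divergence theorem for the weight `(1 - |y|²)^α` on the unit ball. -/
lemma integral_div_eq_zero (hN : 1 ≤ N) {α : ℝ} (hα : 0 < α) {Y : Fin N → Eucl N → ℝ}
    {g : Fin N → Fin N → Eucl N → ℝ} (h : ∀ i, HasGrad (Y i) (g i)) :
    ∫ y, (∑ i, (g i i y - 2 * α * (Y i y * y i / (1 - ‖y‖ ^ 2)))) ∂(ballMeas N α) = 0 := by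
  have hi : ∀ i, Integrable (fun y => 2 * α * (Y i y * y i / (1 - ‖y‖ ^ 2))) (ballMeas N α) :=
    fun i => (integrable_ballMeas_div hN hα (F := fun y => Y i y * y i) (by
      have := (h i).continuous; fun_prop)).const_mul _
  rw [integral_finsetSum _ fun i _ => by exact (integrable_ballMeas hα.le ((h i).cont i)).sub (hi i)]
  refine Finset.sum_eq_zero fun i _ => ?_
  rw [integral_sub (integrable_ballMeas hα.le ((h i).cont i)) (hi i), (h i).integral_eq hN hα i,
    sub_self]

lemma integrable_div (hN : 1 ≤ N) {α : ℝ} (hα : 0 < α) {Y : Fin N → Eucl N → ℝ}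
    {g : Fin N → Fin N → Eucl N → ℝ} (h : ∀ i, HasGrad (Y i) (g i)) :
    Integrable (fun y => ∑ i, (g i i y - 2 * α * (Y i y * y i / (1 - ‖y‖ ^ 2)))) (ballMeas N α) := by
  refine integrable_finsetSum _ fun i _ => (integrable_ballMeas hα.le ((h i).cont i)).sub ?_
  exact (integrable_ballMeas_div hN hα (F := fun y => Y i y * y i) (by
      have := (h i).continuous; fun_prop)).const_mul _

end BallMeasure

/-! ### The energy inequality at a fixed time, for smooth functions. -/

section StaticInequality

/-- The pointwise quadratic estimate behind the energy inequality. -/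
lemma pointwise_energy_bound {α a κ₀ c₂ β μ n η w v D g2 r2 t S₂ : ℝ} (hα : 0 < α) (ha : 0 < a)
    (hκ : 0 < κ₀) (hβ : 0 < β) (hμ : 0 < μ) (hη : 0 < η) (hη1 : η ≤ 1)
    (ht : 0 < t) (hr : r2 = 1 - t) (hr0 : 0 ≤ r2) (hD : D ^ 2 ≤ r2 * g2)
    (hg : 0 ≤ g2) (hβ1 : β ≤ a / 4 * α) (hβ2 : β * n ≤ a * κ₀ / 4) (hμ1 : μ ≤ β * α / 2)
    (hμ2 : μ ≤ a * κ₀ / 4)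
    (hηs : η * (c₂ ^ 2 / (a * κ₀) + 4 / a + 8 * α / β) ≤ α) :
    -(2 * α) * (v ^ 2 / t) + S₂ * v - η * (w * S₂) + η * (-(a * (g2 - D ^ 2)) - a * κ₀ * w ^ 2
        + c₂ * (|w| * |v|) - 2 * (v * D) + 4 * α * (w * v * r2 / t)) ≤
      -(min (a / 2) (a * κ₀ / 4) * η * (t * g2 + w ^ 2))
        + (1 / (2 * α) + 1 / (4 * μ)) * (t * S₂ ^ 2)
        + β * η * (2 * α * (w ^ 2 * r2 / t) - n * w ^ 2 - 2 * (w * D)) := by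
  set V := v ^ 2 / t with hV
  set H := w ^ 2 * r2 / t with hH
  have hV0 : 0 ≤ V := by positivity
  have hH0 : 0 ≤ H := by positivity
  have ht1 : t ≤ 1 := by linarith
  have eV : V * t = v ^ 2 := by rw [hV]; field_simp
  have eH : H * t = w ^ 2 * r2 := by rw [hH]; field_simp
  have hvV : v ^ 2 ≤ V := by rw [← eV]; nlinarith
  have hG : t * g2 ≤ g2 - D ^ 2 := by rw [hr] at hD; nlinarith
  have hD2 : D ^ 2 ≤ g2 := by nlinarith
  -- Weighted Young inequality. It is applied once to each cross term, with the weight `s` dictated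
  -- by the share of the dissipation that this term may consume.
  have young : ∀ {x A B s : ℝ}, 0 < s → 0 ≤ A → 0 ≤ B → x ^ 2 ≤ A * B → x ≤ s * A + 1 / (4 * s) * B := by
    intro x A B s hs hA hB hx
    have h1 : x ^ 2 ≤ (s * A + 1 / (4 * s) * B) ^ 2 := by
      have : (s * A + 1 / (4 * s) * B) ^ 2 = A * B + (s * A - 1 / (4 * s) * B) ^ 2 := by
        field_simp; ring
      rw [this]; nlinarith [sq_nonneg (s * A - 1 / (4 * s) * B)]
    exact le_of_abs_le (abs_le_of_sq_le_sq h1 (by positivity))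
  have y1 : c₂ * (|w| * |v|) ≤ a * κ₀ / 4 * w ^ 2 + c₂ ^ 2 / (a * κ₀) * V := by
    have := young (x := c₂ * (|w| * |v|)) (A := w ^ 2) (B := c₂ ^ 2 * V) (s := a * κ₀ / 4)
      (by positivity) (by positivity) (by positivity) (by
        rw [mul_pow, mul_pow, sq_abs, sq_abs]
        have := mul_le_mul_of_nonneg_left hvV (by positivity : 0 ≤ c₂ ^ 2 * w ^ 2)
        linarith)
    refine this.trans (le_of_eq ?_); field_simp
  have y2 : -(2 * (v * D)) ≤ a / 4 * (t * g2) + 4 / a * V := by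
    have := young (x := -(2 * (v * D))) (A := t * g2) (B := 4 * V) (s := a / 4)
      (by positivity) (by positivity) (by positivity) (by
        have : (-(2 * (v * D))) ^ 2 = 4 * (V * t) * D ^ 2 := by rw [eV]; ring
        rw [this]
        have := mul_le_mul_of_nonneg_left hD2 (by positivity : 0 ≤ 4 * (V * t))
        linarith)
    refine this.trans (le_of_eq ?_); field_simp
  have y3 : 4 * α * (w * v * r2 / t) ≤ β * α / 2 * H + 8 * α / β * V := by
    have := young (x := 4 * α * (w * v * r2 / t)) (A := H) (B := 16 * α ^ 2 * V) (s := β * α / 2)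
      (by positivity) hH0 (by positivity) (by
        have : (4 * α * (w * v * r2 / t)) ^ 2 = 16 * α ^ 2 * (H * V) * r2 := by
          rw [hH, hV]; field_simp; ring
        rw [this]
        have h1 : 0 ≤ 16 * α ^ 2 * (H * V) := by positivity
        have h2 : r2 ≤ 1 := by linarith
        have := mul_le_mul_of_nonneg_left h2 h1
        linarith)
    refine this.trans (le_of_eq ?_); field_simp; ring
  have y4 : S₂ * v ≤ α / 2 * V + 1 / (2 * α) * (t * S₂ ^ 2) := by
    have := young (x := S₂ * v) (A := V) (B := t * S₂ ^ 2) (s := α / 2)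
      (by positivity) hV0 (by positivity) (by
        have : (S₂ * v) ^ 2 = V * t * S₂ ^ 2 := by rw [eV]; ring
        rw [this]; exact le_of_eq (by ring))
    refine this.trans (le_of_eq ?_); field_simp; ring
  have y5 : -(w * S₂) ≤ μ * (H + w ^ 2) + 1 / (4 * μ) * (t * S₂ ^ 2) := by
    refine young (x := -(w * S₂)) (A := H + w ^ 2) (B := t * S₂ ^ 2) (s := μ) hμ
      (by positivity) (by positivity) ?_
    have : (H + w ^ 2) * (t * S₂ ^ 2) = (H * t + w ^ 2 * t) * S₂ ^ 2 := by ring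
    rw [this, eH, hr]; exact le_of_eq (by ring)
  have y6 : 2 * (w * D) ≤ α * H + 1 / α * (t * g2) := by
    have := young (x := 2 * (w * D)) (A := H) (B := 4 * (t * g2)) (s := α) hα hH0 (by positivity) (by
      have e : H * (4 * (t * g2)) = 4 * (H * t) * g2 := by ring
      rw [e, eH]
      have := mul_le_mul_of_nonneg_left hD (by positivity : 0 ≤ 4 * w ^ 2)
      linarith)
    refine this.trans (le_of_eq ?_); field_simp
  have m1 : min (a / 2) (a * κ₀ / 4) ≤ a / 2 := min_le_left _ _
  have m2 : min (a / 2) (a * κ₀ / 4) ≤ a * κ₀ / 4 := min_le_right _ _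
  have tg : 0 ≤ t * g2 := by positivity
  have tS : 0 ≤ 1 / (4 * μ) * (t * S₂ ^ 2) := by positivity
  have hβα : β * (1 / α) ≤ a / 4 := by rw [mul_one_div, div_le_iff₀ hα]; exact hβ1
  -- Bookkeeping. The Hardy quantity `H` receives `βα/2 + βα/2 + βα = 2αβ`, exactly what the term
  -- with `β` supplies. The loss in `(1-|y|²)|∇w|²` is `a/4 + a/4` out of `a`, and the loss in `w²`
  -- is three quarters of `a κ₀`. All of `V` is postponed: with the small factor `η` it costs at
  -- most `α`, and together with the `α/2` from `y4` it stays below the available `2α`.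
  have k1 : -(w * S₂) + (-(a * (g2 - D ^ 2)) - a * κ₀ * w ^ 2
        + c₂ * (|w| * |v|) - 2 * (v * D) + 4 * α * (w * v * r2 / t))
        - β * (2 * α * H - n * w ^ 2 - 2 * (w * D)) ≤
      (c₂ ^ 2 / (a * κ₀) + 4 / a + 8 * α / β) * V + 1 / (4 * μ) * (t * S₂ ^ 2)
        - min (a / 2) (a * κ₀ / 4) * (t * g2 + w ^ 2) := by
    have z1 := mul_le_mul_of_nonneg_left y6 hβ.le
    have z2 := mul_le_mul_of_nonneg_left hG ha.le
    have z3 : β * (1 / α * (t * g2)) ≤ a / 4 * (t * g2) := by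
      rw [← mul_assoc]; exact mul_le_mul_of_nonneg_right hβα tg
    have z4 : min (a / 2) (a * κ₀ / 4) * (t * g2) ≤ a / 2 * (t * g2) :=
      mul_le_mul_of_nonneg_right m1 tg
    have z5 : min (a / 2) (a * κ₀ / 4) * w ^ 2 ≤ a * κ₀ / 4 * w ^ 2 :=
      mul_le_mul_of_nonneg_right m2 (sq_nonneg w)
    have z6 : β * n * w ^ 2 ≤ a * κ₀ / 4 * w ^ 2 := mul_le_mul_of_nonneg_right hβ2 (sq_nonneg w)
    have z7 : μ * w ^ 2 ≤ a * κ₀ / 4 * w ^ 2 := mul_le_mul_of_nonneg_right hμ2 (sq_nonneg w)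
    have z8 : μ * H ≤ β * α / 2 * H := mul_le_mul_of_nonneg_right hμ1 hH0
    linarith
  have k2 := mul_le_mul_of_nonneg_left k1 hη.le
  have k3 : η * (c₂ ^ 2 / (a * κ₀) + 4 / a + 8 * α / β) * V ≤ α * V :=
    mul_le_mul_of_nonneg_right hηs hV0
  have k4 : η * (1 / (4 * μ) * (t * S₂ ^ 2)) ≤ 1 / (4 * μ) * (t * S₂ ^ 2) :=
    mul_le_of_le_one_left tS hη1
  have k5 : 0 ≤ α * V := by positivity
  have e1 : -(2 * α) * (v ^ 2 / t) = -(2 * α) * V := rfl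
  have e2 : w ^ 2 * r2 / t = H := rfl
  linarith

variable {N : ℕ}

lemma sum_coord_sq (y : Eucl N) : ∑ i, y i ^ 2 = ‖y‖ ^ 2 := by
  rw [EuclideanSpace.norm_sq_eq]; simp

lemma sq_sum_coord_mul_le (y : Eucl N) (g : Fin N → ℝ) :
    (∑ i, y i * g i) ^ 2 ≤ ‖y‖ ^ 2 * ∑ i, g i ^ 2 := by
  rw [← sum_coord_sq]; exact Finset.sum_mul_sq_le_sq_mul_sq _ _ _

/-- The energy density `½v² + ½|∇w|² - ½(y·∇w)² + ½κ₀w²`. -/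
noncomputable def linDensity (κ₀ w v : ℝ) (g : Fin N → ℝ) (y : Eucl N) : ℝ :=
  1 / 2 * v ^ 2 + 1 / 2 * ∑ i, g i ^ 2 - 1 / 2 * (∑ i, y i * g i) ^ 2 + 1 / 2 * κ₀ * w ^ 2

/-- The second time derivative prescribed by the equation, in terms of the first and second
derivatives of the unknown and the source `S`. -/
noncomputable def waveOp (k w v : ℝ) (g vg : Fin N → ℝ) (h : Fin N → Fin N → ℝ) (S : ℝ)
    (y : Eucl N) : ℝ :=
  (∑ i, h i i) - (∑ j, y j * (g j + ∑ i, y i * h i j)) - (2 * k + 1) * (∑ i, y i * g i)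
    - (2 * k + 1) * v - 2 * (∑ j, y j * vg j) - k * (k + 1) * w + S

/-- The time derivative of the energy density, combined with the time derivatives of the
weights. -/
noncomputable def rateDensity (k p γ η w v : ℝ) (g vg : Fin N → ℝ) (h : Fin N → Fin N → ℝ) (S : ℝ)
    (y : Eucl N) : ℝ :=
  v * waveOp k w v g vg h S y + ∑ i, g i * vg i - (∑ i, y i * g i) * (∑ i, y i * vg i)
    + k * (k + 1) * w * v + γ * η * w * v - η * v ^ 2 - η * w * waveOp k w v g vg h S y
    - (p + 3) / 2 * η * (linDensity (k * (k + 1)) w v g y - η * w * v)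

/-- The integral of the rate is unchanged when a weighted divergence is subtracted. For a suitable
vector field all second derivatives cancel, and what remains is bounded pointwise by
`pointwise_energy_bound`. The two sources play different roles: `S₁` is kept exactly, because it
will cancel against the derivative of the potential energy, whereas `S₂` is absorbed by
`v²/(1-|y|²)`, which leaves the weighted square `(1-|y|²) S₂²`. -/
theorem static_energy_inequality (hN : 1 ≤ N) {α k p γ : ℝ} (hα : 0 < α) (hk : 0 < k) (hp : 1 < p)
    (hNk : (N : ℝ) + 2 * α = 2 * k + 1) :
    ∃ c > 0, ∃ C > 0, ∃ η₀ > 0, η₀ ≤ 1 ∧ ∀ η, 0 < η → η ≤ η₀ →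
      ∀ (w v : Eucl N → ℝ) (g vg : Fin N → Eucl N → ℝ) (h : Fin N → Fin N → Eucl N → ℝ)
        (S₁ S₂ : Eucl N → ℝ), HasGrad w g → HasGrad v vg → (∀ i, HasGrad (g i) (h i)) →
        Continuous S₁ → Continuous S₂ →
        ∫ y, rateDensity k p γ η (w y) (v y) (fun i => g i y) (fun i => vg i y)
            (fun i j => h i j y) (S₁ y + S₂ y) y ∂(ballMeas N α) ≤
          ∫ y, (S₁ y * v y - η * (w y * S₁ y)
            - c * η * (v y ^ 2 + (1 - ‖y‖ ^ 2) * (∑ i, g i y ^ 2) + w y ^ 2)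
            + C * ((1 - ‖y‖ ^ 2) * S₂ y ^ 2)) ∂(ballMeas N α) := by
  -- The multiplier `-η w` produces `+η(|∇w|² - (y·∇w)² + κ₀ w²)`, and the exponential weight
  -- produces `-(p+3)/4` times `η` times the same quantity. The balance is `-(p-1)/4`.
  set a := (p - 1) / 4 with ha'
  have ha : 0 < a := by rw [ha']; linarith
  set κ₀ := k * (k + 1) with hκ'
  have hκ : 0 < κ₀ := by positivity
  set c₂ := |γ + (2 * k + 1) - 2 * N| + (p + 3) / 2 with hc₂
  have hN0 : (0 : ℝ) < N := by exact_mod_cast hN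
  set β := min (a / 4 * α) (a * κ₀ / 4 / N) with hβ'
  have hβ : 0 < β := lt_min (by positivity) (by positivity)
  set μ := min (β * α / 2) (a * κ₀ / 4) with hμ'
  have hμ : 0 < μ := lt_min (by positivity) (by positivity)
  set Z := c₂ ^ 2 / (a * κ₀) + 4 / a + 8 * α / β with hZ
  have hZ0 : 0 < Z := by positivity
  refine ⟨min 1 (min (a / 2) (a * κ₀ / 4)), by positivity, 1 / (2 * α) + 1 / (4 * μ), by positivity,
    min 1 (α / Z), by positivity, min_le_left _ _, ?_⟩
  intro η hη hη0 w v g vg h S₁ S₂ hw hv hg hS₁ hS₂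
  have hη1 : η ≤ 1 := hη0.trans (min_le_left _ _)
  have hηs : η * Z ≤ α := by
    have := hη0.trans (min_le_right _ _)
    rwa [le_div_iff₀ hZ0] at this
  set D : Eucl N → ℝ := fun y => ∑ i, y i * g i y with hD'
  have hD : HasGrad D (fun j y => g j y + ∑ i, y i * h i j y) := by
    refine (HasGrad.sum Finset.univ fun i _ => (HasGrad.coord i).mul (hg i)).congr_grad fun j y => ?_
    rw [Finset.sum_add_distrib]
    simp
  -- The first line is the flux of the energy and the second the flux of the multiplier `η w`. The
  -- last one encodes a Hardy inequality: the divergence of `y w²` controls `w²|y|²/(1-|y|²)` by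
  -- `w²` and `(1-|y|²)|∇w|²`, which is needed for the singular cross term in `w v`.
  let Y : Fin N → Eucl N → ℝ := fun i y =>
    v y * g i y + (-1) * (y i * (v y * D y)) + (-1) * (y i * (v y * v y))
      + (-η) * (w y * g i y + (-1) * (y i * (w y * D y)) + (-2) * (y i * (w y * v y)))
      + (-(β * η)) * (y i * (w y * w y))
  have hY := fun i => ((((hv.mul (hg i)).add (((HasGrad.coord i).mul (hv.mul hD)).const_mul (-1))).add
    (((HasGrad.coord i).mul (hv.mul hv)).const_mul (-1))).add
    ((((hw.mul (hg i)).add (((HasGrad.coord i).mul (hw.mul hD)).const_mul (-1))).add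
      (((HasGrad.coord i).mul (hw.mul hv)).const_mul (-2))).const_mul (-η))).add
      (((HasGrad.coord i).mul (hw.mul hw)).const_mul (-(β * η)))
  have hdiv0 := integral_div_eq_zero hN hα hY
  have hdivi := integrable_div hN hα hY
  have hwc := hw.continuous
  have hvc := hv.continuous
  have hgc : ∀ i, Continuous (g i) := hw.cont
  have hvgc : ∀ i, Continuous (vg i) := hv.cont
  have hhc : ∀ i j, Continuous (h i j) := fun i j => (hg i).cont j
  have hLi : Integrable (fun y => rateDensity k p γ η (w y) (v y) (fun i => g i y)
      (fun i => vg i y) (fun i j => h i j y) (S₁ y + S₂ y) y) (ballMeas N α) := by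
    refine integrable_ballMeas hα.le ?_
    unfold rateDensity waveOp linDensity
    fun_prop
  have hRi : Integrable (fun y => S₁ y * v y - η * (w y * S₁ y)
            - min 1 (min (a / 2) (a * κ₀ / 4)) * η *
              (v y ^ 2 + (1 - ‖y‖ ^ 2) * (∑ i, g i y ^ 2) + w y ^ 2)
            + (1 / (2 * α) + 1 / (4 * μ)) * ((1 - ‖y‖ ^ 2) * S₂ y ^ 2)) (ballMeas N α) :=
    integrable_ballMeas hα.le (by fun_prop)
  rw [← sub_zero (∫ y, rateDensity k p γ η (w y) (v y) (fun i => g i y) (fun i => vg i y)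
            (fun i j => h i j y) (S₁ y + S₂ y) y ∂(ballMeas N α)), ← hdiv0,
            ← integral_sub hLi hdivi]
  refine integral_mono_ae (hLi.sub hdivi) hRi ?_
  filter_upwards [ae_ballMeas_mem α] with y hy
  have ht := one_sub_pos hy
  have key := pointwise_energy_bound (w := w y) (v := v y) (D := D y) (g2 := ∑ i, g i y ^ 2)
    (r2 := ‖y‖ ^ 2) (t := 1 - ‖y‖ ^ 2) (S₂ := S₂ y) (n := N) (c₂ := c₂) hα ha hκ hβ hμ hη hη1
    ht (by ring) (by positivity) (sq_sum_coord_mul_le y _)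
    (Finset.sum_nonneg fun i _ => sq_nonneg _) (min_le_left _ _)
    (by have := min_le_right (a / 4 * α) (a * κ₀ / 4 / N)
        rwa [le_div_iff₀ hN0] at this) (min_le_left _ _) (min_le_right _ _) hηs
  have hsum : ∀ (gy vgy hy' : Fin N → ℝ) (q : Fin N → ℝ) (vv ww DD t : ℝ),
      (∑ i, ((vgy i * gy i + vv * hy' i + (-1) * ((1 : ℝ) * (vv * DD) + y i * (vgy i * DD + vv * q i))
        + (-1) * (1 * (vv * vv) + y i * (vgy i * vv + vv * vgy i))
        + (-η) * (gy i * gy i + ww * hy' i + (-1) * (1 * (ww * DD) + y i * (gy i * DD + ww * q i))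
          + (-2) * (1 * (ww * vv) + y i * (gy i * vv + ww * vgy i)))
        + (-(β * η)) * (1 * (ww * ww) + y i * (gy i * ww + ww * gy i)))
        - 2 * α * ((vv * gy i + (-1) * (y i * (vv * DD)) + (-1) * (y i * (vv * vv))
      + (-η) * (ww * gy i + (-1) * (y i * (ww * DD)) + (-2) * (y i * (ww * vv)))
      + (-(β * η)) * (y i * (ww * ww))) * y i / t))) =
      (∑ i, gy i * vgy i) + (vv - η * ww) * (∑ i, hy' i) - η * (∑ i, gy i ^ 2)
        + (-(vv * DD) - vv ^ 2 + η * (ww * DD + 2 * (ww * vv)) - β * η * ww ^ 2) * N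
        + (-(DD + 2 * vv) + 2 * η * ww) * (∑ i, y i * vgy i)
        + (-vv + η * ww) * (∑ i, y i * q i)
        + (η * (DD + 2 * vv) - 2 * β * η * ww - 2 * α * (vv - η * ww) / t) * (∑ i, y i * gy i)
        - 2 * α * (-(vv * DD) - vv ^ 2 + η * (ww * DD + 2 * (ww * vv)) - β * η * ww ^ 2) / t
          * (∑ i, y i ^ 2) := by
    intro gy vgy hy' q vv ww DD t
    have hN' : (N : ℝ) = ∑ _i : Fin N, (1 : ℝ) := by simp
    rw [hN']
    simp only [Finset.mul_sum, ← Finset.sum_add_distrib, ← Finset.sum_sub_distrib]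
    refine Finset.sum_congr rfl fun i _ => ?_
    ring
  have hs := hsum (fun i => g i y) (fun i => vg i y) (fun i => h i i y)
    (fun j => g j y + ∑ i, y i * h i j y) (v y) (w y) (D y) (1 - ‖y‖ ^ 2)
  simp only [if_true]
  rw [hs, sum_coord_sq]
  have hwv : (γ + (2 * k + 1) - 2 * N + (p + 3) / 2 * η) * (w y * v y) ≤ c₂ * (|w y| * |v y|) := by
    rw [← abs_mul]
    refine (le_abs_self _).trans ?_
    rw [abs_mul]
    refine mul_le_mul_of_nonneg_right ?_ (abs_nonneg _)
    refine (abs_add_le _ _).trans ?_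
    rw [hc₂, abs_of_nonneg (by positivity : 0 ≤ (p + 3) / 2 * η)]
    have : (p + 3) / 2 * η ≤ (p + 3) / 2 := mul_le_of_le_one_right (by linarith) hη1
    linarith
  have hwv' := mul_le_mul_of_nonneg_left hwv hη.le
  have hm1 : min 1 (min (a / 2) (a * κ₀ / 4)) * η * v y ^ 2 ≤ η * v y ^ 2 * ((p + 7) / 4) := by
    have h1 : min 1 (min (a / 2) (a * κ₀ / 4)) ≤ 1 := min_le_left _ _
    have h2 : 0 ≤ η * v y ^ 2 := by positivity
    have h3 := mul_le_mul_of_nonneg_right h1 h2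
    have h4 : (1 : ℝ) ≤ (p + 7) / 4 := by linarith
    have h5 := mul_le_mul_of_nonneg_left h4 h2
    linarith
  have hm2 : min 1 (min (a / 2) (a * κ₀ / 4)) * η * ((1 - ‖y‖ ^ 2) * (∑ i, g i y ^ 2) + w y ^ 2) ≤
      min (a / 2) (a * κ₀ / 4) * η * ((1 - ‖y‖ ^ 2) * (∑ i, g i y ^ 2) + w y ^ 2) := by
    have h1 : min 1 (min (a / 2) (a * κ₀ / 4)) ≤ min (a / 2) (a * κ₀ / 4) := min_le_right _ _
    have h2 : 0 ≤ η * ((1 - ‖y‖ ^ 2) * (∑ i, g i y ^ 2) + w y ^ 2) :=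
      mul_nonneg hη.le (add_nonneg (mul_nonneg ht.le (Finset.sum_nonneg fun i _ => sq_nonneg _))
        (sq_nonneg _))
    have h3 := mul_le_mul_of_nonneg_right h1 h2
    linarith
  have hDy : D y = ∑ i, y i * g i y := rfl
  simp only [rateDensity, waveOp, linDensity, ← hDy] at key ⊢
  generalize min 1 (min (a / 2) (a * κ₀ / 4)) = m1 at *
  generalize min (a / 2) (a * κ₀ / 4) = m2 at *
  generalize (∑ i, g i y * vg i y) = GV at *
  generalize (∑ i, h i i y) = L at *
  generalize (∑ i, g i y ^ 2) = G2 at *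
  generalize (∑ i, y i * vg i y) = DV at *
  generalize (∑ j, y j * (g j y + ∑ i, y i * h i j y)) = DD at *
  generalize D y = d at *
  generalize w y = ww at *
  generalize v y = vv at *
  generalize S₁ y = s1 at *
  generalize S₂ y = s2 at *
  have ed : ∀ x : ℝ, x * ‖y‖ ^ 2 / (1 - ‖y‖ ^ 2) = x / (1 - ‖y‖ ^ 2) - x := fun x => by
    field_simp; ring
  have er : ∀ x : ℝ, x / (1 - ‖y‖ ^ 2) * ‖y‖ ^ 2 = x / (1 - ‖y‖ ^ 2) - x := fun x => by
    field_simp; ring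
  rw [er]
  rw [ed (ww ^ 2), ed (ww * vv)] at key
  -- This is the choice of `α`: it makes the zero and first order terms of the equation match the
  -- divergence of the weight.
  have hN2 : (N : ℝ) = 2 * k + 1 - 2 * α := by linarith
  rw [hN2] at key hwv' ⊢
  rw [← hDy, hκ', ha'] at *
  generalize (1 - ‖y‖ ^ 2) = t at *
  simp only [div_eq_mul_inv] at key ⊢
  generalize t⁻¹ = T at *
  linarith

end StaticInequality

/-! ### Smoothing kernels, their derivatives, and pairings with time-dependent kernels. -/

section Kernels

variable {N : ℕ}

/-- The directional derivative of `κ` along `e`, as a function. -/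
noncomputable def dirD (e : Eucl N) (κ : Eucl N → ℝ) (x : Eucl N) : ℝ := fderiv ℝ κ x e

/-- The Laplacian of `κ`. -/
noncomputable def lapl (κ : Eucl N → ℝ) (x : Eucl N) : ℝ :=
  ∑ i, dirD (EuclideanSpace.single i 1) (dirD (EuclideanSpace.single i 1) κ) x

lemma ContDiff.dirD {κ : Eucl N → ℝ} (h : ContDiff ℝ ∞ κ) (e : Eucl N) :
    ContDiff ℝ ∞ (dirD e κ) :=
  (h.fderiv_right (m := ∞) (by simp)).clm_apply contDiff_const

lemma HasCompactSupport.dirD {κ : Eucl N → ℝ} (h : HasCompactSupport κ) (e : Eucl N) :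
    HasCompactSupport (dirD e κ) := h.fderiv_apply (𝕜 := ℝ) e

lemma ContDiff.lapl {κ : Eucl N → ℝ} (h : ContDiff ℝ ∞ κ) : ContDiff ℝ ∞ (lapl κ) :=
  ContDiff.sum fun _ _ => (h.dirD _).dirD _

lemma HasCompactSupport.lapl {κ : Eucl N → ℝ} (h : HasCompactSupport κ) :
    HasCompactSupport (lapl κ) := by
  refine HasCompactSupport.intro (K := tsupport κ) h fun x hx => ?_
  refine Finset.sum_eq_zero fun _ _ => ?_
  have h1 : ∀ (f : Eucl N → ℝ) (e : Eucl N), tsupport (_root_.dirD e f) ⊆ tsupport f := fun f e =>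
    (tsupport_fderiv_apply_subset ℝ e)
  exact image_eq_zero_of_notMem_tsupport fun h2 => hx (h1 _ _ (h1 _ _ h2))

lemma dirD_eq_sum (κ : Eucl N → ℝ) (y x : Eucl N) :
    dirD y κ x = ∑ i, y i * dirD (EuclideanSpace.single i 1) κ x := by
  have h : y = ∑ i, y i • EuclideanSpace.single i (1 : ℝ) := by
    ext j; simp [Pi.single_apply]
  unfold dirD
  conv_lhs => rw [h]
  simp [map_sum, smul_eq_mul]

lemma dirD_comm {κ : Eucl N → ℝ} (h : ContDiff ℝ ∞ κ) (e e' x : Eucl N) :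
    dirD e (dirD e' κ) x = dirD e' (dirD e κ) x := by
  have h1 : DifferentiableAt ℝ (fderiv ℝ κ) x :=
    ((h.fderiv_right (m := 1) (by norm_cast)).differentiable one_ne_zero) x
  have h2 : ∀ a : Eucl N, HasFDerivAt (dirD a κ) ((fderiv ℝ (fderiv ℝ κ) x).flip a) x := fun a => by
    have := h1.hasFDerivAt.clm_apply (hasFDerivAt_const a x)
    convert! this using 1
    ext v; simp
  have h3 : IsSymmSndFDerivAt ℝ κ x := h.contDiffAt.isSymmSndFDerivAt (by
    rw [minSmoothness_of_isRCLikeNormedField]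
    exact WithTop.coe_le_coe.2 (le_top : (2 : ℕ∞) ≤ ⊤))
  have e1 : dirD e (dirD e' κ) x = (fderiv ℝ (fderiv ℝ κ) x e) e' := by
    conv_lhs => rw [dirD, (h2 e').fderiv]
    rfl
  have e2 : dirD e' (dirD e κ) x = (fderiv ℝ (fderiv ℝ κ) x e') e := by
    conv_lhs => rw [dirD, (h2 e).fderiv]
    rfl
  rw [e1, e2]
  exact h3 e e'

lemma exists_bound_of_compactSupport {κ : Eucl N → ℝ} (h : Continuous κ)
    (hs : HasCompactSupport κ) : ∃ C, 0 ≤ C ∧ ∀ x, |κ x| ≤ C := by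
  obtain ⟨C, hC⟩ := h.bounded_above_of_compact_support hs
  exact ⟨max C 0, le_max_right _ _, fun x => (hC x).trans (le_max_left _ _)⟩

lemma integrable_mul_kernel {u χ : Eucl N → ℝ} (hu : Integrable u) (hχ : Continuous χ) {C : ℝ}
    (hC : ∀ z, u z ≠ 0 → |χ z| ≤ C) : Integrable (fun z => u z * χ z) := by
  refine Integrable.mono' (hu.norm.mul_const C) (hu.1.mul hχ.aestronglyMeasurable) (.of_forall ?_)
  intro z
  rw [norm_mul]
  by_cases h : u z = 0
  · simp [h]
  · exact mul_le_mul_of_nonneg_left (hC z h) (norm_nonneg _)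

lemma integrable_kerT {u κ : Eucl N → ℝ} (hu : Integrable u) (hκ : Continuous κ)
    (hs : HasCompactSupport κ) (c τ : ℝ) (y : Eucl N) :
    Integrable (fun z => u z * κ (c • y - τ • z)) := by
  obtain ⟨C, _, hC⟩ := exists_bound_of_compactSupport hκ hs
  exact integrable_mul_kernel hu (by fun_prop) fun z _ => hC _

lemma abs_kerT_le {u κ : Eucl N → ℝ} (hu : Integrable u) {C : ℝ}
    (hC : ∀ x, |κ x| ≤ C) (c τ : ℝ) (y : Eucl N) :
    |kerT u κ c τ y| ≤ C * ∫ z, |u z| := by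
  rw [kerT, ← Real.norm_eq_abs, ← integral_const_mul]
  refine norm_integral_le_of_norm_le (hu.abs.const_mul C) (.of_forall fun z => ?_)
  rw [norm_mul, mul_comm]
  exact mul_le_mul_of_nonneg_right (hC _) (abs_nonneg _)

lemma kerT_hasGrad {u κ : Eucl N → ℝ} (hu : Integrable u) (hκ : ContDiff ℝ ∞ κ)
    (hs : HasCompactSupport κ) (c τ : ℝ) :
    HasGrad (kerT u κ c τ) fun i y => c * kerT u (dirD (EuclideanSpace.single i 1) κ) c τ y := by
  have hd : ∀ {κ : Eucl N → ℝ}, ContDiff ℝ ∞ κ → HasCompactSupport κ → ∀ y, HasFDerivAt (kerT u κ c τ)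
      (∑ i, (c * kerT u (dirD (EuclideanSpace.single i 1) κ) c τ y) •
        (EuclideanSpace.proj i : Eucl N →L[ℝ] ℝ)) y := by
    intro κ hκ hs y
    let F' : Eucl N → Eucl N → (Eucl N →L[ℝ] ℝ) := fun y z => (u z * c) • fderiv ℝ κ (c • y - τ • z)
    have hfc : Continuous (fderiv ℝ κ) := hκ.continuous_fderiv (by simp)
    obtain ⟨C, hC⟩ := hfc.bounded_above_of_compact_support (hs.fderiv ℝ)
    have hFb : ∀ z x, ‖F' x z‖ ≤ |u z| * (|c| * C) := by
      intro z x
      simp only [F', norm_smul, norm_mul, Real.norm_eq_abs, mul_assoc]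
      have := hC (c • x - τ • z)
      gcongr
    have hbi : Integrable (fun z => |u z| * (|c| * C)) := hu.abs.mul_const _
    have hFint : ∀ y, Integrable (F' y) := fun y =>
      hbi.mono' ((hu.1.mul_const c).smul (hfc.comp (by fun_prop)).aestronglyMeasurable)
        (.of_forall fun z => hFb z y)
    have hFd : ∀ z x, HasFDerivAt (fun x => u z * κ (c • x - τ • z)) (F' x z) x := by
      intro z x
      have h1 : HasFDerivAt (fun x : Eucl N => c • x - τ • z) (c • ContinuousLinearMap.id ℝ (Eucl N)) x :=
        ((hasFDerivAt_id x).const_smul c).sub_const _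
      have h2 := (((hκ.differentiable (by simp)) (c • x - τ • z)).hasFDerivAt.comp x h1).const_mul (u z)
      refine h2.congr_fderiv ?_
      ext v
      simp only [F', smul_apply, smul_eq_mul, ContinuousLinearMap.comp_apply, map_smul,
        ContinuousLinearMap.id_apply]
      ring
    have e : ∫ z, F' y z = ∑ i, (c * kerT u (dirD (EuclideanSpace.single i 1) κ) c τ y) •
        (EuclideanSpace.proj i : Eucl N →L[ℝ] ℝ) := by
      ext v
      rw [ContinuousLinearMap.integral_apply (hFint y)]
      have h1 : ∀ z, F' y z v = ∑ i, c * v i *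
          (u z * dirD (EuclideanSpace.single i 1) κ (c • y - τ • z)) := fun z => by
        have h3 := dirD_eq_sum κ v (c • y - τ • z)
        rw [dirD] at h3
        simp only [F', smul_apply, smul_eq_mul, h3, Finset.mul_sum]
        exact Finset.sum_congr rfl fun i _ => by ring
      simp only [h1]
      rw [integral_finsetSum _ fun i _ => (integrable_kerT hu (hκ.dirD _).continuous
        (hs.dirD _) c τ y).const_mul _]
      simp only [sum_apply, smul_apply, smul_eq_mul]
      refine Finset.sum_congr rfl fun i _ => ?_
      have h2 : (EuclideanSpace.proj i : Eucl N →L[ℝ] ℝ) v = v i := rfl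
      rw [integral_const_mul, kerT, h2]; ring
    rw [← e]
    clear_value F'
    exact hasFDerivAt_integral_of_dominated_of_fderiv_le
      (F := fun x z => u z * κ (c • x - τ • z)) (F' := F') (s := univ) univ_mem
      (.of_forall fun x => (integrable_kerT hu hκ.continuous hs c τ x).1)
      (integrable_kerT hu hκ.continuous hs c τ y) (hFint y).1
      (.of_forall fun z x _ => hFb z x) hbi (.of_forall fun z x _ => hFd z x)
  refine ⟨hd hκ hs, fun i => ?_⟩
  have : Continuous (kerT u (dirD (EuclideanSpace.single i 1) κ) c τ) :=
    continuous_iff_continuousAt.2 fun y => (hd (hκ.dirD _) (hs.dirD _) y).continuousAt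
  fun_prop

lemma kerT_continuous {u κ : Eucl N → ℝ} (hu : Integrable u) (hκ : ContDiff ℝ ∞ κ)
    (hs : HasCompactSupport κ) (c τ : ℝ) : Continuous (kerT u κ c τ) :=
  (kerT_hasGrad hu hκ hs c τ).continuous

lemma measurable_kerT {u : ℝ → Eucl N → ℝ} (hu : Measurable (Function.uncurry u))
    {κ : Eucl N → ℝ} (hκ : Continuous κ) {c τ : ℝ → ℝ} (hc : Measurable c) (hτ : Measurable τ) :
    Measurable (fun q : ℝ × Eucl N => kerT (u q.1) κ (c q.1) (τ q.1) q.2) := by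
  unfold kerT
  refine (StronglyMeasurable.integral_prod_right (f := fun (q : ℝ × Eucl N) z =>
    u q.1 z * κ (c q.1 • q.2 - τ q.1 • z)) (Measurable.stronglyMeasurable ?_)).measurable
  have hκ' := hκ.measurable
  have h1 : Measurable fun x : (ℝ × Eucl N) × Eucl N => u x.1.1 x.2 :=
    hu.comp ((measurable_fst.comp measurable_fst).prodMk measurable_snd)
  unfold Function.uncurry
  exact h1.mul (hκ'.comp (by fun_prop))

/-- Absolute continuity in time of the pairing of a weak solution of `∂ₜ u = ∑ⱼ χⱼ(pⱼ)` with a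
time-dependent kernel. -/
lemma isPrim_pairing {ι : Type*} [Fintype ι] {a b r : ℝ} (hab : a ≤ b) {u : ℝ → Eucl N → ℝ}
    (hu : ContL2 volume u) (husupp : ∀ s z, r ≤ ‖z‖ → u s z = 0)
    {p : ι → ℝ → Eucl N → ℝ} (hpm : ∀ j, Measurable (Function.uncurry (p j)))
    (hpi : ∀ j, Integrable (Function.uncurry (p j)) ((volume.restrict (Icc a b)).prod volume))
    (hpsupp : ∀ j s z, r ≤ ‖z‖ → p j s z = 0)
    {ψ ψ' : ℝ → Eucl N → ℝ} {χ : ι → ℝ → Eucl N → ℝ}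
    (hψ : ∀ μ, Continuous (ψ μ)) (hψ' : Continuous (Function.uncurry ψ'))
    (hχ : ∀ j, Continuous (Function.uncurry (χ j)))
    (hd : ∀ μ z, HasDerivAt (fun μ => ψ μ z) (ψ' μ z) μ)
    (hweak : ∀ μ ∈ Icc a b, ∀ t₁ t₂, a ≤ t₁ → t₁ ≤ t₂ → t₂ ≤ b →
      (∫ z, u t₂ z * ψ μ z) - (∫ z, u t₁ z * ψ μ z) =
        ∫ s in t₁..t₂, ∑ j, ∫ z, p j s z * χ j μ z) :
    IsPrim (fun s => ∫ z, u s z * ψ s z)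
      (fun s => (∑ j, ∫ z, p j s z * χ j s z) + ∫ z, u s z * ψ' s z) a b := by
  classical
  have hKc : IsCompact (Icc a b ×ˢ Metric.closedBall (0 : Eucl N) r) :=
    isCompact_Icc.prod (isCompact_closedBall _ _)
  have hbd : ∀ {χ : ℝ → Eucl N → ℝ}, Continuous (Function.uncurry χ) → ∃ C, 0 ≤ C ∧
      ∀ μ ∈ Icc a b, ∀ z, ‖z‖ < r → |χ μ z| ≤ C := by
    intro χ hχ
    obtain ⟨C, hC⟩ := hKc.exists_bound_of_continuousOn hχ.continuousOn
    exact ⟨max C 0, le_max_right _ _, fun μ hμ z hz =>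
      (hC (μ, z) ⟨hμ, by simpa using hz.le⟩).trans (le_max_left _ _)⟩
  have huc : ∀ {χ : ℝ → Eucl N → ℝ}, Continuous (Function.uncurry χ) → ∀ ε > 0, ∃ δ > 0,
      ∀ μ ∈ Icc a b, ∀ μ' ∈ Icc a b, |μ - μ'| < δ → ∀ z, ‖z‖ < r → |χ μ z - χ μ' z| ≤ ε := by
    intro χ hχ ε hε
    have := hKc.uniformContinuousOn_of_continuous hχ.continuousOn
    rw [Metric.uniformContinuousOn_iff] at this
    obtain ⟨δ, hδ, H⟩ := this ε hε
    refine ⟨δ, hδ, fun μ hμ μ' hμ' hd z hz => ?_⟩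
    have := H (μ, z) ⟨hμ, by simpa using hz.le⟩ (μ', z) ⟨hμ', by simpa using hz.le⟩ (by
      rw [Prod.dist_eq]; simpa [Real.dist_eq] using hd)
    exact this.le
  have hslice : ∀ {χ : ℝ → Eucl N → ℝ}, Continuous (Function.uncurry χ) → ∀ μ, Continuous (χ μ) :=
    fun hχ μ => hχ.comp (by fun_prop : Continuous fun z : Eucl N => (μ, z))
  have hball : volume (Metric.ball (0 : Eucl N) r) < ⊤ := measure_ball_lt_top
  have hui : ∀ s, Integrable (u s) := fun s => by
    have h1 : MemLp (u s) 2 (volume.restrict (Metric.ball (0 : Eucl N) r)) :=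
      ((hu s).2.1).mono_measure Measure.restrict_le_self
    have : IsFiniteMeasure (volume.restrict (Metric.ball (0 : Eucl N) r)) := ⟨by simpa using hball⟩
    have h2 := h1.integrable (by norm_num)
    refine (integrableOn_iff_integrable_of_support_subset fun z hz => ?_).1 h2
    by_contra hc
    exact hz (husupp s z (by simpa using hc))
  have hL2 : ∀ {χ : Eucl N → ℝ}, Continuous χ →
      MemLp ((Metric.ball (0 : Eucl N) r).indicator χ) 2 volume := by
    intro χ hχ
    rw [memLp_indicator_iff_restrict Metric.isOpen_ball.measurableSet]
    obtain ⟨C, hC⟩ := (isCompact_closedBall (0 : Eucl N) r).exists_bound_of_continuousOn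
      hχ.continuousOn
    have : IsFiniteMeasure (volume.restrict (Metric.ball (0 : Eucl N) r)) := ⟨by simpa using hball⟩
    refine MemLp.of_bound hχ.aestronglyMeasurable C ?_
    filter_upwards [ae_restrict_mem Metric.isOpen_ball.measurableSet] with z hz
    exact hC z (Metric.ball_subset_closedBall hz)
  have hq : ContinuousOn (Function.uncurry fun t μ => ∫ z, u t z * ψ' μ z) (Icc a b ×ˢ Icc a b) := by
    rintro ⟨t, μ⟩ ⟨ht, hμ⟩
    have h1 : L2Tendsto volume (fun x : ℝ × ℝ => u x.1) (u t) (𝓝 (t, μ)) :=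
      (hu t).comp_tendsto (by rw [nhds_prod_eq]; exact tendsto_fst)
    have h2 : L2Tendsto volume (fun x : ℝ × ℝ => (Metric.ball (0 : Eucl N) r).indicator (ψ' x.2))
        ((Metric.ball (0 : Eucl N) r).indicator (ψ' μ)) (𝓝 (t, μ)) := by
      refine ⟨fun x => hL2 (hslice hψ' _), hL2 (hslice hψ' _), ?_⟩
      have hK : IsCompact (Metric.closedBall μ 1 ×ˢ Metric.closedBall (0 : Eucl N) r) :=
        (isCompact_closedBall _ _).prod (isCompact_closedBall _ _)
      have hu' := hK.uniformContinuousOn_of_continuous hψ'.continuousOn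
      rw [Metric.uniformContinuousOn_iff] at hu'
      rw [ENNReal.tendsto_nhds_zero]
      intro ε hε
      set V := volume (Metric.ball (0 : Eucl N) r) ^ (1 / 2 : ℝ) with hV
      have hVt : V ≠ ⊤ := ENNReal.rpow_ne_top_of_nonneg (by norm_num) hball.ne
      obtain ⟨c, hc, hcV⟩ : ∃ c : ℝ, 0 < c ∧ ENNReal.ofReal c * V ≤ ε := by
        have h3 : Tendsto (fun c : ℝ => ENNReal.ofReal c * V) (𝓝[>] 0) (𝓝 0) := by
          have h4 : Tendsto (fun c : ℝ => ENNReal.ofReal c) (𝓝[>] 0) (𝓝 0) := by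
            have := (ENNReal.continuous_ofReal.tendsto 0).mono_left (nhdsWithin_le_nhds (s := Ioi 0))
            simpa using this
          simpa using ENNReal.Tendsto.mul_const h4 (Or.inr hVt)
        have h5 := (ENNReal.tendsto_nhds_zero.1 h3 ε hε).and self_mem_nhdsWithin
        obtain ⟨c, hc1, hc2⟩ := h5.exists
        exact ⟨c, hc2, hc1⟩
      obtain ⟨δ, hδ, H⟩ := hu' c hc
      have hn : ∀ᶠ x : ℝ × ℝ in 𝓝 (t, μ), dist x.2 μ < min δ 1 :=
        (continuous_snd.tendsto (t, μ)).eventually (Metric.ball_mem_nhds μ (lt_min hδ one_pos))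
      filter_upwards [hn] with x hx
      refine le_trans ?_ hcV
      have hbound : ∀ z, ‖((Metric.ball (0 : Eucl N) r).indicator (ψ' x.2) -
          (Metric.ball (0 : Eucl N) r).indicator (ψ' μ)) z‖ ≤
          ‖(Metric.ball (0 : Eucl N) r).indicator (fun _ => c) z‖ := by
        intro z
        by_cases hz : z ∈ Metric.ball (0 : Eucl N) r
        · simp only [Pi.sub_apply, indicator_of_mem hz]
          rw [Real.norm_of_nonneg hc.le]
          have := H (x.2, z) ⟨by simpa using (hx.trans_le (min_le_right _ _)).le,
            Metric.ball_subset_closedBall hz⟩ (μ, z) ⟨by simp, Metric.ball_subset_closedBall hz⟩ (by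
              rw [Prod.dist_eq]; simpa using hx.trans_le (min_le_left _ _))
          exact this.le
        · simp [indicator_of_notMem hz]
      refine (eLpNorm_mono hbound).trans ?_
      rw [eLpNorm_indicator_const Metric.isOpen_ball.measurableSet (by norm_num) (by norm_num)]
      simp [hV, Real.enorm_eq_ofReal hc.le]
    have h3 := h1.tendsto_integral_mul h2
    have e : ∀ t μ, ∫ z, u t z * (Metric.ball (0 : Eucl N) r).indicator (ψ' μ) z =
        ∫ z, u t z * ψ' μ z := fun t μ => by
      congr 1; ext z
      by_cases hz : z ∈ Metric.ball (0 : Eucl N) r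
      · rw [indicator_of_mem hz]
      · rw [husupp t z (by simpa using hz)]; simp
    simp only [e] at h3
    exact h3.mono_left nhdsWithin_le_nhds
  have hIoc : ∀ {f : ℝ → ℝ}, IntegrableOn f (Icc a b) → IntervalIntegrable f volume a b :=
    fun hf => (intervalIntegrable_iff_integrableOn_Icc_of_le hab).2 hf
  have hℓ : IntegrableOn (fun s => ∑ j, ∫ z, |p j s z|) (Icc a b) :=
    integrable_finsetSum _ fun j _ => (hpi j).norm.integral_prod_left
  have hae : ∀ᵐ s, s ∈ Icc a b → ∀ j, Integrable (p j s) := by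
    rw [← ae_restrict_iff' measurableSet_Icc]
    exact ae_all_iff.2 fun j => (hpi j).prod_right_ae
  have hker : ∀ {χ₁ : Eucl N → ℝ} {f : Eucl N → ℝ} {C : ℝ}, Continuous χ₁ → Integrable f →
      (∀ z, r ≤ ‖z‖ → f z = 0) → (∀ z, ‖z‖ < r → |χ₁ z| ≤ C) →
      Integrable (fun z => f z * χ₁ z) ∧ |∫ z, f z * χ₁ z| ≤ C * ∫ z, |f z| := by
    intro χ₁ f C hχ₁ hf hfs hC
    have hC' : ∀ z, f z ≠ 0 → |χ₁ z| ≤ C := fun z hz => hC z (by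
      by_contra hc; exact hz (hfs z (not_lt.1 hc)))
    refine ⟨integrable_mul_kernel hf hχ₁ hC', ?_⟩
    rw [← Real.norm_eq_abs, ← integral_const_mul]
    refine norm_integral_le_of_norm_le (hf.abs.const_mul C) (.of_forall fun z => ?_)
    rw [norm_mul, mul_comm]
    by_cases h : f z = 0
    · simp [h]
    · exact mul_le_mul_of_nonneg_right (hC' z h) (abs_nonneg _)
  choose C hC0 hC using fun j => hbd (hχ j)
  have hmeas : ∀ j {χ₁ : ℝ → Eucl N → ℝ}, Continuous (Function.uncurry χ₁) →
      StronglyMeasurable fun s => ∫ z, p j s z * χ₁ s z := fun j χ₁ hχ₁ =>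
    StronglyMeasurable.integral_prod_right (f := fun s z => p j s z * χ₁ s z)
      ((hpm j).mul hχ₁.measurable).stronglyMeasurable
  have hrint : ∀ {χ₁ : ι → ℝ → Eucl N → ℝ}, (∀ j, Continuous (Function.uncurry (χ₁ j))) →
      (∀ j, ∀ s ∈ Icc a b, ∀ z, ‖z‖ < r → |χ₁ j s z| ≤ C j) →
      IntegrableOn (fun s => ∑ j, ∫ z, p j s z * χ₁ j s z) (Icc a b) := by
    intro χ₁ hχ₁ hC₁
    refine integrable_finsetSum _ fun j _ => ?_
    refine Integrable.mono' (((hpi j).norm.integral_prod_left).const_mul (C j))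
      (hmeas j (hχ₁ j)).aestronglyMeasurable ?_
    filter_upwards [(ae_restrict_iff' measurableSet_Icc).2 hae,
      ae_restrict_mem measurableSet_Icc] with s hs hsI
    exact (hker (hslice (hχ₁ j) s) (hs j) (hpsupp j s) (hC₁ j s hsI)).2
  -- The kernels are uniformly continuous on a compact set, so near the diagonal freezing the
  -- parameter costs at most `ε` times the `L¹` norm of the sources. This is the domination required
  -- by `IsPrim.diag`.
  have hdiff : ∀ ε > 0, ∃ δ > 0, ∀ x ∈ Icc a b, ∀ᵐ s, s ∈ Icc a b → |x - s| < δ →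
      |(∑ j, ∫ z, p j s z * χ j x z) - ∑ j, ∫ z, p j s z * χ j s z| ≤
        ε * ∑ j, ∫ z, |p j s z| := by
    intro ε hε
    choose δ hδ H using fun j => huc (hχ j) ε hε
    obtain ⟨δ₀, hδ₀, hδ₁⟩ : ∃ δ₀ > 0, ∀ j, δ₀ ≤ δ j := by
      rcases isEmpty_or_nonempty ι with h | h
      · exact ⟨1, one_pos, fun j => h.elim j⟩
      · exact ⟨Finset.univ.inf' Finset.univ_nonempty δ,
          (Finset.lt_inf'_iff _).2 fun j _ => hδ j, fun j => Finset.inf'_le _ (Finset.mem_univ j)⟩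
    refine ⟨δ₀, hδ₀, fun x hx => ?_⟩
    filter_upwards [hae] with s hs hsI hxs
    rw [← Finset.sum_sub_distrib, Finset.mul_sum]
    refine (Finset.abs_sum_le_sum_abs _ _).trans (Finset.sum_le_sum fun j _ => ?_)
    rw [← integral_sub (hker (hslice (hχ j) x) (hs hsI j) (hpsupp j s) (hC j x hx)).1
      (hker (hslice (hχ j) s) (hs hsI j) (hpsupp j s) (hC j s hsI)).1]
    simp_rw [← mul_sub]
    refine (hker (χ₁ := fun z => χ j x z - χ j s z) ((hslice (hχ j) x).sub (hslice (hχ j) s))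
      (hs hsI j) (hpsupp j s) fun z hz => ?_).2
    exact H j x hx s hsI (hxs.trans_le (hδ₁ j)) z hz
  refine IsPrim.diag (Ψ := fun t μ => ∫ z, u t z * ψ μ z)
    (r := fun s μ => ∑ j, ∫ z, p j s z * χ j μ z) (q := fun t μ => ∫ z, u t z * ψ' μ z)
    (ℓ := fun s => ∑ j, ∫ z, |p j s z|) hab hweak ?_ ?_ hq (hIoc hℓ) ?_ hdiff
  · intro μ hμ
    refine hIoc (hrint (χ₁ := fun j _ => χ j μ) (fun j => ?_) fun j s _ => hC j μ hμ)
    exact (hslice (hχ j) μ).comp continuous_snd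
  · intro t ht μ hμ
    have hK : IsCompact (Metric.closedBall μ 1 ×ˢ Metric.closedBall (0 : Eucl N) r) :=
      (isCompact_closedBall _ _).prod (isCompact_closedBall _ _)
    obtain ⟨C', hC'⟩ := hK.exists_bound_of_continuousOn hψ'.continuousOn
    have hprod : ∀ {f : Eucl N → ℝ}, Continuous f → Integrable (fun z => u t z * f z) := by
      intro f hf
      obtain ⟨C₂, hC₂⟩ := (isCompact_closedBall (0 : Eucl N) r).exists_bound_of_continuousOn
        hf.continuousOn
      exact (hker hf (hui t) (husupp t) fun z hz => hC₂ z (by simpa using hz.le)).1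
    refine (hasDerivAt_integral_of_dominated_loc_of_deriv_le (s := Metric.closedBall μ 1)
      (bound := fun z => |u t z| * C') (Metric.closedBall_mem_nhds μ one_pos)
      (.of_forall fun x => (hprod (hψ x)).1) (hprod (hψ μ)) (hprod (hslice hψ' μ)).1
      (.of_forall fun z x hx => ?_) ((hui t).abs.mul_const _)
      (.of_forall fun z x _ => (hd x z).const_mul (u t z))).2
    rw [norm_mul]
    by_cases hz : ‖z‖ < r
    · exact mul_le_mul_of_nonneg_left (hC' (x, z) ⟨hx, by simpa using hz.le⟩) (norm_nonneg _)
    · rw [husupp t z (not_lt.1 hz)]; simp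
  · exact hIoc (hrint hχ hC)

end Kernels

/-! ### Fields on a smaller ball and the first order system. -/

section Fields

variable {N : ℕ}

/-- A jointly measurable family of functions supported in the ball of radius `r`, continuous in
`L²`. -/
structure ContField (N : ℕ) (r : ℝ) (u : ℝ → Eucl N → ℝ) : Prop where
  meas : Measurable (Function.uncurry u)
  supp : ∀ s z, r ≤ ‖z‖ → u s z = 0
  cont : ContL2 volume u

/-- A jointly measurable family of functions supported in the ball of radius `r`, which is
integrable over `[a, b]` with values in `L²`. -/
structure SrcField (N : ℕ) (r a b : ℝ) (u : ℝ → Eucl N → ℝ) : Prop where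
  meas : Measurable (Function.uncurry u)
  supp : ∀ s z, r ≤ ‖z‖ → u s z = 0
  memLp : ∀ s, MemLp (u s) 2 volume
  fin : ∫⁻ s in Icc a b, eLpNorm (u s) 2 volume < ⊤

lemma measurable_eLpNorm_slice {u : ℝ → Eucl N → ℝ} (h : Measurable (Function.uncurry u))
    (μ : Measure (Eucl N)) [SFinite μ] : Measurable fun s => eLpNorm (u s) 2 μ := by
  have h1 : Measurable fun s => ∫⁻ y, ‖u s y‖ₑ ^ 2 ∂μ :=
    Measurable.lintegral_prod_right' (f := fun q : ℝ × Eucl N => ‖u q.1 q.2‖ₑ ^ 2)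
      (h.enorm.pow_const 2)
  have h2 : (fun s => eLpNorm (u s) 2 μ) = fun s => (∫⁻ y, ‖u s y‖ₑ ^ 2 ∂μ) ^ (1 / 2 : ℝ) := by
    ext s
    rw [← sq_eLpNorm_eq_lintegral, ← ENNReal.rpow_natCast, ← ENNReal.rpow_mul]
    norm_num
  rw [h2]
  exact h1.pow_const _

lemma exists_eLpNorm_le {α : Type*} [MeasurableSpace α] {μ : Measure α} {u : ℝ → α → ℝ}
    (h : ContL2 μ u) (a b : ℝ) : ∃ C : ℝ, 0 ≤ C ∧ ∀ s ∈ Icc a b, (eLpNorm (u s) 2 μ).toReal ≤ C := by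
  have hc : Continuous fun s => ((h s).2.1).toLp (u s) :=
    continuous_iff_continuousAt.2 fun s => (h s).tendsto_toLp
  obtain ⟨C, hC⟩ := isCompact_Icc.exists_bound_of_continuousOn (hc.continuousOn (s := Icc a b))
  refine ⟨max C 0, le_max_right _ _, fun s hs => ?_⟩
  have := hC s hs
  rw [Lp.norm_toLp] at this
  exact this.trans (le_max_left _ _)

lemma ContField.srcField {r : ℝ} {u : ℝ → Eucl N → ℝ} (h : ContField N r u) (a b : ℝ) :
    SrcField N r a b u := by
  refine ⟨h.meas, h.supp, fun s => (h.cont s).2.1, ?_⟩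
  obtain ⟨C, _, hC⟩ := exists_eLpNorm_le h.cont a b
  calc ∫⁻ s in Icc a b, eLpNorm (u s) 2 volume ≤ ∫⁻ s in Icc a b, ENNReal.ofReal C := by
        refine setLIntegral_mono measurable_const fun s hs => ?_
        rw [← ENNReal.ofReal_toReal (h.cont s).2.1.eLpNorm_ne_top]
        exact ENNReal.ofReal_le_ofReal (hC s hs)
    _ < ⊤ := by
        rw [setLIntegral_const]
        exact ENNReal.mul_lt_top ENNReal.ofReal_lt_top (by simp)

namespace SrcField

variable {r a b : ℝ} {u u₁ : ℝ → Eucl N → ℝ}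

lemma add (h : SrcField N r a b u) (h₁ : SrcField N r a b u₁) :
    SrcField N r a b (fun s z => u s z + u₁ s z) := by
  refine ⟨h.meas.add h₁.meas, fun s z hz => by rw [h.supp s z hz, h₁.supp s z hz, add_zero],
    fun s => (h.memLp s).add (h₁.memLp s), ?_⟩
  calc ∫⁻ s in Icc a b, eLpNorm (fun z => u s z + u₁ s z) 2 volume
      ≤ ∫⁻ s in Icc a b, (eLpNorm (u s) 2 volume + eLpNorm (u₁ s) 2 volume) :=
        lintegral_mono fun s => eLpNorm_add_le (h.memLp s).1 (h₁.memLp s).1 (by norm_num)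
    _ < ⊤ := by
        rw [lintegral_add_left (measurable_eLpNorm_slice h.meas volume)]
        exact ENNReal.add_lt_top.2 ⟨h.fin, h₁.fin⟩

lemma abs_integral_le (h : SrcField N r a b u) (s : ℝ) :
    Integrable (u s) ∧ ∫ z, |u s z| ≤
      (volume (Metric.ball (0 : Eucl N) r)).toReal ^ (1 / 2 : ℝ) * (eLpNorm (u s) 2 volume).toReal := by
  have hball : volume (Metric.ball (0 : Eucl N) r) < ⊤ := measure_ball_lt_top
  have hχ : MemLp ((Metric.ball (0 : Eucl N) r).indicator fun _ => (1 : ℝ)) 2 volume :=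
    memLp_indicator_const _ Metric.isOpen_ball.measurableSet _ (Or.inr hball.ne)
  have e : ∀ z, u s z * (Metric.ball (0 : Eucl N) r).indicator (fun _ => (1 : ℝ)) z = u s z := by
    intro z
    by_cases hz : z ∈ Metric.ball (0 : Eucl N) r
    · simp [indicator_of_mem hz]
    · rw [h.supp s z (by simpa using hz)]; simp
  have h1 := L2Tendsto.integrable_mul (h.memLp s) hχ
  have h2 := integral_abs_mul_le_sqrt (h.memLp s) hχ
  simp only [e] at h1 h2
  refine ⟨h1, h2.trans_eq ?_⟩
  rw [eLpNorm_indicator_const Metric.isOpen_ball.measurableSet (by norm_num) (by norm_num), mul_comm]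
  simp [ENNReal.toReal_rpow]

lemma integrable_slice (h : SrcField N r a b u) (s : ℝ) : Integrable (u s) := (h.abs_integral_le s).1

lemma integrable_mul (h : SrcField N r a b u) (s : ℝ) {χ : Eucl N → ℝ} (hχ : Continuous χ) :
    Integrable (fun z => u s z * χ z) := by
  obtain ⟨C, hC⟩ := (isCompact_closedBall (0 : Eucl N) r).exists_bound_of_continuousOn hχ.continuousOn
  refine integrable_mul_kernel (h.integrable_slice s) hχ (C := C) fun z hz => hC z ?_
  by_contra hc
  exact hz (h.supp s z (by simpa using (not_le.1 fun hh => hc (by simpa using hh)).le))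

lemma integrable_norm (h : SrcField N r a b u) :
    IntegrableOn (fun s => (eLpNorm (u s) 2 volume).toReal) (Icc a b) := by
  refine integrable_toReal_of_lintegral_ne_top
    (measurable_eLpNorm_slice h.meas volume).aemeasurable h.fin.ne

lemma integrable_prod (h : SrcField N r a b u) :
    Integrable (Function.uncurry u) ((volume.restrict (Icc a b)).prod volume) := by
  rw [integrable_prod_iff h.meas.aestronglyMeasurable]
  refine ⟨.of_forall fun s => h.integrable_slice s, ?_⟩
  refine Integrable.mono' (h.integrable_norm.const_mul
    ((volume (Metric.ball (0 : Eucl N) r)).toReal ^ (1 / 2 : ℝ))) ?_ (.of_forall fun s => ?_)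
  · exact (h.meas.norm.stronglyMeasurable.integral_prod_right (f := fun s z => ‖u s z‖)).aestronglyMeasurable
  · rw [Real.norm_of_nonneg (integral_nonneg fun _ => norm_nonneg _)]
    exact (h.abs_integral_le s).2

end SrcField

/-- The linear wave equation in self-similar variables with source `S`, as a first order system in
the weak form: `w_s = A - k w - z·∇w` and `A_s = -(k+1) A - z·∇A + Δw + S`, and `G = ∇w`. -/
structure WaveSystem (N : ℕ) (k r a b : ℝ) (w A : ℝ → Eucl N → ℝ) (G : Fin N → ℝ → Eucl N → ℝ)
    (S : ℝ → Eucl N → ℝ) : Prop where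
  hab : a ≤ b
  fw : ContField N r w
  fA : ContField N r A
  fG : ∀ i, ContField N r (G i)
  fS : SrcField N r a b S
  grad : ∀ i, ∀ s ∈ Icc a b, ∀ ψ : Eucl N → ℝ, ContDiff ℝ ∞ ψ →
    tsupport ψ ⊆ Metric.ball 0 r →
    ∫ z, w s z * dirD (EuclideanSpace.single i 1) ψ z = -∫ z, G i s z * ψ z
  eq_w : ∀ ψ : Eucl N → ℝ, ContDiff ℝ ∞ ψ → tsupport ψ ⊆ Metric.ball 0 r →
    ∀ t₁ t₂, a ≤ t₁ → t₁ ≤ t₂ → t₂ ≤ b →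
    (∫ z, w t₂ z * ψ z) - (∫ z, w t₁ z * ψ z) = ∫ s in t₁..t₂,
      ((∫ z, A s z * ψ z) + ∫ z, w s z * ((N - k) * ψ z + dirD z ψ z))
  eq_A : ∀ ψ : Eucl N → ℝ, ContDiff ℝ ∞ ψ → tsupport ψ ⊆ Metric.ball 0 r →
    ∀ t₁ t₂, a ≤ t₁ → t₁ ≤ t₂ → t₂ ≤ b →
    (∫ z, A t₂ z * ψ z) - (∫ z, A t₁ z * ψ z) = ∫ s in t₁..t₂,
      ((∫ z, A s z * ((N - k - 1) * ψ z + dirD z ψ z)) + (∫ z, w s z * lapl ψ z)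
        + ∫ z, S s z * ψ z)

lemma dirD_comp_affine {κ : Eucl N → ℝ} (hκ : Differentiable ℝ κ) (x₀ : Eucl N) (τ : ℝ)
    (e z : Eucl N) :
    dirD e (fun z => κ (x₀ - τ • z)) z = -τ * dirD e κ (x₀ - τ • z) := by
  have h1 : HasFDerivAt (fun z : Eucl N => x₀ - τ • z) (-(τ • ContinuousLinearMap.id ℝ (Eucl N))) z :=
    ((hasFDerivAt_id z).const_smul τ).const_sub _
  have h2 := ((hκ (x₀ - τ • z)).hasFDerivAt.comp z h1).fderiv
  have h3 : (κ ∘ fun z : Eucl N => x₀ - τ • z) = fun z => κ (x₀ - τ • z) := rfl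
  rw [h3] at h2
  rw [dirD, h2, dirD]
  simp

lemma lapl_comp_affine {κ : Eucl N → ℝ} (hκ : ContDiff ℝ ∞ κ) (x₀ : Eucl N) (τ : ℝ) (z : Eucl N) :
    lapl (fun z => κ (x₀ - τ • z)) z = τ ^ 2 * lapl κ (x₀ - τ • z) := by
  unfold lapl
  rw [Finset.mul_sum]
  refine Finset.sum_congr rfl fun i _ => ?_
  have h1 : dirD (EuclideanSpace.single i 1) (fun z => κ (x₀ - τ • z)) =
      fun z => -τ * dirD (EuclideanSpace.single i 1) κ (x₀ - τ • z) :=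
    funext fun z => dirD_comp_affine (hκ.differentiable (by simp)) x₀ τ _ z
  have h2 : (fun z => -τ * dirD (EuclideanSpace.single i 1) κ (x₀ - τ • z)) =
      fun z => (fun x => -τ * dirD (EuclideanSpace.single i 1) κ x) (x₀ - τ • z) := rfl
  have h4 : ContDiff ℝ ∞ (dirD (EuclideanSpace.single i 1) κ) := hκ.dirD _
  rw [h1, h2, dirD_comp_affine ((h4.differentiable (by simp)).const_mul (-τ))]
  have h3 : dirD (EuclideanSpace.single i 1) (fun x => -τ * dirD (EuclideanSpace.single i 1) κ x)
      (x₀ - τ • z) = -τ * dirD (EuclideanSpace.single i 1) (dirD (EuclideanSpace.single i 1) κ)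
      (x₀ - τ • z) := by
    rw [dirD, fderiv_const_mul (h4.differentiable (by simp) _)]
    simp [dirD]
  rw [h3]; ring

/-- On the support of the kernel `|τ z| ≤ c|y| + ε`, so the condition `c + ε < τ r` makes it an
admissible test function in the ball of radius `r` for all `|y| ≤ 1`. With `c = τ - δ` and `δ > 0`
there is room for some `r < 1`. -/
lemma tsupport_comp_affine {κ : Eucl N → ℝ} {ε c τ r : ℝ} (hκ : ∀ x, ε < ‖x‖ → κ x = 0)
    (hc : 0 ≤ c) (hτ : 0 < τ) (hr : c + ε < τ * r) {y : Eucl N} (hy : ‖y‖ ≤ 1) :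
    tsupport (fun z => κ (c • y - τ • z)) ⊆ Metric.ball 0 r := by
  have h1 : tsupport (fun z => κ (c • y - τ • z)) ⊆ Metric.closedBall 0 ((c + ε) / τ) := by
    refine closure_minimal (fun z hz => ?_) Metric.isClosed_closedBall
    have h2 : ‖c • y - τ • z‖ ≤ ε := not_lt.1 fun h => hz (hκ _ h)
    have h3 : ‖τ • z‖ ≤ ‖c • y‖ + ‖c • y - τ • z‖ := by
      have : τ • z = c • y - (c • y - τ • z) := by abel
      conv_lhs => rw [this]
      exact norm_sub_le _ _
    rw [norm_smul, norm_smul, Real.norm_of_nonneg hτ.le, Real.norm_of_nonneg hc] at h3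
    have h4 : c * ‖y‖ ≤ c := mul_le_of_le_one_right hc hy
    rw [mem_closedBall_zero_iff, le_div_iff₀ hτ]
    linarith
  refine h1.trans (Metric.closedBall_subset_ball ?_)
  rw [div_lt_iff₀ hτ]; linarith

lemma dirD_eq_zero_of_lt {κ : Eucl N → ℝ} {ε : ℝ} (hκ : ∀ x, ε < ‖x‖ → κ x = 0) (e : Eucl N) :
    ∀ x, ε < ‖x‖ → dirD e κ x = 0 := by
  intro x hx
  have h1 : κ =ᶠ[𝓝 x] fun _ => 0 := by
    filter_upwards [(isOpen_lt continuous_const continuous_norm).mem_nhds hx] with z hz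
    exact hκ z hz
  rw [dirD, h1.fderiv_eq]; simp

lemma hasCompactSupport_of_lt {κ : Eucl N → ℝ} {ε : ℝ} (hκ : ∀ x, ε < ‖x‖ → κ x = 0) :
    HasCompactSupport κ :=
  HasCompactSupport.intro (isCompact_closedBall 0 ε) fun x hx => hκ x (by simpa using hx)

lemma kerT_dirD {u κ : Eucl N → ℝ} (hu : Integrable u) (hκ : ContDiff ℝ ∞ κ)
    (hs : HasCompactSupport κ) (c τ : ℝ) (y e : Eucl N) :
    kerT u (dirD e κ) c τ y = ∑ i, e i * kerT u (dirD (EuclideanSpace.single i 1) κ) c τ y := by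
  have h1 : ∀ z, u z * dirD e κ (c • y - τ • z) =
      ∑ i, e i * (u z * dirD (EuclideanSpace.single i 1) κ (c • y - τ • z)) := fun z => by
    rw [dirD_eq_sum, Finset.mul_sum]
    exact Finset.sum_congr rfl fun i _ => by ring
  simp only [kerT, h1]
  rw [integral_finsetSum _ fun i _ =>
    (integrable_kerT hu (hκ.dirD _).continuous (hs.dirD _) c τ y).const_mul _]
  simp only [integral_const_mul]

lemma kerT_lapl {u κ : Eucl N → ℝ} (hu : Integrable u) (hκ : ContDiff ℝ ∞ κ)
    (hs : HasCompactSupport κ) (c τ : ℝ) (y : Eucl N) :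
    kerT u (lapl κ) c τ y = ∑ i, kerT u (dirD (EuclideanSpace.single i 1)
      (dirD (EuclideanSpace.single i 1) κ)) c τ y := by
  simp only [kerT, lapl, Finset.mul_sum]
  rw [integral_finsetSum _ fun i _ =>
    integrable_kerT hu ((hκ.dirD _).dirD _).continuous ((hs.dirD _).dirD _) c τ y]

lemma continuous_dirD_uncurry {κ : Eucl N → ℝ} (hκ : ContDiff ℝ ∞ κ) {X : Type*}
    [TopologicalSpace X] {e x : X → Eucl N} (he : Continuous e) (hx : Continuous x) :
    Continuous fun q => dirD (e q) κ (x q) := by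
  unfold dirD
  exact ((hκ.continuous_fderiv (by simp)).comp hx).clm_apply he

namespace WaveSystem

variable {k r a b : ℝ} {w A : ℝ → Eucl N → ℝ} {G : Fin N → ℝ → Eucl N → ℝ} {S : ℝ → Eucl N → ℝ}

lemma hasDerivAt_kernel {κ : Eucl N → ℝ} (hκ : ContDiff ℝ ∞ κ) (δ : ℝ) (y z : Eucl N) (μ : ℝ) :
    HasDerivAt (fun μ => κ ((Real.exp (-μ) - δ) • y - Real.exp (-μ) • z))
      (dirD (Real.exp (-μ) • z - Real.exp (-μ) • y) κ
        ((Real.exp (-μ) - δ) • y - Real.exp (-μ) • z)) μ := by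
  have h0 : HasDerivAt (fun μ => Real.exp (-μ)) (-Real.exp (-μ)) μ := by
    have := (hasDerivAt_neg μ).exp
    simpa using this
  have h1 : HasDerivAt (fun μ => (Real.exp (-μ) - δ) • y - Real.exp (-μ) • z)
      (Real.exp (-μ) • z - Real.exp (-μ) • y) μ := by
    have := ((h0.sub_const δ).smul_const y).sub (h0.smul_const z)
    convert! this using 1
    simp [sub_eq_add_neg, add_comm]
  exact ((hκ.differentiable (by simp)) _).hasFDerivAt.comp_hasDerivAt μ h1

lemma continuous_kernel {κ : Eucl N → ℝ} (hκ : Continuous κ) (δ : ℝ) (y : Eucl N) :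
    Continuous (Function.uncurry fun (μ : ℝ) (z : Eucl N) =>
      κ ((Real.exp (-μ) - δ) • y - Real.exp (-μ) • z)) := by
  unfold Function.uncurry
  fun_prop

lemma continuous_kernel_dirD {κ : Eucl N → ℝ} (hκ : ContDiff ℝ ∞ κ) (δ : ℝ) (y : Eucl N)
    {e : ℝ × Eucl N → Eucl N} (he : Continuous e) :
    Continuous (Function.uncurry fun (μ : ℝ) (z : Eucl N) =>
      dirD (e (μ, z)) κ ((Real.exp (-μ) - δ) • y - Real.exp (-μ) • z)) :=
  continuous_dirD_uncurry hκ he (by fun_prop)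

/-- The transport term of the system differentiates the kernel along `-τ z`, and the motion of the
kernel differentiates it along `τ z - τ y`. The parts along `z` cancel, because the kernel is at
rest in the unscaled variable `τ z`; only the motion of the evaluation point along `y` survives. -/
lemma integral_combine {u : ℝ → Eucl N → ℝ} (hu : SrcField N r a b u) {κ : Eucl N → ℝ}
    (hκ : ContDiff ℝ ∞ κ) (s d δ τ : ℝ) (y : Eucl N) (hκs : HasCompactSupport κ) :
    (∫ z, u s z * (d * κ ((τ - δ) • y - τ • z) + -τ * dirD z κ ((τ - δ) • y - τ • z)))
      + ∫ z, u s z * dirD (τ • z - τ • y) κ ((τ - δ) • y - τ • z) =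
    d * kerT (u s) κ (τ - δ) τ y - τ * kerT (u s) (dirD y κ) (τ - δ) τ y := by
  have hX : Continuous fun z : Eucl N => (τ - δ) • y - τ • z := by fun_prop
  have c1 : Continuous fun z : Eucl N => κ ((τ - δ) • y - τ • z) := hκ.continuous.comp hX
  have c2 : Continuous fun z : Eucl N => dirD z κ ((τ - δ) • y - τ • z) :=
    continuous_dirD_uncurry hκ continuous_id hX
  have c3 : Continuous fun z : Eucl N => dirD (τ • z - τ • y) κ ((τ - δ) • y - τ • z) :=
    continuous_dirD_uncurry hκ (by fun_prop) hX
  rw [← integral_add (hu.integrable_mul s (by fun_prop)) (hu.integrable_mul s c3), kerT, kerT,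
    ← integral_const_mul, ← integral_const_mul,
    ← integral_sub ((integrable_kerT (hu.integrable_slice s) hκ.continuous hκs _ _ _).const_mul _)
    ((integrable_kerT (hu.integrable_slice s) (hκ.dirD y).continuous (hκs.dirD y) _ _ _).const_mul _)]
  congr 1
  ext z
  have h1 : dirD (τ • z - τ • y) κ ((τ - δ) • y - τ • z) = τ * dirD z κ ((τ - δ) • y - τ • z)
      - τ * dirD y κ ((τ - δ) • y - τ • z) := by
    simp [dirD]
  rw [h1]; ring

/-- The weak equation holds for each kernel frozen in time; `isPrim_pairing` lets the kernel move,
and `integral_combine` removes the transport term. The same scheme gives the equation for `A`. -/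
lemma isPrim_w (h : WaveSystem N k r a b w A G S) {δ ε : ℝ}
    (hgeo : ∀ s ∈ Icc a b, 0 < Real.exp (-s) - δ ∧ Real.exp (-s) - δ + ε < Real.exp (-s) * r)
    {κ : Eucl N → ℝ} (hκ : ContDiff ℝ ∞ κ) (hκs : ∀ x, ε < ‖x‖ → κ x = 0) {y : Eucl N}
    (hy : ‖y‖ ≤ 1) :
    IsPrim (fun s => kerT (w s) κ (Real.exp (-s) - δ) (Real.exp (-s)) y)
      (fun s => kerT (A s) κ (Real.exp (-s) - δ) (Real.exp (-s)) y
        + ((N - k) * kerT (w s) κ (Real.exp (-s) - δ) (Real.exp (-s)) y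
        - Real.exp (-s) * kerT (w s) (dirD y κ) (Real.exp (-s) - δ) (Real.exp (-s)) y)) a b := by
  have hcs := hasCompactSupport_of_lt hκs
  have c1 := continuous_kernel hκ.continuous δ y
  have c2 : Continuous (Function.uncurry fun (μ : ℝ) (z : Eucl N) => (N - k) *
      κ ((Real.exp (-μ) - δ) • y - Real.exp (-μ) • z)
        + -Real.exp (-μ) * dirD z κ ((Real.exp (-μ) - δ) • y - Real.exp (-μ) • z)) :=
    (c1.const_mul _).add ((by fun_prop : Continuous
      fun q : ℝ × Eucl N => -Real.exp (-q.1)).mul (continuous_kernel_dirD hκ δ y continuous_snd))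
  have key := isPrim_pairing (ι := Fin 2) (r := r) h.hab h.fw.cont h.fw.supp (p := ![A, w])
    (ψ := fun μ z => κ ((Real.exp (-μ) - δ) • y - Real.exp (-μ) • z))
    (ψ' := fun μ z => dirD (Real.exp (-μ) • z - Real.exp (-μ) • y) κ
        ((Real.exp (-μ) - δ) • y - Real.exp (-μ) • z))
    (χ := ![fun μ z => κ ((Real.exp (-μ) - δ) • y - Real.exp (-μ) • z),
      fun μ z => (N - k) * κ ((Real.exp (-μ) - δ) • y - Real.exp (-μ) • z)
        + -Real.exp (-μ) * dirD z κ ((Real.exp (-μ) - δ) • y - Real.exp (-μ) • z)])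
    (by intro j; fin_cases j; exacts [h.fA.meas, h.fw.meas])
    (by intro j; fin_cases j
        exacts [(h.fA.srcField a b).integrable_prod, (h.fw.srcField a b).integrable_prod])
    (by intro j; fin_cases j; exacts [h.fA.supp, h.fw.supp])
    (fun μ => hκ.continuous.comp (by fun_prop))
    (continuous_kernel_dirD hκ δ y (e := fun q => Real.exp (-q.1) • q.2 - Real.exp (-q.1) • y)
      (by fun_prop))
    (by intro j; fin_cases j; exacts [c1, c2])
    (fun μ z => hasDerivAt_kernel hκ δ y z μ)
    (by
      intro μ hμ t₁ t₂ h₁ h₂ h₃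
      have hg := hgeo μ hμ
      have hψ : ContDiff ℝ ∞ (fun z => κ ((Real.exp (-μ) - δ) • y - Real.exp (-μ) • z)) :=
        hκ.comp (by fun_prop)
      rw [h.eq_w _ hψ (tsupport_comp_affine hκs hg.1.le (Real.exp_pos _) hg.2 hy) t₁ t₂ h₁ h₂ h₃]
      congr 1
      ext s
      simp only [Fin.sum_univ_two, Matrix.cons_val_zero, Matrix.cons_val_one,
        dirD_comp_affine (hκ.differentiable (by simp))])
  refine key.congr_deriv fun s _ => ?_
  simp only [Fin.sum_univ_two, Matrix.cons_val_zero, Matrix.cons_val_one]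
  rw [add_assoc, integral_combine (h.fw.srcField a b) hκ s _ δ _ y hcs]
  rfl

lemma isPrim_A (h : WaveSystem N k r a b w A G S) {δ ε : ℝ}
    (hgeo : ∀ s ∈ Icc a b, 0 < Real.exp (-s) - δ ∧ Real.exp (-s) - δ + ε < Real.exp (-s) * r)
    {κ : Eucl N → ℝ} (hκ : ContDiff ℝ ∞ κ) (hκs : ∀ x, ε < ‖x‖ → κ x = 0) {y : Eucl N}
    (hy : ‖y‖ ≤ 1) :
    IsPrim (fun s => kerT (A s) κ (Real.exp (-s) - δ) (Real.exp (-s)) y)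
      (fun s => Real.exp (-s) ^ 2 * kerT (w s) (lapl κ) (Real.exp (-s) - δ) (Real.exp (-s)) y
        + kerT (S s) κ (Real.exp (-s) - δ) (Real.exp (-s)) y
        + ((N - k - 1) * kerT (A s) κ (Real.exp (-s) - δ) (Real.exp (-s)) y
        - Real.exp (-s) * kerT (A s) (dirD y κ) (Real.exp (-s) - δ) (Real.exp (-s)) y)) a b := by
  have hcs := hasCompactSupport_of_lt hκs
  have c1 := continuous_kernel hκ.continuous δ y
  have c2 : Continuous (Function.uncurry fun (μ : ℝ) (z : Eucl N) => (N - k - 1) *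
      κ ((Real.exp (-μ) - δ) • y - Real.exp (-μ) • z)
        + -Real.exp (-μ) * dirD z κ ((Real.exp (-μ) - δ) • y - Real.exp (-μ) • z)) :=
    (c1.const_mul _).add ((by fun_prop : Continuous
      fun q : ℝ × Eucl N => -Real.exp (-q.1)).mul (continuous_kernel_dirD hκ δ y continuous_snd))
  have c3 : Continuous (Function.uncurry fun (μ : ℝ) (z : Eucl N) => Real.exp (-μ) ^ 2 *
      lapl κ ((Real.exp (-μ) - δ) • y - Real.exp (-μ) • z)) :=
    (by fun_prop : Continuous fun q : ℝ × Eucl N => Real.exp (-q.1) ^ 2).mul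
      (continuous_kernel hκ.lapl.continuous δ y)
  have key := isPrim_pairing (ι := Fin 3) (r := r) h.hab h.fA.cont h.fA.supp (p := ![w, S, A])
    (ψ := fun μ z => κ ((Real.exp (-μ) - δ) • y - Real.exp (-μ) • z))
    (ψ' := fun μ z => dirD (Real.exp (-μ) • z - Real.exp (-μ) • y) κ
        ((Real.exp (-μ) - δ) • y - Real.exp (-μ) • z))
    (χ := ![fun μ z => Real.exp (-μ) ^ 2 * lapl κ ((Real.exp (-μ) - δ) • y - Real.exp (-μ) • z),
      fun μ z => κ ((Real.exp (-μ) - δ) • y - Real.exp (-μ) • z),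
      fun μ z => (N - k - 1) * κ ((Real.exp (-μ) - δ) • y - Real.exp (-μ) • z)
        + -Real.exp (-μ) * dirD z κ ((Real.exp (-μ) - δ) • y - Real.exp (-μ) • z)])
    (by intro j; fin_cases j; exacts [h.fw.meas, h.fS.meas, h.fA.meas])
    (by intro j; fin_cases j
        exacts [(h.fw.srcField a b).integrable_prod, h.fS.integrable_prod,
          (h.fA.srcField a b).integrable_prod])
    (by intro j; fin_cases j; exacts [h.fw.supp, h.fS.supp, h.fA.supp])
    (fun μ => hκ.continuous.comp (by fun_prop))
    (continuous_kernel_dirD hκ δ y (e := fun q => Real.exp (-q.1) • q.2 - Real.exp (-q.1) • y)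
      (by fun_prop))
    (by intro j; fin_cases j; exacts [c3, c1, c2])
    (fun μ z => hasDerivAt_kernel hκ δ y z μ)
    (by
      intro μ hμ t₁ t₂ h₁ h₂ h₃
      have hg := hgeo μ hμ
      have hψ : ContDiff ℝ ∞ (fun z => κ ((Real.exp (-μ) - δ) • y - Real.exp (-μ) • z)) :=
        hκ.comp (by fun_prop)
      rw [h.eq_A _ hψ (tsupport_comp_affine hκs hg.1.le (Real.exp_pos _) hg.2 hy) t₁ t₂ h₁ h₂ h₃]
      congr 1
      ext s
      simp only [Fin.sum_univ_three, Matrix.cons_val_zero, Matrix.cons_val_one,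
        Matrix.cons_val, dirD_comp_affine (hκ.differentiable (by simp)), lapl_comp_affine hκ]
      ring)
  refine key.congr_deriv fun s _ => ?_
  simp only [Fin.sum_univ_three, Matrix.cons_val_zero, Matrix.cons_val_one,
    Matrix.cons_val]
  rw [add_assoc, integral_combine (h.fA.srcField a b) hκ s _ δ _ y hcs]
  congr 2
  rw [kerT, ← integral_const_mul]
  congr 1; ext z; ring

/-- Integration by parts in a smoothing kernel. -/
lemma kerT_dirD_eq (h : WaveSystem N k r a b w A G S) {δ ε : ℝ} {s : ℝ} (hs : s ∈ Icc a b)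
    (hgeo : 0 < Real.exp (-s) - δ ∧ Real.exp (-s) - δ + ε < Real.exp (-s) * r)
    {κ : Eucl N → ℝ} (hκ : ContDiff ℝ ∞ κ) (hκs : ∀ x, ε < ‖x‖ → κ x = 0) {y : Eucl N}
    (hy : ‖y‖ ≤ 1) (i : Fin N) :
    Real.exp (-s) * kerT (w s) (dirD (EuclideanSpace.single i 1) κ) (Real.exp (-s) - δ) (Real.exp (-s)) y
      = kerT (G i s) κ (Real.exp (-s) - δ) (Real.exp (-s)) y := by
  have hψ : ContDiff ℝ ∞ (fun z => κ ((Real.exp (-s) - δ) • y - Real.exp (-s) • z)) :=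
    hκ.comp (by fun_prop)
  have := h.grad i s hs _ hψ (tsupport_comp_affine hκs hgeo.1.le (Real.exp_pos _) hgeo.2 hy)
  simp only [dirD_comp_affine (hκ.differentiable (by simp))] at this
  rw [kerT, kerT, ← integral_const_mul, ← neg_inj, ← this, ← integral_neg]
  congr 1; ext z; ring

end WaveSystem

end Fields

/-- A bounded derivative makes `Γ` Lipschitz, and composition with a Lipschitz function preserves
absolute continuity. This is one reason for truncating the nonlinearity first. -/
lemma IsPrim.comp_lipschitz {f f' : ℝ → ℝ} {a b : ℝ} (hf : IsPrim f f' a b) {Γ g : ℝ → ℝ}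
    (hΓ : ∀ x, HasDerivAt Γ (g x) x) {K : ℝ} (hK : ∀ x, |g x| ≤ K) :
    IsPrim (fun s => Γ (f s)) (fun s => g (f s) * f' s) a b := by
  have hK0 : 0 ≤ K := (abs_nonneg _).trans (hK 0)
  have hL : ∀ x y, dist (Γ x) (Γ y) ≤ K * dist x y := fun x y => by
    have := convex_univ.norm_image_sub_le_of_norm_hasDerivWithin_le (f := Γ) (f' := g) (C := K)
      (fun x _ => (hΓ x).hasDerivWithinAt) (fun x _ => hK x) (mem_univ y) (mem_univ x)
    simpa [Real.dist_eq] using this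
  constructor
  · have h3 := hf.1
    rw [absolutelyContinuousOnInterval_iff] at h3 ⊢
    intro ε hε
    obtain ⟨δ, hδ, H⟩ := h3 (ε / (K + 1)) (by positivity)
    refine ⟨δ, hδ, fun E hE hE2 => ?_⟩
    have h4 := H E hE hE2
    rw [lt_div_iff₀ (by positivity)] at h4
    refine lt_of_le_of_lt ?_ h4
    rw [Finset.sum_mul]
    refine Finset.sum_le_sum fun i _ => (hL _ _).trans ?_
    rw [mul_comm]
    exact mul_le_mul_of_nonneg_left (by linarith) dist_nonneg
  · filter_upwards [hf.2] with x hx hx'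
    exact (hΓ (f x)).comp x (hx hx')

/-! ### The smoothed rescaled solution and its exact equations. -/

section Mollified

variable {N : ℕ}

/-- The smoothing `λ^j τ^n ∫ u(s, z) κ((τ - δ) y - τ z) dz`, with `τ = e^{-s}` and
`λ = (τ - δ) / τ`, of the rescaled function `λ^j u(s, λ y)`. -/
noncomputable def moll (δ j : ℝ) (n : ℕ) (κ : Eucl N → ℝ) (u : ℝ → Eucl N → ℝ) (s : ℝ)
    (y : Eucl N) : ℝ :=
  (1 - δ * Real.exp s) ^ j * Real.exp (-s) ^ n * kerT (u s) κ (Real.exp (-s) - δ) (Real.exp (-s)) y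

lemma hasDerivAt_prefactor {δ s : ℝ} (j : ℝ) (n : ℕ) (hs : 0 < 1 - δ * Real.exp s) :
    HasDerivAt (fun s => (1 - δ * Real.exp s) ^ j * Real.exp (-s) ^ n)
      ((j - n - j * (1 - δ * Real.exp s)⁻¹) * ((1 - δ * Real.exp s) ^ j * Real.exp (-s) ^ n)) s := by
  have h0 : HasDerivAt (fun s => Real.exp (-s)) (-Real.exp (-s)) s := by
    have := (hasDerivAt_neg s).exp
    simpa using this
  have h1 := (((Real.hasDerivAt_exp s).const_mul δ).const_sub 1).rpow_const (p := j) (Or.inl hs.ne')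
  have h2 := h1.mul (h0.pow n)
  refine h2.congr_deriv ?_
  rw [Real.rpow_sub_one hs.ne']
  rcases n with - | n
  · simp; field_simp; ring
  · simp only [Nat.add_sub_cancel, pow_succ, Pi.pow_apply]; push_cast; field_simp; ring

lemma one_sub_mul_exp {δ s : ℝ} : 1 - δ * Real.exp s = (Real.exp (-s) - δ) / Real.exp (-s) := by
  rw [sub_div, div_self (Real.exp_pos _).ne', Real.exp_neg, div_inv_eq_mul]

lemma one_sub_pos_of {δ s : ℝ} (h : 0 < Real.exp (-s) - δ) : 0 < 1 - δ * Real.exp s := by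
  rw [one_sub_mul_exp]; exact div_pos h (Real.exp_pos _)

lemma isPrim_moll {a b δ j : ℝ} (hab : a ≤ b) (n : ℕ) {κ : Eucl N → ℝ} {u : ℝ → Eucl N → ℝ}
    (hpos : ∀ s ∈ Icc a b, 0 < Real.exp (-s) - δ) {y : Eucl N} {d : ℝ → ℝ}
    (h : IsPrim (fun s => kerT (u s) κ (Real.exp (-s) - δ) (Real.exp (-s)) y) d a b) :
    IsPrim (fun s => moll δ j n κ u s y)
      (fun s => (1 - δ * Real.exp s) ^ j * Real.exp (-s) ^ n * d s
        + (j - n - j * (1 - δ * Real.exp s)⁻¹) * moll δ j n κ u s y) a b := by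
  have h1 : IsPrim _ _ a b := IsPrim.of_hasDerivAt hab
    (fun s hs => hasDerivAt_prefactor j n (one_sub_pos_of (hpos s hs)))
    (by
      intro s hs
      have := (one_sub_pos_of (hpos s hs)).ne'
      refine ContinuousAt.continuousWithinAt ?_
      have hc : ContinuousAt (fun s => 1 - δ * Real.exp s) s := by fun_prop
      exact ((continuousAt_const.sub (continuousAt_const.mul (hc.inv₀ this))).mul
        ((hc.rpow_const (Or.inl this)).mul (by fun_prop))))
  refine (h1.mul h).congr_deriv fun s _ => ?_
  rw [moll]; ring

/-- Since `e^{-s} - δ = λ e^{-s}`, each derivative in `y` brings out one power of `λ` and one of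
`e^{-s}`. This explains the exponents in the smoothed gradient and Hessian. -/
lemma moll_hasGrad {u : ℝ → Eucl N → ℝ} {s δ j : ℝ} (n : ℕ) (hu : Integrable (u s)) {κ : Eucl N → ℝ}
    (hκ : ContDiff ℝ ∞ κ) (hs : HasCompactSupport κ) (hpos : 0 < Real.exp (-s) - δ) :
    HasGrad (moll δ j n κ u s)
      fun i => moll δ (j + 1) (n + 1) (dirD (EuclideanSpace.single i 1) κ) u s := by
  refine ((kerT_hasGrad hu hκ hs (Real.exp (-s) - δ) (Real.exp (-s))).const_mul
    ((1 - δ * Real.exp s) ^ j * Real.exp (-s) ^ n)).congr_grad fun i y => ?_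
  have h1 : Real.exp (-s) - δ = (1 - δ * Real.exp s) * Real.exp (-s) := by
    rw [one_sub_mul_exp, div_mul_cancel₀ _ (Real.exp_pos _).ne']
  rw [moll, Real.rpow_add_one (one_sub_pos_of hpos).ne', pow_succ]
  conv_lhs => rw [← mul_assoc]
  congr 1
  rw [h1]; ring

variable {k r a b : ℝ} {w A : ℝ → Eucl N → ℝ} {G : Fin N → ℝ → Eucl N → ℝ} {S : ℝ → Eucl N → ℝ}

/-- The smoothed gradient of the rescaled unknown. -/
noncomputable def mollG (k δ : ℝ) (κ : Eucl N → ℝ) (w : ℝ → Eucl N → ℝ) (i : Fin N) (s : ℝ)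
    (y : Eucl N) : ℝ :=
  moll δ (k + 1) (N + 1) (dirD (EuclideanSpace.single i 1) κ) w s y

/-- The smoothed Hessian of the rescaled unknown. -/
noncomputable def mollH (k δ : ℝ) (κ : Eucl N → ℝ) (w : ℝ → Eucl N → ℝ) (i j : Fin N) (s : ℝ)
    (y : Eucl N) : ℝ :=
  moll δ (k + 1 + 1) (N + 1 + 1)
    (dirD (EuclideanSpace.single j 1) (dirD (EuclideanSpace.single i 1) κ)) w s y

/-- The smoothed time derivative of the rescaled unknown. -/
noncomputable def mollV (k δ : ℝ) (κ : Eucl N → ℝ) (w A : ℝ → Eucl N → ℝ) (s : ℝ)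
    (y : Eucl N) : ℝ :=
  moll δ (k + 1) N κ A s y - k * moll δ k N κ w s y - ∑ i, y i * mollG k δ κ w i s y

/-- The gradient of the smoothed time derivative of the rescaled unknown. -/
noncomputable def mollVG (k δ : ℝ) (κ : Eucl N → ℝ) (w A : ℝ → Eucl N → ℝ) (i : Fin N) (s : ℝ)
    (y : Eucl N) : ℝ :=
  moll δ (k + 1 + 1) (N + 1) (dirD (EuclideanSpace.single i 1) κ) A s y
    - (k + 1) * mollG k δ κ w i s y - ∑ j, y j * mollH k δ κ w j i s y

lemma mollV_hasGrad {s δ : ℝ} (hw : Integrable (w s)) (hA : Integrable (A s)) {κ : Eucl N → ℝ}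
    (hκ : ContDiff ℝ ∞ κ) (hs : HasCompactSupport κ) (hpos : 0 < Real.exp (-s) - δ) :
    HasGrad (mollV k δ κ w A s) fun i => mollVG k δ κ w A i s := by
  have hG : ∀ i, HasGrad (mollG k δ κ w i s) fun j => mollH k δ κ w i j s := fun i =>
    moll_hasGrad (N + 1) hw (hκ.dirD _) (hs.dirD _) hpos
  have h1 := ((moll_hasGrad (j := k + 1) N hA hκ hs hpos).add
    ((moll_hasGrad (j := k) N hw hκ hs hpos).const_mul (-k))).add
    ((HasGrad.sum Finset.univ fun i _ => (HasGrad.coord i).mul (hG i)).const_mul (-1))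
  have e : mollV k δ κ w A s = fun y => (moll δ (k + 1) N κ A s y + -k * moll δ k N κ w s y)
      + -1 * ∑ i, y i * mollG k δ κ w i s y := by
    ext y; rw [mollV]; ring
  rw [e]
  refine h1.congr_grad fun i y => ?_
  simp only [mollVG, Finset.sum_add_distrib, ite_mul, one_mul, zero_mul, Finset.sum_ite_eq,
    Finset.mem_univ, if_true]
  have : mollG k δ κ w i s y =
    moll δ (k + 1) (N + 1) (dirD (EuclideanSpace.single i 1) κ) w s y := rfl
  rw [← this]; ring

namespace WaveSystem

/-- The factor `(1 - δ e^s)⁻¹` is `ds'/ds` for `s' = -log(e^{-s} - δ)`, the self-similar time about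
the shifted vertex. In that time `mollV` is the derivative of the smoothed unknown. -/
lemma isPrim_mollW (h : WaveSystem N k r a b w A G S) {δ ε : ℝ}
    (hgeo : ∀ s ∈ Icc a b, 0 < Real.exp (-s) - δ ∧ Real.exp (-s) - δ + ε < Real.exp (-s) * r)
    {κ : Eucl N → ℝ} (hκ : ContDiff ℝ ∞ κ) (hκs : ∀ x, ε < ‖x‖ → κ x = 0) {y : Eucl N}
    (hy : ‖y‖ ≤ 1) :
    IsPrim (fun s => moll δ k N κ w s y)
      (fun s => (1 - δ * Real.exp s)⁻¹ * mollV k δ κ w A s y) a b := by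
  refine (isPrim_moll h.hab N (fun s hs => (hgeo s hs).1) (h.isPrim_w hgeo hκ hκs hy)).congr_deriv
    fun s hs => ?_
  rw [uIcc_of_le h.hab] at hs
  have hl := one_sub_pos_of (hgeo s hs).1
  have hw := (h.fw.srcField a b).integrable_slice s
  rw [kerT_dirD hw hκ (hasCompactSupport_of_lt hκs)]
  simp only [mollV, mollG, moll, Real.rpow_add_one hl.ne', pow_succ]
  have e : ∀ K : Fin N → ℝ, ∑ i, y i * ((1 - δ * Real.exp s) ^ k * (1 - δ * Real.exp s) *
      (Real.exp (-s) ^ N * Real.exp (-s)) * K i) = (1 - δ * Real.exp s) ^ k * (1 - δ * Real.exp s) *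
      (Real.exp (-s) ^ N * Real.exp (-s)) * ∑ i, y i * K i := fun K => by
    rw [Finset.mul_sum]; exact Finset.sum_congr rfl fun i _ => by ring
  rw [e]
  generalize (∑ i, y i * kerT (w s) _ _ _ y) = Q
  field_simp
  ring

lemma isPrim_mollG (h : WaveSystem N k r a b w A G S) {δ ε : ℝ}
    (hgeo : ∀ s ∈ Icc a b, 0 < Real.exp (-s) - δ ∧ Real.exp (-s) - δ + ε < Real.exp (-s) * r)
    {κ : Eucl N → ℝ} (hκ : ContDiff ℝ ∞ κ) (hκs : ∀ x, ε < ‖x‖ → κ x = 0) {y : Eucl N}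
    (hy : ‖y‖ ≤ 1) (i : Fin N) :
    IsPrim (fun s => mollG k δ κ w i s y)
      (fun s => (1 - δ * Real.exp s)⁻¹ * mollVG k δ κ w A i s y) a b := by
  have hκi := hκ.dirD (EuclideanSpace.single i 1)
  have hκis := dirD_eq_zero_of_lt hκs (EuclideanSpace.single i 1)
  refine (isPrim_moll h.hab (N + 1) (fun s hs => (hgeo s hs).1)
    (h.isPrim_w hgeo hκi hκis hy)).congr_deriv fun s hs => ?_
  rw [uIcc_of_le h.hab] at hs
  have hl := one_sub_pos_of (hgeo s hs).1
  have hw := (h.fw.srcField a b).integrable_slice s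
  rw [kerT_dirD hw hκi (hasCompactSupport_of_lt hκis)]
  have hcomm : ∀ j, dirD (EuclideanSpace.single i 1) (dirD (EuclideanSpace.single j 1) κ) =
      dirD (EuclideanSpace.single j 1) (dirD (EuclideanSpace.single i 1) κ) := fun j =>
    funext fun x => dirD_comm hκ _ _ x
  simp only [mollVG, mollH, mollG, hcomm]
  simp only [moll, Real.rpow_add_one hl.ne', pow_succ]
  have e : ∀ K : Fin N → ℝ, ∑ i, y i * ((1 - δ * Real.exp s) ^ k * (1 - δ * Real.exp s) *
      (1 - δ * Real.exp s) * (Real.exp (-s) ^ N * Real.exp (-s) * Real.exp (-s)) * K i) =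
      (1 - δ * Real.exp s) ^ k * (1 - δ * Real.exp s) * (1 - δ * Real.exp s) *
      (Real.exp (-s) ^ N * Real.exp (-s) * Real.exp (-s)) * ∑ i, y i * K i := fun K => by
    rw [Finset.mul_sum]; exact Finset.sum_congr rfl fun i _ => by ring
  rw [e]
  generalize (∑ j, y j * kerT (w s) _ _ _ y) = Q
  push_cast
  field_simp
  ring

lemma isPrim_mollA (h : WaveSystem N k r a b w A G S) {δ ε : ℝ}
    (hgeo : ∀ s ∈ Icc a b, 0 < Real.exp (-s) - δ ∧ Real.exp (-s) - δ + ε < Real.exp (-s) * r)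
    {κ : Eucl N → ℝ} (hκ : ContDiff ℝ ∞ κ) (hκs : ∀ x, ε < ‖x‖ → κ x = 0) {y : Eucl N}
    (hy : ‖y‖ ≤ 1) :
    IsPrim (fun s => moll δ (k + 1) N κ A s y)
      (fun s => (1 - δ * Real.exp s)⁻¹ * (-(k + 1) * moll δ (k + 1) N κ A s y
        - (∑ i, y i * moll δ (k + 1 + 1) (N + 1) (dirD (EuclideanSpace.single i 1) κ) A s y)
        + (∑ i, mollH k δ κ w i i s y) + moll δ (k + 1 + 1) N κ S s y)) a b := by
  refine (isPrim_moll h.hab N (fun s hs => (hgeo s hs).1) (h.isPrim_A hgeo hκ hκs hy)).congr_deriv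
    fun s hs => ?_
  rw [uIcc_of_le h.hab] at hs
  have hl := one_sub_pos_of (hgeo s hs).1
  have hw := (h.fw.srcField a b).integrable_slice s
  have hA := (h.fA.srcField a b).integrable_slice s
  have hcs := hasCompactSupport_of_lt hκs
  rw [kerT_dirD hA hκ hcs, kerT_lapl hw hκ hcs]
  simp only [mollH, moll, Real.rpow_add_one hl.ne', pow_succ]
  have e : ∀ K : Fin N → ℝ, ∑ i, y i * ((1 - δ * Real.exp s) ^ k * (1 - δ * Real.exp s) *
      (1 - δ * Real.exp s) * (Real.exp (-s) ^ N * Real.exp (-s)) * K i) =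
      (1 - δ * Real.exp s) ^ k * (1 - δ * Real.exp s) * (1 - δ * Real.exp s) *
      (Real.exp (-s) ^ N * Real.exp (-s)) * ∑ i, y i * K i := fun K => by
    rw [Finset.mul_sum]; exact Finset.sum_congr rfl fun i _ => by ring
  rw [e, ← Finset.mul_sum]
  generalize (∑ i, y i * kerT (A s) _ _ _ y) = Q
  generalize (∑ i : Fin N, kerT (w s) _ _ _ y) = Q'
  field_simp
  ring

/-- In the unscaled variable the wave operator has constant coefficients and the kernel does not
depend on time, so smoothing commutes with the equation. The second order equation therefore holds
exactly, with the smoothed source. It is obtained by differentiating `V = A - k W - ∑ yᵢ Gᵢ` and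
eliminating `A`. -/
lemma isPrim_mollV (h : WaveSystem N k r a b w A G S) {δ ε : ℝ}
    (hgeo : ∀ s ∈ Icc a b, 0 < Real.exp (-s) - δ ∧ Real.exp (-s) - δ + ε < Real.exp (-s) * r)
    {κ : Eucl N → ℝ} (hκ : ContDiff ℝ ∞ κ) (hκs : ∀ x, ε < ‖x‖ → κ x = 0) {y : Eucl N}
    (hy : ‖y‖ ≤ 1) :
    IsPrim (fun s => mollV k δ κ w A s y)
      (fun s => (1 - δ * Real.exp s)⁻¹ * waveOp k (moll δ k N κ w s y) (mollV k δ κ w A s y)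
        (fun i => mollG k δ κ w i s y) (fun i => mollVG k δ κ w A i s y)
        (fun i j => mollH k δ κ w i j s y) (moll δ (k + 1 + 1) N κ S s y) y) a b := by
  refine (((h.isPrim_mollA hgeo hκ hκs hy).sub ((h.isPrim_mollW hgeo hκ hκs hy).const_mul k)).sub
    (IsPrim.sum Finset.univ fun i _ => (h.isPrim_mollG hgeo hκ hκs hy i).const_mul (y i))).congr_deriv
    fun s _ => ?_
  have e1 : ∀ i, moll δ (k + 1 + 1) (N + 1) (dirD (EuclideanSpace.single i 1) κ) A s y =
      mollVG k δ κ w A i s y + (k + 1) * mollG k δ κ w i s y + ∑ j, y j * mollH k δ κ w j i s y :=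
    fun i => by rw [mollVG]; ring
  have e2 : moll δ (k + 1) N κ A s y = mollV k δ κ w A s y + k * moll δ k N κ w s y
      + ∑ i, y i * mollG k δ κ w i s y := by rw [mollV]; ring
  simp only [e1, e2, waveOp]
  generalize mollV k δ κ w A s y = V
  have e3 : ∑ i, y i * (mollVG k δ κ w A i s y + (k + 1) * mollG k δ κ w i s y
      + ∑ j, y j * mollH k δ κ w j i s y) = (∑ i, y i * mollVG k δ κ w A i s y)
      + k * (∑ i, y i * mollG k δ κ w i s y)
      + ∑ i, y i * (mollG k δ κ w i s y + ∑ j, y j * mollH k δ κ w j i s y) := by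
    rw [Finset.mul_sum, ← Finset.sum_add_distrib, ← Finset.sum_add_distrib]
    exact Finset.sum_congr rfl fun i _ => by ring
  have e4 : ∑ i, y i * ((1 - δ * Real.exp s)⁻¹ * mollVG k δ κ w A i s y) =
      (1 - δ * Real.exp s)⁻¹ * ∑ i, y i * mollVG k δ κ w A i s y := by
    rw [Finset.mul_sum]
    exact Finset.sum_congr rfl fun i _ => by ring
  rw [e3, e4]
  ring

end WaveSystem

/-- The potential energy density enters the energy with the weight `c^{2(k+1)}`, where
`c = e^{-s} - δ`. -/
noncomputable def energyDensity (k p γ c : ℝ) (Γ : ℝ → ℝ) (w v : ℝ) (g : Fin N → ℝ) (y : Eucl N) : ℝ :=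
  Real.exp ((p + 3) / (2 * γ) * c ^ γ) * (linDensity (k * (k + 1)) w v g y - c ^ γ * (w * v)
    - c ^ (2 * (k + 1)) * Γ (c ^ (-k) * w))

/-- The contribution of the potential energy to the time derivative of the energy density. -/
noncomputable def potRate (k p γ c : ℝ) (Γ G : ℝ → ℝ) (w v : ℝ) : ℝ :=
  c ^ (2 * (k + 1)) * (((p + 3) / 2 * c ^ γ + 2 * (k + 1)) * Γ (c ^ (-k) * w)
    - G (c ^ (-k) * w) * (c ^ (-k) * (v + k * w)))

lemma hasDerivAt_rpow_exp {δ s : ℝ} (j : ℝ) (h : 0 < Real.exp (-s) - δ) :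
    HasDerivAt (fun s => (Real.exp (-s) - δ) ^ j)
      ((1 - δ * Real.exp s)⁻¹ * (-j * (Real.exp (-s) - δ) ^ j)) s := by
  have h0 : HasDerivAt (fun s => Real.exp (-s) - δ) (-Real.exp (-s)) s := by
    have := ((hasDerivAt_neg s).exp).sub_const δ
    simpa using this
  refine (h0.rpow_const (p := j) (Or.inl h.ne')).congr_deriv ?_
  rw [Real.rpow_sub_one h.ne', one_sub_mul_exp]
  have := (Real.exp_pos (-s)).ne'
  field_simp

lemma isPrim_rpow_exp {δ : ℝ} (hab : a ≤ b) (j : ℝ) (h : ∀ s ∈ Icc a b, 0 < Real.exp (-s) - δ) :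
    IsPrim (fun s => (Real.exp (-s) - δ) ^ j)
      (fun s => (1 - δ * Real.exp s)⁻¹ * (-j * (Real.exp (-s) - δ) ^ j)) a b := by
  refine IsPrim.of_hasDerivAt hab (fun s hs => hasDerivAt_rpow_exp j (h s hs)) fun s hs => ?_
  refine ContinuousAt.continuousWithinAt ?_
  have hc : ContinuousAt (fun s => 1 - δ * Real.exp s) s := by fun_prop
  have hc' : ContinuousAt (fun s => Real.exp (-s) - δ) s := by fun_prop
  exact (hc.inv₀ (one_sub_pos_of (h s hs)).ne').mul
    (continuousAt_const.mul (hc'.rpow_const (Or.inl (h s hs).ne')))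

/-- Product and chain rules in the time `s'`, where `c` has derivative `-c`. Hence `η = c^γ` has
derivative `-γ η`, and the exponential weight has logarithmic derivative `-(p+3)/2 η`; these are the
explicit `γ` and `(p+3)/2` terms in `rateDensity` and `potRate`. -/
lemma isPrim_energyDensity {δ p γ : ℝ} (hγ : 0 < γ) (hab : a ≤ b)
    (hpos : ∀ s ∈ Icc a b, 0 < Real.exp (-s) - δ) {W V Sv : ℝ → ℝ} {g vg : Fin N → ℝ → ℝ}
    {hh : Fin N → Fin N → ℝ → ℝ} {y : Eucl N}
    (hW : IsPrim W (fun s => (1 - δ * Real.exp s)⁻¹ * V s) a b)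
    (hV : IsPrim V (fun s => (1 - δ * Real.exp s)⁻¹ * waveOp k (W s) (V s) (fun i => g i s)
      (fun i => vg i s) (fun i j => hh i j s) (Sv s) y) a b)
    (hg : ∀ i, IsPrim (g i) (fun s => (1 - δ * Real.exp s)⁻¹ * vg i s) a b) {Γ Γ' : ℝ → ℝ}
    (hΓ : ∀ x, HasDerivAt Γ (Γ' x) x) {K : ℝ} (hK : ∀ x, |Γ' x| ≤ K) :
    IsPrim (fun s => energyDensity k p γ (Real.exp (-s) - δ) Γ (W s) (V s) (fun i => g i s) y)
      (fun s => (1 - δ * Real.exp s)⁻¹ *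
        (Real.exp ((p + 3) / (2 * γ) * (Real.exp (-s) - δ) ^ γ) *
        (rateDensity k p γ ((Real.exp (-s) - δ) ^ γ) (W s) (V s) (fun i => g i s) (fun i => vg i s)
          (fun i j => hh i j s) (Sv s) y
        + potRate k p γ (Real.exp (-s) - δ) Γ Γ' (W s) (V s)))) a b := by
  have hη := isPrim_rpow_exp hab γ hpos
  have hm : IsPrim (fun s => Real.exp ((p + 3) / (2 * γ) * (Real.exp (-s) - δ) ^ γ))
      (fun s => (1 - δ * Real.exp s)⁻¹ * (-((p + 3) / 2) * (Real.exp (-s) - δ) ^ γ *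
        Real.exp ((p + 3) / (2 * γ) * (Real.exp (-s) - δ) ^ γ))) a b := by
    refine IsPrim.of_hasDerivAt hab (fun s hs =>
      ((hasDerivAt_rpow_exp γ (hpos s hs)).const_mul ((p + 3) / (2 * γ))).exp.congr_deriv ?_) ?_
    · field_simp
    · intro s hs
      refine ContinuousAt.continuousWithinAt ?_
      have hc : ContinuousAt (fun s => 1 - δ * Real.exp s) s := by fun_prop
      have hc' : ContinuousAt (fun s => Real.exp (-s) - δ) s := by fun_prop
      have hc'' := hc'.rpow_const (p := γ) (Or.inl (hpos s hs).ne')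
      exact (hc.inv₀ (one_sub_pos_of (hpos s hs)).ne').mul
        ((continuousAt_const.mul hc'').mul (continuousAt_const.mul hc'').rexp)
  have hX := (isPrim_rpow_exp hab (-k) hpos).mul hW
  have hΓX := (isPrim_rpow_exp hab (2 * (k + 1)) hpos).mul (hX.comp_lipschitz hΓ hK)
  have hD := IsPrim.sum Finset.univ fun i _ => (hg i).const_mul (y i)
  have hG2 := IsPrim.sum Finset.univ fun i _ => (hg i).mul (hg i)
  have hlin := (((((hV.mul hV).const_mul (1 / 2)).add (hG2.const_mul (1 / 2))).sub
    ((hD.mul hD).const_mul (1 / 2))).add ((hW.mul hW).const_mul (1 / 2 * (k * (k + 1)))))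
  have hfin := hm.mul ((hlin.sub (hη.mul (hW.mul hV))).sub hΓX)
  have e : (fun s => energyDensity k p γ (Real.exp (-s) - δ) Γ (W s) (V s) (fun i => g i s) y) =
      fun s => Real.exp ((p + 3) / (2 * γ) * (Real.exp (-s) - δ) ^ γ) *
        (1 / 2 * (V s * V s) + 1 / 2 * ∑ i, g i s * g i s
            - 1 / 2 * ((∑ i, y i * g i s) * ∑ i, y i * g i s)
            + 1 / 2 * (k * (k + 1)) * (W s * W s) -
          (Real.exp (-s) - δ) ^ γ * (W s * V s) -
        (Real.exp (-s) - δ) ^ (2 * (k + 1)) * Γ ((Real.exp (-s) - δ) ^ (-k) * W s)) := by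
    ext s
    simp only [energyDensity, linDensity, pow_two]
  rw [e]
  refine hfin.congr_deriv fun s _ => ?_
  have e1 : ∑ i, ((1 - δ * Real.exp s)⁻¹ * vg i s * g i s + g i s * ((1 - δ * Real.exp s)⁻¹ * vg i s))
      = 2 * (1 - δ * Real.exp s)⁻¹ * ∑ i, g i s * vg i s := by
    rw [Finset.mul_sum]; exact Finset.sum_congr rfl fun i _ => by ring
  have e2 : ∑ i, y i * ((1 - δ * Real.exp s)⁻¹ * vg i s) =
      (1 - δ * Real.exp s)⁻¹ * ∑ i, y i * vg i s := by
    rw [Finset.mul_sum]; exact Finset.sum_congr rfl fun i _ => by ring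
  have e3 : ∑ i, g i s * g i s = ∑ i, g i s ^ 2 := Finset.sum_congr rfl fun i _ => by ring
  simp only [e1, e2, e3, rateDensity, potRate, linDensity]
  generalize waveOp k (W s) (V s) (fun i => g i s) (fun i => vg i s) (fun i j => hh i j s) (Sv s) y = Q
  ring

end Mollified

/-! ### Joint measurability and bounds of the smoothed quantities. -/

section BoundedMeasurable

variable {N : ℕ} {a b : ℝ}

/-- Joint measurability, and boundedness over `[a, b] × B`. -/
structure BddMeas (N : ℕ) (a b : ℝ) (F : ℝ → Eucl N → ℝ) : Prop where
  meas : Measurable (Function.uncurry F)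
  bdd : ∃ C, ∀ s ∈ Icc a b, ∀ y ∈ unitBall N, |F s y| ≤ C

namespace BddMeas

variable {F F₁ : ℝ → Eucl N → ℝ}

lemma add (h : BddMeas N a b F) (h₁ : BddMeas N a b F₁) :
    BddMeas N a b fun s y => F s y + F₁ s y := by
  obtain ⟨C, hC⟩ := h.bdd
  obtain ⟨C₁, hC₁⟩ := h₁.bdd
  exact ⟨h.meas.add h₁.meas, C + C₁, fun s hs y hy =>
    (abs_add_le _ _).trans (add_le_add (hC s hs y hy) (hC₁ s hs y hy))⟩

lemma mul (h : BddMeas N a b F) (h₁ : BddMeas N a b F₁) :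
    BddMeas N a b fun s y => F s y * F₁ s y := by
  obtain ⟨C, hC⟩ := h.bdd
  obtain ⟨C₁, hC₁⟩ := h₁.bdd
  refine ⟨h.meas.mul h₁.meas, C * C₁, fun s hs y hy => ?_⟩
  rw [abs_mul]
  exact mul_le_mul (hC s hs y hy) (hC₁ s hs y hy) (abs_nonneg _) ((abs_nonneg _).trans (hC s hs y hy))

lemma const (c : ℝ) : BddMeas N a b fun _ _ => c :=
  ⟨measurable_const, |c|, fun _ _ _ _ => le_rfl⟩

lemma of_time {f : ℝ → ℝ} (hf : Measurable f) (hc : ContinuousOn f (Icc a b)) :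
    BddMeas N a b fun s _ => f s := by
  obtain ⟨C, hC⟩ := isCompact_Icc.exists_bound_of_continuousOn hc
  exact ⟨hf.comp measurable_fst, C, fun s hs _ _ => hC s hs⟩

lemma of_space {f : Eucl N → ℝ} (hf : Continuous f) : BddMeas N a b fun _ y => f y := by
  obtain ⟨C, hC⟩ := (isCompact_closedBall (0 : Eucl N) 1).exists_bound_of_continuousOn hf.continuousOn
  exact ⟨hf.measurable.comp measurable_snd, C, fun s hs y hy =>
    hC y (Metric.ball_subset_closedBall hy)⟩

lemma neg (h : BddMeas N a b F) : BddMeas N a b fun s y => -F s y := by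
  simpa using (const (N := N) (-1)).mul h

lemma sub (h : BddMeas N a b F) (h₁ : BddMeas N a b F₁) :
    BddMeas N a b fun s y => F s y - F₁ s y := by
  simpa [sub_eq_add_neg] using h.add h₁.neg

lemma sq (h : BddMeas N a b F) : BddMeas N a b fun s y => F s y ^ 2 := by
  simpa [pow_two] using h.mul h

lemma sum {ι : Type*} (t : Finset ι) {F : ι → ℝ → Eucl N → ℝ} (h : ∀ i, BddMeas N a b (F i)) :
    BddMeas N a b fun s y => ∑ i ∈ t, F i s y := by
  classical
  induction t using Finset.induction_on with
  | empty => simpa using const (N := N) (a := a) (b := b) 0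
  | insert i t hi ih =>
    simp only [Finset.sum_insert hi]
    exact (h i).add ih

lemma comp (h : BddMeas N a b F) {Γ : ℝ → ℝ} (hΓ : Continuous Γ) :
    BddMeas N a b fun s y => Γ (F s y) := by
  obtain ⟨C, hC⟩ := h.bdd
  obtain ⟨C₁, hC₁⟩ := (isCompact_Icc (a := -C) (b := C)).exists_bound_of_continuousOn
    hΓ.continuousOn
  exact ⟨hΓ.measurable.comp h.meas, C₁, fun s hs y hy => hC₁ _ (abs_le.1 (hC s hs y hy))⟩

lemma integrable {α : ℝ} (hα : 0 ≤ α) (h : BddMeas N a b F) :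
    Integrable (Function.uncurry F) ((volume.restrict (Icc a b)).prod (ballMeas N α)) := by
  have := isFiniteMeasure_ballMeas (N := N) hα
  obtain ⟨C, hC⟩ := h.bdd
  refine Integrable.of_bound h.meas.aestronglyMeasurable C ?_
  have h1 : ∀ᵐ q ∂((volume.restrict (Icc a b)).prod (ballMeas N α)),
      q ∈ Icc a b ×ˢ unitBall N := by
    have e : (volume.restrict (Icc a b)).prod (ballMeas N α) =
        ((volume.restrict (Icc a b)).prod (ballMeas N α)).restrict (Icc a b ×ˢ unitBall N) := by
      rw [← Measure.prod_restrict, Measure.restrict_restrict measurableSet_Icc, inter_self]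
      congr 1
      rw [Measure.restrict_eq_self_of_ae_mem (ae_ballMeas_mem α)]
    rw [e]
    exact ae_restrict_mem (measurableSet_Icc.prod measurableSet_unitBall)
  filter_upwards [h1] with q hq using hC q.1 hq.1 q.2 hq.2

lemma mul_integrable {α : ℝ} (h : BddMeas N a b F)
    (h₁ : Integrable (Function.uncurry F₁) ((volume.restrict (Icc a b)).prod (ballMeas N α)))
    (hm : Measurable (Function.uncurry F₁)) :
    Integrable (Function.uncurry fun s y => F s y * F₁ s y)
      ((volume.restrict (Icc a b)).prod (ballMeas N α)) := by
  obtain ⟨C, hC⟩ := h.bdd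
  have : SFinite (ballMeas N α) := by unfold ballMeas; infer_instance
  refine Integrable.mono' (h₁.norm.const_mul C) (h.meas.mul hm).aestronglyMeasurable ?_
  have h1 : ∀ᵐ q ∂((volume.restrict (Icc a b)).prod (ballMeas N α)),
      q ∈ Icc a b ×ˢ unitBall N := by
    have e : (volume.restrict (Icc a b)).prod (ballMeas N α) =
        ((volume.restrict (Icc a b)).prod (ballMeas N α)).restrict (Icc a b ×ˢ unitBall N) := by
      rw [← Measure.prod_restrict, Measure.restrict_restrict measurableSet_Icc, inter_self]
      congr 1
      rw [Measure.restrict_eq_self_of_ae_mem (ae_ballMeas_mem α)]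
    rw [e]
    exact ae_restrict_mem (measurableSet_Icc.prod measurableSet_unitBall)
  filter_upwards [h1] with q hq
  simp only [Function.uncurry, norm_mul]
  exact mul_le_mul_of_nonneg_right (hC q.1 hq.1 q.2 hq.2) (norm_nonneg _)

end BddMeas

lemma measurable_moll {u : ℝ → Eucl N → ℝ} (hu : Measurable (Function.uncurry u))
    {κ : Eucl N → ℝ} (hκ : Continuous κ) (δ j : ℝ) (n : ℕ) :
    Measurable (Function.uncurry (moll δ j n κ u)) := by
  unfold moll Function.uncurry
  have h1 := measurable_kerT hu hκ (c := fun s => Real.exp (-s) - δ) (τ := fun s => Real.exp (-s))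
    (by fun_prop) (by fun_prop)
  have h2 : Measurable fun q : ℝ × Eucl N => (1 - δ * Real.exp q.1) ^ j * Real.exp (-q.1) ^ n := by
    fun_prop
  exact h2.mul h1

lemma continuousOn_prefactor {δ : ℝ} (hpos : ∀ s ∈ Icc a b, 0 < Real.exp (-s) - δ) (j : ℝ) (n : ℕ) :
    ContinuousOn (fun s => (1 - δ * Real.exp s) ^ j * Real.exp (-s) ^ n) (Icc a b) := fun s hs =>
  (hasDerivAt_prefactor j n (one_sub_pos_of (hpos s hs))).continuousAt.continuousWithinAt

lemma abs_moll_le {r : ℝ} {u : ℝ → Eucl N → ℝ} (hu : SrcField N r a b u) {κ : Eucl N → ℝ}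
    (hκ : Continuous κ) (hs : HasCompactSupport κ) {δ : ℝ}
    (hpos : ∀ s ∈ Icc a b, 0 < Real.exp (-s) - δ) (j : ℝ) (n : ℕ) :
    ∃ C, 0 ≤ C ∧ ∀ s ∈ Icc a b, ∀ y, |moll δ j n κ u s y| ≤ C * (eLpNorm (u s) 2 volume).toReal := by
  obtain ⟨C, hC⟩ := isCompact_Icc.exists_bound_of_continuousOn (continuousOn_prefactor hpos j n)
  obtain ⟨C₁, hC₁0, hC₁⟩ := exists_bound_of_compactSupport hκ hs
  refine ⟨max C 0 * (C₁ * (volume (Metric.ball (0 : Eucl N) r)).toReal ^ (1 / 2 : ℝ)),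
    by positivity, fun s hs' y => ?_⟩
  have h1 := hu.abs_integral_le s
  have h2 := abs_kerT_le h1.1 hC₁ (Real.exp (-s) - δ) (Real.exp (-s)) y
  rw [moll, abs_mul, mul_assoc]
  refine mul_le_mul ((hC s hs').trans (le_max_left _ _)) ?_ (abs_nonneg _) (le_max_right _ _)
  refine h2.trans ?_
  rw [mul_assoc]
  exact mul_le_mul_of_nonneg_left h1.2 hC₁0

lemma bddMeas_moll {r : ℝ} {u : ℝ → Eucl N → ℝ} (hu : SrcField N r a b u) {B : ℝ}
    (hB : ∀ s ∈ Icc a b, (eLpNorm (u s) 2 volume).toReal ≤ B) {κ : Eucl N → ℝ}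
    (hκ : Continuous κ) (hs : HasCompactSupport κ) {δ : ℝ}
    (hpos : ∀ s ∈ Icc a b, 0 < Real.exp (-s) - δ) (j : ℝ) (n : ℕ) :
    BddMeas N a b (moll δ j n κ u) := by
  obtain ⟨C, hC0, hC⟩ := abs_moll_le hu hκ hs hpos j n
  exact ⟨measurable_moll hu.meas hκ δ j n, C * B, fun s hs y _ =>
    (hC s hs y).trans (mul_le_mul_of_nonneg_left (hB s hs) hC0)⟩

lemma ContField.bddMeas_moll {r : ℝ} {u : ℝ → Eucl N → ℝ} (hu : ContField N r u) {κ : Eucl N → ℝ}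
    (hκ : Continuous κ) (hs : HasCompactSupport κ) {δ : ℝ}
    (hpos : ∀ s ∈ Icc a b, 0 < Real.exp (-s) - δ) (j : ℝ) (n : ℕ) :
    BddMeas N a b (moll δ j n κ u) := by
  obtain ⟨B, _, hB⟩ := exists_eLpNorm_le hu.cont a b
  exact _root_.bddMeas_moll (hu.srcField a b) hB hκ hs hpos j n

lemma integrable_moll {r α : ℝ} (hα : 0 ≤ α) {u : ℝ → Eucl N → ℝ} (hu : SrcField N r a b u)
    {κ : Eucl N → ℝ} (hκ : Continuous κ) (hs : HasCompactSupport κ) {δ : ℝ}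
    (hpos : ∀ s ∈ Icc a b, 0 < Real.exp (-s) - δ) (j : ℝ) (n : ℕ) :
    Integrable (Function.uncurry (moll δ j n κ u))
      ((volume.restrict (Icc a b)).prod (ballMeas N α)) := by
  have := isFiniteMeasure_ballMeas (N := N) hα
  obtain ⟨C, hC0, hC⟩ := abs_moll_le hu hκ hs hpos j n
  have h1 : Integrable (fun q : ℝ × Eucl N => C * (eLpNorm (u q.1) 2 volume).toReal)
      ((volume.restrict (Icc a b)).prod (ballMeas N α)) :=
    ((hu.integrable_norm.comp_fst (ballMeas N α)).const_mul C)
  refine h1.mono' (measurable_moll hu.meas hκ δ j n).aestronglyMeasurable ?_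
  have h2 : ∀ᵐ q ∂((volume.restrict (Icc a b)).prod (ballMeas N α)), q.1 ∈ Icc a b :=
    (Measure.quasiMeasurePreserving_fst (μ := volume.restrict (Icc a b))
      (ν := ballMeas N α)).ae (ae_restrict_mem measurableSet_Icc)
  filter_upwards [h2] with q hq using hC q.1 hq q.2

/-- The integrand of the energy dissipation rate. -/
noncomputable def dissDensity (k p γ c₀ C₀ c : ℝ) (Γ Γ' : ℝ → ℝ) (w v : ℝ) (g : Fin N → ℝ)
    (S₁ S₂ : ℝ) (y : Eucl N) : ℝ :=
  S₁ * v - c ^ γ * (w * S₁) - c₀ * c ^ γ * (v ^ 2 + (1 - ‖y‖ ^ 2) * (∑ i, g i ^ 2) + w ^ 2)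
    + C₀ * ((1 - ‖y‖ ^ 2) * S₂ ^ 2) + potRate k p γ c Γ Γ' w v

/-- The exponential weight of the energy times the Jacobian of the change of time. -/
noncomputable def timeWeight (p γ δ s : ℝ) : ℝ :=
  (1 - δ * Real.exp s)⁻¹ * Real.exp ((p + 3) / (2 * γ) * (Real.exp (-s) - δ) ^ γ)

lemma continuousOn_rpow_exp {δ : ℝ} (hpos : ∀ s ∈ Icc a b, 0 < Real.exp (-s) - δ) (j : ℝ) :
    ContinuousOn (fun s => (Real.exp (-s) - δ) ^ j) (Icc a b) := fun s hs =>
  (hasDerivAt_rpow_exp j (hpos s hs)).continuousAt.continuousWithinAt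

lemma continuousOn_timeWeight {p γ δ : ℝ} (hpos : ∀ s ∈ Icc a b, 0 < Real.exp (-s) - δ) :
    ContinuousOn (timeWeight p γ δ) (Icc a b) := by
  refine ContinuousOn.mul (fun s hs => ?_)
    ((continuousOn_const.mul (continuousOn_rpow_exp hpos γ)).rexp)
  have hc : ContinuousAt (fun s => 1 - δ * Real.exp s) s := by fun_prop
  exact (hc.inv₀ (one_sub_pos_of (hpos s hs)).ne').continuousWithinAt

lemma timeWeight_pos {p γ δ s : ℝ} (h : 0 < Real.exp (-s) - δ) : 0 < timeWeight p γ δ s :=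
  mul_pos (inv_pos.2 (one_sub_pos_of h)) (Real.exp_pos _)

lemma measurable_timeWeight (p γ δ : ℝ) : Measurable (timeWeight p γ δ) := by
  unfold timeWeight; fun_prop

lemma moll_add {r δ j : ℝ} {n : ℕ} {κ : Eucl N → ℝ} (hκ : Continuous κ) (hs : HasCompactSupport κ)
    {u u₁ : ℝ → Eucl N → ℝ} (hu : SrcField N r a b u) (hu₁ : SrcField N r a b u₁) (s : ℝ)
    (y : Eucl N) :
    moll δ j n κ (fun s z => u s z + u₁ s z) s y = moll δ j n κ u s y + moll δ j n κ u₁ s y := by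
  rw [moll, moll, moll, ← mul_add, kerT, kerT, kerT,
    ← integral_add (integrable_kerT (hu.integrable_slice s) hκ hs _ _ _)
      (integrable_kerT (hu₁.integrable_slice s) hκ hs _ _ _)]
  simp only [add_mul]

variable {k r : ℝ} {w A : ℝ → Eucl N → ℝ} {G : Fin N → ℝ → Eucl N → ℝ} {S₁ S₂ : ℝ → Eucl N → ℝ}

lemma BddMeas.potRate {W V : ℝ → Eucl N → ℝ} (hW : BddMeas N a b W) (hV : BddMeas N a b V)
    {p γ δ : ℝ} (hpos : ∀ s ∈ Icc a b, 0 < Real.exp (-s) - δ) {Γ Γ' : ℝ → ℝ} (hΓ : Continuous Γ)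
    (hΓ' : Continuous Γ') :
    BddMeas N a b fun s y => potRate k p γ (Real.exp (-s) - δ) Γ Γ' (W s y) (V s y) := by
  have ht : ∀ j : ℝ, BddMeas N a b fun s _ => (Real.exp (-s) - δ) ^ j := fun j =>
    BddMeas.of_time (by fun_prop) (continuousOn_rpow_exp hpos j)
  have hX := (ht (-k)).mul hW
  exact (ht _).mul (((((BddMeas.const _).mul (ht γ)).add (BddMeas.const _)).mul (hX.comp hΓ)).sub
    ((hX.comp hΓ').mul ((ht _).mul (hV.add ((BddMeas.const k).mul hW)))))

end BoundedMeasurable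

/-! ### The energy inequality for the smoothed solution. -/

section MollifiedEnergy

variable {N : ℕ}

/-- The static energy inequality holds with the constants `c₀, C₀` for all `η ∈ (0, η₀]`. -/
def StaticIneq (N : ℕ) (α k p γ c₀ C₀ η₀ : ℝ) : Prop :=
  ∀ η, 0 < η → η ≤ η₀ →
      ∀ (w v : Eucl N → ℝ) (g vg : Fin N → Eucl N → ℝ) (h : Fin N → Fin N → Eucl N → ℝ)
        (S₁ S₂ : Eucl N → ℝ), HasGrad w g → HasGrad v vg → (∀ i, HasGrad (g i) (h i)) →
        Continuous S₁ → Continuous S₂ →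
        ∫ y, rateDensity k p γ η (w y) (v y) (fun i => g i y) (fun i => vg i y)
            (fun i j => h i j y) (S₁ y + S₂ y) y ∂(ballMeas N α) ≤
          ∫ y, (S₁ y * v y - η * (w y * S₁ y)
            - c₀ * η * (v y ^ 2 + (1 - ‖y‖ ^ 2) * (∑ i, g i y ^ 2) + w y ^ 2)
            + C₀ * ((1 - ‖y‖ ^ 2) * S₂ y ^ 2)) ∂(ballMeas N α)

variable {k p γ α r a b c₀ C₀ η₀ δ ε : ℝ} {w A : ℝ → Eucl N → ℝ} {G : Fin N → ℝ → Eucl N → ℝ}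
  {S₁ S₂ : ℝ → Eucl N → ℝ}

/-- The energy rate of the smoothed unknown. -/
noncomputable def mollRate (k p γ δ : ℝ) (Γ Γ' : ℝ → ℝ) (κ : Eucl N → ℝ)
    (w A S : ℝ → Eucl N → ℝ) (s : ℝ) (y : Eucl N) : ℝ :=
  timeWeight p γ δ s *
        (rateDensity k p γ ((Real.exp (-s) - δ) ^ γ) (moll δ k N κ w s y) (mollV k δ κ w A s y)
          (fun i => mollG k δ κ w i s y) (fun i => mollVG k δ κ w A i s y)
          (fun i j => mollH k δ κ w i j s y) (moll δ (k + 1 + 1) N κ S s y) y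
        + potRate k p γ (Real.exp (-s) - δ) Γ Γ' (moll δ k N κ w s y) (mollV k δ κ w A s y))

/-- The energy density of the smoothed unknown. -/
noncomputable def mollEnergy (k p γ δ : ℝ) (Γ : ℝ → ℝ) (κ : Eucl N → ℝ)
    (w A : ℝ → Eucl N → ℝ) (s : ℝ) (y : Eucl N) : ℝ :=
  energyDensity k p γ (Real.exp (-s) - δ) Γ (moll δ k N κ w s y) (mollV k δ κ w A s y)
    (fun i => mollG k δ κ w i s y) y

/-- The dissipation of the smoothed unknown. -/
noncomputable def mollDiss (k p γ δ c₀ C₀ : ℝ) (Γ Γ' : ℝ → ℝ) (κ : Eucl N → ℝ)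
    (w A S₁ S₂ : ℝ → Eucl N → ℝ) (s : ℝ) (y : Eucl N) : ℝ :=
  dissDensity k p γ c₀ C₀ (Real.exp (-s) - δ) Γ Γ' (moll δ k N κ w s y) (mollV k δ κ w A s y)
    (fun i => mollG k δ κ w i s y) (moll δ (k + 1 + 1) N κ S₁ s y) (moll δ (k + 1 + 1) N κ S₂ s y) y

/-- Hypotheses on the kernels and on the range of times under which the smoothed unknown solves
the wave equation in the unit ball. -/
structure MollSetup (r a b δ ε : ℝ) (κ : Eucl N → ℝ) : Prop where
  geo : ∀ s ∈ Icc a b, 0 < Real.exp (-s) - δ ∧ Real.exp (-s) - δ + ε < Real.exp (-s) * r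
  smooth : ContDiff ℝ ∞ κ
  supp : ∀ x, ε < ‖x‖ → κ x = 0

namespace MollSetup

variable {κ : Eucl N → ℝ} {S : ℝ → Eucl N → ℝ}

lemma pos (hκ : MollSetup r a b δ ε κ) : ∀ s ∈ Icc a b, 0 < Real.exp (-s) - δ :=
  fun s hs => (hκ.geo s hs).1

lemma bddMeas_G (hκ : MollSetup r a b δ ε κ) (hw : ContField N r w) (i : Fin N) :
    BddMeas N a b (mollG k δ κ w i) :=
  hw.bddMeas_moll (hκ.smooth.dirD _).continuous ((hasCompactSupport_of_lt hκ.supp).dirD _) hκ.pos _ _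

lemma bddMeas_H (hκ : MollSetup r a b δ ε κ) (hw : ContField N r w) (i j : Fin N) :
    BddMeas N a b (mollH k δ κ w i j) :=
  hw.bddMeas_moll ((hκ.smooth.dirD _).dirD _).continuous
    (((hasCompactSupport_of_lt hκ.supp).dirD _).dirD _) hκ.pos _ _

lemma bddMeas_W (hκ : MollSetup r a b δ ε κ) (hw : ContField N r w) :
    BddMeas N a b (moll δ k N κ w) :=
  hw.bddMeas_moll hκ.smooth.continuous (hasCompactSupport_of_lt hκ.supp) hκ.pos _ _

lemma bddMeas_V (hκ : MollSetup r a b δ ε κ) (hw : ContField N r w) (hA : ContField N r A) :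
    BddMeas N a b (mollV k δ κ w A) :=
  ((hA.bddMeas_moll hκ.smooth.continuous (hasCompactSupport_of_lt hκ.supp) hκ.pos _ _).sub
    ((BddMeas.const k).mul (hκ.bddMeas_W hw))).sub
    (BddMeas.sum _ fun i => (BddMeas.of_space (by fun_prop)).mul (hκ.bddMeas_G hw i))

lemma bddMeas_VG (hκ : MollSetup r a b δ ε κ) (hw : ContField N r w) (hA : ContField N r A)
    (i : Fin N) : BddMeas N a b (mollVG k δ κ w A i) :=
  ((hA.bddMeas_moll (hκ.smooth.dirD _).continuous ((hasCompactSupport_of_lt hκ.supp).dirD _)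
    hκ.pos _ _).sub ((BddMeas.const (k + 1)).mul (hκ.bddMeas_G hw i))).sub
    (BddMeas.sum _ fun j => (BddMeas.of_space (by fun_prop)).mul (hκ.bddMeas_H hw j i))

lemma bddMeas_rpow (hκ : MollSetup r a b δ ε κ) (j : ℝ) :
    BddMeas N a b fun s _ => (Real.exp (-s) - δ) ^ j :=
  BddMeas.of_time (by fun_prop) (continuousOn_rpow_exp hκ.pos j)

lemma bddMeas_timeWeight (hκ : MollSetup r a b δ ε κ) :
    BddMeas N a b fun s _ => timeWeight p γ δ s :=
  BddMeas.of_time (measurable_timeWeight _ _ _) (continuousOn_timeWeight hκ.pos)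

lemma bddMeas_energy (hκ : MollSetup r a b δ ε κ) (hw : ContField N r w) (hA : ContField N r A)
    {Γ : ℝ → ℝ} (hΓ : Continuous Γ) : BddMeas N a b (mollEnergy k p γ δ Γ κ w A) := by
  have hW := hκ.bddMeas_W (k := k) hw
  have hV := hκ.bddMeas_V (k := k) hw hA
  have hG := hκ.bddMeas_G (k := k) hw
  have hD := BddMeas.sum Finset.univ fun i =>
    (BddMeas.of_space (a := a) (b := b) (by fun_prop : Continuous fun y : Eucl N => y i)).mul (hG i)
  unfold mollEnergy energyDensity linDensity
  exact (((BddMeas.const _).mul (hκ.bddMeas_rpow γ)).comp Real.continuous_exp).mul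
    ((((((BddMeas.const _).mul hV.sq).add ((BddMeas.const _).mul
      (BddMeas.sum _ fun i => (hG i).sq))).sub ((BddMeas.const _).mul hD.sq)).add
      ((BddMeas.const _).mul hW.sq)).sub ((hκ.bddMeas_rpow γ).mul (hW.mul hV)) |>.sub
      ((hκ.bddMeas_rpow _).mul (((hκ.bddMeas_rpow _).mul hW).comp hΓ)))

lemma integrable_rate (hκ : MollSetup r a b δ ε κ) (hα : 0 ≤ α) (hw : ContField N r w)
    (hA : ContField N r A) (hS : SrcField N r a b S) {Γ Γ' : ℝ → ℝ} (hΓ : Continuous Γ)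
    (hΓ' : Continuous Γ') :
    Integrable (Function.uncurry (mollRate k p γ δ Γ Γ' κ w A S))
      ((volume.restrict (Icc a b)).prod (ballMeas N α)) := by
  have hW := hκ.bddMeas_W (k := k) hw
  have hV := hκ.bddMeas_V (k := k) hw hA
  have hG := hκ.bddMeas_G (k := k) hw
  have hH := hκ.bddMeas_H (k := k) hw
  have hVG := hκ.bddMeas_VG (k := k) hw hA
  have hy : ∀ i, BddMeas N a b fun _ y => y i := fun i => BddMeas.of_space (by fun_prop)
  have hS' := integrable_moll hα hS hκ.smooth.continuous (hasCompactSupport_of_lt hκ.supp) hκ.pos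
    (k + 1 + 1) N
  have hSm := measurable_moll hS.meas hκ.smooth.continuous δ (k + 1 + 1) N
  have hD := BddMeas.sum Finset.univ fun i => (hy i).mul (hG i)
  have hDV := BddMeas.sum Finset.univ fun i => (hy i).mul (hVG i)
  have hη := hκ.bddMeas_rpow γ
  have hOp : BddMeas N a b fun s y => waveOp k (moll δ k N κ w s y) (mollV k δ κ w A s y)
      (fun i => mollG k δ κ w i s y) (fun i => mollVG k δ κ w A i s y)
      (fun i j => mollH k δ κ w i j s y) 0 y :=
    (((((((BddMeas.sum _ fun i => hH i i).sub (BddMeas.sum _ fun j => (hy j).mul ((hG j).add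
      (BddMeas.sum _ fun i => (hy i).mul (hH i j))))).sub ((BddMeas.const _).mul hD)).sub
      ((BddMeas.const _).mul hV)).sub ((BddMeas.const _).mul hDV)).sub
      ((BddMeas.const (k * (k + 1))).mul hW)).add (BddMeas.const 0))
  have hlin : BddMeas N a b fun s y => linDensity (k * (k + 1)) (moll δ k N κ w s y)
      (mollV k δ κ w A s y) (fun i => mollG k δ κ w i s y) y :=
    ((((BddMeas.const _).mul hV.sq).add ((BddMeas.const _).mul
      (BddMeas.sum _ fun i => (hG i).sq))).sub ((BddMeas.const _).mul hD.sq)).add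
      ((BddMeas.const _).mul hW.sq)
  have hpot := hW.potRate (p := p) (γ := γ) (k := k) hV hκ.pos hΓ hΓ'
  have hT := hκ.bddMeas_timeWeight (p := p) (γ := γ)
  -- The rate is affine in the source, which is only integrable in time. The source-free part is
  -- bounded, and the remainder is the bounded factor `V - η W` times the smoothed source.
  have hR : BddMeas N a b fun s y => timeWeight p γ δ s *
        (rateDensity k p γ ((Real.exp (-s) - δ) ^ γ) (moll δ k N κ w s y) (mollV k δ κ w A s y)
          (fun i => mollG k δ κ w i s y) (fun i => mollVG k δ κ w A i s y)
          (fun i j => mollH k δ κ w i j s y) 0 y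
        + potRate k p γ (Real.exp (-s) - δ) Γ Γ' (moll δ k N κ w s y) (mollV k δ κ w A s y)) :=
    hT.mul ((((((((((hV.mul hOp).add (BddMeas.sum _ fun i => (hG i).mul (hVG i))).sub
      (hD.mul hDV)).add (((BddMeas.const _).mul hW).mul hV)).add
      ((((BddMeas.const γ).mul hη).mul hW).mul hV)).sub (hη.mul hV.sq)).sub
      ((hη.mul hW).mul hOp)).sub (((BddMeas.const _).mul hη).mul (hlin.sub
      ((hη.mul hW).mul hV))))).add hpot)
  have hQ := (hT.mul (hV.sub (hη.mul hW))).mul_integrable hS' hSm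
  refine ((hR.integrable hα).add hQ).congr (.of_forall fun q => ?_)
  simp only [Function.uncurry, mollRate, rateDensity, waveOp, Pi.add_apply]
  ring

lemma integrable_diss (hκ : MollSetup r a b δ ε κ) (hα : 0 ≤ α) (hw : ContField N r w)
    (hA : ContField N r A) (hS₁ : SrcField N r a b S₁) (hS₂ : SrcField N r a b S₂) {B : ℝ}
    (hB : ∀ s ∈ Icc a b, (eLpNorm (S₂ s) 2 volume).toReal ≤ B) {Γ Γ' : ℝ → ℝ} (hΓ : Continuous Γ)
    (hΓ' : Continuous Γ') :
    Integrable (Function.uncurry fun s y => timeWeight p γ δ s *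
      mollDiss k p γ δ c₀ C₀ Γ Γ' κ w A S₁ S₂ s y)
      ((volume.restrict (Icc a b)).prod (ballMeas N α)) := by
  have hW := hκ.bddMeas_W (k := k) hw
  have hV := hκ.bddMeas_V (k := k) hw hA
  have hG := hκ.bddMeas_G (k := k) hw
  have hcs := hasCompactSupport_of_lt hκ.supp
  have hS' := integrable_moll hα hS₁ hκ.smooth.continuous hcs hκ.pos (k + 1 + 1) N
  have hSm := measurable_moll hS₁.meas hκ.smooth.continuous δ (k + 1 + 1) N
  have hS₂' := bddMeas_moll hS₂ hB hκ.smooth.continuous hcs hκ.pos (k + 1 + 1) N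
  have hη := hκ.bddMeas_rpow γ
  have hpot := hW.potRate (p := p) (γ := γ) (k := k) hV hκ.pos hΓ hΓ'
  have hT := hκ.bddMeas_timeWeight (p := p) (γ := γ)
  have hy : BddMeas N a b fun _ y => 1 - ‖y‖ ^ 2 := BddMeas.of_space (by fun_prop)
  have hR := hT.mul (((((BddMeas.const (N := N) (a := a) (b := b) c₀).mul hη).mul ((hV.sq.add (hy.mul
    (BddMeas.sum Finset.univ fun i => (hG i).sq))).add hW.sq)).neg.add ((BddMeas.const C₀).mul
      (hy.mul hS₂'.sq))).add hpot)
  have hQ := (hT.mul (hV.sub (hη.mul hW))).mul_integrable hS' hSm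
  refine ((hR.integrable hα).add hQ).congr (.of_forall fun q => ?_)
  simp only [Function.uncurry, mollDiss, dissDensity, Pi.add_apply]
  ring

end MollSetup

lemma integral_prod_ballMeas {F : ℝ → Eucl N → ℝ} (hab : a ≤ b) (hα : 0 ≤ α)
    (hF : Integrable (Function.uncurry F) ((volume.restrict (Icc a b)).prod (ballMeas N α))) :
    ∫ y, (∫ s in a..b, F s y) ∂(ballMeas N α) = ∫ s in a..b, ∫ y, F s y ∂(ballMeas N α) := by
  have := isFiniteMeasure_ballMeas (N := N) hα
  simp only [intervalIntegral.integral_of_le hab, ← integral_Icc_eq_integral_Ioc]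
  exact integral_integral_swap (f := fun y s => F s y) hF.swap

lemma intervalIntegrable_integral {F : ℝ → Eucl N → ℝ} (hab : a ≤ b) (hα : 0 ≤ α)
    (hF : Integrable (Function.uncurry F) ((volume.restrict (Icc a b)).prod (ballMeas N α))) :
    IntervalIntegrable (fun s => ∫ y, F s y ∂(ballMeas N α)) volume a b := by
  have := isFiniteMeasure_ballMeas (N := N) hα
  rw [intervalIntegrable_iff_integrableOn_Icc_of_le hab]
  exact hF.integral_prod_left

/-- For each fixed `y` the density is absolutely continuous in time. Fubini turns this into a
formula for the energy, and the static inequality applies to every time slice. The rate of the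
potential energy is carried along unchanged: the smoothed source is not a function of the smoothed
unknown, so nothing can cancel at this stage. -/
theorem WaveSystem.mollified_energy_le (h : WaveSystem N k r a b w A G fun s z => S₁ s z + S₂ s z)
    (hα : 0 < α) (hγ : 0 < γ) (hst : StaticIneq N α k p γ c₀ C₀ η₀)
    (hS₁ : SrcField N r a b S₁) (hS₂ : SrcField N r a b S₂) {B : ℝ}
    (hB : ∀ s ∈ Icc a b, (eLpNorm (S₂ s) 2 volume).toReal ≤ B) {κ : Eucl N → ℝ}
    (hκ : MollSetup r a b δ ε κ) (hη : ∀ s ∈ Icc a b, (Real.exp (-s) - δ) ^ γ ≤ η₀) {Γ Γ' : ℝ → ℝ}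
    (hΓ : ∀ x, HasDerivAt Γ (Γ' x) x) (hΓ' : Continuous Γ') {K : ℝ} (hK : ∀ x, |Γ' x| ≤ K) :
    (∫ y, mollEnergy k p γ δ Γ κ w A b y ∂(ballMeas N α))
        - ∫ y, mollEnergy k p γ δ Γ κ w A a y ∂(ballMeas N α) ≤
      ∫ s in a..b, timeWeight p γ δ s *
        ∫ y, mollDiss k p γ δ c₀ C₀ Γ Γ' κ w A S₁ S₂ s y ∂(ballMeas N α) := by
  have hfin := isFiniteMeasure_ballMeas (N := N) hα.le
  have hΓc : Continuous Γ := continuous_iff_continuousAt.2 fun x => (hΓ x).continuousAt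
  have hcs := hasCompactSupport_of_lt hκ.supp
  have hE := hκ.bddMeas_energy (k := k) (p := p) (γ := γ) h.fw h.fA hΓc
  have hEi : ∀ s ∈ Icc a b, Integrable (mollEnergy k p γ δ Γ κ w A s) (ballMeas N α) := by
    intro s hs
    obtain ⟨C, hC⟩ := hE.bdd
    refine Integrable.of_bound (hE.meas.comp (measurable_const.prodMk measurable_id)).aestronglyMeasurable
      C ?_
    filter_upwards [ae_ballMeas_mem α] with y hy using hC s hs y hy
  have hRi := hκ.integrable_rate (k := k) (p := p) (γ := γ) hα.le h.fw h.fA h.fS hΓc hΓ'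
  have hDi := hκ.integrable_diss (k := k) (p := p) (γ := γ) (c₀ := c₀) (C₀ := C₀) hα.le h.fw h.fA
    hS₁ hS₂ hB hΓc hΓ'
  have hprim : ∀ y ∈ unitBall N, mollEnergy k p γ δ Γ κ w A b y - mollEnergy k p γ δ Γ κ w A a y =
      ∫ s in a..b, mollRate k p γ δ Γ Γ' κ w A (fun s z => S₁ s z + S₂ s z) s y := by
    intro y hy
    have hy' := (mem_unitBall.1 hy).le
    have := isPrim_energyDensity (p := p) hγ h.hab hκ.pos
      (h.isPrim_mollW hκ.geo hκ.smooth hκ.supp hy') (h.isPrim_mollV hκ.geo hκ.smooth hκ.supp hy')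
      (fun i => h.isPrim_mollG hκ.geo hκ.smooth hκ.supp hy' i) hΓ hK
    refine this.integral_eq.symm.trans ?_
    congr 1; ext s
    rw [mollRate, timeWeight]; ring
  rw [← integral_sub (hEi b ⟨h.hab, le_rfl⟩) (hEi a ⟨le_rfl, h.hab⟩),
    integral_congr_ae ((ae_ballMeas_mem α).mono hprim), integral_prod_ballMeas h.hab hα.le hRi]
  have hDi' := intervalIntegrable_integral h.hab hα.le hDi
  simp only [integral_const_mul] at hDi'
  refine intervalIntegral.integral_mono_on h.hab (intervalIntegrable_integral h.hab hα.le hRi)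
    hDi' fun s hs => ?_
  have hpos := hκ.pos s hs
  have hw := (h.fw.srcField a b).integrable_slice s
  have hA := (h.fA.srcField a b).integrable_slice s
  have hs₁ := kerT_continuous (hS₁.integrable_slice s) hκ.smooth hcs (Real.exp (-s) - δ) (Real.exp (-s))
  have hs₂ := kerT_continuous (hS₂.integrable_slice s) hκ.smooth hcs (Real.exp (-s) - δ) (Real.exp (-s))
  have hW := moll_hasGrad (j := k) N hw hκ.smooth hcs hpos
  have hV := mollV_hasGrad (k := k) hw hA hκ.smooth hcs hpos
  have hG : ∀ i, HasGrad (mollG k δ κ w i s) fun j => mollH k δ κ w i j s := fun i =>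
    moll_hasGrad (N + 1) hw (hκ.smooth.dirD _) (hcs.dirD _) hpos
  have key := hst _ (Real.rpow_pos_of_pos hpos γ) (hη s hs) (moll δ k N κ w s) (mollV k δ κ w A s)
    (fun i => mollG k δ κ w i s) (fun i => mollVG k δ κ w A i s) (fun i j => mollH k δ κ w i j s)
    (moll δ (k + 1 + 1) N κ S₁ s) (moll δ (k + 1 + 1) N κ S₂ s)
    hW hV hG (by unfold moll; fun_prop) (by unfold moll; fun_prop)
  have hWc := hW.continuous
  have hVc := hV.continuous
  have hGc := fun i => (hG i).continuous
  have hVGc := hV.cont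
  have hHc := fun i => (hG i).cont
  have hpc : Continuous fun y => potRate k p γ (Real.exp (-s) - δ) Γ Γ' (moll δ k N κ w s y)
      (mollV k δ κ w A s y) := by
    unfold potRate; fun_prop
  have hSc₁ : Continuous (moll δ (k + 1 + 1) N κ S₁ s) := by unfold moll; fun_prop
  have hSc₂ : Continuous (moll δ (k + 1 + 1) N κ S₂ s) := by unfold moll; fun_prop
  simp only [mollRate, integral_const_mul, mollDiss, dissDensity,
    moll_add hκ.smooth.continuous hcs hS₁ hS₂]
  refine mul_le_mul_of_nonneg_left ?_ (timeWeight_pos hpos).le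
  rw [integral_add (integrable_ballMeas hα.le ?_) (integrable_ballMeas hα.le hpc),
    integral_add (integrable_ballMeas hα.le ?_) (integrable_ballMeas hα.le hpc)]
  · exact add_le_add_left key _
  · fun_prop
  · unfold rateDensity waveOp linDensity
    fun_prop

end MollifiedEnergy

/-! ### Convergence of integrals and elementary norm estimates. -/

section IntTendsto

variable {X ι : Type*} [MeasurableSpace X] {μ : Measure X} {F F₁ H : ι → X → ℝ} {f f₁ h : X → ℝ}
  {l : Filter ι}

/-- Integrable functions whose integrals converge to the integral of the integrable limit. -/
def IntTendsto (μ : Measure X) (F : ι → X → ℝ) (f : X → ℝ) (l : Filter ι) : Prop :=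
  (∀ i, Integrable (F i) μ) ∧ Integrable f μ ∧ Tendsto (fun i => ∫ x, F i x ∂μ) l (𝓝 (∫ x, f x ∂μ))

namespace IntTendsto

lemma add (hF : IntTendsto μ F f l) (hF₁ : IntTendsto μ F₁ f₁ l) :
    IntTendsto μ (fun i x => F i x + F₁ i x) (fun x => f x + f₁ x) l := by
  refine ⟨fun i => (hF.1 i).add (hF₁.1 i), hF.2.1.add hF₁.2.1, ?_⟩
  rw [integral_add hF.2.1 hF₁.2.1]
  simp_rw [fun i => integral_add (hF.1 i) (hF₁.1 i)]
  exact hF.2.2.add hF₁.2.2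

lemma const_mul (hF : IntTendsto μ F f l) (c : ℝ) :
    IntTendsto μ (fun i x => c * F i x) (fun x => c * f x) l := by
  refine ⟨fun i => (hF.1 i).const_mul c, hF.2.1.const_mul c, ?_⟩
  simp only [integral_const_mul]
  exact hF.2.2.const_mul c

lemma sub (hF : IntTendsto μ F f l) (hF₁ : IntTendsto μ F₁ f₁ l) :
    IntTendsto μ (fun i x => F i x - F₁ i x) (fun x => f x - f₁ x) l := by
  simpa [sub_eq_add_neg] using hF.add (hF₁.const_mul (-1))

lemma zero : IntTendsto μ (fun (_ : ι) (_ : X) => (0 : ℝ)) (fun _ => 0) l :=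
  ⟨fun _ => integrable_zero _ _ _, integrable_zero _ _ _, by simpa using tendsto_const_nhds⟩

lemma sum {κ : Type*} (s : Finset κ) {F : κ → ι → X → ℝ} {f : κ → X → ℝ}
    (h : ∀ j, IntTendsto μ (F j) (f j) l) :
    IntTendsto μ (fun i x => ∑ j ∈ s, F j i x) (fun x => ∑ j ∈ s, f j x) l := by
  classical
  induction s using Finset.induction_on with
  | empty => simpa using zero
  | insert j s hj ih =>
    simp only [Finset.sum_insert hj]
    exact (h j).add ih

end IntTendsto

lemma L2Tendsto.mul_int (hF : L2Tendsto μ F f l) (hH : L2Tendsto μ H h l) :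
    IntTendsto μ (fun i x => F i x * H i x) (fun x => f x * h x) l :=
  ⟨fun i => L2Tendsto.integrable_mul (hF.1 i) (hH.1 i), L2Tendsto.integrable_mul hF.2.1 hH.2.1,
    hF.tendsto_integral_mul hH⟩

lemma L2Tendsto.int [IsFiniteMeasure μ] (hF : L2Tendsto μ F f l) : IntTendsto μ F f l :=
  ⟨fun i => (hF.1 i).integrable (by norm_num), hF.2.1.integrable (by norm_num), hF.tendsto_integral⟩

end IntTendsto

section Norms

variable {X : Type*} [MeasurableSpace X] {μ ν : Measure X} {f g : X → ℝ}

lemma toReal_eLpNorm_sub_le (hf : MemLp f 2 μ) (hg : MemLp g 2 μ) :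
    (eLpNorm (fun x => f x - g x) 2 μ).toReal ≤ (eLpNorm f 2 μ).toReal + (eLpNorm g 2 μ).toReal := by
  rw [← ENNReal.toReal_add hf.eLpNorm_ne_top hg.eLpNorm_ne_top]
  exact ENNReal.toReal_mono (ENNReal.add_ne_top.2 ⟨hf.eLpNorm_ne_top, hg.eLpNorm_ne_top⟩)
    (eLpNorm_sub_le hf.1 hg.1 (by norm_num))

lemma toReal_eLpNorm_const_mul (c : ℝ) :
    (eLpNorm (fun x => c * f x) 2 μ).toReal = |c| * (eLpNorm f 2 μ).toReal := by
  have : (fun x => c * f x) = c • f := rfl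
  rw [this, eLpNorm_const_smul, ENNReal.toReal_mul, toReal_enorm, Real.norm_eq_abs]

lemma toReal_eLpNorm_sum_le {ι : Type*} (t : Finset ι) {f : ι → X → ℝ} (hf : ∀ i, MemLp (f i) 2 μ) :
    (eLpNorm (fun x => ∑ i ∈ t, f i x) 2 μ).toReal ≤ ∑ i ∈ t, (eLpNorm (f i) 2 μ).toReal := by
  have e : (fun x => ∑ i ∈ t, f i x) = ∑ i ∈ t, f i := by ext x; simp
  rw [e, ← ENNReal.toReal_sum fun i _ => (hf i).eLpNorm_ne_top]
  exact ENNReal.toReal_mono (ENNReal.sum_ne_top.2 fun i _ => (hf i).eLpNorm_ne_top)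
    (eLpNorm_sum_le (fun i _ => (hf i).1) (by norm_num))

lemma toReal_eLpNorm_mono_measure (h : ν ≤ μ) (hf : MemLp f 2 μ) :
    (eLpNorm f 2 ν).toReal ≤ (eLpNorm f 2 μ).toReal :=
  ENNReal.toReal_mono hf.eLpNorm_ne_top (eLpNorm_mono_measure f h)

lemma toReal_eLpNorm_mono_ae (hg : MemLp g 2 μ) (h : ∀ᵐ x ∂μ, |f x| ≤ |g x|) :
    (eLpNorm f 2 μ).toReal ≤ (eLpNorm g 2 μ).toReal :=
  ENNReal.toReal_mono hg.eLpNorm_ne_top (eLpNorm_mono_ae h)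

end Norms

/-! ### Removing the smoothing: the energy inequality with a linear source. -/

section LinearEnergy

variable {N : ℕ}

/-- The rescaled function `λ^j u(s, λ y)`, with `λ = 1 - δ e^s`. -/
noncomputable def resc (δ j : ℝ) (u : ℝ → Eucl N → ℝ) (s : ℝ) (y : Eucl N) : ℝ :=
  (1 - δ * Real.exp s) ^ j * u s ((1 - δ * Real.exp s) • y)

/-- The time derivative of the rescaled unknown. -/
noncomputable def rescV (k δ : ℝ) (w A : ℝ → Eucl N → ℝ) (G : Fin N → ℝ → Eucl N → ℝ) (s : ℝ)
    (y : Eucl N) : ℝ :=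
  resc δ (k + 1) A s y - k * resc δ k w s y - ∑ i, y i * resc δ (k + 1) (G i) s y

lemma moll_tendsto {κ : ℕ → Eucl N → ℝ} {ε : ℕ → ℝ} (h : ∀ n, IsMollifier (κ n) (ε n))
    (hε : Tendsto ε atTop (𝓝 0)) {u : ℝ → Eucl N → ℝ} {s δ : ℝ} (hu : MemLp (u s) 2 volume)
    (hpos : 0 < Real.exp (-s) - δ) (j : ℝ) :
    L2Tendsto volume (fun n => moll δ j N (κ n) u s) (resc δ j u s) atTop := by
  have h1 := (L2Tendsto.kerT h hε hu hpos (Real.exp_pos (-s))).const_mul ((1 - δ * Real.exp s) ^ j)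
  rw [← one_sub_mul_exp] at h1
  simp only [← mul_assoc] at h1
  exact h1

lemma eLpNorm_moll_le {δ s : ℝ} (hpos : 0 < Real.exp (-s) - δ) (j : ℝ) {κ : Eucl N → ℝ} {ε : ℝ}
    (h : IsMollifier κ ε) {u : ℝ → Eucl N → ℝ} (hu : MemLp (u s) 2 volume) :
    (eLpNorm (moll δ j N κ u s) 2 volume).toReal ≤
      (1 - δ * Real.exp s) ^ j * √(((1 - δ * Real.exp s) ^ N)⁻¹) *
        (eLpNorm (u s) 2 volume).toReal := by
  have hl := one_sub_pos_of hpos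
  have h1 := eLpNorm_kerT_sq_le h hu hpos (Real.exp_pos (-s))
  rw [← one_sub_mul_exp] at h1
  set K : Eucl N → ℝ := fun y => Real.exp (-s) ^ N * kerT (u s) κ (Real.exp (-s) - δ) (Real.exp (-s)) y
    with hK
  have e : moll δ j N κ u s = (1 - δ * Real.exp s) ^ j • K := by
    ext y; simp [moll, hK, mul_assoc]
  rw [e, eLpNorm_const_smul, ENNReal.toReal_mul, toReal_enorm, Real.norm_of_nonneg (by positivity),
    mul_assoc]
  refine mul_le_mul_of_nonneg_left ?_ (by positivity)
  have h2 := ENNReal.toReal_mono (ENNReal.mul_ne_top ENNReal.ofReal_ne_top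
    (ENNReal.pow_ne_top hu.eLpNorm_ne_top)) h1
  rw [ENNReal.toReal_pow, ENNReal.toReal_mul, ENNReal.toReal_pow, ENNReal.toReal_ofReal (by positivity)]
    at h2
  refine abs_le_of_sq_le_sq' ?_ (by positivity) |>.2
  rw [mul_pow, Real.sq_sqrt (by positivity)]
  exact h2

/-- The constant depends on the time interval but not on the kernel, so it provides domination when
the smoothing is removed. -/
lemma exists_eLpNorm_moll_le {a b δ : ℝ} (hpos : ∀ s ∈ Icc a b, 0 < Real.exp (-s) - δ) (j : ℝ) :
    ∃ C, 0 ≤ C ∧ ∀ s ∈ Icc a b, ∀ (κ : Eucl N → ℝ) (ε : ℝ), IsMollifier κ ε →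
      ∀ u : ℝ → Eucl N → ℝ, MemLp (u s) 2 volume →
      (eLpNorm (moll δ j N κ u s) 2 volume).toReal ≤ C * (eLpNorm (u s) 2 volume).toReal := by
  have hc : ContinuousOn (fun s => (1 - δ * Real.exp s) ^ j * √(((1 - δ * Real.exp s) ^ N)⁻¹))
      (Icc a b) := by
    intro s hs
    have hl := (one_sub_pos_of (hpos s hs)).ne'
    have hc : ContinuousAt (fun s => 1 - δ * Real.exp s) s := by fun_prop
    exact ((hc.rpow_const (Or.inl hl)).mul
      ((hc.pow N).inv₀ (pow_ne_zero _ hl)).sqrt).continuousWithinAt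
  obtain ⟨C, hC⟩ := isCompact_Icc.exists_bound_of_continuousOn hc
  refine ⟨max C 0, le_max_right _ _, fun s hs κ ε h u hu => ?_⟩
  refine (eLpNorm_moll_le (hpos s hs) j h hu).trans ?_
  exact mul_le_mul_of_nonneg_right (((le_abs_self _).trans (hC s hs)).trans (le_max_left _ _))
    ENNReal.toReal_nonneg

variable {k p γ α r a b c₀ C₀ η₀ δ : ℝ} {w A : ℝ → Eucl N → ℝ} {G : Fin N → ℝ → Eucl N → ℝ}
  {S₁ S₂ : ℝ → Eucl N → ℝ}

/-- All terms but one are products of two `L²`-convergent factors with bounded coefficients. The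
potential is the exception, and for it the Lipschitz bound gives `L²` convergence on a finite
measure space. -/
lemma energyDensity_tendsto {c : ℝ} {μ : Measure (Eucl N)} [IsFiniteMeasure μ]
    (hμ : ∀ᵐ y ∂μ, y ∈ unitBall N) {l : Filter ℕ} {W V : ℕ → Eucl N → ℝ} {g : Fin N → ℕ → Eucl N → ℝ}
    {W₀ V₀ : Eucl N → ℝ} {g₀ : Fin N → Eucl N → ℝ} (hW : L2Tendsto μ W W₀ l) (hV : L2Tendsto μ V V₀ l)
    (hg : ∀ i, L2Tendsto μ (g i) (g₀ i) l) {Γ : ℝ → ℝ} {K : NNReal} (hΓ : LipschitzWith K Γ) :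
    IntTendsto μ (fun n y => energyDensity k p γ c Γ (W n y) (V n y) (fun i => g i n y) y)
      (fun y => energyDensity k p γ c Γ (W₀ y) (V₀ y) (fun i => g₀ i y) y) l := by
  have hD : L2Tendsto μ (fun n y => ∑ i, y i * g i n y) (fun y => ∑ i, y i * g₀ i y) l :=
    L2Tendsto.sum _ fun i _ => (hg i).mul_bdd (C := 1) (om := fun y => y i) (by fun_prop)
      (hμ.mono fun y hy => (PiLp.norm_apply_le y i).trans (mem_unitBall.1 hy).le)
  have hX := ((hW.const_mul (c ^ (-k))).lipschitz_comp hΓ).int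
  have := (((((((hV.mul_int hV).const_mul (1 / 2)).add ((IntTendsto.sum Finset.univ fun i =>
    (hg i).mul_int (hg i)).const_mul (1 / 2))).sub ((hD.mul_int hD).const_mul (1 / 2))).add
    ((hW.mul_int hW).const_mul (1 / 2 * (k * (k + 1))))).sub ((hW.mul_int hV).const_mul (c ^ γ))).sub
    (hX.const_mul (c ^ (2 * (k + 1))))).const_mul (Real.exp ((p + 3) / (2 * γ) * c ^ γ))
  simpa only [energyDensity, linDensity, pow_two, mul_assoc] using this

lemma dissDensity_tendsto {c : ℝ} {μ : Measure (Eucl N)} [IsFiniteMeasure μ]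
    (hμ : ∀ᵐ y ∂μ, y ∈ unitBall N) {l : Filter ℕ} {W V T₁ T₂ : ℕ → Eucl N → ℝ}
    {g : Fin N → ℕ → Eucl N → ℝ} {W₀ V₀ T₁₀ T₂₀ : Eucl N → ℝ} {g₀ : Fin N → Eucl N → ℝ}
    (hW : L2Tendsto μ W W₀ l) (hV : L2Tendsto μ V V₀ l) (hg : ∀ i, L2Tendsto μ (g i) (g₀ i) l)
    (hT₁ : L2Tendsto μ T₁ T₁₀ l) (hT₂ : L2Tendsto μ T₂ T₂₀ l) {Γ Γ' : ℝ → ℝ} {K K' : NNReal}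
    (hΓ : LipschitzWith K Γ) (hΓ' : LipschitzWith K' Γ') :
    IntTendsto μ (fun n y => dissDensity k p γ c₀ C₀ c Γ Γ' (W n y) (V n y) (fun i => g i n y)
        (T₁ n y) (T₂ n y) y)
      (fun y => dissDensity k p γ c₀ C₀ c Γ Γ' (W₀ y) (V₀ y) (fun i => g₀ i y) (T₁₀ y) (T₂₀ y) y) l := by
  have ht : ∀ {F : ℕ → Eucl N → ℝ} {f : Eucl N → ℝ}, L2Tendsto μ F f l →
      L2Tendsto μ (fun n y => (1 - ‖y‖ ^ 2) * F n y) (fun y => (1 - ‖y‖ ^ 2) * f y) l := fun hF =>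
    hF.mul_bdd (C := 1) (by fun_prop) (hμ.mono fun y hy => by
      have h1 := one_sub_pos hy
      rw [abs_of_pos h1]; linarith [sq_nonneg ‖y‖])
  have hX := hW.const_mul (c ^ (-k))
  have h1 := (hX.lipschitz_comp hΓ).int
  have h2 := (hX.lipschitz_comp hΓ').mul_int ((hV.add (hW.const_mul k)).const_mul (c ^ (-k)))
  have := ((((hT₁.mul_int hV).sub ((hW.mul_int hT₁).const_mul (c ^ γ))).sub
    ((((hV.mul_int hV).add (IntTendsto.sum Finset.univ fun i => (ht (hg i)).mul_int (hg i))).add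
      (hW.mul_int hW)).const_mul (c₀ * c ^ γ))).add (((ht hT₂).mul_int hT₂).const_mul C₀)).add
    (((h1.const_mul ((p + 3) / 2 * c ^ γ + 2 * (k + 1))).sub h2).const_mul (c ^ (2 * (k + 1))))
  simpa only [dissDensity, potRate, pow_two, mul_assoc, Finset.mul_sum] using this

lemma abs_potRate_le {c P K : ℝ} {Γ Γ' : ℝ → ℝ} (hc : 0 ≤ c) (hP : 0 ≤ P) (hK0 : 0 ≤ K)
    (h1 : c ^ (2 * (k + 1)) ≤ P) (h2 : c ^ (-k) ≤ P)
    (h3 : c ^ γ ≤ P) (hΓ : ∀ x, |Γ x| ≤ K * (1 + |x|)) (hΓ' : ∀ x, |Γ' x| ≤ K) (w v : ℝ) :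
    |potRate k p γ c Γ Γ' w v| ≤ P * ((|(p + 3) / 2| * P + |2 * (k + 1)|) * (K * (1 + P))
      + K * P * (1 + |k|)) * (1 + w ^ 2 + v ^ 2) := by
  have hw1 : |w| ≤ 1 + w ^ 2 := by nlinarith [sq_abs w, sq_nonneg (|w| - 1), abs_nonneg w]
  have hv1 : |v| ≤ 1 + v ^ 2 := by nlinarith [sq_abs v, sq_nonneg (|v| - 1), abs_nonneg v]
  have a1 := Real.rpow_nonneg hc (2 * (k + 1))
  have a2 := Real.rpow_nonneg hc (-k)
  have a3 := Real.rpow_nonneg hc γ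
  set Z := 1 + w ^ 2 + v ^ 2 with hZ
  have hZ1 : 1 ≤ Z := by rw [hZ]; nlinarith [sq_nonneg w, sq_nonneg v]
  have hwZ : |w| ≤ Z := by rw [hZ]; nlinarith [sq_nonneg v]
  have b1 : |Γ (c ^ (-k) * w)| ≤ K * (1 + P) * Z := by
    refine (hΓ _).trans ?_
    rw [mul_assoc]
    refine mul_le_mul_of_nonneg_left ?_ hK0
    rw [abs_mul, abs_of_nonneg a2]
    have : c ^ (-k) * |w| ≤ P * Z := mul_le_mul h2 hwZ (abs_nonneg _) hP
    linarith
  have b2 : |c ^ (-k) * (v + k * w)| ≤ P * ((1 + |k|) * Z) := by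
    rw [abs_mul, abs_of_nonneg a2]
    refine mul_le_mul h2 ?_ (abs_nonneg _) hP
    refine (abs_add_le _ _).trans ?_
    rw [abs_mul]
    have h4 : |v| ≤ Z := by rw [hZ]; nlinarith [sq_nonneg w]
    have := mul_le_mul_of_nonneg_left hwZ (abs_nonneg k)
    linarith
  have b3 : |Γ' (c ^ (-k) * w) * (c ^ (-k) * (v + k * w))| ≤ K * P * (1 + |k|) * Z := by
    rw [abs_mul]
    refine (mul_le_mul (hΓ' _) b2 (abs_nonneg _) hK0).trans_eq (by ring)
  have b4 : |((p + 3) / 2 * c ^ γ + 2 * (k + 1))| ≤ |(p + 3) / 2| * P + |2 * (k + 1)| := by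
    refine (abs_add_le _ _).trans (add_le_add_left ?_ _)
    rw [abs_mul, abs_of_nonneg a3]
    exact mul_le_mul_of_nonneg_left h3 (abs_nonneg _)
  rw [potRate, abs_mul, abs_of_nonneg a1, mul_assoc]
  refine mul_le_mul h1 ?_ (abs_nonneg _) hP
  refine (abs_sub _ _).trans ?_
  rw [abs_mul, add_mul, mul_assoc _ _ Z]
  exact add_le_add (mul_le_mul b4 b1 (abs_nonneg _) (by positivity)) b3

/-- The source `T₁` enters at most linearly, paired with `v` or `w`. This matters because `S₁` is
only integrable in time with values in `L²`, so that its square need not be integrable. -/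
lemma exists_abs_dissDensity_le {P K : ℝ} (hP : 0 ≤ P) (hK0 : 0 ≤ K) {Γ Γ' : ℝ → ℝ}
    (hΓ : ∀ x, |Γ x| ≤ K * (1 + |x|)) (hΓ' : ∀ x, |Γ' x| ≤ K) : ∃ Q, 0 ≤ Q ∧
    ∀ (c w v : ℝ) (g : Fin N → ℝ) (T₁ T₂ : ℝ) (y : Eucl N), 0 ≤ c → c ^ (2 * (k + 1)) ≤ P →
      c ^ (-k) ≤ P → c ^ γ ≤ P → y ∈ unitBall N →
    |dissDensity k p γ c₀ C₀ c Γ Γ' w v g T₁ T₂ y| ≤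
      |T₁ * v| + P * |T₁ * w| + Q * (1 + w ^ 2 + v ^ 2 + (∑ i, g i ^ 2) + T₂ ^ 2) := by
  set R := P * ((|(p + 3) / 2| * P + |2 * (k + 1)|) * (K * (1 + P)) + K * P * (1 + |k|)) with hR
  have hR0 : 0 ≤ R := by positivity
  refine ⟨|c₀| * P + |C₀| + R, by positivity, fun c w v g T₁ T₂ y hc h1 h2 h3 hy => ?_⟩
  have hpot := abs_potRate_le (p := p) hc hP hK0 h1 h2 h3 hΓ hΓ' w v
  rw [← hR] at hpot
  have a3 := Real.rpow_nonneg hc γ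
  have ht := one_sub_pos hy
  have ht1 : 1 - ‖y‖ ^ 2 ≤ 1 := by linarith [sq_nonneg ‖y‖]
  have hG : 0 ≤ ∑ i, g i ^ 2 := Finset.sum_nonneg fun i _ => sq_nonneg _
  have b1 : |c ^ γ * (w * T₁)| ≤ P * |T₁ * w| := by
    rw [abs_mul, abs_of_nonneg a3, mul_comm w]
    exact mul_le_mul_of_nonneg_right h3 (abs_nonneg _)
  have b2 : |c₀ * c ^ γ * (v ^ 2 + (1 - ‖y‖ ^ 2) * (∑ i, g i ^ 2) + w ^ 2)| ≤
      |c₀| * P * (v ^ 2 + (∑ i, g i ^ 2) + w ^ 2) := by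
    have h4 : 0 ≤ v ^ 2 + (1 - ‖y‖ ^ 2) * (∑ i, g i ^ 2) + w ^ 2 :=
      add_nonneg (add_nonneg (sq_nonneg _) (mul_nonneg ht.le hG)) (sq_nonneg _)
    rw [abs_mul, abs_mul, abs_of_nonneg a3, abs_of_nonneg h4]
    refine mul_le_mul (mul_le_mul_of_nonneg_left h3 (abs_nonneg _)) ?_ h4 (by positivity)
    have := mul_le_mul_of_nonneg_right ht1 hG
    linarith
  have b3 : |C₀ * ((1 - ‖y‖ ^ 2) * T₂ ^ 2)| ≤ |C₀| * T₂ ^ 2 := by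
    rw [abs_mul, abs_of_nonneg (mul_nonneg ht.le (sq_nonneg T₂))]
    refine mul_le_mul_of_nonneg_left ?_ (abs_nonneg _)
    have := mul_le_mul_of_nonneg_right ht1 (sq_nonneg T₂)
    linarith
  have tri : ∀ x₁ x₂ x₃ x₄ x₅ : ℝ, |x₁ - x₂ - x₃ + x₄ + x₅| ≤ |x₁| + |x₂| + |x₃| + |x₄| + |x₅| := by
    intro x₁ x₂ x₃ x₄ x₅
    refine (abs_add_le _ _).trans (add_le_add_left ((abs_add_le _ _).trans (add_le_add_left
      ((abs_sub _ _).trans (add_le_add_left (abs_sub _ _) _)) _)) _)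
  rw [dissDensity]
  refine (tri _ _ _ _ _).trans ?_
  have hc0 := mul_nonneg (abs_nonneg c₀) hP
  have hC0 := abs_nonneg C₀
  have e1 := sq_nonneg w
  have e2 := sq_nonneg v
  have e3 := sq_nonneg T₂
  have p1 := mul_nonneg hc0 e3
  have p2 := mul_nonneg hC0 (by positivity : 0 ≤ 1 + w ^ 2 + v ^ 2 + ∑ i, g i ^ 2)
  have p3 := mul_nonneg hR0 (add_nonneg hG e3)
  nlinarith

lemma abs_integral_dissDensity_le {μ : Measure (Eucl N)} [IsFiniteMeasure μ] {P Q c : ℝ}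
    (hμ : ∀ᵐ y ∂μ, y ∈ unitBall N) {Γ Γ' : ℝ → ℝ} {w v T₁ T₂ : Eucl N → ℝ}
    {g : Fin N → Eucl N → ℝ}
    (hQ : ∀ y ∈ unitBall N,
      |dissDensity k p γ c₀ C₀ c Γ Γ' (w y) (v y) (fun i => g i y) (T₁ y) (T₂ y) y| ≤
      |T₁ y * v y| + P * |T₁ y * w y| +
        Q * (1 + w y ^ 2 + v y ^ 2 + (∑ i, g i y ^ 2) + T₂ y ^ 2))
    (hw : MemLp w 2 μ) (hv : MemLp v 2 μ) (hg : ∀ i, MemLp (g i) 2 μ) (hT₁ : MemLp T₁ 2 μ)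
    (hT₂ : MemLp T₂ 2 μ) (hP : 0 ≤ P) :
    |∫ y, dissDensity k p γ c₀ C₀ c Γ Γ' (w y) (v y) (fun i => g i y) (T₁ y) (T₂ y) y ∂μ| ≤
      (eLpNorm T₁ 2 μ).toReal * (eLpNorm v 2 μ).toReal
        + P * ((eLpNorm T₁ 2 μ).toReal * (eLpNorm w 2 μ).toReal)
        + Q * (μ.real univ + (eLpNorm w 2 μ).toReal ^ 2 + (eLpNorm v 2 μ).toReal ^ 2
          + (∑ i, (eLpNorm (g i) 2 μ).toReal ^ 2) + (eLpNorm T₂ 2 μ).toReal ^ 2) := by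
  have i1 : Integrable (fun y => |T₁ y * v y|) μ := (L2Tendsto.integrable_mul hT₁ hv).abs
  have i2 : Integrable (fun y => |T₁ y * w y|) μ := (L2Tendsto.integrable_mul hT₁ hw).abs
  have isq : ∀ {f : Eucl N → ℝ}, MemLp f 2 μ → Integrable (fun y => f y ^ 2) μ := fun hf =>
    hf.integrable_sq
  have i3 : Integrable (fun y => ∑ i, g i y ^ 2) μ := integrable_finsetSum _ fun i _ => isq (hg i)
  have i4 : Integrable (fun y => 1 + w y ^ 2) μ := (integrable_const _).add (isq hw)
  have i5 : Integrable (fun y => 1 + w y ^ 2 + v y ^ 2) μ := i4.add (isq hv)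
  have i6 : Integrable (fun y => 1 + w y ^ 2 + v y ^ 2 + ∑ i, g i y ^ 2) μ := i5.add i3
  have i7 : Integrable (fun y => 1 + w y ^ 2 + v y ^ 2 + (∑ i, g i y ^ 2) + T₂ y ^ 2) μ :=
    i6.add (isq hT₂)
  have i8 : Integrable (fun y => |T₁ y * v y| + P * |T₁ y * w y|) μ := i1.add (i2.const_mul P)
  have key := norm_integral_le_of_norm_le (f := fun y => dissDensity k p γ c₀ C₀ c Γ Γ' (w y) (v y) (fun i => g i y) (T₁ y) (T₂ y) y)
    (i8.add (i7.const_mul Q)) (hμ.mono fun y hy => hQ y hy)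
  refine key.trans ?_
  rw [integral_add' i8 (i7.const_mul Q), integral_add i1 (i2.const_mul P), integral_const_mul,
    integral_const_mul, integral_add i6 (isq hT₂), integral_add i5 i3, integral_add i4 (isq hv),
    integral_add (integrable_const _) (isq hw), integral_finsetSum _ fun i _ => isq (hg i),
    ← sq_eLpNorm_toReal hw, ← sq_eLpNorm_toReal hv, ← sq_eLpNorm_toReal hT₂]
  simp only [← sq_eLpNorm_toReal (hg _), integral_const, smul_eq_mul, mul_one]
  have a1 := integral_abs_mul_le_sqrt hT₁ hv
  have a2 := mul_le_mul_of_nonneg_left (integral_abs_mul_le_sqrt hT₁ hw) hP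
  linarith

/-- A differentiated mollifier is not a mollifier. Moving the derivative onto `w` shows that `mollG`
is a mollification of the weak gradient, and this is what converges. -/
lemma WaveSystem.mollG_eq {ε : ℝ} {S : ℝ → Eucl N → ℝ} (h : WaveSystem N k r a b w A G S)
    {κ : Eucl N → ℝ} (hκ : MollSetup r a b δ ε κ) {s : ℝ} (hs : s ∈ Icc a b) {y : Eucl N}
    (hy : ‖y‖ ≤ 1) (i : Fin N) : mollG k δ κ w i s y = moll δ (k + 1) N κ (G i) s y := by
  rw [mollG, moll, moll, ← h.kerT_dirD_eq hs (hκ.geo s hs) hκ.smooth hκ.supp hy i]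
  ring

/-- On a compact time interval the gap between `e^{-s} - δ` and `e^{-s} r` has a positive minimum,
and kernels of smaller radius fit for all these times. -/
lemma exists_mollSetup {a b : ℝ} (hab : a ≤ b)
    (hgeo : ∀ s ∈ Icc a b, 0 < Real.exp (-s) - δ ∧ Real.exp (-s) - δ < Real.exp (-s) * r) :
    ∃ (κ : ℕ → Eucl N → ℝ) (ε : ℕ → ℝ), (∀ n, IsMollifier (κ n) (ε n)) ∧
      Tendsto ε atTop (𝓝 0) ∧ ∀ n, MollSetup r a b δ (ε n) (κ n) := by
  obtain ⟨s₀, hs₀, hmin⟩ := isCompact_Icc.exists_isMinOn (nonempty_Icc.2 hab)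
    (f := fun s => Real.exp (-s) * r - (Real.exp (-s) - δ)) (by fun_prop)
  have hd : 0 < Real.exp (-s₀) * r - (Real.exp (-s₀) - δ) := sub_pos.2 (hgeo s₀ hs₀).2
  obtain ⟨n₀, hn₀⟩ := exists_nat_one_div_lt hd
  obtain ⟨κ, hκ, hm⟩ := exists_mollifier_seq N
  refine ⟨fun n => κ (n + n₀), fun n => 1 / ((n + n₀ : ℕ) + 1), fun n => hm _,
    (tendsto_one_div_add_atTop_nhds_zero_nat (𝕜 := ℝ)).comp (tendsto_add_atTop_nat n₀), fun n =>
    ⟨fun s hs => ⟨(hgeo s hs).1, ?_⟩, hκ _, fun x hx => (hm (n + n₀)).supp x hx.le⟩⟩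
  have h1 : Real.exp (-s₀) * r - (Real.exp (-s₀) - δ) ≤ Real.exp (-s) * r - (Real.exp (-s) - δ) :=
    hmin hs
  have h2 : (1 : ℝ) / ((n + n₀ : ℕ) + 1) ≤ 1 / (n₀ + 1) := by
    apply one_div_le_one_div_of_le (by positivity)
    push_cast
    linarith [(Nat.cast_nonneg n : (0 : ℝ) ≤ n)]
  linarith

/-- The energy inequality for the rescaled solution of the linear wave equation with source
`S₁ + S₂`, including a smooth potential energy. -/
theorem WaveSystem.energy_le (h : WaveSystem N k r a b w A G fun s z => S₁ s z + S₂ s z)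
    (hα : 0 < α) (hγ : 0 < γ) (hst : StaticIneq N α k p γ c₀ C₀ η₀)
    (hS₁ : SrcField N r a b S₁) (hS₂ : SrcField N r a b S₂) {B : ℝ}
    (hB : ∀ s ∈ Icc a b, (eLpNorm (S₂ s) 2 volume).toReal ≤ B)
    (hgeo : ∀ s ∈ Icc a b, 0 < Real.exp (-s) - δ ∧ Real.exp (-s) - δ < Real.exp (-s) * r)
    (hη : ∀ s ∈ Icc a b, (Real.exp (-s) - δ) ^ γ ≤ η₀) {Γ Γ' : ℝ → ℝ}
    (hΓ : ∀ x, HasDerivAt Γ (Γ' x) x) {K' : NNReal} (hΓ' : LipschitzWith K' Γ') {K : ℝ}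
    (hK : ∀ x, |Γ' x| ≤ K) :
    (∫ y, energyDensity k p γ (Real.exp (-b) - δ) Γ (resc δ k w b y) (rescV k δ w A G b y)
          (fun i => resc δ (k + 1) (G i) b y) y ∂(ballMeas N α))
        - ∫ y, energyDensity k p γ (Real.exp (-a) - δ) Γ (resc δ k w a y) (rescV k δ w A G a y)
          (fun i => resc δ (k + 1) (G i) a y) y ∂(ballMeas N α) ≤
      ∫ s in a..b, timeWeight p γ δ s *
        ∫ y, dissDensity k p γ c₀ C₀ (Real.exp (-s) - δ) Γ Γ' (resc δ k w s y)
          (rescV k δ w A G s y) (fun i => resc δ (k + 1) (G i) s y) (resc δ (k + 1 + 1) S₁ s y)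
          (resc δ (k + 1 + 1) S₂ s y) y ∂(ballMeas N α) := by
  have hfin := isFiniteMeasure_ballMeas (N := N) hα.le
  have hν : ballMeas N α ≤ volume := (ballMeas_le hα.le).trans Measure.restrict_le_self
  have hK0 : 0 ≤ K := (abs_nonneg _).trans (hK 0)
  obtain ⟨κ, ε, hm, hε, hκ⟩ := exists_mollSetup (N := N) h.hab hgeo
  have hpos : ∀ s ∈ Icc a b, 0 < Real.exp (-s) - δ := fun s hs => (hgeo s hs).1
  have hΓL : LipschitzWith (Real.toNNReal K) Γ := by
    refine LipschitzWith.of_dist_le_mul fun x y => ?_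
    have := convex_univ.norm_image_sub_le_of_norm_hasDerivWithin_le (f := Γ) (f' := Γ') (C := K)
      (fun x _ => (hΓ x).hasDerivWithinAt) (fun x _ => hK x) (mem_univ y) (mem_univ x)
    simpa [Real.dist_eq, Real.coe_toNNReal _ hK0] using this
  have hL : ∀ {u : ℝ → Eucl N → ℝ} {s : ℝ}, s ∈ Icc a b → MemLp (u s) 2 volume → ∀ j,
      L2Tendsto (ballMeas N α) (fun n => moll δ j N (κ n) u s) (resc δ j u s) atTop :=
    fun hs hu j => (moll_tendsto hm hε hu (hpos _ hs) j).mono_measure hν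
  have hG : ∀ s ∈ Icc a b, ∀ i, L2Tendsto (ballMeas N α) (fun n y => mollG k δ (κ n) w i s y)
      (fun y => resc δ (k + 1) (G i) s y) atTop := fun s hs i =>
    (hL hs ((h.fG i).cont s).2.1 (k + 1)).congr
      (fun n => (ae_ballMeas_mem α).mono fun y hy =>
        (h.mollG_eq (hκ n) hs (mem_unitBall.1 hy).le i).symm) (ae_eq_refl _)
  have hW : ∀ s ∈ Icc a b, L2Tendsto (ballMeas N α) (fun n y => moll δ k N (κ n) w s y)
      (fun y => resc δ k w s y) atTop := fun s hs => hL hs (h.fw.cont s).2.1 k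
  have hA : ∀ s ∈ Icc a b, L2Tendsto (ballMeas N α) (fun n y => moll δ (k + 1) N (κ n) A s y)
      (fun y => resc δ (k + 1) A s y) atTop := fun s hs => hL hs (h.fA.cont s).2.1 (k + 1)
  have hV : ∀ s ∈ Icc a b, L2Tendsto (ballMeas N α) (fun n y => mollV k δ (κ n) w A s y)
      (fun y => rescV k δ w A G s y) atTop := fun s hs =>
    ((hA s hs).sub ((hW s hs).const_mul k)).sub (L2Tendsto.sum _ fun i _ =>
      (hG s hs i).mul_bdd (C := 1) (om := fun y => y i) (by fun_prop)
      ((ae_ballMeas_mem α).mono fun y hy => (PiLp.norm_apply_le y i).trans (mem_unitBall.1 hy).le))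
  have hT : ∀ {T : ℝ → Eucl N → ℝ} {s : ℝ}, s ∈ Icc a b → SrcField N r a b T →
      L2Tendsto (ballMeas N α) (fun n y => moll δ (k + 1 + 1) N (κ n) T s y)
      (fun y => resc δ (k + 1 + 1) T s y) atTop := fun hs hT => hL hs (hT.memLp _) _
  have hE : ∀ s ∈ Icc a b, Tendsto (fun n => ∫ y, mollEnergy k p γ δ Γ (κ n) w A s y ∂(ballMeas N α))
      atTop (𝓝 (∫ y, energyDensity k p γ (Real.exp (-s) - δ) Γ (resc δ k w s y) (rescV k δ w A G s y)
          (fun i => resc δ (k + 1) (G i) s y) y ∂(ballMeas N α))) := fun s hs =>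
    (energyDensity_tendsto (ae_ballMeas_mem α) (hW s hs) (hV s hs) (hG s hs) hΓL).2.2
  have hDt := fun s (hs : s ∈ Icc a b) => dissDensity_tendsto (k := k) (p := p) (γ := γ) (c₀ := c₀)
    (C₀ := C₀) (c := Real.exp (-s) - δ) (ae_ballMeas_mem α)
    (hW s hs) (hV s hs) (hG s hs) (hT hs hS₁) (hT hs hS₂) hΓL hΓ'
  refine le_of_tendsto_of_tendsto ((hE b ⟨h.hab, le_rfl⟩).sub (hE a ⟨le_rfl, h.hab⟩)) ?_
    (.of_forall fun n => h.mollified_energy_le hα hγ hst hS₁ hS₂ hB (hκ n) hη hΓ hΓ'.continuous hK)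
  obtain ⟨Pt, hPt⟩ := isCompact_Icc.exists_bound_of_continuousOn
    (continuousOn_timeWeight (p := p) (γ := γ) hpos)
  obtain ⟨P₁, hP₁⟩ := isCompact_Icc.exists_bound_of_continuousOn
    (continuousOn_rpow_exp hpos (2 * (k + 1)))
  obtain ⟨P₂, hP₂⟩ := isCompact_Icc.exists_bound_of_continuousOn (continuousOn_rpow_exp hpos (-k))
  obtain ⟨P₃, hP₃⟩ := isCompact_Icc.exists_bound_of_continuousOn (continuousOn_rpow_exp hpos γ)
  set P := max (max P₁ P₂) (max P₃ 0) with hP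
  have hP0 : 0 ≤ P := (le_max_right _ _).trans (le_max_right _ _)
  set K₁ := max K |Γ 0| with hK₁
  have hK₁0 : 0 ≤ K₁ := hK0.trans (le_max_left _ _)
  have hΓb : ∀ x, |Γ x| ≤ K₁ * (1 + |x|) := by
    intro x
    have h1 := hΓL.dist_le_mul x 0
    rw [Real.dist_eq, Real.dist_eq, Real.coe_toNNReal _ hK0, sub_zero] at h1
    have h2 : |Γ x| ≤ |Γ x - Γ 0| + |Γ 0| := by
      have := abs_add_le (Γ x - Γ 0) (Γ 0); simpa using this
    have h3 := le_max_right K |Γ 0|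
    have h4 := mul_le_mul_of_nonneg_right (le_max_left K |Γ 0|) (abs_nonneg x)
    rw [hK₁, mul_add, mul_one]
    linarith
  obtain ⟨Q, hQ0, hQ⟩ := exists_abs_dissDensity_le (N := N) (k := k) (p := p) (γ := γ) (c₀ := c₀)
    (C₀ := C₀) hP0 hK₁0 hΓb (fun x => (hK x).trans (le_max_left _ _))
  obtain ⟨Ck, hCk0, hCk⟩ := exists_eLpNorm_moll_le (N := N) hpos k
  obtain ⟨Ck1, hCk10, hCk1⟩ := exists_eLpNorm_moll_le (N := N) hpos (k + 1)
  obtain ⟨Ck2, hCk20, hCk2⟩ := exists_eLpNorm_moll_le (N := N) hpos (k + 1 + 1)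
  obtain ⟨Bw, hBw0, hBw⟩ := exists_eLpNorm_le h.fw.cont a b
  obtain ⟨BA, hBA0, hBA⟩ := exists_eLpNorm_le h.fA.cont a b
  choose BG hBG0 hBG using fun i => exists_eLpNorm_le (h.fG i).cont a b
  set BV := Ck1 * BA + |k| * (Ck * Bw) + ∑ i, Ck1 * BG i with hBV
  set ν := ballMeas N α with hνd
  have hnorm : ∀ {T : ℝ → Eucl N → ℝ} {j C M s : ℝ} (n : ℕ), s ∈ Icc a b → 0 ≤ C →
      MemLp (T s) 2 volume → (eLpNorm (T s) 2 volume).toReal ≤ M →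
      ((eLpNorm (moll δ j N (κ n) T s) 2 volume).toReal ≤ C * (eLpNorm (T s) 2 volume).toReal) →
      (eLpNorm (moll δ j N (κ n) T s) 2 ν).toReal ≤ C * M := by
    intro T j C M s n hs hC hT hM h1
    exact (toReal_eLpNorm_mono_measure hν ((moll_tendsto hm hε hT (hpos s hs) j).1 n)).trans
      (h1.trans (mul_le_mul_of_nonneg_left hM hC))
  -- A majorant independent of `n`: the norm of `S₁(s)` appears linearly and is integrable in time,
  -- and everything else is bounded over `[a, b]`.
  have hbound : ∀ n, ∀ s ∈ Icc a b,
      |timeWeight p γ δ s * ∫ y, mollDiss k p γ δ c₀ C₀ Γ Γ' (κ n) w A S₁ S₂ s y ∂ν| ≤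
      Pt * ((Ck2 * (eLpNorm (S₁ s) 2 volume).toReal) * BV +
        P * ((Ck2 * (eLpNorm (S₁ s) 2 volume).toReal) * (Ck * Bw)) +
        Q * (ν.real univ + (Ck * Bw) ^ 2 + BV ^ 2 + (∑ i, (Ck1 * BG i) ^ 2) + (Ck2 * B) ^ 2)) := by
    intro n s hs
    have n1 : (eLpNorm (moll δ k N (κ n) w s) 2 ν).toReal ≤ Ck * Bw :=
      hnorm n hs hCk0 (h.fw.cont s).2.1 (hBw s hs) (hCk s hs _ _ (hm n) _ (h.fw.cont s).2.1)
    have n2 : (eLpNorm (moll δ (k + 1) N (κ n) A s) 2 ν).toReal ≤ Ck1 * BA :=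
      hnorm n hs hCk10 (h.fA.cont s).2.1 (hBA s hs) (hCk1 s hs _ _ (hm n) _ (h.fA.cont s).2.1)
    have n3 : ∀ i, (eLpNorm (mollG k δ (κ n) w i s) 2 ν).toReal ≤ Ck1 * BG i := fun i => by
      rw [eLpNorm_congr_ae ((ae_ballMeas_mem α).mono fun y hy =>
        h.mollG_eq (hκ n) hs (mem_unitBall.1 hy).le i)]
      exact hnorm n hs hCk10 ((h.fG i).cont s).2.1 (hBG i s hs)
        (hCk1 s hs _ _ (hm n) _ ((h.fG i).cont s).2.1)
    have n4 : (eLpNorm (moll δ (k + 1 + 1) N (κ n) S₁ s) 2 ν).toReal ≤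
        Ck2 * (eLpNorm (S₁ s) 2 volume).toReal :=
      hnorm n hs hCk20 (hS₁.memLp s) le_rfl (hCk2 s hs _ _ (hm n) _ (hS₁.memLp s))
    have n5 : (eLpNorm (moll δ (k + 1 + 1) N (κ n) S₂ s) 2 ν).toReal ≤ Ck2 * B :=
      hnorm n hs hCk20 (hS₂.memLp s) (hB s hs) (hCk2 s hs _ _ (hm n) _ (hS₂.memLp s))
    have hyG : ∀ i, MemLp (fun y => y i * mollG k δ (κ n) w i s y) 2 ν := fun i =>
      ((hG s hs i).mul_bdd (C := 1) (om := fun y => y i) (by fun_prop)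
        ((ae_ballMeas_mem α).mono fun y hy =>
          (PiLp.norm_apply_le y i).trans (mem_unitBall.1 hy).le)).1 n
    have n6 : (eLpNorm (mollV k δ (κ n) w A s) 2 ν).toReal ≤ BV := by
      have h1 := toReal_eLpNorm_sub_le (((hA s hs).1 n).sub (((hW s hs).const_mul k).1 n))
        (memLp_finsetSum Finset.univ fun i _ => hyG i)
      have h2 := toReal_eLpNorm_sub_le ((hA s hs).1 n) (((hW s hs).const_mul k).1 n)
      rw [toReal_eLpNorm_const_mul] at h2
      have h3 := toReal_eLpNorm_sum_le Finset.univ hyG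
      have h4 : ∑ i, (eLpNorm (fun y => y i * mollG k δ (κ n) w i s y) 2 ν).toReal ≤
          ∑ i, Ck1 * BG i := Finset.sum_le_sum fun i _ =>
        (toReal_eLpNorm_mono_ae ((hG s hs i).1 n) ((ae_ballMeas_mem α).mono fun y hy => by
          rw [abs_mul]
          exact mul_le_of_le_one_left (abs_nonneg _)
            ((PiLp.norm_apply_le y i).trans (mem_unitBall.1 hy).le))).trans (n3 i)
      have h5 := mul_le_mul_of_nonneg_left n1 (abs_nonneg k)
      refine (h1.trans (add_le_add h2 h3)).trans ?_
      rw [hBV]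
      linarith
    have hc := hpos s hs
    have key := abs_integral_dissDensity_le (k := k) (p := p) (γ := γ) (c₀ := c₀) (C₀ := C₀)
      (c := Real.exp (-s) - δ) (μ := ν) (Γ := Γ) (Γ' := Γ') (P := P) (Q := Q) (ae_ballMeas_mem α)
      (fun y hy => hQ _ (moll δ k N (κ n) w s y) (mollV k δ (κ n) w A s y)
        (fun i => mollG k δ (κ n) w i s y) (moll δ (k + 1 + 1) N (κ n) S₁ s y)
        (moll δ (k + 1 + 1) N (κ n) S₂ s y) y hc.le
        (((le_abs_self _).trans (hP₁ s hs)).trans ((le_max_left _ _).trans (le_max_left _ _)))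
        (((le_abs_self _).trans (hP₂ s hs)).trans ((le_max_right _ _).trans (le_max_left _ _)))
        (((le_abs_self _).trans (hP₃ s hs)).trans ((le_max_left _ _).trans (le_max_right _ _))) hy)
      ((hW s hs).1 n) ((hV s hs).1 n) (fun i => (hG s hs i).1 n) ((hT hs hS₁).1 n)
      ((hT hs hS₂).1 n) hP0
    rw [abs_mul]
    refine mul_le_mul (hPt s hs) ?_ (abs_nonneg _) ((norm_nonneg _).trans (hPt s hs))
    refine key.trans ?_
    have z : ∀ f : Eucl N → ℝ, 0 ≤ (eLpNorm f 2 ν).toReal := fun _ => ENNReal.toReal_nonneg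
    have z' : ∀ f : Eucl N → ℝ, 0 ≤ (eLpNorm f 2 volume).toReal := fun _ => ENNReal.toReal_nonneg
    have q1 : ∑ i, (eLpNorm (fun y => mollG k δ (κ n) w i s y) 2 ν).toReal ^ 2 ≤
        ∑ i, (Ck1 * BG i) ^ 2 :=
      Finset.sum_le_sum fun i _ => pow_le_pow_left₀ (z _) (n3 i) 2
    have q2 := mul_le_mul n4 n6 (z _) (mul_nonneg hCk20 (z' _))
    have q3 := mul_le_mul_of_nonneg_left (mul_le_mul n4 n1 (z _) (mul_nonneg hCk20 (z' _))) hP0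
    have q4 := pow_le_pow_left₀ (z _) n1 2
    have q5 := pow_le_pow_left₀ (z _) n6 2
    have q6 := pow_le_pow_left₀ (z _) n5 2
    refine add_le_add (add_le_add q2 q3) (mul_le_mul_of_nonneg_left ?_ hQ0)
    exact add_le_add (add_le_add (add_le_add (add_le_add le_rfl q4) q5) q1) q6
  refine intervalIntegral.tendsto_integral_filter_of_dominated_convergence
    (fun s => Pt * ((Ck2 * (eLpNorm (S₁ s) 2 volume).toReal) * BV +
        P * ((Ck2 * (eLpNorm (S₁ s) 2 volume).toReal) * (Ck * Bw)) +
        Q * (ν.real univ + (Ck * Bw) ^ 2 + BV ^ 2 + (∑ i, (Ck1 * BG i) ^ 2) + (Ck2 * B) ^ 2))) (.of_forall fun n => ?_)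
    (.of_forall fun n => .of_forall fun s hs => ?_) ?_ (.of_forall fun s hs => ?_)
  · have hDi := (hκ n).integrable_diss (k := k) (p := p) (γ := γ) (c₀ := c₀) (C₀ := C₀) hα.le h.fw h.fA
      hS₁ hS₂ hB (continuous_iff_continuousAt.2 fun x => (hΓ x).continuousAt) hΓ'.continuous
    have := intervalIntegrable_integral h.hab hα.le hDi
    simp only [integral_const_mul] at this
    exact this.aestronglyMeasurable_restrict_uIoc
  · rw [uIoc_of_le h.hab] at hs
    exact hbound n s (Ioc_subset_Icc_self hs)
  · rw [intervalIntegrable_iff_integrableOn_Icc_of_le h.hab]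
    have h1 := hS₁.integrable_norm
    exact ((((h1.const_mul Ck2).mul_const BV).add (((h1.const_mul Ck2).mul_const (Ck * Bw)).const_mul P)).add
      (integrable_const _)).const_mul Pt
  · rw [uIoc_of_le h.hab] at hs
    exact ((hDt s (Ioc_subset_Icc_self hs)).2.2).const_mul _

end LinearEnergy

/-! ### The nonlinearity, its truncation, and the sign of the dissipation. -/

section Nonlinearity

/-- The nonlinearity `|x|^{p-1} x + f(x)`. -/
noncomputable def nlin (p : ℝ) (f : ℝ → ℝ) (x : ℝ) : ℝ := |x| ^ (p - 1) * x + f x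

/-- The primitive of `nlin` vanishing at the origin. -/
noncomputable def npot (p : ℝ) (f : ℝ → ℝ) (x : ℝ) : ℝ :=
  1 / (p + 1) * |x| ^ (p + 1) + ∫ t in (0 : ℝ)..x, f t

/-- The nonlinearity, truncated outside of `[-K, K]`. -/
noncomputable def nlinT (p : ℝ) (f : ℝ → ℝ) (K : ℝ) (x : ℝ) : ℝ := nlin p f (max (-K) (min x K))

/-- The primitive of `nlinT` vanishing at the origin. -/
noncomputable def npotT (p : ℝ) (f : ℝ → ℝ) (K : ℝ) (x : ℝ) : ℝ := ∫ t in (0 : ℝ)..x, nlinT p f K t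

variable {p q M : ℝ} {f : ℝ → ℝ}

/-- This form exhibits the odd power as a difference of compositions of the `C¹` function `x^p` with
Lipschitz functions, hence as locally Lipschitz. -/
lemma abs_rpow_mul_self (hp : 1 < p) (x : ℝ) :
    |x| ^ (p - 1) * x = (max x 0) ^ p - (max (-x) 0) ^ p := by
  rcases le_total 0 x with h | h
  · rw [abs_of_nonneg h, max_eq_left h, max_eq_right (by linarith), Real.zero_rpow (by linarith), sub_zero,
      ← Real.rpow_add_one' h (by linarith)]
    simp
  · rw [abs_of_nonpos h, max_eq_right h, max_eq_left (by linarith), Real.zero_rpow (by linarith)]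
    have := Real.rpow_add_one' (neg_nonneg.2 h) (y := p - 1) (by linarith)
    rw [sub_add_cancel] at this
    rw [this]; ring

lemma abs_nlin_pow (hp : 1 < p) (x : ℝ) : |(|x| ^ (p - 1) * x)| = |x| ^ p := by
  rw [abs_mul, abs_of_nonneg (Real.rpow_nonneg (abs_nonneg _) _),
    ← Real.rpow_add_one' (abs_nonneg x) (by linarith)]
  simp

lemma locallyLipschitz_nlin (hp : 1 < p) (hf : LocallyLipschitz f) : LocallyLipschitz (nlin p f) := by
  have h1 : LocallyLipschitz fun x : ℝ => x ^ p :=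
    (Real.contDiff_rpow_const_of_le (n := 1) (by simpa using hp.le)).locallyLipschitz
  have h2 : LocallyLipschitz fun x : ℝ => (max x 0) ^ p :=
    h1.comp (LipschitzWith.id.max_const 0).locallyLipschitz
  have h3 : LocallyLipschitz fun x : ℝ => (max (-x) 0) ^ p :=
    h1.comp ((LipschitzWith.id.neg).max_const 0).locallyLipschitz
  have e : nlin p f = fun x => ((max x 0) ^ p - (max (-x) 0) ^ p) + f x := by
    ext x; rw [nlin, abs_rpow_mul_self hp]
  rw [e]
  exact (h2.sub h3).add hf

lemma exists_lipschitz_nlinT (hp : 1 < p) (hf : LocallyLipschitz f) (K : ℝ) :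
    ∃ L : NNReal, LipschitzWith L (nlinT p f K) := by
  obtain ⟨L, hL⟩ := LocallyLipschitzOn.exists_lipschitzOnWith_of_compact
    (isCompact_Icc (a := min (-K) K) (b := max (-K) K))
    ((locallyLipschitz_nlin hp hf).locallyLipschitzOn (s := _))
  have h1 : LipschitzWith 1 fun x : ℝ => max (-K) (min x K) :=
    (LipschitzWith.id.min_const K).const_max (-K)
  refine ⟨L, fun x y => ?_⟩
  have hm : ∀ x : ℝ, max (-K) (min x K) ∈ Icc (min (-K) K) (max (-K) K) := fun x =>
    ⟨(min_le_left _ _).trans (le_max_left _ _), max_le_max le_rfl (min_le_right _ _)⟩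
  refine (hL (hm x) (hm y)).trans ?_
  have := h1 x y
  rw [ENNReal.coe_one, one_mul] at this
  gcongr

lemma continuous_nlin (hp : 1 < p) (hf : LocallyLipschitz f) : Continuous (nlin p f) :=
  (locallyLipschitz_nlin hp hf).continuous

lemma continuous_nlinT (hp : 1 < p) (hf : LocallyLipschitz f) (K : ℝ) : Continuous (nlinT p f K) :=
  (continuous_nlin hp hf).comp (by fun_prop)

lemma hasDerivAt_npot (hp : 1 < p) (hf : LocallyLipschitz f) (x : ℝ) :
    HasDerivAt (npot p f) (nlin p f x) x := by
  have h1 := (hasDerivAt_abs_rpow x (p := p + 1) (by linarith)).const_mul (1 / (p + 1))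
  have h2 := intervalIntegral.integral_hasDerivAt_right (hf.continuous.intervalIntegrable 0 x)
    hf.continuous.stronglyMeasurable.stronglyMeasurableAtFilter hf.continuous.continuousAt
  refine (h1.add h2).congr_deriv ?_
  rw [nlin]
  have : p + 1 - 2 = p - 1 := by ring
  rw [this]
  have : p + 1 ≠ 0 := by linarith
  field_simp

lemma hasDerivAt_npotT (hp : 1 < p) (hf : LocallyLipschitz f) (K x : ℝ) :
    HasDerivAt (npotT p f K) (nlinT p f K x) x := by
  have hc := continuous_nlinT hp hf K
  exact intervalIntegral.integral_hasDerivAt_right (hc.intervalIntegrable 0 x)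
    hc.stronglyMeasurable.stronglyMeasurableAtFilter hc.continuousAt

lemma nlinT_eq {K x : ℝ} (h : |x| ≤ K) : nlinT p f K x = nlin p f x := by
  rw [nlinT, min_eq_left (abs_le.1 h).2, max_eq_right (abs_le.1 h).1]

lemma npotT_eq (hp : 1 < p) (hf : LocallyLipschitz f) {K x : ℝ} (h : |x| ≤ K) :
    npotT p f K x = npot p f x := by
  have h1 : npotT p f K x = ∫ t in (0 : ℝ)..x, nlin p f t := by
    refine intervalIntegral.integral_congr fun t ht => nlinT_eq (le_trans ?_ h)
    have := abs_sub_left_of_mem_uIcc ht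
    simpa using this
  rw [h1, intervalIntegral.integral_eq_sub_of_hasDerivAt (fun t _ => hasDerivAt_npot hp hf t)
    ((continuous_nlin hp hf).intervalIntegrable _ _)]
  have : npot p f 0 = 0 := by
    rw [npot, abs_zero, Real.zero_rpow (by linarith)]; simp
  rw [this, sub_zero]

lemma rpow_le_one_add_rpow {x a b : ℝ} (hx : 0 ≤ x) (ha : 0 ≤ a) (hab : a ≤ b) :
    x ^ a ≤ 1 + x ^ b := by
  rcases le_total x 1 with h | h
  · have := Real.rpow_le_one hx h ha
    linarith [Real.rpow_nonneg hx b]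
  · linarith [Real.rpow_le_rpow_of_exponent_le h hab]

lemma abs_nlin_le (hp : 1 < p) (hq₀ : 0 ≤ q) (hq : q < p) (hM : 0 < M)
    (hf : ∀ x, |f x| ≤ M * (1 + |x| ^ q)) (x : ℝ) :
    |nlin p f x| ≤ (1 + 2 * M) * (1 + |x| ^ p) := by
  have h1 := rpow_le_one_add_rpow (abs_nonneg x) hq₀ hq.le
  have h2 := abs_add_le (|x| ^ (p - 1) * x) (f x)
  rw [abs_nlin_pow hp] at h2
  have h3 := mul_le_mul_of_nonneg_left h1 hM.le
  have h4 := hf x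
  have h5 := mul_nonneg hM.le (Real.rpow_nonneg (abs_nonneg x) p)
  rw [nlin]
  nlinarith

/-- The first bound does not depend on the truncation level and serves as majorant when the
truncation is removed. The second is the global bound at a fixed level which the linear theory
requires. -/
lemma abs_nlinT_le (hp : 1 < p) (hq₀ : 0 ≤ q) (hq : q < p) (hM : 0 < M)
    (hf : ∀ x, |f x| ≤ M * (1 + |x| ^ q)) {K : ℝ} (hK : 0 ≤ K) (x : ℝ) :
    |nlinT p f K x| ≤ (1 + 2 * M) * (1 + |x| ^ p) ∧
      |nlinT p f K x| ≤ (1 + 2 * M) * (1 + K ^ p) := by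
  have h1 : |max (-K) (min x K)| ≤ |x| := by
    rw [abs_le]
    constructor
    · exact le_max_of_le_right (le_min (neg_abs_le x) (by linarith [abs_nonneg x]))
    · exact max_le (by linarith [abs_nonneg x]) ((min_le_left _ _).trans (le_abs_self x))
  have h2 : |max (-K) (min x K)| ≤ K :=
    abs_le.2 ⟨le_max_left _ _, max_le (by linarith) (min_le_right _ _)⟩
  have h3 := abs_nlin_le hp hq₀ hq hM hf (max (-K) (min x K))
  have hp0 : 0 ≤ p := by linarith
  constructor
  · refine h3.trans ?_
    have := Real.rpow_le_rpow (abs_nonneg _) h1 hp0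
    gcongr
  · refine h3.trans ?_
    have := Real.rpow_le_rpow (abs_nonneg _) h2 hp0
    gcongr

lemma abs_integral_le_of_abs_le {h : ℝ → ℝ} {K r : ℝ} (hK : 0 ≤ K) (hr : 0 ≤ r)
    (hh : ∀ x, |h x| ≤ K * (1 + |x| ^ r)) (x : ℝ) :
    |∫ t in (0 : ℝ)..x, h t| ≤ K * (|x| + |x| ^ (r + 1)) := by
  refine (intervalIntegral.norm_integral_le_of_norm_le_const (a := 0) (b := x) (f := h)
    (C := K * (1 + |x| ^ r)) fun t ht => by
    refine (hh t).trans ?_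
    have h2 : |t| ≤ |x| := by simpa using abs_sub_left_of_mem_uIcc (uIoc_subset_uIcc ht)
    gcongr).trans_eq ?_
  rw [sub_zero, Real.rpow_add_one' (abs_nonneg x) (by linarith)]; ring

lemma abs_npotT_le (hp : 1 < p) (hq₀ : 0 ≤ q) (hq : q < p) (hM : 0 < M)
    (hf : ∀ x, |f x| ≤ M * (1 + |x| ^ q)) {K : ℝ} (hK : 0 ≤ K) (x : ℝ) :
    |npotT p f K x| ≤ (1 + 2 * M) * (|x| + |x| ^ (p + 1)) :=
  abs_integral_le_of_abs_le (by positivity) (by linarith)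
    (fun t => (abs_nlinT_le hp hq₀ hq hM hf hK t).1) x

lemma abs_integral_f_le (hq₀ : 0 ≤ q) (hM : 0 < M) (hf : ∀ x, |f x| ≤ M * (1 + |x| ^ q)) (x : ℝ) :
    |∫ t in (0 : ℝ)..x, f t| ≤ M * (|x| + |x| ^ (q + 1)) :=
  abs_integral_le_of_abs_le hM.le hq₀ hf x

/-- The pure power parts of the dissipation have a sign, and the lower order terms are absorbed. -/
lemma power_absorb {k γ c η w : ℝ} (hp : 1 < p) (hq₀ : 0 ≤ q) (hq : q < p) (hM : 0 < M)
    (hk : k = 2 / (p - 1)) (hγ : 0 < γ) (hγ1 : γ ≤ 1 / 2) (hγ2 : 2 * γ ≤ k * (p - q)) (hc : 0 < c)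
    (hc1 : c ≤ 1) (hηd : η = c ^ γ) (hf : ∀ x, |f x| ≤ M * (1 + |x| ^ q))
    (hη : 2 * (M * ((1 + k) + ((p + 3) / 2 + 2 * (k + 1)))) * η ≤ (p - 1) / (4 * (p + 1)) * 1) :
    -(η * (w * (c ^ (k + 2) * nlin p f (c ^ (-k) * w))))
      + c ^ (2 * (k + 1)) * (((p + 3) / 2 * η + 2 * (k + 1)) * npot p f (c ^ (-k) * w)
        - nlin p f (c ^ (-k) * w) * (c ^ (-k) * (k * w))) ≤
      4 * (M * ((1 + k) + ((p + 3) / 2 + 2 * (k + 1)))) * η ^ 2 := by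
  have hk0 : 0 < k := by rw [hk]; exact div_pos two_pos (by linarith)
  have hp1 : p - 1 ≠ 0 := by linarith
  set X := c ^ (-k) * w with hX
  have hw : w = c ^ k * X := by
    rw [hX, ← mul_assoc, ← Real.rpow_add hc]; simp
  have hη0 : 0 < η := by rw [hηd]; exact Real.rpow_pos_of_pos hc γ
  have hη1 : η ≤ 1 := by rw [hηd]; exact Real.rpow_le_one hc.le hc1 hγ.le
  set Z := c ^ (2 * (k + 1)) with hZ
  have hZ0 : 0 < Z := Real.rpow_pos_of_pos hc _
  have e1 : w * (c ^ (k + 2) * nlin p f X) = Z * (X * nlin p f X) := by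
    have h1 : c ^ k * c ^ (k + 2) = Z := by rw [← Real.rpow_add hc]; congr 1; ring
    rw [← h1]
    conv_lhs => rw [hw]
    ring
  have e2 : c ^ (-k) * (k * w) = k * X := by rw [hX]; ring
  have hXp : X * (|X| ^ (p - 1) * X) = |X| ^ (p + 1) := by
    have h1 : |X| ^ (p + 1) = |X| ^ (p - 1) * |X| ^ (2 : ℝ) := by
      rw [← Real.rpow_add' (abs_nonneg X) (by linarith)]; congr 1; ring
    rw [h1, Real.rpow_two, sq_abs]; ring
  set Pw := |X| ^ (p + 1) with hPw
  have hPw0 : 0 ≤ Pw := Real.rpow_nonneg (abs_nonneg _) _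
  set Fx := ∫ t in (0 : ℝ)..X, f t with hFx
  rw [e1, e2, npot, nlin, ← hPw, ← hFx]
  have l1 : |X| * |f X| ≤ M * (|X| + |X| ^ (q + 1)) := by
    have := mul_le_mul_of_nonneg_left (hf X) (abs_nonneg X)
    refine this.trans_eq ?_
    rw [Real.rpow_add_one' (abs_nonneg X) (by linarith)]; ring
  have l2 : |Fx| ≤ M * (|X| + |X| ^ (q + 1)) := abs_integral_f_le hq₀ hM hf X
  have l3 : |X| ≤ 1 + |X| ^ (q + 1) := by
    have := rpow_le_one_add_rpow (abs_nonneg X) zero_le_one (by linarith : 1 ≤ q + 1)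
    simpa using this
  -- Since `k(p+1) = 2(k+1)`, the weight turns `|X|^{p+1}` into `|w|^{p+1}`, while the lower power
  -- picks up `c^{k(p-q)} ≤ c^{2γ} = η²`. This is where `γ ≤ (p-q)/(p-1)` is used.
  have l4 : Z * |X| ^ (q + 1) ≤ η ^ 2 * (1 + Z * Pw) := by
    have hu : |w| = c ^ k * |X| := by
      rw [hw, abs_mul, abs_of_pos (Real.rpow_pos_of_pos hc k)]
    have a1 : Z * Pw = |w| ^ (p + 1) := by
      rw [hu, Real.mul_rpow (by positivity) (abs_nonneg _), ← Real.rpow_mul hc.le, hPw, hZ]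
      congr 2; rw [hk]; field_simp; ring
    have a2 : Z * |X| ^ (q + 1) = c ^ (k * (p - q)) * |w| ^ (q + 1) := by
      rw [hu, Real.mul_rpow (by positivity) (abs_nonneg _), ← Real.rpow_mul hc.le, ← mul_assoc,
        ← Real.rpow_add hc, hZ]
      congr 2; rw [hk]; field_simp; ring
    have a3 : c ^ (k * (p - q)) ≤ η ^ 2 := by
      rw [hηd, ← Real.rpow_natCast, ← Real.rpow_mul hc.le]
      exact Real.rpow_le_rpow_of_exponent_ge hc hc1 (by push_cast; linarith)
    have a4 := rpow_le_one_add_rpow (abs_nonneg w) (by linarith : 0 ≤ q + 1)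
      (by linarith : q + 1 ≤ p + 1)
    rw [a1, a2]
    exact mul_le_mul a3 a4 (Real.rpow_nonneg (abs_nonneg _) _) (sq_nonneg _)
  have l5 : Z ≤ η ^ 2 := by
    rw [hηd, ← Real.rpow_natCast, ← Real.rpow_mul hc.le]
    exact Real.rpow_le_rpow_of_exponent_ge hc hc1 (by push_cast; linarith)
  have l6 : Z * (|X| + |X| ^ (q + 1)) ≤ η ^ 2 * (3 + 2 * (Z * Pw)) := by
    have := mul_le_mul_of_nonneg_left l3 hZ0.le
    linarith
  set CC := (1 + k) + ((p + 3) / 2 + 2 * (k + 1)) with hCC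
  have hfin : -(η * (Z * (X * f X))) + Z * (((p + 3) / 2 * η + 2 * (k + 1)) * Fx - f X * (k * X)) ≤
      M * CC * (η ^ 2 * (3 + 2 * (Z * Pw))) := by
    have b1 : -(X * f X) ≤ |X| * |f X| := by rw [← abs_mul]; exact neg_le_abs _
    have b2 : Fx ≤ |Fx| := le_abs_self _
    have b3 : 0 ≤ |X| * |f X| := by positivity
    have b4 : -(η * (X * f X)) + (((p + 3) / 2 * η + 2 * (k + 1)) * Fx - f X * (k * X)) ≤
        (1 + k) * (|X| * |f X|) + ((p + 3) / 2 + 2 * (k + 1)) * |Fx| := by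
      have c1 := mul_le_mul_of_nonneg_left b1 (by linarith : 0 ≤ η + k)
      have c2 : (η + k) * (|X| * |f X|) ≤ (1 + k) * (|X| * |f X|) :=
        mul_le_mul_of_nonneg_right (by linarith) b3
      have c3 : ((p + 3) / 2 * η + 2 * (k + 1)) * Fx ≤ ((p + 3) / 2 * η + 2 * (k + 1)) * |Fx| :=
        mul_le_mul_of_nonneg_left b2 (by positivity)
      have c4 : ((p + 3) / 2 * η + 2 * (k + 1)) * |Fx| ≤ ((p + 3) / 2 + 2 * (k + 1)) * |Fx| := by
        refine mul_le_mul_of_nonneg_right ?_ (abs_nonneg _)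
        have := mul_le_of_le_one_right (by linarith : 0 ≤ (p + 3) / 2) hη1
        linarith
      linarith
    have b5 : (1 + k) * (|X| * |f X|) + ((p + 3) / 2 + 2 * (k + 1)) * |Fx| ≤
        CC * (M * (|X| + |X| ^ (q + 1))) := by
      refine (add_le_add (mul_le_mul_of_nonneg_left l1 (by linarith : 0 ≤ 1 + k))
        (mul_le_mul_of_nonneg_left l2 (by linarith : 0 ≤ (p + 3) / 2 + 2 * (k + 1)))).trans_eq ?_
      rw [hCC]; ring
    have b6 := mul_le_mul_of_nonneg_left (b4.trans b5) hZ0.le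
    have b7 := mul_le_mul_of_nonneg_left l6 (by rw [hCC]; positivity : 0 ≤ M * CC)
    linarith
  -- The terms of order one cancel because `2(k+1)/(p+1) = k`. Those of order `η` add up to `-1 +
  -- (p+3)/(2(p+1)) = -(p-1)/(2(p+1))`; this negative term absorbs the `η²` errors once `η` is
  -- small.
  have hpow : -(η * (Z * Pw)) + Z * (((p + 3) / 2 * η + 2 * (k + 1)) * (1 / (p + 1) * Pw)
      - k * Pw) = -(η * ((p - 1) / (2 * (p + 1))) * (Z * Pw)) := by
    have h1 : 2 * (k + 1) * (1 / (p + 1)) = k := by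
      rw [hk]
      have : p + 1 ≠ 0 := by linarith
      field_simp; ring
    have h2 : ((p + 3) / 2 * η + 2 * (k + 1)) * (1 / (p + 1) * Pw) =
        (p + 3) / 2 * η * (1 / (p + 1)) * Pw + 2 * (k + 1) * (1 / (p + 1)) * Pw := by ring
    rw [h2, h1]
    have : p + 1 ≠ 0 := by linarith
    field_simp
    ring
  have hab : M * CC * (η ^ 2 * (2 * (Z * Pw))) ≤ η * ((p - 1) / (2 * (p + 1))) * (Z * Pw) := by
    have h1 : 2 * (M * CC) * η ≤ (p - 1) / (2 * (p + 1)) := by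
      refine hη.trans ?_
      rw [mul_one]
      exact div_le_div_of_nonneg_left (by linarith) (by linarith) (by linarith)
    have h2 := mul_le_mul_of_nonneg_right h1 (by positivity : 0 ≤ η * (Z * Pw))
    linarith
  have hXX : X * (|X| ^ (p - 1) * X + f X) = Pw + X * f X := by rw [mul_add, hXp]
  have hXX' : (|X| ^ (p - 1) * X + f X) * (k * X) = k * Pw + f X * (k * X) := by rw [← hXp]; ring
  rw [hXX, hXX']
  have hMC : 0 ≤ M * CC * η ^ 2 := by rw [hCC]; positivity
  linarith

variable {N : ℕ}

/-- Up to terms of order `η²`, the total dissipation has a sign. -/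
lemma dissDensity_le {k γ c₀ C₀ : ℝ} (hp : 1 < p) (hq₀ : 0 ≤ q) (hq : q < p) (hM : 0 < M)
    (hk : k = 2 / (p - 1)) (hγ : 0 < γ) (hγ1 : γ ≤ 1 / 2) (hγ2 : 2 * γ ≤ k * (p - q)) (hc₀ : 0 < c₀)
    (hC₀ : 0 < C₀) : ∃ η₁ > 0, ∃ C, 0 ≤ C ∧ ∀ (c : ℝ), 0 < c → c ≤ 1 → c ^ γ ≤ η₁ →
      ∀ f : ℝ → ℝ, (∀ x, |f x| ≤ M * (1 + |x| ^ q)) → ∀ (w v : ℝ) (g : Fin N → ℝ) (S₂ : ℝ) (y : Eucl N),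
        y ∈ unitBall N → |S₂| ≤ M * (c ^ (k + 2) + c * |v + k * w + ∑ i, y i * g i|) →
        dissDensity k p γ c₀ C₀ c (npot p f) (nlin p f) w v g
          (c ^ (k + 2) * nlin p f (c ^ (-k) * w)) S₂ y ≤ C * (c ^ γ) ^ 2 := by
  have hk0 : 0 < k := by rw [hk]; exact div_pos two_pos (by linarith)
  set CC := M * ((1 + k) + ((p + 3) / 2 + 2 * (k + 1))) with hCC
  have hCC0 : 0 < CC := by rw [hCC]; positivity
  have hp1 : 0 < p - 1 := by linarith
  have hp2 : 0 < p + 1 := by linarith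
  -- The first threshold is the smallness required by `power_absorb`. The second lets the quadratic
  -- dissipation of order `η` absorb the part of `S₂²` that is quadratic of order `η²`.
  refine ⟨min ((p - 1) / (4 * (p + 1)) / (2 * CC)) (c₀ / (6 * M ^ 2 * C₀ * (1 + k ^ 2))),
    lt_min (by positivity) (by positivity), 4 * CC + 2 * M ^ 2 * C₀, by positivity, ?_⟩
  intro c hc hc1 hη f hf w v g S₂ y hy hS₂
  set η := c ^ γ with hηd
  have hη0 : 0 < η := Real.rpow_pos_of_pos hc γ
  have hη1 : η ≤ 1 := Real.rpow_le_one hc.le hc1 hγ.le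
  have h1 : 2 * CC * η ≤ (p - 1) / (4 * (p + 1)) * 1 := by
    have := hη.trans (min_le_left _ _)
    rw [le_div_iff₀ (by positivity)] at this
    linarith
  have h2 : 6 * M ^ 2 * C₀ * (1 + k ^ 2) * η ≤ c₀ := by
    have := hη.trans (min_le_right _ _)
    rw [le_div_iff₀ (by positivity)] at this
    linarith
  have hpw := power_absorb hp hq₀ hq hM hk hγ hγ1 hγ2 hc hc1 hηd (w := w) hf h1
  have ht := one_sub_pos hy
  have ht1 : 1 - ‖y‖ ^ 2 ≤ 1 := by linarith [sq_nonneg ‖y‖]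
  set t := 1 - ‖y‖ ^ 2 with htd
  set D := ∑ i, y i * g i with hD
  set G2 := ∑ i, g i ^ 2 with hG2
  have hG20 : 0 ≤ G2 := Finset.sum_nonneg fun i _ => sq_nonneg _
  have hDG : D ^ 2 ≤ G2 := by
    have := sq_sum_coord_mul_le y g
    have h3 : ‖y‖ ^ 2 ≤ 1 := by linarith
    exact this.trans (mul_le_of_le_one_left hG20 h3)
  have hc2 : c ^ 2 ≤ η ^ 2 := by
    rw [hηd, ← Real.rpow_natCast, ← Real.rpow_natCast, ← Real.rpow_mul hc.le]
    exact Real.rpow_le_rpow_of_exponent_ge hc hc1 (by push_cast; linarith)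
  have hck : (c ^ (k + 2)) ^ 2 ≤ η ^ 2 := by
    rw [hηd, ← Real.rpow_natCast, ← Real.rpow_natCast, ← Real.rpow_mul hc.le, ← Real.rpow_mul hc.le]
    exact Real.rpow_le_rpow_of_exponent_ge hc hc1 (by push_cast; linarith)
  have hS : S₂ ^ 2 ≤ 2 * M ^ 2 * (η ^ 2 + η ^ 2 * (v + k * w + D) ^ 2) := by
    have h3 : S₂ ^ 2 ≤ (M * (c ^ (k + 2) + c * |v + k * w + D|)) ^ 2 := by
      rw [← sq_abs S₂]
      exact pow_le_pow_left₀ (abs_nonneg _) hS₂ 2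
    refine h3.trans ?_
    have h4 : (c ^ (k + 2) + c * |v + k * w + D|) ^ 2 ≤
        2 * ((c ^ (k + 2)) ^ 2 + c ^ 2 * (v + k * w + D) ^ 2) := by
      rw [← sq_abs (v + k * w + D), ← mul_pow]
      exact add_sq_le
    have h6 := mul_le_mul_of_nonneg_right hc2 (sq_nonneg (v + k * w + D))
    rw [mul_pow]
    refine (mul_le_mul_of_nonneg_left (h4.trans (mul_le_mul_of_nonneg_left (add_le_add hck h6)
      two_pos.le)) (sq_nonneg M)).trans_eq (by ring)
  have hA : (v + k * w + D) ^ 2 ≤ 3 * (v ^ 2 + k ^ 2 * w ^ 2 + D ^ 2) := by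
    nlinarith [sq_nonneg (v - k * w), sq_nonneg (v - D), sq_nonneg (k * w - D)]
  -- The factor `t = 1 - |y|²` in front of `S₂²` is essential: `S₂` contains the full radial
  -- derivative, whereas the dissipation controls `|∇w|²` only with that factor. The smallness comes
  -- from `c² ≤ η²`.
  have hSfin : C₀ * (t * S₂ ^ 2) ≤ 2 * M ^ 2 * C₀ * η ^ 2 + c₀ * η * (v ^ 2 + t * G2 + w ^ 2) := by
    have a1 : t * S₂ ^ 2 ≤ 2 * M ^ 2 * η ^ 2 + 6 * M ^ 2 * η ^ 2 * (1 + k ^ 2) *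
        (v ^ 2 + t * G2 + w ^ 2) := by
      have b1 := mul_le_mul_of_nonneg_left hS ht.le
      have b2 : t * (v + k * w + D) ^ 2 ≤ 3 * (1 + k ^ 2) * (v ^ 2 + t * G2 + w ^ 2) := by
        have c1 := mul_le_mul_of_nonneg_left hA ht.le
        have c2 := mul_le_mul_of_nonneg_left hDG ht.le
        have c3 := mul_le_mul_of_nonneg_right ht1 (sq_nonneg v)
        have c4 := mul_le_mul_of_nonneg_right ht1 (mul_nonneg (sq_nonneg k) (sq_nonneg w))
        have c5 : 0 ≤ k ^ 2 * (v ^ 2 + t * G2) := by positivity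
        have c6 : 0 ≤ w ^ 2 := sq_nonneg w
        linarith
      have b3 : 2 * M ^ 2 * η ^ 2 * t ≤ 2 * M ^ 2 * η ^ 2 :=
        mul_le_of_le_one_right (by positivity) ht1
      have b4 := mul_le_mul_of_nonneg_left b2 (by positivity : 0 ≤ 2 * M ^ 2 * η ^ 2)
      linarith
    have a2 := mul_le_mul_of_nonneg_left a1 hC₀.le
    have a3 := mul_le_mul_of_nonneg_right h2
      (by positivity : 0 ≤ η * (v ^ 2 + t * G2 + w ^ 2))
    linarith
  -- This identity makes the work `S₁ v` of the nonlinear source cancel the part of the potential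
  -- rate containing `v`.
  have hcV : c ^ (2 * (k + 1)) * c ^ (-k) = c ^ (k + 2) := by
    rw [← Real.rpow_add hc]; congr 1; ring
  have hsplit : dissDensity k p γ c₀ C₀ c (npot p f) (nlin p f) w v g
      (c ^ (k + 2) * nlin p f (c ^ (-k) * w)) S₂ y =
      (-(η * (w * (c ^ (k + 2) * nlin p f (c ^ (-k) * w))))
      + c ^ (2 * (k + 1)) * (((p + 3) / 2 * η + 2 * (k + 1)) * npot p f (c ^ (-k) * w)
        - nlin p f (c ^ (-k) * w) * (c ^ (-k) * (k * w))))
      + (C₀ * (t * S₂ ^ 2) - c₀ * η * (v ^ 2 + t * G2 + w ^ 2)) := by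
    rw [dissDensity, potRate, ← hcV]
    ring
  rw [hsplit]
  rw [← hCC] at hpw
  linarith

end Nonlinearity

/-! ### The classes `L¹` and `L^∞` in time with values in weighted `L²`. -/

section TimeClasses

variable {N : ℕ} {α a b : ℝ}

/-- Joint measurability, and integrability over `[a, b]` with values in `L²`. -/
structure TimeL1 (N : ℕ) (α a b : ℝ) (F : ℝ → Eucl N → ℝ) : Prop where
  meas : Measurable (Function.uncurry F)
  fin : ∫⁻ s in Icc a b, eLpNorm (F s) 2 (ballMeas N α) < ⊤

/-- Joint measurability, and boundedness over `[a, b]` with values in `L²`. -/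
structure TimeSup (N : ℕ) (α a b : ℝ) (F : ℝ → Eucl N → ℝ) : Prop where
  meas : Measurable (Function.uncurry F)
  bdd : ∃ C : NNReal, ∀ s ∈ Icc a b, eLpNorm (F s) 2 (ballMeas N α) ≤ C

variable {F F₁ m : ℝ → Eucl N → ℝ}

lemma measurable_slice (h : Measurable (Function.uncurry F)) (s : ℝ) : Measurable (F s) :=
  h.comp measurable_prodMk_left

instance sFinite_ballMeas : SFinite (ballMeas N α) := by unfold ballMeas; infer_instance

lemma BddMeas.exists_eLpNorm_mul_le (hm : BddMeas N a b m) : ∃ C : NNReal, ∀ s ∈ Icc a b,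
    ∀ f : Eucl N → ℝ, eLpNorm (fun y => m s y * f y) 2 (ballMeas N α) ≤
      C * eLpNorm f 2 (ballMeas N α) := by
  obtain ⟨C, hC⟩ := hm.bdd
  refine ⟨C.toNNReal, fun s hs f => ?_⟩
  refine eLpNorm_le_mul_eLpNorm_of_ae_le_mul ((ae_ballMeas_mem α).mono fun y hy => ?_) 2
  rw [norm_mul]
  exact mul_le_mul_of_nonneg_right (hC s hs y hy) (norm_nonneg _)

namespace TimeSup

lemma memLp (h : TimeSup N α a b F) {s : ℝ} (hs : s ∈ Icc a b) : MemLp (F s) 2 (ballMeas N α) := by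
  obtain ⟨C, hC⟩ := h.bdd
  exact ⟨(measurable_slice h.meas s).aestronglyMeasurable, (hC s hs).trans_lt ENNReal.coe_lt_top⟩

lemma abs (h : TimeSup N α a b F) : TimeSup N α a b fun s y => |F s y| := by
  obtain ⟨D, hD⟩ := h.bdd
  exact ⟨h.meas.abs, D, fun s hs => by simpa only [← Real.norm_eq_abs, eLpNorm_norm] using hD s hs⟩

lemma timeL1 (h : TimeSup N α a b F) : TimeL1 N α a b F := by
  obtain ⟨C, hC⟩ := h.bdd
  refine ⟨h.meas, (setLIntegral_mono measurable_const hC).trans_lt ?_⟩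
  rw [setLIntegral_const]
  exact ENNReal.mul_lt_top ENNReal.coe_lt_top (by simp)

lemma add (h : TimeSup N α a b F) (h₁ : TimeSup N α a b F₁) :
    TimeSup N α a b fun s y => F s y + F₁ s y := by
  obtain ⟨C, hC⟩ := h.bdd
  obtain ⟨C₁, hC₁⟩ := h₁.bdd
  refine ⟨h.meas.add h₁.meas, C + C₁, fun s hs => ?_⟩
  rw [ENNReal.coe_add]
  exact (eLpNorm_add_le (h.memLp hs).1 (h₁.memLp hs).1 (by norm_num)).trans
    (add_le_add (hC s hs) (hC₁ s hs))

lemma mul_bdd (h : TimeSup N α a b F) (hm : BddMeas N a b m) :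
    TimeSup N α a b fun s y => m s y * F s y := by
  obtain ⟨C, hC⟩ := h.bdd
  obtain ⟨C₁, hC₁⟩ := hm.exists_eLpNorm_mul_le (α := α)
  refine ⟨hm.meas.mul h.meas, C₁ * C, fun s hs => (hC₁ s hs _).trans ?_⟩
  rw [ENNReal.coe_mul]
  exact mul_le_mul_right (hC s hs) _

lemma sub (h : TimeSup N α a b F) (h₁ : TimeSup N α a b F₁) :
    TimeSup N α a b fun s y => F s y - F₁ s y := by
  simpa [sub_eq_add_neg] using h.add (h₁.mul_bdd (BddMeas.const (-1)))

lemma sum {ι : Type*} (t : Finset ι) {F : ι → ℝ → Eucl N → ℝ} (h : ∀ i, TimeSup N α a b (F i)) :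
    TimeSup N α a b fun s y => ∑ i ∈ t, F i s y := by
  classical
  induction t using Finset.induction_on with
  | empty =>
    simp only [Finset.sum_empty]
    exact ⟨measurable_const, 0, by simp⟩
  | insert i t hi ih =>
    simp only [Finset.sum_insert hi]
    exact (h i).add ih

lemma const (hα : 0 ≤ α) (c : ℝ) : TimeSup N α a b fun _ _ => c := by
  have := isFiniteMeasure_ballMeas (N := N) hα
  have h := memLp_const (μ := ballMeas N α) (p := 2) c
  exact ⟨measurable_const, (eLpNorm (fun _ : Eucl N => c) 2 (ballMeas N α)).toNNReal, fun s _ =>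
    (ENNReal.coe_toNNReal h.eLpNorm_ne_top).ge⟩

end TimeSup

namespace TimeL1

lemma mul_bdd (h : TimeL1 N α a b F) (hm : BddMeas N a b m) :
    TimeL1 N α a b fun s y => m s y * F s y := by
  obtain ⟨C₁, hC₁⟩ := hm.exists_eLpNorm_mul_le (α := α)
  refine ⟨hm.meas.mul h.meas, ?_⟩
  refine (setLIntegral_mono ((measurable_eLpNorm_slice h.meas _).const_mul (C₁ : ENNReal))
    fun s hs => hC₁ s hs _).trans_lt ?_
  rw [lintegral_const_mul _ (measurable_eLpNorm_slice h.meas _)]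
  exact ENNReal.mul_lt_top ENNReal.coe_lt_top h.fin

lemma add (h : TimeL1 N α a b F) (h₁ : TimeL1 N α a b F₁) :
    TimeL1 N α a b fun s y => F s y + F₁ s y := by
  refine ⟨h.meas.add h₁.meas, ?_⟩
  calc ∫⁻ s in Icc a b, eLpNorm (fun z => F s z + F₁ s z) 2 (ballMeas N α)
      ≤ ∫⁻ s in Icc a b, (eLpNorm (F s) 2 (ballMeas N α) + eLpNorm (F₁ s) 2 (ballMeas N α)) :=
        lintegral_mono fun s => eLpNorm_add_le (measurable_slice h.meas s).aestronglyMeasurable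
          (measurable_slice h₁.meas s).aestronglyMeasurable (by norm_num)
    _ < ⊤ := by
        rw [lintegral_add_left (measurable_eLpNorm_slice h.meas _)]
        exact ENNReal.add_lt_top.2 ⟨h.fin, h₁.fin⟩

/-- The pairing of `L¹([a, b], L²)` and `L^∞([a, b], L²)`. -/
lemma integrable_mul (h : TimeL1 N α a b F) (h₁ : TimeSup N α a b F₁) :
    Integrable (Function.uncurry fun s y => F s y * F₁ s y)
      ((volume.restrict (Icc a b)).prod (ballMeas N α)) := by
  obtain ⟨C, hC⟩ := h₁.bdd
  have hm : Measurable (Function.uncurry fun s y => F s y * F₁ s y) := h.meas.mul h₁.meas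
  refine ⟨hm.aestronglyMeasurable, ?_⟩
  rw [HasFiniteIntegral, lintegral_prod _ hm.enorm.aemeasurable]
  have h1 : ∀ s ∈ Icc a b, ∫⁻ y, ‖Function.uncurry (fun s y => F s y * F₁ s y) (s, y)‖ₑ ∂(ballMeas N α) ≤
      eLpNorm (F s) 2 (ballMeas N α) * C := by
    intro s hs
    have h2 := eLpNorm_smul_le_mul_eLpNorm (p := 2) (q := 2) (r := 1) (μ := ballMeas N α)
      (f := F₁ s) (φ := F s) (measurable_slice h₁.meas s).aestronglyMeasurable
      (measurable_slice h.meas s).aestronglyMeasurable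
    rw [eLpNorm_one_eq_lintegral_enorm] at h2
    exact h2.trans (mul_le_mul_right (hC s hs) _)
  refine (setLIntegral_mono ((measurable_eLpNorm_slice h.meas _).mul_const _) h1).trans_lt ?_
  rw [lintegral_mul_const _ (measurable_eLpNorm_slice h.meas _)]
  exact ENNReal.mul_lt_top h.fin ENNReal.coe_lt_top

end TimeL1

end TimeClasses

/-! ### Rescaled fields in these classes. -/

section Rescaled

variable {N : ℕ} {α a b δ : ℝ} {u : ℝ → Eucl N → ℝ}

lemma measurable_resc (hu : Measurable (Function.uncurry u)) (δ j : ℝ) :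
    Measurable (Function.uncurry (resc δ j u)) := by
  have h1 : Measurable fun q : ℝ × Eucl N => u q.1 ((1 - δ * Real.exp q.1) • q.2) :=
    hu.comp (measurable_fst.prodMk (g := fun q : ℝ × Eucl N => (1 - δ * Real.exp q.1) • q.2)
      (by fun_prop))
  have h2 : Measurable fun q : ℝ × Eucl N => (1 - δ * Real.exp q.1) ^ j := by fun_prop
  exact h2.mul h1

lemma exists_eLpNorm_resc_le (hα : 0 ≤ α) (hpos : ∀ s ∈ Icc a b, 0 < Real.exp (-s) - δ) (j : ℝ) :
    ∃ C : NNReal, ∀ s ∈ Icc a b, ∀ u : ℝ → Eucl N → ℝ,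
      eLpNorm (resc δ j u s) 2 (ballMeas N α) ≤ C * eLpNorm (u s) 2 volume := by
  have hc : ContinuousOn (fun s => (1 - δ * Real.exp s) ^ j * √(((1 - δ * Real.exp s) ^ N)⁻¹))
      (Icc a b) := by
    intro s hs
    have hl := (one_sub_pos_of (hpos s hs)).ne'
    have hc : ContinuousAt (fun s => 1 - δ * Real.exp s) s := by fun_prop
    exact ((hc.rpow_const (Or.inl hl)).mul
      ((hc.pow N).inv₀ (pow_ne_zero _ hl)).sqrt).continuousWithinAt
  obtain ⟨C, hC⟩ := isCompact_Icc.exists_bound_of_continuousOn hc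
  refine ⟨C.toNNReal, fun s hs u => ?_⟩
  have hl := one_sub_pos_of (hpos s hs)
  refine (eLpNorm_mono_measure _ ((ballMeas_le hα).trans Measure.restrict_le_self)).trans ?_
  have e : resc δ j u s = (1 - δ * Real.exp s) ^ j • fun y => u s ((1 - δ * Real.exp s) • y) := rfl
  rw [e, eLpNorm_const_smul, eLpNorm_comp_smul hl, ← mul_assoc, Real.enorm_of_nonneg (by positivity),
    ← ENNReal.ofReal_mul (by positivity)]
  exact mul_le_mul_left (ENNReal.ofReal_le_ofReal ((le_abs_self _).trans (hC s hs))) _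

lemma TimeL1.resc (hα : 0 ≤ α) (hpos : ∀ s ∈ Icc a b, 0 < Real.exp (-s) - δ) (j : ℝ)
    (hu : Measurable (Function.uncurry u)) (hf : ∫⁻ s in Icc a b, eLpNorm (u s) 2 volume < ⊤) :
    TimeL1 N α a b (resc δ j u) := by
  obtain ⟨C, hC⟩ := exists_eLpNorm_resc_le (N := N) hα hpos j
  refine ⟨measurable_resc hu δ j, ?_⟩
  refine (setLIntegral_mono ((measurable_eLpNorm_slice hu _).const_mul (C : ENNReal))
    fun s hs => hC s hs u).trans_lt ?_
  rw [lintegral_const_mul _ (measurable_eLpNorm_slice hu _)]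
  exact ENNReal.mul_lt_top ENNReal.coe_lt_top hf

lemma TimeSup.resc (hα : 0 ≤ α) (hpos : ∀ s ∈ Icc a b, 0 < Real.exp (-s) - δ) (j : ℝ)
    (hu : Measurable (Function.uncurry u)) {B : NNReal}
    (hB : ∀ s ∈ Icc a b, eLpNorm (u s) 2 volume ≤ B) : TimeSup N α a b (resc δ j u) := by
  obtain ⟨C, hC⟩ := exists_eLpNorm_resc_le (N := N) hα hpos j
  refine ⟨measurable_resc hu δ j, C * B, fun s hs => (hC s hs u).trans ?_⟩
  rw [ENNReal.coe_mul]
  exact mul_le_mul_right (hB s hs) _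

lemma ContField.timeSup_resc {r : ℝ} (hα : 0 ≤ α) (hpos : ∀ s ∈ Icc a b, 0 < Real.exp (-s) - δ)
    (j : ℝ) (hu : ContField N r u) : TimeSup N α a b (_root_.resc δ j u) := by
  obtain ⟨B, hB0, hB⟩ := exists_eLpNorm_le hu.cont a b
  refine TimeSup.resc hα hpos j hu.meas (B := B.toNNReal) fun s hs => ?_
  rw [← ENNReal.ofReal_toReal (hu.cont s).2.1.eLpNorm_ne_top]
  exact ENNReal.ofReal_le_ofReal (hB s hs)

end Rescaled

/-! ### Removing the truncation: the energy inequality for the nonlinear equation. -/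

section NonlinearEnergy

variable {N : ℕ} {k p q M γ α r a b c₀ C₀ η₀ δ : ℝ} {f : ℝ → ℝ} {w A : ℝ → Eucl N → ℝ}
  {G : Fin N → ℝ → Eucl N → ℝ} {S₁ S₂ : ℝ → Eucl N → ℝ}

/-- The nonlinear wave equation in self-similar variables on the ball of radius `r`: the source
consists of the nonlinearity in `w` and a term of at most linear growth in `A`. -/
structure NonlinWave (N : ℕ) (k p M r a b : ℝ) (f : ℝ → ℝ) (w A : ℝ → Eucl N → ℝ)
    (G : Fin N → ℝ → Eucl N → ℝ) (S₁ S₂ : ℝ → Eucl N → ℝ) : Prop where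
  sys : WaveSystem N k r a b w A G fun s z => S₁ s z + S₂ s z
  src₁ : SrcField N r a b S₁
  src₂ : SrcField N r a b S₂
  bdd₂ : ∃ B, ∀ s ∈ Icc a b, (eLpNorm (S₂ s) 2 volume).toReal ≤ B
  pow : ∫⁻ s in Icc a b, eLpNorm (fun z => |w s z| ^ p) 2 volume < ⊤
  eq₁ : ∀ᵐ s ∂volume.restrict (Icc a b), ∀ z, ‖z‖ < r →
    S₁ s z = Real.exp (-(k + 2) * s) * nlin p f (Real.exp (k * s) * w s z)
  le₂ : ∀ s ∈ Icc a b, ∀ z, ‖z‖ < r →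
    |S₂ s z| ≤ M * (Real.exp (-(k + 2) * s) * (1 + Real.exp ((k + 1) * s) * |A s z|))

/-- The energy of the rescaled solution. -/
noncomputable def rescEnergy (N : ℕ) (k p γ α δ : ℝ) (Γ : ℝ → ℝ) (w A : ℝ → Eucl N → ℝ)
    (G : Fin N → ℝ → Eucl N → ℝ) (s : ℝ) : ℝ :=
  ∫ y, energyDensity k p γ (Real.exp (-s) - δ) Γ (resc δ k w s y) (rescV k δ w A G s y)
    (fun i => resc δ (k + 1) (G i) s y) y ∂(ballMeas N α)

lemma ae_prod_ballMeas_mem (a b α : ℝ) :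
    ∀ᵐ x ∂((volume.restrict (Icc a b)).prod (ballMeas N α)), x ∈ Icc a b ×ˢ unitBall N := by
  have e : (volume.restrict (Icc a b)).prod (ballMeas N α) =
      ((volume.restrict (Icc a b)).prod (ballMeas N α)).restrict (Icc a b ×ˢ unitBall N) := by
    rw [← Measure.prod_restrict, Measure.restrict_restrict measurableSet_Icc, inter_self]
    congr 1
    rw [Measure.restrict_eq_self_of_ae_mem (ae_ballMeas_mem α)]
  rw [e]
  exact ae_restrict_mem (measurableSet_Icc.prod measurableSet_unitBall)

lemma intTendsto_of_dominated {m : ℝ → Eucl N → ℝ} (hm : BddMeas N a b m)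
    {F : ℕ → ℝ → Eucl N → ℝ} {F₀ H : ℝ → Eucl N → ℝ} (hF : ∀ n, Measurable (Function.uncurry (F n)))
    (hH : Integrable (Function.uncurry H) ((volume.restrict (Icc a b)).prod (ballMeas N α)))
    (hle : ∀ n s y, |F n s y| ≤ H s y)
    (hlim : ∀ s y, Tendsto (fun n => F n s y) atTop (𝓝 (F₀ s y))) :
    IntTendsto ((volume.restrict (Icc a b)).prod (ballMeas N α))
      (fun n x => m x.1 x.2 * F n x.1 x.2) (fun x => m x.1 x.2 * F₀ x.1 x.2) atTop := by
  have hF₀ : Measurable (Function.uncurry F₀) :=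
    measurable_of_tendsto_metrizable hF (tendsto_pi_nhds.2 fun x => hlim x.1 x.2)
  have h1 : ∀ n, Integrable (Function.uncurry (F n))
      ((volume.restrict (Icc a b)).prod (ballMeas N α)) := fun n =>
    hH.mono' (hF n).aestronglyMeasurable (.of_forall fun x => hle n x.1 x.2)
  have h2 : Integrable (Function.uncurry F₀)
      ((volume.restrict (Icc a b)).prod (ballMeas N α)) :=
    hH.mono' hF₀.aestronglyMeasurable (.of_forall fun x =>
      le_of_tendsto (hlim x.1 x.2).abs (.of_forall fun n => hle n x.1 x.2))
  obtain ⟨C, hC⟩ := hm.bdd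
  refine ⟨fun n => hm.mul_integrable (h1 n) (hF n), hm.mul_integrable h2 hF₀, ?_⟩
  refine tendsto_integral_of_dominated_convergence (fun x => C * Function.uncurry H x)
    (fun n => (hm.mul_integrable (h1 n) (hF n)).1) (hH.const_mul C) (fun n => ?_)
    (.of_forall fun x => (hlim x.1 x.2).const_mul _)
  filter_upwards [ae_prod_ballMeas_mem a b α] with x hx
  rw [norm_mul]
  exact mul_le_mul (hC x.1 hx.1 x.2 hx.2) (hle n x.1 x.2) (abs_nonneg _)
    ((abs_nonneg _).trans (hC x.1 hx.1 x.2 hx.2))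

lemma tendsto_npotT (hp : 1 < p) (hf : LocallyLipschitz f) (x : ℝ) :
    Tendsto (fun n : ℕ => npotT p f n x) atTop (𝓝 (npot p f x)) := by
  obtain ⟨n, hn⟩ := exists_nat_ge |x|
  refine tendsto_const_nhds.congr' ((eventually_ge_atTop n).mono fun m hm => ?_)
  exact (npotT_eq hp hf (hn.trans (by exact_mod_cast hm))).symm

lemma tendsto_nlinT (x : ℝ) :
    Tendsto (fun n : ℕ => nlinT p f n x) atTop (𝓝 (nlin p f x)) := by
  obtain ⟨n, hn⟩ := exists_nat_ge |x|
  refine tendsto_const_nhds.congr' ((eventually_ge_atTop n).mono fun m hm => ?_)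
  exact (nlinT_eq (hn.trans (by exact_mod_cast hm))).symm

/-- Only the potential depends on `n`. The rest is taken from the linear case with constant
sequences and zero potential. The potential converges by dominated convergence, with a majorant that
is integrable because `|W|^{p+1}` is. -/
lemma energyDensity_intTendsto {c : ℝ} {ν : Measure (Eucl N)} [IsFiniteMeasure ν]
    (hν : ∀ᵐ y ∂ν, y ∈ unitBall N) (hp : 1 < p) (hq₀ : 0 ≤ q)
    (hq : q < p) (hM : 0 < M) (hf : LocallyLipschitz f) (hfb : ∀ x, |f x| ≤ M * (1 + |x| ^ q))
    {W V : Eucl N → ℝ} {g : Fin N → Eucl N → ℝ} (hW : MemLp W 2 ν) (hV : MemLp V 2 ν)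
    (hg : ∀ i, MemLp (g i) 2 ν) (hWp : Integrable (fun y => |W y| ^ (p + 1)) ν) :
    IntTendsto ν (fun (n : ℕ) y => energyDensity k p γ c (npotT p f n) (W y) (V y) (fun i => g i y) y)
      (fun y => energyDensity k p γ c (npot p f) (W y) (V y) (fun i => g i y) y) atTop := by
  have hcst : ∀ {F : Eucl N → ℝ}, MemLp F 2 ν → L2Tendsto ν (fun _ : ℕ => F) F atTop := fun hF =>
    ⟨fun _ => hF, hF, by simp⟩
  have h0 := energyDensity_tendsto (k := k) (p := p) (γ := γ) (c := c) hν (hcst hW) (hcst hV)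
    (fun i => hcst (hg i)) (LipschitzWith.const (0 : ℝ))
  have hX : Integrable (fun y => (1 + 2 * M) * (|c ^ (-k) * W y| + |c ^ (-k) * W y| ^ (p + 1))) ν := by
    have h1 := (hW.integrable (by norm_num)).const_mul (c ^ (-k))
    have h2 := hWp.const_mul (|c ^ (-k)| ^ (p + 1))
    refine Integrable.const_mul (h1.abs.add (h2.congr (.of_forall fun y => ?_))) _
    simp only
    rw [abs_mul, Real.mul_rpow (abs_nonneg _) (abs_nonneg _)]
  have hm : ∀ n : ℕ, AEStronglyMeasurable (fun y => npotT p f n (c ^ (-k) * W y)) ν := fun n =>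
    (continuous_iff_continuousAt.2 fun x =>
      (hasDerivAt_npotT hp hf n x).continuousAt).comp_aestronglyMeasurable (hW.1.const_mul _)
  have hle : ∀ (n : ℕ) y, |npotT p f n (c ^ (-k) * W y)| ≤
      (1 + 2 * M) * (|c ^ (-k) * W y| + |c ^ (-k) * W y| ^ (p + 1)) := fun n y =>
    abs_npotT_le hp hq₀ hq hM hfb n.cast_nonneg _
  have hpot : IntTendsto ν (fun (n : ℕ) y => npotT p f n (c ^ (-k) * W y))
      (fun y => npot p f (c ^ (-k) * W y)) atTop := by
    refine ⟨fun n => hX.mono' (hm n) (.of_forall (hle n)), hX.mono' ?_ (.of_forall fun y => ?_), ?_⟩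
    · exact (continuous_iff_continuousAt.2 fun x =>
        (hasDerivAt_npot hp hf x).continuousAt).comp_aestronglyMeasurable (hW.1.const_mul _)
    · exact le_of_tendsto (tendsto_npotT hp hf _).abs (.of_forall fun n => hle n y)
    · exact tendsto_integral_of_dominated_convergence _ hm hX (fun n => .of_forall (hle n))
        (.of_forall fun y => tendsto_npotT hp hf _)
  have := h0.sub (hpot.const_mul (Real.exp ((p + 3) / (2 * γ) * c ^ γ) * c ^ (2 * (k + 1))))
  refine ⟨fun n => (this.1 n).congr (.of_forall fun y => ?_), this.2.1.congr (.of_forall fun y => ?_),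
    ?_⟩
  · simp only [energyDensity]; ring
  · simp only [energyDensity]; ring
  · refine Tendsto.congr (fun n => integral_congr_ae (.of_forall fun y => ?_))
      (this.2.2.mono_right (le_of_eq ?_))
    · simp only [energyDensity]; ring
    · congr 1
      refine integral_congr_ae (.of_forall fun y => ?_)
      simp only [energyDensity]; ring

lemma integral_prod_eq_interval {F : ℝ → Eucl N → ℝ} (hab : a ≤ b)
    (hF : Integrable (Function.uncurry F) ((volume.restrict (Icc a b)).prod (ballMeas N α))) :
    ∫ x, F x.1 x.2 ∂((volume.restrict (Icc a b)).prod (ballMeas N α)) =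
      ∫ s in a..b, ∫ y, F s y ∂(ballMeas N α) := by
  rw [intervalIntegral.integral_of_le hab, ← integral_Icc_eq_integral_Ioc]
  exact integral_prod _ hF

/-- The factors combine to `c^{-k} λ^k = e^{ks}`: the argument of the nonlinearity is the unscaled
unknown, which does not see the choice of the vertex. -/
lemma resc_pow {s : ℝ} (hs : 0 < Real.exp (-s) - δ) (y : Eucl N) :
    |(Real.exp (-s) - δ) ^ (-k) * resc δ k w s y| ^ p =
      Real.exp (k * p * s) * resc δ 0 (fun s z => |w s z| ^ p) s y := by
  have hl := one_sub_pos_of hs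
  have h1 : (Real.exp (-s) - δ) ^ (-k) * (1 - δ * Real.exp s) ^ k = Real.exp (k * s) := by
    rw [one_sub_mul_exp, Real.div_rpow hs.le (Real.exp_pos _).le, Real.rpow_neg hs.le]
    have := (Real.rpow_pos_of_pos hs k).ne'
    field_simp
    rw [← Real.exp_mul, ← Real.exp_add, eq_comm, Real.exp_eq_one_iff]
    ring
  simp only [resc]
  rw [← mul_assoc, h1, abs_mul, abs_of_pos (Real.exp_pos _), Real.mul_rpow (Real.exp_pos _).le
    (abs_nonneg _), ← Real.exp_mul, Real.rpow_zero, one_mul]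
  congr 2; ring

/-- The energy inequality for the rescaled solution of the nonlinear equation. -/
theorem NonlinWave.energy_le (h : NonlinWave N k p M r a b f w A G S₁ S₂)
    (hα : 0 < α) (hγ : 0 < γ) (hst : StaticIneq N α k p γ c₀ C₀ η₀) (hp : 1 < p) (hq₀ : 0 ≤ q)
    (hq : q < p) (hM : 0 < M) (hf : LocallyLipschitz f) (hfb : ∀ x, |f x| ≤ M * (1 + |x| ^ q))
    {C η₁ : ℝ}
    (hdiss : ∀ c : ℝ, 0 < c → c ≤ 1 → c ^ γ ≤ η₁ → ∀ (w v : ℝ) (g : Fin N → ℝ) (S₂ : ℝ) (y : Eucl N),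
      y ∈ unitBall N → |S₂| ≤ M * (c ^ (k + 2) + c * |v + k * w + ∑ i, y i * g i|) →
      dissDensity k p γ c₀ C₀ c (npot p f) (nlin p f) w v g
        (c ^ (k + 2) * nlin p f (c ^ (-k) * w)) S₂ y ≤ C * (c ^ γ) ^ 2)
    (hgeo : ∀ s ∈ Icc a b, 0 < Real.exp (-s) - δ ∧ Real.exp (-s) - δ < Real.exp (-s) * r)
    (hc1 : ∀ s ∈ Icc a b, Real.exp (-s) - δ ≤ 1)
    (hη : ∀ s ∈ Icc a b, (Real.exp (-s) - δ) ^ γ ≤ η₀ ∧ (Real.exp (-s) - δ) ^ γ ≤ η₁)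
    (hpa : Integrable (fun y => |resc δ k w a y| ^ (p + 1)) (ballMeas N α))
    (hpb : Integrable (fun y => |resc δ k w b y| ^ (p + 1)) (ballMeas N α)) :
    rescEnergy N k p γ α δ (npot p f) w A G b - rescEnergy N k p γ α δ (npot p f) w A G a ≤
      ∫ s in a..b, timeWeight p γ δ s *
        (C * ((Real.exp (-s) - δ) ^ γ) ^ 2 * (ballMeas N α).real univ) := by
  have hfin := isFiniteMeasure_ballMeas (N := N) hα.le
  have hab := h.sys.hab
  have hpos : ∀ s ∈ Icc a b, 0 < Real.exp (-s) - δ := fun s hs => (hgeo s hs).1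
  obtain ⟨B, hB⟩ := h.bdd₂
  have cb : ∀ j : ℝ, BddMeas N a b fun s _ => (Real.exp (-s) - δ) ^ j := fun j =>
    BddMeas.of_time (by fun_prop) (continuousOn_rpow_exp hpos j)
  have twb : BddMeas N a b fun s _ => timeWeight p γ δ s :=
    BddMeas.of_time (measurable_timeWeight _ _ _) (continuousOn_timeWeight hpos)
  have hW : TimeSup N α a b (resc δ k w) := h.sys.fw.timeSup_resc hα.le hpos k
  have hA : TimeSup N α a b (resc δ (k + 1) A) := h.sys.fA.timeSup_resc hα.le hpos (k + 1)
  have hG : ∀ i, TimeSup N α a b (resc δ (k + 1) (G i)) := fun i =>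
    (h.sys.fG i).timeSup_resc hα.le hpos (k + 1)
  have hV : TimeSup N α a b (rescV k δ w A G) :=
    (hA.sub (hW.mul_bdd (BddMeas.const k))).sub (TimeSup.sum _ fun i =>
      (hG i).mul_bdd (BddMeas.of_space (by fun_prop)))
  have hT₁ : TimeL1 N α a b (resc δ (k + 1 + 1) S₁) :=
    TimeL1.resc hα.le hpos _ h.src₁.meas h.src₁.fin
  have hT₂ : TimeSup N α a b (resc δ (k + 1 + 1) S₂) :=
    TimeSup.resc hα.le hpos _ h.src₂.meas (B := B.toNNReal) fun s hs => by
      rw [← ENNReal.ofReal_toReal (h.src₂.memLp s).eLpNorm_ne_top]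
      exact ENNReal.ofReal_le_ofReal (hB s hs)
  set X : ℝ → Eucl N → ℝ := fun s y => (Real.exp (-s) - δ) ^ (-k) * resc δ k w s y with hXd
  set Y : ℝ → Eucl N → ℝ := fun s y => (Real.exp (-s) - δ) ^ (-k) *
    (rescV k δ w A G s y + k * resc δ k w s y) with hYd
  have hX : TimeSup N α a b X := hW.mul_bdd (cb _)
  have hY : TimeSup N α a b Y := (hV.add (hW.mul_bdd (BddMeas.const k))).mul_bdd (cb _)
  have hXp : ∫⁻ s in Icc a b, eLpNorm (fun y => |X s y| ^ p) 2 (ballMeas N α) < ⊤ := by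
    have h1 := (TimeL1.resc hα.le hpos 0 (u := fun s z => |w s z| ^ p)
      (h.sys.fw.meas.abs.pow_const p) h.pow).mul_bdd
      (m := fun s _ => Real.exp (k * p * s)) (BddMeas.of_time (by fun_prop) (by fun_prop))
    refine lt_of_eq_of_lt (setLIntegral_congr_fun measurableSet_Icc fun s hs => ?_) h1.fin
    congr 1
    ext y
    exact resc_pow (hpos s hs) y
  have hXpL : TimeL1 N α a b fun s y => |X s y| ^ p := ⟨hX.meas.abs.pow_const p, hXp⟩
  have hXa := hX.abs
  have hYa := hY.abs
  have h1X := (((TimeSup.const hα.le (1 : ℝ)).timeL1 (N := N) (a := a) (b := b)).add hXpL)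
  -- The majorant `(1 + |X|^p)|X|` pairs `L¹` in time with `L^∞` in time, both with values in `L²`.
  -- No space-time bound on `|X|^{p+1}` is assumed. The term `t2` is handled in the same way with
  -- `Y`.
  have t1 := intTendsto_of_dominated (α := α)
    (m := fun s _ => timeWeight p γ δ s * ((Real.exp (-s) - δ) ^ (2 * (k + 1)) *
      ((p + 3) / 2 * (Real.exp (-s) - δ) ^ γ + 2 * (k + 1))))
    (twb.mul ((cb _).mul (((BddMeas.const _).mul (cb γ)).add (BddMeas.const _))))
    (F := fun n s y => npotT p f n (X s y)) (F₀ := fun s y => npot p f (X s y))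
    (H := fun s y => (1 + 2 * M) * ((1 + |X s y| ^ p) * |X s y|))
    (fun n => (continuous_iff_continuousAt.2 fun x =>
      (hasDerivAt_npotT hp hf n x).continuousAt).measurable.comp hX.meas)
    ((h1X.integrable_mul hXa).const_mul (1 + 2 * M))
    (fun n s y => by
      refine (abs_npotT_le hp hq₀ hq hM hfb n.cast_nonneg _).trans_eq ?_
      rw [Real.rpow_add_one' (abs_nonneg _) (by linarith)]; ring)
    (fun s y => tendsto_npotT hp hf _)
  have t2 := intTendsto_of_dominated (α := α)
    (m := fun s _ => timeWeight p γ δ s * (Real.exp (-s) - δ) ^ (2 * (k + 1)))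
    (twb.mul (cb _))
    (F := fun n s y => nlinT p f n (X s y) * Y s y) (F₀ := fun s y => nlin p f (X s y) * Y s y)
    (H := fun s y => (1 + 2 * M) * ((1 + |X s y| ^ p) * |Y s y|))
    (fun n => ((continuous_nlinT hp hf n).measurable.comp hX.meas).mul hY.meas)
    ((h1X.integrable_mul hYa).const_mul (1 + 2 * M))
    (fun n s y => by
      rw [abs_mul]
      refine (mul_le_mul_of_nonneg_right (abs_nlinT_le hp hq₀ hq hM hfb n.cast_nonneg _).1
        (abs_nonneg _)).trans_eq ?_
      ring)
    (fun s y => (tendsto_nlinT _).mul_const _)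
  set μ := (volume.restrict (Icc a b)).prod (ballMeas N α) with hμ
  set L : ℝ → Eucl N → ℝ := fun s y => resc δ (k + 1 + 1) S₁ s y * rescV k δ w A G s y
    - (Real.exp (-s) - δ) ^ γ * (resc δ (k + 1 + 1) S₁ s y * resc δ k w s y)
    - (c₀ * (Real.exp (-s) - δ) ^ γ) * (rescV k δ w A G s y * rescV k δ w A G s y
      + (∑ i, ((1 - ‖y‖ ^ 2) * resc δ (k + 1) (G i) s y) * resc δ (k + 1) (G i) s y)
      + resc δ k w s y * resc δ k w s y)
    + C₀ * (((1 - ‖y‖ ^ 2) * resc δ (k + 1 + 1) S₂ s y) * resc δ (k + 1 + 1) S₂ s y) with hL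
  have ht : BddMeas N a b fun _ y => 1 - ‖y‖ ^ 2 := BddMeas.of_space (by fun_prop)
  have hsq : ∀ {F F₁ : ℝ → Eucl N → ℝ}, TimeSup N α a b F → TimeSup N α a b F₁ →
      Integrable (Function.uncurry fun s y => F s y * F₁ s y) μ := fun hF hF₁ =>
    hF.timeL1.integrable_mul hF₁
  have hLm : Measurable (Function.uncurry L) := by
    have m1 := hT₁.meas
    have m2 := hT₂.meas
    have m3 := hW.meas
    have m4 := hV.meas
    have m5 := fun i => (hG i).meas
    simp only [hL] at m1 m2 m3 m4 m5 ⊢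
    fun_prop
  have hLi : Integrable (Function.uncurry L) μ := by
    have i1 := hT₁.integrable_mul hV
    have i2 := (cb γ).mul_integrable (hT₁.integrable_mul hW) (hT₁.meas.mul hW.meas)
    have i3 : Integrable (Function.uncurry fun s y => rescV k δ w A G s y * rescV k δ w A G s y
      + (∑ i, ((1 - ‖y‖ ^ 2) * resc δ (k + 1) (G i) s y) * resc δ (k + 1) (G i) s y)
      + resc δ k w s y * resc δ k w s y) μ :=
      ((hsq hV hV).add (integrable_finsetSum _ fun i _ => hsq ((hG i).mul_bdd ht) (hG i))).add
        (hsq hW hW)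
    have m3 : Measurable (Function.uncurry fun s y => rescV k δ w A G s y * rescV k δ w A G s y
      + (∑ i, ((1 - ‖y‖ ^ 2) * resc δ (k + 1) (G i) s y) * resc δ (k + 1) (G i) s y)
      + resc δ k w s y * resc δ k w s y) :=
      ((hV.meas.mul hV.meas).add (Finset.measurable_fun_sum _ fun i _ =>
        ((hG i).mul_bdd ht).meas.mul (hG i).meas)).add (hW.meas.mul hW.meas)
    have i4 := ((BddMeas.const c₀).mul (cb γ)).mul_integrable i3 m3
    have i5 := (hsq (hT₂.mul_bdd ht) hT₂).const_mul C₀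
    exact ((i1.sub i2).sub i4).add i5
  have t0 : IntTendsto μ (fun (_ : ℕ) x => timeWeight p γ δ x.1 * L x.1 x.2)
      (fun x => timeWeight p γ δ x.1 * L x.1 x.2) atTop :=
    ⟨fun _ => twb.mul_integrable hLi hLm, twb.mul_integrable hLi hLm, tendsto_const_nhds⟩
  have tt := (t0.add t1).sub t2
  -- Everything independent of the truncation is collected in `L`; only two terms contain `Γ` or
  -- `Γ'`, and their limits are `t1` and `t2`.
  have hdec : ∀ (Γ Γ' : ℝ → ℝ) (x : ℝ × Eucl N), timeWeight p γ δ x.1 *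
      dissDensity k p γ c₀ C₀ (Real.exp (-x.1) - δ) Γ Γ' (resc δ k w x.1 x.2)
          (rescV k δ w A G x.1 x.2) (fun i => resc δ (k + 1) (G i) x.1 x.2)
          (resc δ (k + 1 + 1) S₁ x.1 x.2) (resc δ (k + 1 + 1) S₂ x.1 x.2) x.2 =
      timeWeight p γ δ x.1 * L x.1 x.2 + (timeWeight p γ δ x.1 *
        ((Real.exp (-x.1) - δ) ^ (2 * (k + 1)) * ((p + 3) / 2 * (Real.exp (-x.1) - δ) ^ γ + 2 * (k + 1))))
        * Γ (X x.1 x.2) - (timeWeight p γ δ x.1 * (Real.exp (-x.1) - δ) ^ (2 * (k + 1))) *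
          (Γ' (X x.1 x.2) * Y x.1 x.2) := by
    intro Γ Γ' x
    have : ∑ i, ((1 - ‖x.2‖ ^ 2) * resc δ (k + 1) (G i) x.1 x.2) * resc δ (k + 1) (G i) x.1 x.2 =
        (1 - ‖x.2‖ ^ 2) * ∑ i, resc δ (k + 1) (G i) x.1 x.2 ^ 2 := by
      rw [Finset.mul_sum]
      exact Finset.sum_congr rfl fun i _ => by ring
    simp only [dissDensity, potRate, hL, hXd, hYd]
    rw [this]
    ring
  simp only [← hdec] at tt
  have hbal : ∀ᵐ y ∂(ballMeas N α), y ∈ unitBall N := ae_ballMeas_mem α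
  have hE : ∀ s ∈ Icc a b, Integrable (fun y => |resc δ k w s y| ^ (p + 1)) (ballMeas N α) →
      Tendsto (fun n : ℕ => rescEnergy N k p γ α δ (npotT p f n) w A G s) atTop
        (𝓝 (rescEnergy N k p γ α δ (npot p f) w A G s)) := fun s hs hi =>
    (energyDensity_intTendsto hbal hp hq₀ hq hM hf hfb (hW.memLp hs) (hV.memLp hs)
      (fun i => (hG i).memLp hs) hi).2.2
  have hle : ∀ n : ℕ, rescEnergy N k p γ α δ (npotT p f n) w A G b
      - rescEnergy N k p γ α δ (npotT p f n) w A G a ≤ _ := fun n => by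
    obtain ⟨K', hK'⟩ := exists_lipschitz_nlinT hp hf n
    have := h.sys.energy_le hα hγ hst h.src₁ h.src₂ hB hgeo (fun s hs => (hη s hs).1)
      (hasDerivAt_npotT hp hf n) hK' (fun x => (abs_nlinT_le hp hq₀ hq hM hfb n.cast_nonneg x).2)
    simp only [← integral_const_mul] at this
    exact this.trans_eq (integral_prod_eq_interval hab (tt.1 n)).symm
  refine (le_of_tendsto_of_tendsto ((hE b ⟨hab, le_rfl⟩ hpb).sub (hE a ⟨le_rfl, hab⟩ hpa))
    tt.2.2 (.of_forall hle)).trans ?_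
  have hη2 : BddMeas N a b fun s _ => timeWeight p γ δ s * (C * ((Real.exp (-s) - δ) ^ γ) ^ 2) :=
    twb.mul ((BddMeas.const C).mul (cb γ).sq)
  have hfinal : ∫ x, timeWeight p γ δ x.1 * (C * ((Real.exp (-x.1) - δ) ^ γ) ^ 2) ∂μ =
      ∫ s in a..b, timeWeight p γ δ s *
        (C * ((Real.exp (-s) - δ) ^ γ) ^ 2 * (ballMeas N α).real univ) := by
    rw [integral_prod_eq_interval (F := fun s _ => timeWeight p γ δ s *
      (C * ((Real.exp (-s) - δ) ^ γ) ^ 2)) hab (hη2.integrable hα.le)]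
    refine intervalIntegral.integral_congr fun s _ => ?_
    simp only [integral_const, smul_eq_mul]
    ring
  rw [← hfinal]
  refine integral_mono_ae tt.2.1 (hη2.integrable hα.le) ?_
  have h1 : ∀ᵐ x ∂μ, ∀ z, ‖z‖ < r →
      S₁ x.1 z = Real.exp (-(k + 2) * x.1) * nlin p f (Real.exp (k * x.1) * w x.1 z) :=
    Measure.quasiMeasurePreserving_fst.ae h.eq₁
  filter_upwards [h1, ae_prod_ballMeas_mem a b α] with x hx hxm
  obtain ⟨s, y⟩ := x
  obtain ⟨hs, hy⟩ := hxm
  simp only at hs hy hx ⊢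
  have hcp := hpos s hs
  have hl := one_sub_pos_of hcp
  refine mul_le_mul_of_nonneg_left ?_ (timeWeight_pos hcp).le
  -- The dilated point stays in the ball of radius `r`, where the source is known in terms of `w`
  -- and `A`.
  have hlr : ‖(1 - δ * Real.exp s) • y‖ < r := by
    rw [norm_smul, Real.norm_of_nonneg hl.le]
    have h2 : 1 - δ * Real.exp s < r := by
      rw [one_sub_mul_exp, div_lt_iff₀ (Real.exp_pos _), mul_comm]
      exact (hgeo s hs).2
    refine lt_of_le_of_lt ?_ h2
    exact mul_le_of_le_one_right hl.le (mem_unitBall.1 hy).le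
  -- Powers of `λ` convert the weights `e^{-js}` of the original vertex into the weights `c^j` of
  -- the shifted one. Hence the rescaled source has the form which `hdiss` expects.
  have hce : ∀ j : ℝ, (1 - δ * Real.exp s) ^ j * Real.exp (-j * s) = (Real.exp (-s) - δ) ^ j := by
    intro j
    rw [one_sub_mul_exp, Real.div_rpow hcp.le (Real.exp_pos _).le, ← Real.exp_mul]
    have : -s * j = -j * s := by ring
    rw [this, div_mul_cancel₀ _ (Real.exp_pos _).ne']
  have hS₁ : resc δ (k + 1 + 1) S₁ s y = (Real.exp (-s) - δ) ^ (k + 2) *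
      nlin p f ((Real.exp (-s) - δ) ^ (-k) * resc δ k w s y) := by
    have h3 : (Real.exp (-s) - δ) ^ (-k) * resc δ k w s y =
        Real.exp (k * s) * w s ((1 - δ * Real.exp s) • y) := by
      rw [resc, ← hce (-k), Real.rpow_neg hl.le]
      have := (Real.rpow_pos_of_pos hl k).ne'
      rw [neg_neg]
      field_simp
    rw [h3, resc, hx _ hlr, ← hce, show k + 1 + 1 = k + 2 by ring]
    ring
  rw [hS₁]
  refine hdiss _ hcp (hc1 s hs) (hη s hs).2 _ _ _ _ y hy ?_
  have h4 : rescV k δ w A G s y + k * resc δ k w s y + ∑ i, y i * resc δ (k + 1) (G i) s y =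
      resc δ (k + 1) A s y := by rw [rescV]; ring
  rw [h4, resc, abs_mul, abs_of_pos (Real.rpow_pos_of_pos hl _)]
  refine (mul_le_mul_of_nonneg_left (h.le₂ s hs _ hlr) (Real.rpow_nonneg hl.le _)).trans_eq ?_
  have h5 : Real.exp (-(k + 2) * s) * Real.exp ((k + 1) * s) = Real.exp (-1 * s) := by
    rw [← Real.exp_add]; congr 1; ring
  have h6 := hce 1
  rw [Real.rpow_one, Real.rpow_one] at h6
  rw [resc, abs_mul, abs_of_pos (Real.rpow_pos_of_pos hl _), ← hce (k + 2), ← h6, ← h5,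
    show k + 1 + 1 = k + 2 by ring, show k + 2 = (k + 1) + 1 by ring, Real.rpow_add_one hl.ne']
  ring

/-- The energy, corrected by a multiple of `c^{2γ}`, decreases. -/
lemma NonlinWave.lyapunov_le (h : NonlinWave N k p M r a b f w A G S₁ S₂)
    (hα : 0 < α) (hγ : 0 < γ) (hst : StaticIneq N α k p γ c₀ C₀ η₀) (hp : 1 < p) (hq₀ : 0 ≤ q)
    (hq : q < p) (hM : 0 < M) (hf : LocallyLipschitz f) (hfb : ∀ x, |f x| ≤ M * (1 + |x| ^ q))
    {C η₁ θ : ℝ} (hC : 0 ≤ C)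
    (hdiss : ∀ c : ℝ, 0 < c → c ≤ 1 → c ^ γ ≤ η₁ → ∀ (w v : ℝ) (g : Fin N → ℝ) (S₂ : ℝ) (y : Eucl N),
      y ∈ unitBall N → |S₂| ≤ M * (c ^ (k + 2) + c * |v + k * w + ∑ i, y i * g i|) →
      dissDensity k p γ c₀ C₀ c (npot p f) (nlin p f) w v g
        (c ^ (k + 2) * nlin p f (c ^ (-k) * w)) S₂ y ≤ C * (c ^ γ) ^ 2)
    (hθ : C * (ballMeas N α).real univ * Real.exp ((p + 3) / (2 * γ)) / (2 * γ) ≤ θ)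
    (hgeo : ∀ s ∈ Icc a b, 0 < Real.exp (-s) - δ ∧ Real.exp (-s) - δ < Real.exp (-s) * r)
    (hc1 : ∀ s ∈ Icc a b, Real.exp (-s) - δ ≤ 1)
    (hη : ∀ s ∈ Icc a b, (Real.exp (-s) - δ) ^ γ ≤ η₀ ∧ (Real.exp (-s) - δ) ^ γ ≤ η₁)
    (hpa : Integrable (fun y => |resc δ k w a y| ^ (p + 1)) (ballMeas N α))
    (hpb : Integrable (fun y => |resc δ k w b y| ^ (p + 1)) (ballMeas N α)) :
    rescEnergy N k p γ α δ (npot p f) w A G b + θ * (Real.exp (-b) - δ) ^ (2 * γ) ≤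
      rescEnergy N k p γ α δ (npot p f) w A G a + θ * (Real.exp (-a) - δ) ^ (2 * γ) := by
  have hab := h.sys.hab
  have hpos : ∀ s ∈ Icc a b, 0 < Real.exp (-s) - δ := fun s hs => (hgeo s hs).1
  have h1 := h.energy_le hα hγ hst hp hq₀ hq hM hf hfb hdiss hgeo hc1 hη hpa hpb
  have hprim := isPrim_rpow_exp hab (2 * γ) hpos
  set V := (ballMeas N α).real univ with hV
  have hV0 : 0 ≤ V := measureReal_nonneg
  have hγ2 : ∀ s ∈ Icc a b, ((Real.exp (-s) - δ) ^ γ) ^ 2 = (Real.exp (-s) - δ) ^ (2 * γ) := by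
    intro s hs
    rw [← Real.rpow_natCast, ← Real.rpow_mul (hpos s hs).le, mul_comm]; norm_num
  -- The correction `θ c^{2γ}` decreases at the rate `2γθ c^{2γ}` in the time `s'`, the same power
  -- as the error `C η²`. The exponential weight is at most `exp((p+3)/(2γ))` because `c ≤ 1`, which
  -- explains the threshold on `θ`.
  have h2 : ∫ s in a..b, timeWeight p γ δ s * (C * ((Real.exp (-s) - δ) ^ γ) ^ 2 * V) ≤
      ∫ s in a..b, -θ * ((1 - δ * Real.exp s)⁻¹ * (-(2 * γ) * (Real.exp (-s) - δ) ^ (2 * γ))) := by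
    refine intervalIntegral.integral_mono_on hab ?_ (hprim.intervalIntegrable.const_mul _)
      fun s hs => ?_
    · refine ContinuousOn.intervalIntegrable ?_
      rw [uIcc_of_le hab]
      exact (continuousOn_timeWeight hpos).mul ((continuousOn_const.mul
        ((continuousOn_rpow_exp hpos γ).pow 2)).mul continuousOn_const)
    · have hl := one_sub_pos_of (hpos s hs)
      rw [hγ2 s hs, timeWeight]
      have hz := Real.rpow_nonneg (hpos s hs).le (2 * γ)
      set z := (Real.exp (-s) - δ) ^ (2 * γ)
      have h3 : Real.exp ((p + 3) / (2 * γ) * (Real.exp (-s) - δ) ^ γ) ≤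
          Real.exp ((p + 3) / (2 * γ)) := by
        refine Real.exp_le_exp.2 (mul_le_of_le_one_right (by positivity) ?_)
        exact Real.rpow_le_one (hpos s hs).le (hc1 s hs) hγ.le
      have h4 : C * V * Real.exp ((p + 3) / (2 * γ)) ≤ θ * (2 * γ) := by
        rwa [div_le_iff₀ (by positivity)] at hθ
      have h5 := mul_le_mul_of_nonneg_left h3 (mul_nonneg hC hV0)
      have h6 := mul_le_mul_of_nonneg_left (h5.trans h4) (mul_nonneg (inv_pos.2 hl).le hz)
      linarith
  rw [intervalIntegral.integral_const_mul, hprim.integral_eq] at h2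
  linarith

end NonlinearEnergy

/-! ### Weak gradients. -/

section WeakGradient

variable {N : ℕ}

lemma inner_gradient_eq (ψ : Eucl N → ℝ) (y e : Eucl N) :
    inner ℝ (gradient ψ y) e = fderiv ℝ ψ y e := by
  rw [gradient, InnerProductSpace.toDual_symm_apply]

lemma inner_gradient_eq' (ψ : Eucl N → ℝ) (y e : Eucl N) :
    inner ℝ e (gradient ψ y) = fderiv ℝ ψ y e := by
  rw [real_inner_comm, inner_gradient_eq]

lemma continuous_gradient {ψ : Eucl N → ℝ} (h : ContDiff ℝ ∞ ψ) : Continuous (gradient ψ) :=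
  (InnerProductSpace.toDual ℝ (Eucl N)).symm.continuous.comp (h.continuous_fderiv (by simp))

lemma integrable_smul_of_compact {E : Type*} [NormedAddCommGroup E] [NormedSpace ℝ E]
    {U : Set (Eucl N)} {u : Eucl N → ℝ} {F : Eucl N → E} {K : Set (Eucl N)} (hK : IsCompact K)
    (hKU : K ⊆ U) (hu : LocallyIntegrableOn u U) (hF : Continuous F) (h0 : ∀ y ∉ K, F y = 0) :
    Integrable (fun y => u y • F y) := by
  have h1 : IntegrableOn (fun y => u y • F y) K :=
    (hu.integrableOn_compact_subset hKU hK).smul_continuousOn hF.continuousOn hK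
  refine (integrableOn_iff_integrable_of_support_subset fun y hy => ?_).1 h1
  by_contra hc
  exact hy (by simp [h0 y hc])

lemma integrable_smul_of_compact' {E : Type*} [NormedAddCommGroup E] [NormedSpace ℝ E]
    {U : Set (Eucl N)} {u : Eucl N → ℝ} {F : Eucl N → E} {K : Set (Eucl N)} (hK : IsCompact K)
    (hKU : K ⊆ U) (hF : LocallyIntegrableOn F U) (hu : Continuous u) (h0 : ∀ y ∉ K, u y = 0) :
    Integrable (fun y => u y • F y) := by
  have h1 : IntegrableOn (fun y => u y • F y) K :=
    (hF.integrableOn_compact_subset hKU hK).continuousOn_smul hu.continuousOn hK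
  refine (integrableOn_iff_integrable_of_support_subset fun y hy => ?_).1 h1
  by_contra hc
  exact hy (by simp [h0 y hc])

lemma gradient_eq_zero {ψ : Eucl N → ℝ} {y : Eucl N} (h : y ∉ tsupport ψ) : gradient ψ y = 0 := by
  have h1 : ψ =ᶠ[𝓝 y] fun _ => 0 := notMem_tsupport_iff_eventuallyEq.1 h
  rw [gradient, h1.fderiv_eq]
  simp

namespace HasWeakGrad

variable {u u₁ : Eucl N → ℝ} {G G₁ : Eucl N → Eucl N}

lemma integrable_left (h : HasWeakGrad N u G) {ψ : Eucl N → ℝ} (hψ : IsTestFun N ψ) :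
    Integrable fun y => u y • gradient ψ y :=
  integrable_smul_of_compact hψ.2.1 hψ.2.2 h.1 (continuous_gradient hψ.1) fun _ => gradient_eq_zero

lemma integrable_right (h : HasWeakGrad N u G) {ψ : Eucl N → ℝ} (hψ : IsTestFun N ψ) :
    Integrable fun y => ψ y • G y :=
  integrable_smul_of_compact' hψ.2.1 hψ.2.2 h.2.1 hψ.1.continuous fun _ => image_eq_zero_of_notMem_tsupport

lemma sub (h : HasWeakGrad N u G) (h₁ : HasWeakGrad N u₁ G₁) :
    HasWeakGrad N (u - u₁) (G - G₁) := by
  refine ⟨h.1.sub h₁.1, h.2.1.sub h₁.2.1, fun ψ hψ => ?_⟩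
  simp only [Pi.sub_apply, sub_smul, smul_sub]
  rw [integral_sub (h.integrable_left hψ).integrableOn (h₁.integrable_left hψ).integrableOn,
    integral_sub (h.integrable_right hψ).integrableOn (h₁.integrable_right hψ).integrableOn,
    h.2.2 ψ hψ, h₁.2.2 ψ hψ]
  abel

lemma congr (h : HasWeakGrad N u G) (e : u =ᵐ[volume.restrict (unitBall N)] u₁) :
    HasWeakGrad N u₁ G := by
  refine ⟨h.1.congr e, h.2.1, fun ψ hψ => ?_⟩
  rw [← h.2.2 ψ hψ]
  exact integral_congr_ae (e.mono fun y hy => by simp only [hy])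

/-- Fundamental lemma of the calculus of variations. The function `weakGrad` is selected by choice,
so every identity for it goes through this uniqueness up to null sets. -/
lemma unique (h : HasWeakGrad N u G) (h₁ : HasWeakGrad N u G₁) :
    G =ᵐ[volume.restrict (unitBall N)] G₁ := by
  have key := (Metric.isOpen_ball (x := (0 : Eucl N)) (ε := 1)).ae_eq_zero_of_integral_contDiff_smul_eq_zero
    (f := G - G₁) (μ := volume) (h.2.1.sub h₁.2.1) fun ψ h1 h2 h3 => by
      have hψ : IsTestFun N ψ := ⟨h1, h2, h3⟩
      have e1 : ∫ x, ψ x • (G - G₁) x = ∫ x in unitBall N, ψ x • (G - G₁) x := by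
        rw [setIntegral_eq_integral_of_forall_compl_eq_zero fun x hx => ?_]
        rw [image_eq_zero_of_notMem_tsupport fun hc => hx (h3 hc), zero_smul]
      rw [e1]
      simp only [Pi.sub_apply, smul_sub]
      rw [integral_sub (h.integrable_right hψ).integrableOn (h₁.integrable_right hψ).integrableOn,
        sub_eq_zero, ← neg_inj, ← h.2.2 ψ hψ, ← h₁.2.2 ψ hψ]
  rw [Filter.EventuallyEq, ae_restrict_iff' measurableSet_unitBall]
  exact key.mono fun y hy hm => sub_eq_zero.1 (hy hm)

lemma weakGrad (h : HasWeakGrad N u G) : HasWeakGrad N u (weakGrad N u) := by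
  have hex : ∃ G, HasWeakGrad N u G := ⟨G, h⟩
  rw [_root_.weakGrad, dif_pos hex]
  exact hex.choose_spec

/-- The defining identity of the weak gradient, by components. -/
lemma integral_dirD (h : HasWeakGrad N u G) {ψ : Eucl N → ℝ} (hψ : IsTestFun N ψ) (i : Fin N) :
    ∫ y in unitBall N, u y * dirD (EuclideanSpace.single i 1) ψ y =
      -∫ y in unitBall N, G y i * ψ y := by
  have h1 := congrArg (fun x => EuclideanSpace.proj (𝕜 := ℝ) i x) (h.2.2 ψ hψ)
  simp only [map_neg] at h1
  rw [← ContinuousLinearMap.integral_comp_comm _ (h.integrable_left hψ).integrableOn,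
    ← ContinuousLinearMap.integral_comp_comm _ (h.integrable_right hψ).integrableOn] at h1
  have e1 : ∀ y, EuclideanSpace.proj (𝕜 := ℝ) i (u y • gradient ψ y) =
      u y * dirD (EuclideanSpace.single i 1) ψ y := fun y => by
    rw [map_smul, smul_eq_mul, dirD, ← inner_gradient_eq, EuclideanSpace.inner_single_right]
    simp
  have e2 : ∀ y, EuclideanSpace.proj (𝕜 := ℝ) i (ψ y • G y) = G y i * ψ y := fun y => by
    rw [map_smul, smul_eq_mul, mul_comm]; rfl
  simpa only [e1, e2] using h1

lemma weakGrad_sub (h : HasWeakGrad N u G) (h₁ : HasWeakGrad N u₁ G₁) :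
    _root_.weakGrad N (u - u₁) =ᵐ[volume.restrict (unitBall N)]
      _root_.weakGrad N u - _root_.weakGrad N u₁ :=
  (h.sub h₁).weakGrad.unique (h.weakGrad.sub h₁.weakGrad)

lemma weakGrad_congr (h : HasWeakGrad N u G) (e : u =ᵐ[volume.restrict (unitBall N)] u₁) :
    _root_.weakGrad N u =ᵐ[volume.restrict (unitBall N)] _root_.weakGrad N u₁ :=
  (h.weakGrad.congr e).unique (h.congr e).weakGrad

lemma aestronglyMeasurable (h : HasWeakGrad N u G) :
    AEStronglyMeasurable G (volume.restrict (unitBall N)) := h.2.1.aestronglyMeasurable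

end HasWeakGrad

end WeakGradient

/-! ### The energy space and its control of `L²` norms in smaller balls. -/

section EnergySpace

variable {N : ℕ} {p r : ℝ} {w₁ w₂ u₁ u₂ : Eucl N → ℝ}

lemma norm_sq_eq_sum (x : Eucl N) : ‖x‖ ^ 2 = ∑ i, x i ^ 2 := by
  rw [EuclideanSpace.norm_sq_eq]; simp

lemma coord_sq_le (x : Eucl N) (i : Fin N) : x i ^ 2 ≤ ‖x‖ ^ 2 := by
  rw [← sq_abs (x i)]
  exact pow_le_pow_left₀ (abs_nonneg _) (PiLp.norm_apply_le x i) 2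

lemma wRho_pos {y : Eucl N} (hy : y ∈ unitBall N) : 0 < wRho N p y :=
  Real.rpow_pos_of_pos (one_sub_pos hy) _

lemma hDensity_nonneg {y : Eucl N} (hy : y ∈ unitBall N) : 0 ≤ hDensity N p w₁ w₂ y := by
  have := one_sub_pos hy
  have := wRho_pos (p := p) hy
  unfold hDensity
  positivity

lemma MemH.sub (h : MemH N p w₁ w₂) (h' : MemH N p u₁ u₂) : MemH N p (w₁ - u₁) (w₂ - u₂) := by
  obtain ⟨m1, m2, ⟨G, hG⟩, hi⟩ := h
  obtain ⟨m1', m2', ⟨G', hG'⟩, hi'⟩ := h'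
  have hgm := (hG.sub hG').weakGrad.aestronglyMeasurable
  refine ⟨m1.sub m1', m2.sub m2', ⟨_, hG.sub hG'⟩, ?_⟩
  refine Integrable.mono' ((hi.const_mul 2).add (hi'.const_mul 2)) ?_ ?_
  · have hρ : Measurable (wRho N p) := measurable_weight _
    have h1 : Measurable fun y : Eucl N => 1 - ‖y‖ ^ 2 := by fun_prop
    exact ((((m2.sub m2').pow 2).add ((hgm.norm.pow 2).mul h1.aestronglyMeasurable)).add
      ((m1.sub m1').pow 2)).mul hρ.aestronglyMeasurable
  · filter_upwards [hG.weakGrad_sub hG', ae_restrict_mem measurableSet_unitBall] with y hy hm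
    rw [Real.norm_of_nonneg (hDensity_nonneg hm)]
    have hρ := wRho_pos (p := p) hm
    have ht := one_sub_pos hm
    have h2 : ∀ a b : ℝ, (a - b) ^ 2 ≤ 2 * a ^ 2 + 2 * b ^ 2 := fun a b => by
      nlinarith [sq_nonneg (a + b)]
    have h3 : ‖weakGrad N w₁ y - weakGrad N u₁ y‖ ^ 2 ≤
        2 * ‖weakGrad N w₁ y‖ ^ 2 + 2 * ‖weakGrad N u₁ y‖ ^ 2 := by
      refine (pow_le_pow_left₀ (norm_nonneg _) (norm_sub_le _ _) 2).trans ?_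
      nlinarith [sq_nonneg (‖weakGrad N w₁ y‖ - ‖weakGrad N u₁ y‖)]
    simp only [hDensity, hy, Pi.sub_apply, Pi.add_apply]
    have h4 := mul_le_mul_of_nonneg_right h3 ht.le
    have h5 := mul_le_mul_of_nonneg_right (add_le_add (add_le_add (h2 (w₂ y) (u₂ y)) h4)
      (h2 (w₁ y) (u₁ y))) hρ.le
    linarith

lemma ball_subset_unitBall (hr : r < 1) : Metric.ball (0 : Eucl N) r ⊆ unitBall N :=
  Metric.ball_subset_ball hr.le

/-- In a smaller ball, `L²` norms are controlled by the norm of the energy space. -/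
lemma MemH.sq_eLpNorm_le (h : MemH N p w₁ w₂) (hα : 0 < wAlpha N p) (hr0 : 0 < r) (hr : r < 1)
    {φ : Eucl N → ℝ} (hφ : ∀ᵐ y ∂volume.restrict (unitBall N),
      φ y ^ 2 ≤ w₂ y ^ 2 + ‖weakGrad N w₁ y‖ ^ 2 + w₁ y ^ 2) :
    eLpNorm φ 2 (volume.restrict (Metric.ball 0 r)) ^ 2 ≤
      ENNReal.ofReal (((1 - r ^ 2) ^ (wAlpha N p + 1))⁻¹ * hNormSq N p w₁ w₂) := by
  have hr2 : 0 < 1 - r ^ 2 := by nlinarith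
  set c := (1 - r ^ 2) ^ (wAlpha N p + 1) with hc
  have hc0 : 0 < c := Real.rpow_pos_of_pos hr2 _
  have hi := h.2.2.2
  have hnn : 0 ≤ᵐ[volume.restrict (unitBall N)] hDensity N p w₁ w₂ :=
    (ae_restrict_mem measurableSet_unitBall).mono fun y hy => hDensity_nonneg hy
  rw [sq_eLpNorm_eq_lintegral, ENNReal.ofReal_mul (by positivity), hNormSq,
    ofReal_integral_eq_lintegral_ofReal hi hnn, ← lintegral_const_mul' _ _ ENNReal.ofReal_ne_top]
  have hsub := ball_subset_unitBall (N := N) hr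
  refine le_trans ?_ (lintegral_mono_set hsub)
  refine lintegral_mono_ae ?_
  filter_upwards [ae_restrict_of_ae_restrict_of_subset hsub hφ,
    ae_restrict_mem Metric.isOpen_ball.measurableSet] with y hy hm
  have hyr : ‖y‖ < r := by simpa using hm
  have hyB := hsub hm
  rw [← ENNReal.ofReal_mul (by positivity), ← ofReal_norm, ← ENNReal.ofReal_pow (norm_nonneg _)]
  refine ENNReal.ofReal_le_ofReal ?_
  rw [Real.norm_eq_abs, sq_abs, le_inv_mul_iff₀ hc0]
  have h1 : 1 - r ^ 2 ≤ 1 - ‖y‖ ^ 2 := by nlinarith [norm_nonneg y]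
  have ht1 : 1 - ‖y‖ ^ 2 ≤ 1 := by nlinarith [norm_nonneg y]
  have h2 : c ≤ (1 - ‖y‖ ^ 2) * wRho N p y := by
    rw [wRho, mul_comm, ← Real.rpow_add_one (one_sub_pos hyB).ne']
    exact Real.rpow_le_rpow hr2.le h1 (by linarith)
  refine (mul_le_mul_of_nonneg_left hy hc0.le).trans ?_
  refine (mul_le_mul_of_nonneg_right h2 (by positivity)).trans ?_
  have hρ := wRho_pos (p := p) hyB
  rw [hDensity, mul_comm (1 - _), mul_assoc, mul_comm (wRho N p y)]
  refine mul_le_mul_of_nonneg_right ?_ hρ.le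
  have h3 := mul_le_mul_of_nonneg_right ht1 (sq_nonneg (w₂ y))
  have h4 := mul_le_mul_of_nonneg_right ht1 (sq_nonneg (w₁ y))
  linarith

end EnergySpace

/-! ### Jointly measurable versions of a finite energy solution. -/

section FieldVersions

variable {N : ℕ} {r a b : ℝ}

/-- The family is extended by zero in space and made constant in time outside `[a, b]` by
projection. This yields an `L²`-continuous family on the whole line, to which
`ContL2.exists_measurable` applies. -/
lemma exists_contField (hab : a ≤ b) {u : ℝ → Eucl N → ℝ}
    (hm : ∀ s ∈ Icc a b, MemLp (u s) 2 (volume.restrict (Metric.ball 0 r)))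
    (hc : ∀ s ∈ Icc a b, Tendsto (fun s' => eLpNorm (u s' - u s) 2 (volume.restrict (Metric.ball 0 r)))
      (𝓝[Icc a b] s) (𝓝 0)) :
    ∃ U, ContField N r U ∧ ∀ s ∈ Icc a b, U s =ᵐ[volume.restrict (Metric.ball 0 r)] u s := by
  have hB : MeasurableSet (Metric.ball (0 : Eucl N) r) := Metric.isOpen_ball.measurableSet
  set û : ℝ → Eucl N → ℝ := fun s => (Metric.ball (0 : Eucl N) r).indicator (u (projIcc a b hab s))
    with hû
  have h1 : ∀ s, MemLp (û s) 2 volume := fun s =>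
    (memLp_indicator_iff_restrict hB).2 (hm _ (projIcc a b hab s).2)
  have h2 : ContL2 volume û := fun s => by
    refine ⟨h1, h1 s, ?_⟩
    have e : ∀ s', eLpNorm (fun x => û s' x - û s x) 2 volume =
        eLpNorm (u (projIcc a b hab s') - u (projIcc a b hab s)) 2
          (volume.restrict (Metric.ball 0 r)) := fun s' => by
      rw [← eLpNorm_indicator_eq_eLpNorm_restrict hB, indicator_sub']
      rfl
    refine Tendsto.congr (fun s' => (e s').symm) ?_
    refine (hc _ (projIcc a b hab s).2).comp (tendsto_nhdsWithin_iff.2 ⟨?_, .of_forall fun s' =>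
      (projIcc a b hab s').2⟩)
    exact (continuous_subtype_val.comp continuous_projIcc).tendsto s
  obtain ⟨U, hUm, hU⟩ := h2.exists_measurable hab fun s => by simp [hû]
  refine ⟨fun s => (Metric.ball (0 : Eucl N) r).indicator (U s),
    ⟨hUm.indicator (measurable_snd hB), fun s z hz => ?_, ?_⟩, fun s hs => ?_⟩
  · exact indicator_of_notMem (by simpa using hz) _
  · have e : ∀ s, (Metric.ball (0 : Eucl N) r).indicator (U s) =ᵐ[volume] û s := fun s =>
      (hU s).mono fun z hz => by
        by_cases hz' : z ∈ Metric.ball (0 : Eucl N) r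
        · rw [indicator_of_mem hz', hz]
        · simp only [hû, indicator_of_notMem hz']
    exact fun s => (h2 s).congr (fun i => (e i).symm) (e s).symm
  · filter_upwards [ae_restrict_of_ae (hU s), ae_restrict_mem hB] with z hz hm
    rw [indicator_of_mem hm, hz]
    simp only [hû, indicator_of_mem hm, projIcc_of_mem hab hs]

namespace ContField

variable {u u₁ : ℝ → Eucl N → ℝ}

lemma add (h : ContField N r u) (h₁ : ContField N r u₁) : ContField N r fun s z => u s z + u₁ s z :=
  ⟨h.meas.add h₁.meas, fun s z hz => by rw [h.supp s z hz, h₁.supp s z hz, add_zero],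
    fun s => (h.cont s).add (h₁.cont s)⟩

lemma const_mul (h : ContField N r u) (c : ℝ) : ContField N r fun s z => c * u s z :=
  ⟨h.meas.const_mul c, fun s z hz => by rw [h.supp s z hz, mul_zero], fun s => (h.cont s).const_mul c⟩

lemma coord_mul (h : ContField N r u) (i : Fin N) : ContField N r fun s z => z i * u s z := by
  refine ⟨((by fun_prop : Measurable fun q : ℝ × Eucl N => q.2 i)).mul h.meas,
    fun s z hz => by rw [h.supp s z hz, mul_zero], fun s => ?_⟩
  have hm : Measurable ((Metric.ball (0 : Eucl N) r).indicator fun z : Eucl N => z i) :=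
    (by fun_prop : Measurable fun z : Eucl N => z i).indicator Metric.isOpen_ball.measurableSet
  have e : ∀ s z, (Metric.ball (0 : Eucl N) r).indicator (fun z : Eucl N => z i) z * u s z =
      z i * u s z := fun s z => by
    by_cases hz : z ∈ Metric.ball (0 : Eucl N) r
    · rw [indicator_of_mem hz]
    · rw [h.supp s z (by simpa using hz)]; simp
  have := (h.cont s).mul_bdd (C := |r|) hm.aestronglyMeasurable (.of_forall fun z => by
    by_cases hz : z ∈ Metric.ball (0 : Eucl N) r
    · rw [indicator_of_mem hz]
      exact (PiLp.norm_apply_le z i).trans ((mem_ball_zero_iff.1 hz).le.trans (le_abs_self r))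
    · rw [indicator_of_notMem hz]; simp)
  simpa only [e] using this

lemma zero : ContField N r fun _ _ => 0 :=
  ⟨measurable_const, fun _ _ _ => rfl, fun _ => L2Tendsto.zero⟩

lemma sum {ι : Type*} (t : Finset ι) {u : ι → ℝ → Eucl N → ℝ} (h : ∀ i, ContField N r (u i)) :
    ContField N r fun s z => ∑ i ∈ t, u i s z := by
  classical
  induction t using Finset.induction_on with
  | empty => simpa using zero
  | insert i t hi ih =>
    simp only [Finset.sum_insert hi]
    exact (h i).add ih

end ContField

/-- The pairing with a fixed test function is integrable in time. -/
lemma SrcField.intervalIntegrable {u : ℝ → Eucl N → ℝ} (h : SrcField N r a b u) {χ : Eucl N → ℝ}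
    (hχ : Continuous χ) (hs : HasCompactSupport χ) {t₁ t₂ : ℝ} (h₁ : a ≤ t₁) (h₁₂ : t₁ ≤ t₂)
    (h₂ : t₂ ≤ b) : IntervalIntegrable (fun s => ∫ z, u s z * χ z) volume t₁ t₂ := by
  obtain ⟨C, hC0, hC⟩ := exists_bound_of_compactSupport hχ hs
  rw [intervalIntegrable_iff_integrableOn_Icc_of_le h₁₂]
  have h3 : Integrable (fun q : ℝ × Eucl N => u q.1 q.2 * χ q.2)
      ((volume.restrict (Icc a b)).prod volume) :=
    h.integrable_prod.mul_bdd (c := C) (hχ.measurable.comp measurable_snd).aestronglyMeasurable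
      (.of_forall fun q => hC q.2)
  exact IntegrableOn.mono_set (t := Icc a b) (s := Icc t₁ t₂) h3.integral_prod_left
    (Icc_subset_Icc h₁ h₂)

variable {p s₀ T : ℝ} {w v : ℝ → Eucl N → ℝ}

/-- Finite energy solutions have versions which are jointly measurable and continuous in `L²`
over a smaller ball. -/
lemma ContInH.exists_contField (h : ContInH N p s₀ T w v) (hα : 0 < wAlpha N p) (hr0 : 0 < r)
    (hr : r < 1) (ha : s₀ ≤ a) (hab : a ≤ b) (hb : b < T) {φ : ℝ → Eucl N → ℝ}
    (hm : ∀ s ∈ Ico s₀ T, AEStronglyMeasurable (φ s) (volume.restrict (unitBall N)))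
    (hφ : ∀ s ∈ Ico s₀ T, ∀ᵐ y ∂volume.restrict (unitBall N),
      φ s y ^ 2 ≤ v s y ^ 2 + ‖weakGrad N (w s) y‖ ^ 2 + w s y ^ 2)
    (hφ' : ∀ s ∈ Ico s₀ T, ∀ s' ∈ Ico s₀ T, ∀ᵐ y ∂volume.restrict (unitBall N),
      (φ s' - φ s) y ^ 2 ≤ (v s' - v s) y ^ 2 + ‖weakGrad N (w s' - w s) y‖ ^ 2
        + (w s' - w s) y ^ 2) :
    ∃ U, ContField N r U ∧ ∀ s ∈ Icc a b, U s =ᵐ[volume.restrict (Metric.ball 0 r)] φ s := by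
  have hI : Icc a b ⊆ Ico s₀ T := fun s hs => ⟨ha.trans hs.1, hs.2.trans_lt hb⟩
  have hsub := ball_subset_unitBall (N := N) hr
  have hfin : ∀ {x : ENNReal} {y : ℝ}, x ^ 2 ≤ ENNReal.ofReal y → x < ⊤ := fun {x y} hxy => by
    by_contra hc
    rw [not_lt, top_le_iff] at hc
    rw [hc] at hxy
    simp at hxy
  refine _root_.exists_contField hab (fun s hs => ⟨(hm s (hI hs)).mono_measure
    (Measure.restrict_mono hsub le_rfl), ?_⟩) fun s hs => ?_
  · exact hfin ((h s (hI hs)).1.sq_eLpNorm_le hα hr0 hr (hφ s (hI hs)))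
  · have h1 := ((h s (hI hs)).2.mono_left (nhdsWithin_mono s hI)).const_mul
      ((1 - r ^ 2) ^ (wAlpha N p + 1))⁻¹
    rw [mul_zero] at h1
    have h2 := (ENNReal.continuous_ofReal.tendsto 0).comp h1
    rw [ENNReal.ofReal_zero] at h2
    have h3 : Tendsto (fun s' => eLpNorm (φ s' - φ s) 2 (volume.restrict (Metric.ball 0 r)) ^ 2)
        (𝓝[Icc a b] s) (𝓝 0) := by
      refine tendsto_of_tendsto_of_tendsto_of_le_of_le' tendsto_const_nhds h2
        (.of_forall fun _ => zero_le) ?_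
      filter_upwards [self_mem_nhdsWithin] with s' hs'
      exact ((h s' (hI hs')).1.sub (h s (hI hs)).1).sq_eLpNorm_le hα hr0 hr
        (hφ' s (hI hs) s' (hI hs'))
    have h4 := (ENNReal.continuous_rpow_const (y := 1 / 2)).tendsto 0 |>.comp h3
    rw [ENNReal.zero_rpow_of_pos (by norm_num)] at h4
    refine h4.congr fun s' => ?_
    simp only [Function.comp]
    rw [← ENNReal.rpow_natCast, ← ENNReal.rpow_mul]
    norm_num

/-- `W`, `V`, `G` are versions of `w`, `v` and `∇w` over the ball of radius `r`. -/
structure IsVersion (N : ℕ) (r a b : ℝ) (w v : ℝ → Eucl N → ℝ) (W V : ℝ → Eucl N → ℝ)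
    (G : Fin N → ℝ → Eucl N → ℝ) : Prop where
  fW : ContField N r W
  fV : ContField N r V
  fG : ∀ i, ContField N r (G i)
  eW : ∀ s ∈ Icc a b, W s =ᵐ[volume.restrict (Metric.ball 0 r)] w s
  eV : ∀ s ∈ Icc a b, V s =ᵐ[volume.restrict (Metric.ball 0 r)] v s
  eG : ∀ i, ∀ s ∈ Icc a b, G i s =ᵐ[volume.restrict (Metric.ball 0 r)] fun y => weakGrad N (w s) y i

lemma ContInH.exists_isVersion (h : ContInH N p s₀ T w v) (hα : 0 < wAlpha N p) (hr0 : 0 < r)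
    (hr : r < 1) (ha : s₀ ≤ a) (hab : a ≤ b) (hb : b < T) :
    ∃ W V G, IsVersion N r a b w v W V G := by
  obtain ⟨W, hW, eW⟩ := h.exists_contField hα hr0 hr ha hab hb (φ := w) (fun s hs => (h s hs).1.1)
    (fun s _ => .of_forall fun y => by nlinarith [sq_nonneg (v s y), sq_nonneg ‖weakGrad N (w s) y‖])
    (fun s _ s' _ => .of_forall fun y => by
      nlinarith [sq_nonneg ((v s' - v s) y), sq_nonneg ‖weakGrad N (w s' - w s) y‖])
  obtain ⟨V, hV, eV⟩ := h.exists_contField hα hr0 hr ha hab hb (φ := v) (fun s hs => (h s hs).1.2.1)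
    (fun s _ => .of_forall fun y => by nlinarith [sq_nonneg (w s y), sq_nonneg ‖weakGrad N (w s) y‖])
    (fun s _ s' _ => .of_forall fun y => by
      nlinarith [sq_nonneg ((w s' - w s) y), sq_nonneg ‖weakGrad N (w s' - w s) y‖])
  have hG := fun i : Fin N => h.exists_contField hα hr0 hr ha hab hb
    (φ := fun s y => weakGrad N (w s) y i)
    (fun s hs => by
      obtain ⟨G, hG⟩ := (h s hs).1.2.2.1
      exact (by fun_prop : Continuous fun x : Eucl N => x i).comp_aestronglyMeasurable
        hG.weakGrad.aestronglyMeasurable)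
    (fun s _ => .of_forall fun y => by
      nlinarith [sq_nonneg (w s y), sq_nonneg (v s y), coord_sq_le (weakGrad N (w s) y) i])
    (fun s hs s' hs' => by
      obtain ⟨G, hG⟩ := (h s hs).1.2.2.1
      obtain ⟨G', hG'⟩ := (h s' hs').1.2.2.1
      filter_upwards [hG'.weakGrad_sub hG] with y hy
      have := coord_sq_le (weakGrad N (w s' - w s) y) i
      rw [hy] at this ⊢
      simp only [Pi.sub_apply, PiLp.sub_apply] at this ⊢
      nlinarith [sq_nonneg (w s' y - w s y), sq_nonneg (v s' y - v s y)])
  choose G hG eG using hG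
  exact ⟨W, V, G, hW, hV, hG, eW, eV, eG⟩

end FieldVersions

/-! ### From the weighted weak equation to the weak first order system. -/

section WeakEquation

variable {N : ℕ} {p r : ℝ} {ψ : Eucl N → ℝ}

lemma isTestFun_of_ball (hr : r < 1) (hψ : ContDiff ℝ ∞ ψ) (hs : tsupport ψ ⊆ Metric.ball 0 r) :
    IsTestFun N ψ :=
  ⟨hψ, (isCompact_closedBall 0 r).of_isClosed_subset (isClosed_tsupport _)
    (hs.trans Metric.ball_subset_closedBall), hs.trans (ball_subset_unitBall hr)⟩

lemma hasFDerivAt_wRho {y : Eucl N} (hy : y ∈ unitBall N) :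
    HasFDerivAt (wRho N p) ((wAlpha N p * (1 - ‖y‖ ^ 2) ^ (wAlpha N p - 1)) •
      (-((2 : ℝ) • innerSL ℝ y))) y := by
  have h1 : HasFDerivAt (fun y : Eucl N => 1 - ‖y‖ ^ 2) (-((2 : ℝ) • innerSL ℝ y)) y := by
    have := (hasStrictFDerivAt_norm_sq y).hasFDerivAt.const_sub 1
    simpa [two_smul] using this
  exact h1.rpow_const (Or.inl (one_sub_pos hy).ne')

lemma tsupport_div_wRho (ψ : Eucl N → ℝ) :
    tsupport (fun z => ψ z / wRho N p z) ⊆ tsupport ψ :=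
  closure_mono fun z hz hc => hz (by simp [hc])

/-- The weak equation is tested against `ρψ`, so the test function `ψ/ρ` recovers the unweighted
pairing. It is admissible because `ρ` is smooth and positive on the support of `ψ`. -/
lemma contDiff_div_wRho (hψ : IsTestFun N ψ) : ContDiff ℝ ∞ fun z => ψ z / wRho N p z := by
  refine contDiff_iff_contDiffAt.2 fun y => ?_
  by_cases hy : y ∈ tsupport fun z => ψ z / wRho N p z
  swap
  · exact contDiffAt_const.congr_of_eventuallyEq (notMem_tsupport_iff_eventuallyEq.1 hy)
  have hyB := hψ.2.2 (tsupport_div_wRho ψ hy)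
  have h1 : ContDiffAt ℝ ∞ (wRho N p) y := by
    have : ContDiffAt ℝ ∞ (fun y : Eucl N => 1 - ‖y‖ ^ 2) y :=
      contDiffAt_const.sub ((contDiff_norm_sq ℝ).contDiffAt)
    exact this.rpow_const_of_ne (one_sub_pos hyB).ne'
  exact hψ.1.contDiffAt.div h1 (wRho_pos hyB).ne'

lemma isTestFun_div_wRho (hψ : IsTestFun N ψ) : IsTestFun N fun z => ψ z / wRho N p z :=
  ⟨contDiff_div_wRho hψ, hψ.2.1.of_isClosed_subset (isClosed_tsupport _) (tsupport_div_wRho ψ),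
    (tsupport_div_wRho ψ).trans hψ.2.2⟩

lemma wRho_mul_div {y : Eucl N} (hy : y ∈ unitBall N) : wRho N p y * (ψ y / wRho N p y) = ψ y :=
  mul_div_cancel₀ _ (wRho_pos hy).ne'

lemma fderiv_wRho_mul {y : Eucl N} (hy : y ∈ unitBall N) :
    fderiv ℝ (fun z => wRho N p z * (ψ z / wRho N p z)) y = fderiv ℝ ψ y := by
  refine Filter.EventuallyEq.fderiv_eq ?_
  filter_upwards [Metric.isOpen_ball.mem_nhds hy] with z hz using wRho_mul_div hz

/-- Product rule for `ψ = ρ · (ψ/ρ)` with `∇ρ = -2αρ y/(1-|y|²)`. In the combination `∇w·∇ψ -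
(y·∇w)(y·∇ψ)` of the equation the singular factor cancels and leaves `2α ψ y·∇w`. -/
lemma wRho_mul_fderiv_div (hψ : IsTestFun N ψ) {y : Eucl N} (hy : y ∈ unitBall N) (e : Eucl N) :
    wRho N p y * fderiv ℝ (fun z => ψ z / wRho N p z) y e =
      fderiv ℝ ψ y e + 2 * wAlpha N p / (1 - ‖y‖ ^ 2) * (ψ y * inner ℝ y e) := by
  have h1 := ((contDiff_div_wRho (p := p) hψ).differentiable (by simp) y).hasFDerivAt
  have h2 := congrArg (fun L => L e) ((hasFDerivAt_wRho (p := p) hy).mul h1).fderiv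
  change fderiv ℝ (fun z => wRho N p z * (ψ z / wRho N p z)) y e = _ at h2
  rw [fderiv_wRho_mul hy] at h2
  have ht := one_sub_pos hy
  have h3 : (1 - ‖y‖ ^ 2) ^ (wAlpha N p - 1) = wRho N p y / (1 - ‖y‖ ^ 2) := by
    rw [Real.rpow_sub_one ht.ne', wRho]
  have hρ := (wRho_pos (p := p) hy).ne'
  rw [h2, h3]
  simp only [add_apply, smul_apply,
    neg_apply, innerSL_apply_apply, smul_eq_mul]
  field_simp
  ring

lemma integral_unitBall_eq (hr : r < 1) {F F' : Eucl N → ℝ} (hF : ∀ y, r ≤ ‖y‖ → F y = 0)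
    (hF' : ∀ y, r ≤ ‖y‖ → F' y = 0) (h : F =ᵐ[volume.restrict (Metric.ball 0 r)] F') :
    ∫ y in unitBall N, F y = ∫ y, F' y := by
  rw [setIntegral_eq_of_subset_of_forall_sdiff_eq_zero measurableSet_unitBall
    (ball_subset_unitBall (N := N) hr) fun y hy => hF y (by simpa using hy.2),
    integral_congr_ae h, setIntegral_eq_integral_of_forall_compl_eq_zero fun y hy =>
      hF' y (by simpa using hy)]

lemma eq_zero_of_tsupport (hs : tsupport ψ ⊆ Metric.ball 0 r) {y : Eucl N} (hy : r ≤ ‖y‖) :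
    ψ y = 0 ∧ fderiv ℝ ψ y = 0 := by
  have h1 : y ∉ tsupport ψ := fun hc => by
    have := hs hc
    rw [mem_ball_zero_iff] at this
    exact absurd this (not_lt.2 hy)
  refine ⟨image_eq_zero_of_notMem_tsupport h1, ?_⟩
  rw [(notMem_tsupport_iff_eventuallyEq.1 h1).fderiv_eq]
  exact fderiv_const_apply _

lemma tsupport_subset_of_eq_zero {φ : Eucl N → ℝ} (h : ∀ y ∉ tsupport ψ, φ y = 0) :
    tsupport φ ⊆ tsupport ψ :=
  closure_minimal (fun y hy => by_contra fun hc => hy (h y hc)) (isClosed_tsupport _)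

lemma dirD_eq_zero_of_notMem {y e : Eucl N} (h : y ∉ tsupport ψ) : dirD e ψ y = 0 := by
  rw [dirD, (notMem_tsupport_iff_eventuallyEq.1 h).fderiv_eq]
  simp

lemma contDiff_dirD_self (hψ : ContDiff ℝ ∞ ψ) : ContDiff ℝ ∞ fun z => dirD z ψ z :=
  (hψ.fderiv_right (by simp)).clm_apply contDiff_id

lemma dirD_coord_mul (hψ : ContDiff ℝ ∞ ψ) (i : Fin N) (z : Eucl N) :
    dirD (EuclideanSpace.single i 1) (fun z => z i * ψ z) z =
      ψ z + z i * dirD (EuclideanSpace.single i 1) ψ z := by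
  have h1 : HasFDerivAt (fun z : Eucl N => z i) (EuclideanSpace.proj (𝕜 := ℝ) i) z :=
    (EuclideanSpace.proj (𝕜 := ℝ) i).hasFDerivAt
  have h2 := (h1.mul (hψ.differentiable (by simp) z).hasFDerivAt).fderiv
  have h3 := congrArg (fun L => L (EuclideanSpace.single i 1)) h2
  change fderiv ℝ (fun z : Eucl N => z i * ψ z) z _ = _ at h3
  rw [dirD, h3]
  simp only [add_apply, smul_apply, smul_eq_mul, dirD]
  have : EuclideanSpace.proj (𝕜 := ℝ) i (EuclideanSpace.single i 1) = (1 : ℝ) := by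
    change (EuclideanSpace.single i (1 : ℝ)) i = 1
    simp
  rw [this]; ring

variable {W V S : Eucl N → ℝ} {G : Fin N → Eucl N → ℝ}

/-- The radial derivative in the weak form. -/
lemma sum_integral_coord (hW : ∀ χ : Eucl N → ℝ, Continuous χ → Integrable fun z => W z * χ z)
    (hgrad : ∀ i, ∀ ψ : Eucl N → ℝ, ContDiff ℝ ∞ ψ → tsupport ψ ⊆ Metric.ball 0 r →
      ∫ z, W z * dirD (EuclideanSpace.single i 1) ψ z = -∫ z, G i z * ψ z)
    (hψ : ContDiff ℝ ∞ ψ) (hs : tsupport ψ ⊆ Metric.ball 0 r) :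
    ∑ i, ∫ z, G i z * (z i * ψ z) = -∫ z, W z * (N * ψ z + dirD z ψ z) := by
  have h1 : ∀ i, ∫ z, G i z * (z i * ψ z) =
      -∫ z, W z * (ψ z + z i * dirD (EuclideanSpace.single i 1) ψ z) := fun i => by
    have := hgrad i (fun z => z i * ψ z) ((by fun_prop : ContDiff ℝ ∞ fun z : Eucl N => z i).mul hψ)
      ((tsupport_subset_of_eq_zero fun y hy => by
        rw [image_eq_zero_of_notMem_tsupport hy, mul_zero]).trans hs)
    simp only [dirD_coord_mul hψ] at this
    rw [this, neg_neg]
  simp only [h1]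
  rw [Finset.sum_neg_distrib, ← integral_finsetSum _ fun i _ => hW _ ?_]
  · congr 2
    ext z
    rw [← Finset.mul_sum, Finset.sum_add_distrib, dirD_eq_sum]
    simp
  · have := (hψ.dirD (EuclideanSpace.single i 1)).continuous
    have := hψ.continuous
    fun_prop

/-- The equation for a finite energy solution, rewritten in terms of `A = v + k w + y·∇w`. -/
lemma weakRHS_eq (hp : 1 < p) {k : ℝ} (hk : k = 2 / (p - 1)) (hr : r < 1) {f g : ℝ → ℝ} {s : ℝ}
    {w v : Eucl N → ℝ} (eW : W =ᵐ[volume.restrict (Metric.ball 0 r)] w)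
    (eV : V =ᵐ[volume.restrict (Metric.ball 0 r)] v)
    (eG : ∀ i, G i =ᵐ[volume.restrict (Metric.ball 0 r)] fun y => weakGrad N w y i)
    (hW : ∀ χ : Eucl N → ℝ, Continuous χ → Integrable fun z => W z * χ z)
    (hV : ∀ χ : Eucl N → ℝ, Continuous χ → Integrable fun z => V z * χ z)
    (hG : ∀ i, ∀ χ : Eucl N → ℝ, Continuous χ → Integrable fun z => G i z * χ z)
    (hS : ∀ χ : Eucl N → ℝ, Continuous χ → Integrable fun z => S z * χ z)
    (hgrad : ∀ i, ∀ ψ : Eucl N → ℝ, ContDiff ℝ ∞ ψ → tsupport ψ ⊆ Metric.ball 0 r →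
      ∫ z, W z * dirD (EuclideanSpace.single i 1) ψ z = -∫ z, G i z * ψ z)
    (eS : ∀ z, ‖z‖ < r → S z = |W z| ^ (p - 1) * W z + (Real.exp (-(2 * p * s / (p - 1))) *
      f (Real.exp (2 * s / (p - 1)) * W z) + Real.exp (-(2 * p * s / (p - 1))) *
      g (Real.exp ((p + 1) * s / (p - 1)) * (V z + k * W z + ∑ i, z i * G i z))))
    (hψ : ContDiff ℝ ∞ ψ) (hs : tsupport ψ ⊆ Metric.ball 0 r) :
    weakRHS N p f g s w v (fun z => ψ z / wRho N p z) =
      ((∫ z, (V z + k * W z + ∑ i, z i * G i z) * ((N - k - 1) * ψ z + dirD z ψ z))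
        + (∫ z, W z * lapl ψ z) + ∫ z, S z * ψ z) - ∫ z, V z * ((k - N) * ψ z - dirD z ψ z) := by
  have hT := isTestFun_of_ball hr hψ hs
  have hp1 : p - 1 ≠ 0 := by linarith
  have hNk : (N : ℝ) + 2 * wAlpha N p = 2 * k + 1 := by rw [wAlpha, hk]; ring
  have e1 : (2 * p + 2) / (p - 1) ^ 2 = k * (k + 1) := by rw [hk]; field_simp; ring
  have e2 : (p + 3) / (p - 1) = 2 * k + 1 := by rw [hk]; field_simp; ring
  have hD := (contDiff_dirD_self hψ).continuous
  have hDi : ∀ i, Continuous (dirD (EuclideanSpace.single i 1) ψ) := fun i => (hψ.dirD _).continuous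
  have hψc := hψ.continuous
  -- The integrand with the weight removed, grouped around `A`. The term with `V` is isolated
  -- because it is the time derivative of the pairing of `k w + y·∇w` with `ψ`.
  set Φ : Eucl N → ℝ := fun z => (V z + k * W z + ∑ i, z i * G i z) * ((N - k - 1) * ψ z + dirD z ψ z)
    + S z * ψ z - V z * ((k - N) * ψ z - dirD z ψ z)
    - (∑ i, G i z * dirD (EuclideanSpace.single i 1) ψ z) - k * (∑ i, G i z * (z i * ψ z))
    - k * (W z * (N * ψ z + dirD z ψ z)) with hΦ
  have h1 : weakRHS N p f g s w v (fun z => ψ z / wRho N p z) = ∫ z, Φ z := by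
    rw [weakRHS]
    refine integral_unitBall_eq hr (fun y hy => ?_) (fun y hy => ?_) ?_
    · obtain ⟨a1, a2⟩ := eq_zero_of_tsupport ((tsupport_div_wRho (p := p) ψ).trans hs) hy
      have a3 : (fun z => wRho N p z * (ψ z / wRho N p z)) =ᶠ[𝓝 y] fun _ => 0 := by
        have : y ∉ tsupport ψ := fun hc => absurd (mem_ball_zero_iff.1 (hs hc)) (not_lt.2 hy)
        filter_upwards [notMem_tsupport_iff_eventuallyEq.1 this] with z hz
        rw [hz]; simp
      simp only [inner_gradient_eq', a1, a2, a3.fderiv_eq]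
      simp
    · obtain ⟨a1, a2⟩ := eq_zero_of_tsupport hs hy
      simp [hΦ, dirD, a1, a2]
    · filter_upwards [eW, eV, ae_all_iff.2 eG, ae_restrict_mem Metric.isOpen_ball.measurableSet]
        with y h1 h2 h3 hm
      have hyr : ‖y‖ < r := by simpa using hm
      have hy := ball_subset_unitBall hr hm
      have ht := (one_sub_pos hy).ne'
      have b1 : inner ℝ y (weakGrad N w y) = ∑ i, y i * G i y := by
        rw [PiLp.inner_apply]
        exact Finset.sum_congr rfl fun i _ => by rw [h3 i]; simp [mul_comm]
      have b2 : fderiv ℝ ψ y (weakGrad N w y) =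
          ∑ i, G i y * dirD (EuclideanSpace.single i 1) ψ y := by
        have := dirD_eq_sum ψ (weakGrad N w y) y
        rw [dirD] at this
        rw [this]
        exact Finset.sum_congr rfl fun i _ => by rw [h3 i]
      have b3 := wRho_mul_fderiv_div (p := p) hT hy (weakGrad N w y)
      have b4 := wRho_mul_fderiv_div (p := p) hT hy y
      rw [real_inner_self_eq_norm_sq] at b4
      have b5 : ∑ i, G i y * (y i * ψ y) = (∑ i, y i * G i y) * ψ y := by
        rw [Finset.sum_mul]; exact Finset.sum_congr rfl fun i _ => by ring
      have b6 := wRho_mul_div (p := p) (ψ := ψ) hy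
      have b7 := eS y hyr
      have b8 : 2 * wAlpha N p / (1 - ‖y‖ ^ 2) * (1 - ‖y‖ ^ 2) = 2 * wAlpha N p := div_mul_cancel₀ _ ht
      rw [add_right_comm (V y)] at b7
      simp only [perturbation, inner_gradient_eq', fderiv_wRho_mul hy, ← h1, ← h2, b1, ← hk, hΦ, b5,
        ← b2, e1, e2]
      simp only [dirD]
      set ρ := wRho N p y
      set D := ∑ i, y i * G i y
      rw [b1] at b3
      generalize hfe : Real.exp (-(2 * p * s / (p - 1))) * f (Real.exp (2 * s / (p - 1)) * W y) +
        Real.exp (-(2 * p * s / (p - 1))) *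
          g (Real.exp ((p + 1) * s / (p - 1)) * (V y + D + k * W y)) = P at b7 ⊢
      -- Here `b3`, `b4` and `b8` clear the weight from the derivative terms, `b6` clears it from
      -- the zero order ones, `b7` inserts the source, and `hNk` matches the coefficients of `y·∇w`.
      linear_combination (-1) * b3 + D * b4 - (ψ y * D) * b8 + (-(k * (k + 1)) * W y
        + |W y| ^ (p - 1) * W y - (2 * k + 1) * V y + P + 2 * V y * N) * b6 - ψ y * b7
        - (ψ y * D) * hNk
  have hA : ∀ χ : Eucl N → ℝ, Continuous χ →
      Integrable fun z => (V z + k * W z + ∑ i, z i * G i z) * χ z := fun χ hχ => by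
    refine (((hV χ hχ).add ((hW χ hχ).const_mul k)).add (integrable_finsetSum Finset.univ fun i _ =>
      hG i (fun z => z i * χ z) (by fun_prop))).congr (.of_forall fun z => ?_)
    simp only [Pi.add_apply, add_mul, Finset.sum_mul]
    congr 1
    · ring
    · exact Finset.sum_congr rfl fun i _ => by ring
  have i1 := hA (fun z => (N - k - 1) * ψ z + dirD z ψ z) (by fun_prop)
  have i2 := hS ψ hψc
  have i3 := hV (fun z => (k - N) * ψ z - dirD z ψ z) (by fun_prop)
  have i4 : ∀ i, Integrable fun z => G i z * dirD (EuclideanSpace.single i 1) ψ z := fun i =>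
    hG i _ (hDi i)
  have i5 : ∀ i, Integrable fun z => G i z * (z i * ψ z) := fun i =>
    hG i (fun z => z i * ψ z) (by fun_prop)
  have i6 := hW (fun z => N * ψ z + dirD z ψ z) (by fun_prop)
  have i4' := integrable_finsetSum Finset.univ fun i _ => i4 i
  have i5' := integrable_finsetSum Finset.univ fun i _ => i5 i
  have e : ∫ z, Φ z = (∫ z, (V z + k * W z + ∑ i, z i * G i z) * ((N - k - 1) * ψ z + dirD z ψ z))
      + (∫ z, S z * ψ z) - (∫ z, V z * ((k - N) * ψ z - dirD z ψ z))
      - (∫ z, ∑ i, G i z * dirD (EuclideanSpace.single i 1) ψ z)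
      - (∫ z, k * ∑ i, G i z * (z i * ψ z)) - ∫ z, k * (W z * (N * ψ z + dirD z ψ z)) := by
    rw [← integral_add' i1 i2, ← integral_sub' (i1.add i2) i3, ← integral_sub' ((i1.add i2).sub i3) i4',
      ← integral_sub' (((i1.add i2).sub i3).sub i4') (i5'.const_mul k),
      ← integral_sub' ((((i1.add i2).sub i3).sub i4').sub (i5'.const_mul k)) (i6.const_mul k)]
    rfl
  rw [h1, e, integral_const_mul, integral_const_mul, integral_finsetSum _ fun i _ => i4 i,
    integral_finsetSum _ fun i _ => i5 i, sum_integral_coord hW hgrad hψ hs]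
  have h2 : ∑ i, ∫ z, G i z * dirD (EuclideanSpace.single i 1) ψ z = -∫ z, W z * lapl ψ z := by
    have h3 : ∀ i, ∫ z, G i z * dirD (EuclideanSpace.single i 1) ψ z =
        -∫ z, W z * dirD (EuclideanSpace.single i 1) (dirD (EuclideanSpace.single i 1) ψ) z := fun i => by
      rw [hgrad i _ (hψ.dirD _) ((tsupport_subset_of_eq_zero fun y hy =>
        dirD_eq_zero_of_notMem hy).trans hs), neg_neg]
    simp only [h3, lapl, Finset.mul_sum]
    rw [Finset.sum_neg_distrib, integral_finsetSum _ fun i _ =>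
      hW _ ((hψ.dirD _).dirD _).continuous]
  rw [h2]
  ring

end WeakEquation

/-! ### The source terms as fields on a smaller ball. -/

section Sources

variable {N : ℕ} {r a b : ℝ}

/-- A source field must have every slice in `L²`, while finiteness of the time integral gives this
only for almost every time. The field is therefore required to vanish at the times where the
majorant has infinite norm. -/
lemma SrcField.of_le {u H : ℝ → Eucl N → ℝ} {c : ℝ}
    (hu : Measurable (Function.uncurry u)) (hsupp : ∀ s z, r ≤ ‖z‖ → u s z = 0)
    (hH : Measurable (Function.uncurry H))
    (hle : ∀ s z, |u s z| ≤ c * ((Metric.ball (0 : Eucl N) r).indicator (fun _ => 1) z + |H s z|))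
    (hz : ∀ s, eLpNorm (H s) 2 volume = ⊤ → u s = 0)
    (hfin : ∫⁻ s in Icc a b, eLpNorm (H s) 2 volume < ⊤) :
    SrcField N r a b u ∧ ∃ C : NNReal, ∀ s, eLpNorm (u s) 2 volume ≤
      C * (C + eLpNorm (H s) 2 volume) := by
  have hball : volume (Metric.ball (0 : Eucl N) r) < ⊤ := measure_ball_lt_top
  have hχ : MemLp ((Metric.ball (0 : Eucl N) r).indicator fun _ => (1 : ℝ)) 2 volume :=
    memLp_indicator_const _ Metric.isOpen_ball.measurableSet _ (Or.inr hball.ne)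
  set χ := (Metric.ball (0 : Eucl N) r).indicator fun _ => (1 : ℝ) with hχd
  set D := (eLpNorm χ 2 volume).toNNReal with hD
  have hDe : (D : ENNReal) = eLpNorm χ 2 volume := ENNReal.coe_toNNReal hχ.eLpNorm_ne_top
  have key : ∀ s, eLpNorm (u s) 2 volume ≤ c.toNNReal * (D + eLpNorm (H s) 2 volume) := fun s => by
    have hm := (measurable_slice hH s).aestronglyMeasurable (μ := volume)
    refine (eLpNorm_le_mul_eLpNorm_of_ae_le_mul (g := fun z => χ z + |H s z|) (c := c)
      (.of_forall fun z => ?_) 2).trans (mul_le_mul_right ?_ _)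
    · rw [Real.norm_of_nonneg (add_nonneg (indicator_nonneg (fun _ _ => zero_le_one) z)
        (abs_nonneg _))]
      exact hle s z
    · rw [hDe, ← eLpNorm_norm (H s)]
      exact eLpNorm_add_le hχ.1 hm.norm (by norm_num)
  refine ⟨⟨hu, hsupp, fun s => ⟨(measurable_slice hu s).aestronglyMeasurable, ?_⟩, ?_⟩,
    max c.toNNReal D, fun s => (key s).trans ?_⟩
  · by_cases hs : eLpNorm (H s) 2 volume = ⊤
    · rw [hz s hs]; simp
    · exact (key s).trans_lt (ENNReal.mul_lt_top ENNReal.coe_lt_top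
        (ENNReal.add_lt_top.2 ⟨ENNReal.coe_lt_top, lt_top_iff_ne_top.2 hs⟩))
  · refine (lintegral_mono key).trans_lt ?_
    rw [lintegral_const_mul _ ((measurable_eLpNorm_slice hH _).const_add _),
      lintegral_add_left measurable_const, setLIntegral_const]
    exact ENNReal.mul_lt_top ENNReal.coe_lt_top (ENNReal.add_lt_top.2
      ⟨ENNReal.mul_lt_top ENNReal.coe_lt_top (by simp), hfin⟩)
  · have h1 : (c.toNNReal : ENNReal) ≤ (max c.toNNReal D : NNReal) := by
      exact_mod_cast le_max_left _ _
    have h2 : (D : ENNReal) ≤ (max c.toNNReal D : NNReal) := by exact_mod_cast le_max_right _ _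
    exact mul_le_mul' h1 (add_le_add h2 le_rfl)

variable {k p q M : ℝ} {f g : ℝ → ℝ} {W A : ℝ → Eucl N → ℝ}

/-- The nonlinear source, set to zero at the exceptional times. -/
lemma exists_source_nlin (hk : k * p = k + 2) (hk0 : 0 < k) (hp : 1 < p) (hq₀ : 0 ≤ q) (hq : q < p)
    (hM : 0 < M) (hf : LocallyLipschitz f) (hfb : ∀ x, |f x| ≤ M * (1 + |x| ^ q))
    (hW : Measurable (Function.uncurry W))
    (hpow : ∫⁻ s in Icc a b, eLpNorm (fun z => |W s z| ^ p) 2 volume < ⊤) :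
    ∃ S : ℝ → Eucl N → ℝ, SrcField N r a b S ∧ ∀ᵐ s ∂volume.restrict (Icc a b), ∀ z, ‖z‖ < r →
      S s z = Real.exp (-(k + 2) * s) * nlin p f (Real.exp (k * s) * W s z) := by
  have hB : MeasurableSet (Metric.ball (0 : Eucl N) r) := Metric.isOpen_ball.measurableSet
  have hH : Measurable (Function.uncurry fun s z => |W s z| ^ p) := hW.abs.pow_const p
  have hHs := measurable_eLpNorm_slice hH volume
  -- Restricting to times after `a` keeps the factor `e^{-(k+2)s}` bounded for all times at which
  -- the source is nonzero.
  set E : Set ℝ := Ici a ∩ {s | eLpNorm (fun z => |W s z| ^ p) 2 volume < ⊤} with hE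
  have hEm : MeasurableSet E := measurableSet_Ici.inter (measurableSet_lt hHs measurable_const)
  set S : ℝ × Eucl N → ℝ := (E ×ˢ Metric.ball (0 : Eucl N) r).indicator fun x =>
    Real.exp (-(k + 2) * x.1) * nlin p f (Real.exp (k * x.1) * W x.1 x.2) with hS
  have hSm : Measurable S := by
    have h1 : Measurable fun x : ℝ × Eucl N => Real.exp (k * x.1) * W x.1 x.2 :=
      (by fun_prop : Measurable fun x : ℝ × Eucl N => Real.exp (k * x.1)).mul hW
    have h2 := (continuous_nlin hp hf).measurable.comp h1
    exact ((by fun_prop : Measurable fun x : ℝ × Eucl N => Real.exp (-(k + 2) * x.1)).mul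
      h2).indicator (hEm.prod hB)
  refine ⟨fun s z => S (s, z), (SrcField.of_le (a := a) (b := b) (r := r)
    (u := fun s z => S (s, z)) (H := fun s z => |W s z| ^ p) (c := (1 + 2 * M) * (1 + Real.exp (-(k + 2) * a)))
    hSm (fun s z hz => ?_) hH (fun s z => ?_) (fun s hs => ?_) hpow).1, ?_⟩
  · exact indicator_of_notMem (fun hc => absurd hc.2 (by simpa using hz)) _
  · by_cases hm : (s, z) ∈ E ×ˢ Metric.ball (0 : Eucl N) r
    · rw [hS, indicator_of_mem hm, indicator_of_mem hm.2, abs_mul, abs_of_pos (Real.exp_pos _),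
        abs_of_nonneg (Real.rpow_nonneg (abs_nonneg _) _)]
      refine (mul_le_mul_of_nonneg_left (abs_nlin_le hp hq₀ hq hM hfb _) (Real.exp_pos _).le).trans ?_
      have h1 : Real.exp (-(k + 2) * s) ≤ Real.exp (-(k + 2) * a) := by
        refine Real.exp_le_exp.2 ?_
        have : a ≤ s := hm.1.1
        nlinarith
      have h2 : Real.exp (-(k + 2) * s) * |Real.exp (k * s) * W s z| ^ p = |W s z| ^ p := by
        rw [abs_mul, abs_of_pos (Real.exp_pos _), Real.mul_rpow (Real.exp_pos _).le (abs_nonneg _),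
          ← Real.exp_mul, ← mul_assoc, ← Real.exp_add]
        have : -(k + 2) * s + k * s * p = 0 := by linear_combination s * hk
        rw [this, Real.exp_zero, one_mul]
      have h3 : 0 ≤ |W s z| ^ p := Real.rpow_nonneg (abs_nonneg _) _
      have h4 : Real.exp (-(k + 2) * s) * ((1 + 2 * M) * (1 + |Real.exp (k * s) * W s z| ^ p)) =
          (1 + 2 * M) * (Real.exp (-(k + 2) * s) + |W s z| ^ p) := by
        rw [← h2]; ring
      rw [h4, mul_assoc]
      refine mul_le_mul_of_nonneg_left ?_ (by linarith)
      have := mul_nonneg (Real.exp_pos (-(k + 2) * a)).le h3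
      nlinarith
    · rw [hS, indicator_of_notMem hm, abs_zero]
      have : 0 ≤ (Metric.ball (0 : Eucl N) r).indicator (fun _ => (1 : ℝ)) z :=
        indicator_nonneg (fun _ _ => zero_le_one) z
      positivity
  · ext z
    exact indicator_of_notMem (fun hc => absurd hc.1.2 (by simp [hs])) _
  · filter_upwards [ae_lt_top hHs hpow.ne, ae_restrict_mem measurableSet_Icc] with s hs hm z hz
    have : (s, z) ∈ E ×ˢ Metric.ball (0 : Eucl N) r := ⟨⟨hm.1, hs⟩, by simpa using hz⟩
    simp only [hS, indicator_of_mem this]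

/-- The source of linear growth. -/
lemma exists_source_lin (hk0 : 0 < k) (hM : 0 < M) (hg : LocallyLipschitz g)
    (hgb : ∀ x, |g x| ≤ M * (1 + |x|)) (hA : ContField N r A) :
    ∃ S : ℝ → Eucl N → ℝ, SrcField N r a b S ∧
      (∃ B, ∀ s ∈ Icc a b, (eLpNorm (S s) 2 volume).toReal ≤ B) ∧ ∀ s ∈ Icc a b, ∀ z, ‖z‖ < r →
      S s z = Real.exp (-(k + 2) * s) * g (Real.exp ((k + 1) * s) * A s z) := by
  have hB : MeasurableSet (Metric.ball (0 : Eucl N) r) := Metric.isOpen_ball.measurableSet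
  set S : ℝ × Eucl N → ℝ := (Ici a ×ˢ Metric.ball (0 : Eucl N) r).indicator fun x =>
    Real.exp (-(k + 2) * x.1) * g (Real.exp ((k + 1) * x.1) * A x.1 x.2) with hS
  have hSm : Measurable S := by
    have h1 : Measurable fun x : ℝ × Eucl N => Real.exp ((k + 1) * x.1) * A x.1 x.2 :=
      (by fun_prop : Measurable fun x : ℝ × Eucl N => Real.exp ((k + 1) * x.1)).mul hA.meas
    exact ((by fun_prop : Measurable fun x : ℝ × Eucl N => Real.exp (-(k + 2) * x.1)).mul
      (hg.continuous.measurable.comp h1)).indicator (measurableSet_Ici.prod hB)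
  obtain ⟨h1, C, hC⟩ := SrcField.of_le (a := a) (b := b)
    (u := fun s z => S (s, z)) (H := A) (r := r)
    (c := M * (Real.exp (-(k + 2) * a) + Real.exp (-a))) hSm
    (fun s z hz => indicator_of_notMem (fun hc => absurd hc.2 (by simpa using hz)) _) hA.meas
    (fun s z => by
      by_cases hm : (s, z) ∈ Ici a ×ˢ Metric.ball (0 : Eucl N) r
      · have hs : a ≤ s := hm.1
        rw [hS, indicator_of_mem hm, indicator_of_mem hm.2, abs_mul, abs_of_pos (Real.exp_pos _)]
        refine (mul_le_mul_of_nonneg_left (hgb _) (Real.exp_pos _).le).trans ?_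
        have h1 : Real.exp (-(k + 2) * s) ≤ Real.exp (-(k + 2) * a) :=
          Real.exp_le_exp.2 (by nlinarith)
        have h2 : Real.exp (-(k + 2) * s) * Real.exp ((k + 1) * s) ≤ Real.exp (-a) := by
          rw [← Real.exp_add]
          exact Real.exp_le_exp.2 (by linarith)
        rw [abs_mul, abs_of_pos (Real.exp_pos _)]
        have h3 := mul_le_mul_of_nonneg_right h2 (abs_nonneg (A s z))
        have h4 : Real.exp (-(k + 2) * s) * (M * (1 + Real.exp ((k + 1) * s) * |A s z|)) =
            M * (Real.exp (-(k + 2) * s)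
              + Real.exp (-(k + 2) * s) * Real.exp ((k + 1) * s) * |A s z|) := by ring
        rw [h4, mul_assoc M]
        refine mul_le_mul_of_nonneg_left ?_ hM.le
        have := mul_nonneg (Real.exp_pos (-(k + 2) * a)).le (abs_nonneg (A s z))
        have := Real.exp_pos (-a)
        nlinarith
      · rw [hS, indicator_of_notMem hm, abs_zero]
        have : 0 ≤ (Metric.ball (0 : Eucl N) r).indicator (fun _ => (1 : ℝ)) z :=
          indicator_nonneg (fun _ _ => zero_le_one) z
        positivity)
    (fun s hs => absurd hs (hA.cont s).2.1.eLpNorm_ne_top) (hA.srcField a b).fin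
  obtain ⟨B, hB0, hBd⟩ := exists_eLpNorm_le hA.cont a b
  refine ⟨fun s z => S (s, z), h1, ⟨C * (C + B), fun s hs => ?_⟩, fun s hs z hz => ?_⟩
  · have hfin := (hA.cont s).2.1.eLpNorm_ne_top
    have h2 := ENNReal.toReal_mono (ENNReal.mul_ne_top ENNReal.coe_ne_top
      (ENNReal.add_ne_top.2 ⟨ENNReal.coe_ne_top, hfin⟩)) (hC s)
    rw [ENNReal.toReal_mul, ENNReal.toReal_add ENNReal.coe_ne_top hfin] at h2
    refine h2.trans (mul_le_mul_of_nonneg_left ?_ C.2)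
    exact add_le_add le_rfl (hBd s hs)
  · have : (s, z) ∈ Ici a ×ˢ Metric.ball (0 : Eucl N) r := ⟨hs.1, by simpa using hz⟩
    simp only [hS, indicator_of_mem this]

end Sources

/-! ### A solution of the weak equation satisfies the first order system. -/

section FromSolution

variable {N : ℕ} {p q M r a b s₀ T : ℝ} {f g : ℝ → ℝ} {w v W V : ℝ → Eucl N → ℝ}
  {G : Fin N → ℝ → Eucl N → ℝ}

lemma pairing_eq (hr : r < 1) {u U χ : Eucl N → ℝ} (e : U =ᵐ[volume.restrict (Metric.ball 0 r)] u)
    (hχ : ∀ y, r ≤ ‖y‖ → χ y = 0) : ∫ y in unitBall N, u y * χ y = ∫ y, U y * χ y :=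
  integral_unitBall_eq hr (fun y hy => by rw [hχ y hy, mul_zero]) (fun y hy => by
    rw [hχ y hy, mul_zero]) (e.mono fun y hy => by simp only [hy])

/-- A finite energy solution satisfies the first order system in the interior. -/
theorem IsSolution.exists_nonlinWave (h : IsSolution N p f g s₀ T w v) (hp : 1 < p) (hq₀ : 0 ≤ q)
    (hq : q < p) (hM : 0 < M) (hf : LocallyLipschitz f) (hg : LocallyLipschitz g)
    (hfb : ∀ x, |f x| ≤ M * (1 + |x| ^ q)) (hgb : ∀ x, |g x| ≤ M * (1 + |x|))
    (hr : r < 1) (ha : s₀ ≤ a) (hab : a ≤ b) (hb : b < T)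
    (hV : IsVersion N r a b w v W V G) : ∃ S₁ S₂, NonlinWave N (2 / (p - 1)) p M r a b f W
      (fun s z => V s z + 2 / (p - 1) * W s z + ∑ i, z i * G i s z) G S₁ S₂ := by
  set k := 2 / (p - 1) with hk
  have hp1 : p - 1 ≠ 0 := by linarith
  have hk0 : 0 < k := div_pos two_pos (by linarith)
  have hkp : k * p = k + 2 := by rw [hk]; field_simp; ring
  have hI : ∀ {s}, s ∈ Icc a b → s ∈ Ico s₀ T := fun hs => ⟨ha.trans hs.1, hs.2.trans_lt hb⟩
  set A : ℝ → Eucl N → ℝ := fun s z => V s z + k * W s z + ∑ i, z i * G i s z with hA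
  have hAf : ContField N r A := (hV.fV.add (hV.fW.const_mul k)).add
    (ContField.sum _ fun i => (hV.fG i).coord_mul i)
  have hpow : ∫⁻ s in Icc a b, eLpNorm (fun z => |W s z| ^ p) 2 volume < ⊤ := by
    refine lt_of_le_of_lt ?_ (h.nonlin b hb r hr)
    refine le_trans (le_of_eq (setLIntegral_congr_fun measurableSet_Icc fun s hs => ?_))
      (lintegral_mono_set (Icc_subset_Icc_left ha))
    have e1 : (fun z => |W s z| ^ p) =
        (Metric.ball (0 : Eucl N) r).indicator fun z => |W s z| ^ p := by
      ext z
      by_cases hz : z ∈ Metric.ball (0 : Eucl N) r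
      · rw [indicator_of_mem hz]
      · rw [indicator_of_notMem hz, hV.fW.supp s z (by simpa using hz), abs_zero,
          Real.zero_rpow (by linarith)]
    rw [e1, eLpNorm_indicator_eq_eLpNorm_restrict Metric.isOpen_ball.measurableSet]
    exact eLpNorm_congr_ae ((hV.eW s hs).mono fun z hz => by simp only [hz])
  obtain ⟨S₁, hS₁, eS₁⟩ := exists_source_nlin (r := r) hkp hk0 hp hq₀ hq hM hf hfb hV.fW.meas hpow
  obtain ⟨S₂, hS₂, hB, eS₂⟩ := exists_source_lin (a := a) (b := b) hk0 hM hg hgb hAf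
  have iW : ∀ s, ∀ χ : Eucl N → ℝ, Continuous χ → Integrable fun z => W s z * χ z :=
    fun s χ hχ => (hV.fW.srcField a b).integrable_mul s hχ
  have iV : ∀ s, ∀ χ : Eucl N → ℝ, Continuous χ → Integrable fun z => V s z * χ z :=
    fun s χ hχ => (hV.fV.srcField a b).integrable_mul s hχ
  have iG : ∀ s, ∀ i, ∀ χ : Eucl N → ℝ, Continuous χ → Integrable fun z => G i s z * χ z :=
    fun s i χ hχ => ((hV.fG i).srcField a b).integrable_mul s hχ
  have hgrad : ∀ i, ∀ s ∈ Icc a b, ∀ ψ : Eucl N → ℝ, ContDiff ℝ ∞ ψ →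
      tsupport ψ ⊆ Metric.ball 0 r →
      ∫ z, W s z * dirD (EuclideanSpace.single i 1) ψ z = -∫ z, G i s z * ψ z := by
    intro i s hs ψ hψ hsψ
    obtain ⟨G', hG'⟩ := (h.cont s (hI hs)).1.2.2.1
    have := hG'.weakGrad.integral_dirD (isTestFun_of_ball hr hψ hsψ) i
    rwa [pairing_eq hr (hV.eW s hs) fun y hy => by
        rw [dirD, (eq_zero_of_tsupport hsψ hy).2, zero_apply],
      pairing_eq hr (hV.eG i s hs) fun y hy => (eq_zero_of_tsupport hsψ hy).1] at this
  have hAψ : ∀ s ∈ Icc a b, ∀ ψ : Eucl N → ℝ, ContDiff ℝ ∞ ψ → tsupport ψ ⊆ Metric.ball 0 r →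
      ∫ z, A s z * ψ z = (∫ z, V s z * ψ z) + k * (∫ z, W s z * ψ z)
        - ∫ z, W s z * (N * ψ z + dirD z ψ z) := by
    intro s hs ψ hψ hsψ
    have hc := hψ.continuous
    have h1 := sum_integral_coord (iW s) (fun i ψ => hgrad i s hs ψ) hψ hsψ
    have i5 : ∀ i, Integrable fun z => G i s z * (z i * ψ z) := fun i =>
      iG s i (fun z => z i * ψ z) (by fun_prop)
    have e : ∀ z, A s z * ψ z = V s z * ψ z + k * (W s z * ψ z) + ∑ i, G i s z * (z i * ψ z) := by
      intro z
      rw [hA]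
      simp only [add_mul, Finset.sum_mul]
      congr 1
      · ring
      · exact Finset.sum_congr rfl fun i _ => by ring
    have e' : ∫ z, A s z * ψ z = (∫ z, V s z * ψ z) + (∫ z, k * (W s z * ψ z))
        + ∫ z, ∑ i, G i s z * (z i * ψ z) := by
      simp only [e]
      rw [← integral_add' (iV s ψ hc) ((iW s ψ hc).const_mul k),
        ← integral_add' ((iV s ψ hc).add ((iW s ψ hc).const_mul k))
          (integrable_finsetSum _ fun i _ => i5 i)]
      rfl
    rw [e', integral_const_mul, integral_finsetSum _ fun i _ => i5 i, h1]
    ring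
  have hwψ : ∀ χ : Eucl N → ℝ, ContDiff ℝ ∞ χ → tsupport χ ⊆ Metric.ball 0 r →
      ∀ t₁ t₂, a ≤ t₁ → t₁ ≤ t₂ → t₂ ≤ b →
      (∫ z, W t₂ z * χ z) - (∫ z, W t₁ z * χ z) = ∫ s in t₁..t₂, ∫ z, V s z * χ z := by
    intro χ hχ hs t₁ t₂ h₁ h₁₂ h₂
    have h0 := fun y hy => (eq_zero_of_tsupport hs (y := y) hy).1
    have := h.deriv_eq χ (isTestFun_of_ball hr hχ hs) t₁ t₂ (ha.trans h₁) h₁₂ (h₂.trans_lt hb)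
    rw [pairing_eq hr (hV.eW t₂ ⟨h₁.trans h₁₂, h₂⟩) h0,
      pairing_eq hr (hV.eW t₁ ⟨h₁, h₁₂.trans h₂⟩) h0] at this
    rw [this]
    refine intervalIntegral.integral_congr fun s hs => ?_
    rw [uIcc_of_le h₁₂] at hs
    exact pairing_eq hr (hV.eV s ⟨h₁.trans hs.1, hs.2.trans h₂⟩) h0
  have hle₂ : ∀ s ∈ Icc a b, ∀ z, ‖z‖ < r →
      |S₂ s z| ≤ M * (Real.exp (-(k + 2) * s) * (1 + Real.exp ((k + 1) * s) * |A s z|)) := by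
    intro s hs z hz
    rw [eS₂ s hs z hz, abs_mul, abs_of_pos (Real.exp_pos _)]
    refine (mul_le_mul_of_nonneg_left (hgb _) (Real.exp_pos _).le).trans_eq ?_
    rw [abs_mul, abs_of_pos (Real.exp_pos _)]; ring
  refine ⟨S₁, S₂, ⟨hab, hV.fW, hAf, hV.fG, hS₁.add hS₂, hgrad, ?_, ?_⟩, hS₁, hS₂, hB, hpow, eS₁, hle₂⟩
  · intro ψ hψ hs t₁ t₂ h₁ h₁₂ h₂
    rw [hwψ ψ hψ hs t₁ t₂ h₁ h₁₂ h₂]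
    refine intervalIntegral.integral_congr fun s hs' => ?_
    rw [uIcc_of_le h₁₂] at hs'
    have hsI : s ∈ Icc a b := ⟨h₁.trans hs'.1, hs'.2.trans h₂⟩
    have hc := hψ.continuous
    have hD := (contDiff_dirD_self hψ).continuous
    have e : ∫ z, W s z * ((N - k) * ψ z + dirD z ψ z) =
        (∫ z, W s z * (N * ψ z + dirD z ψ z)) - k * ∫ z, W s z * ψ z := by
      rw [← integral_const_mul, ← integral_sub (iW s (fun z => N * ψ z + dirD z ψ z) (by fun_prop))
        ((iW s ψ hc).const_mul k)]
      congr 1; ext z; ring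
    simp only [e, hAψ s hsI ψ hψ hs]
    ring
  · intro ψ hψ hs t₁ t₂ h₁ h₁₂ h₂
    have hc := hψ.continuous
    have hD := (contDiff_dirD_self hψ).continuous
    have hT := isTestFun_of_ball hr hψ hs
    have m₁ : t₁ ∈ Icc a b := ⟨h₁, h₁₂.trans h₂⟩
    have m₂ : t₂ ∈ Icc a b := ⟨h₁.trans h₁₂, h₂⟩
    -- The part `k w + y·∇w` of `A`, paired with `ψ`, is the pairing of `w` with `χ` after an
    -- integration by parts. Its time derivative is therefore the pairing of `v` with `χ`.
    set χ : Eucl N → ℝ := fun z => (k - N) * ψ z - dirD z ψ z with hχ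
    have hχs : ContDiff ℝ ∞ χ := (contDiff_const.mul hψ).sub (contDiff_dirD_self hψ)
    have hχt : tsupport χ ⊆ tsupport ψ := tsupport_subset_of_eq_zero fun y hy => by
      simp only [hχ]
      rw [image_eq_zero_of_notMem_tsupport hy, dirD_eq_zero_of_notMem hy]; ring
    have hsum : ∀ s ∈ Icc a b, ∫ z, A s z * ψ z = (∫ z, V s z * ψ z) + ∫ z, W s z * χ z := by
      intro s hsI
      have e : ∫ z, W s z * χ z = k * (∫ z, W s z * ψ z) - ∫ z, W s z * (N * ψ z + dirD z ψ z) := by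
        rw [← integral_const_mul, ← integral_sub ((iW s ψ hc).const_mul k)
          (iW s (fun z => N * ψ z + dirD z ψ z) (by fun_prop))]
        congr 1; ext z; simp only [hχ]; ring
      rw [e, hAψ s hsI ψ hψ hs]; ring
    have hcs : ∀ {φ : Eucl N → ℝ}, (∀ y ∉ tsupport ψ, φ y = 0) → HasCompactSupport φ := fun hφ =>
      hT.2.1.of_isClosed_subset (isClosed_tsupport _) (tsupport_subset_of_eq_zero hφ)
    -- Testing with `ψ/ρ` gives the increment of the pairing of `v` with `ψ`; the increment of the
    -- pairing of `w` with `χ` is added at the end, and the terms in `V χ` cancel.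
    have hE := h.eqn _ (isTestFun_div_wRho (p := p) hT) t₁ t₂ (ha.trans h₁) h₁₂ (h₂.trans_lt hb)
    have hLHS : ∀ s ∈ Icc a b, ∫ y in unitBall N, v s y * wRho N p y * (ψ y / wRho N p y) =
        ∫ z, V s z * ψ z := by
      intro s hsI
      rw [← pairing_eq hr (hV.eV s hsI) fun y hy => (eq_zero_of_tsupport hs hy).1]
      refine setIntegral_congr_fun measurableSet_unitBall fun y hy => ?_
      rw [mul_assoc, wRho_mul_div hy]
    rw [hLHS t₁ m₁, hLHS t₂ m₂] at hE
    have iQ : IntervalIntegrable (fun s => ∫ z, V s z * χ z) volume t₁ t₂ :=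
      (hV.fV.srcField a b).intervalIntegrable hχs.continuous
        (hT.2.1.of_isClosed_subset (isClosed_tsupport _) hχt) h₁ h₁₂ h₂
    have iR : IntervalIntegrable (fun s => (∫ z, A s z * ((N - k - 1) * ψ z + dirD z ψ z))
        + (∫ z, W s z * lapl ψ z) + ∫ z, (S₁ s z + S₂ s z) * ψ z) volume t₁ t₂ := by
      refine (IntervalIntegrable.add ?_ ?_).add ?_
      · exact (hAf.srcField a b).intervalIntegrable (by fun_prop) (hcs fun y hy => by
          rw [image_eq_zero_of_notMem_tsupport hy, dirD_eq_zero_of_notMem hy]; ring) h₁ h₁₂ h₂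
      · exact (hV.fW.srcField a b).intervalIntegrable hψ.lapl.continuous hT.2.1.lapl h₁ h₁₂ h₂
      · exact (hS₁.add hS₂).intervalIntegrable hc hT.2.1 h₁ h₁₂ h₂
    have hRHS : ∀ᵐ s, s ∈ uIoc t₁ t₂ → weakRHS N p f g s (w s) (v s) (fun z => ψ z / wRho N p z) =
        ((∫ z, A s z * ((N - k - 1) * ψ z + dirD z ψ z))
        + (∫ z, W s z * lapl ψ z) + ∫ z, (S₁ s z + S₂ s z) * ψ z) - ∫ z, V s z * χ z := by
      filter_upwards [(ae_restrict_iff' measurableSet_Icc).1 eS₁] with s hs₁ hsm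
      rw [uIoc_of_le h₁₂] at hsm
      have hsI : s ∈ Icc a b := ⟨h₁.trans hsm.1.le, hsm.2.trans h₂⟩
      refine weakRHS_eq hp hk hr (hV.eW s hsI) (hV.eV s hsI) (fun i => hV.eG i s hsI) (iW s) (iV s)
        (iG s) (fun χ hχ => (hS₁.add hS₂).integrable_mul s hχ) (fun i ψ => hgrad i s hsI ψ)
        (fun z hz => ?_) hψ hs
      have e1 : 2 * p * s / (p - 1) = (k + 2) * s := by rw [hk]; field_simp; ring
      have e2 : 2 * s / (p - 1) = k * s := by rw [hk]; ring
      have e3 : (p + 1) * s / (p - 1) = (k + 1) * s := by rw [hk]; field_simp; ring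
      rw [hs₁ hsI z hz, eS₂ s hsI z hz, e1, e2, e3, nlin, abs_mul, abs_of_pos (Real.exp_pos _),
        Real.mul_rpow (Real.exp_pos _).le (abs_nonneg _), ← Real.exp_mul]
      have e4 : Real.exp (-(k + 2) * s) * (Real.exp (k * s * (p - 1)) * Real.exp (k * s)) = 1 := by
        rw [← Real.exp_add, ← Real.exp_add, Real.exp_eq_one_iff]
        linear_combination s * hkp
      have e5 : -(k + 2) * s = -((k + 2) * s) := by ring
      rw [e5] at e4 ⊢
      linear_combination (|W s z| ^ (p - 1) * W s z) * e4
    rw [intervalIntegral.integral_congr_ae hRHS, intervalIntegral.integral_sub iR iQ] at hE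
    rw [hsum t₁ m₁, hsum t₂ m₂]
    linarith [hwψ χ hχs (hχt.trans hs) t₁ t₂ h₁ h₁₂ h₂]

end FromSolution

/-! ### Change of variables and lower bound for the rescaled energy. -/

section RescaledEnergy

variable {N : ℕ} {p q γ k α δ r l s M : ℝ} {f : ℝ → ℝ}

lemma ae_comp_smul {P : Eucl N → Prop} (hl : 0 < l) (hlr : l ≤ r)
    (h : ∀ᵐ z ∂volume.restrict (Metric.ball (0 : Eucl N) r), P z) :
    ∀ᵐ y ∂ballMeas N α, P (l • y) := by
  rw [ae_restrict_iff' Metric.isOpen_ball.measurableSet] at h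
  have h1 := (Measure.quasiMeasurePreserving_smul (volume : Measure (Eucl N)) hl.ne').ae h
  filter_upwards [((ballMeas_ac (N := N) α).trans Measure.restrict_le_self.absolutelyContinuous).ae_le h1,
    ae_ballMeas_mem α] with y hy hm
  refine hy ?_
  rw [mem_ball_zero_iff, norm_smul, Real.norm_of_nonneg hl.le]
  rw [mem_unitBall] at hm
  nlinarith

lemma rescEnergy_congr {Γ : ℝ → ℝ} {w w' A A' : ℝ → Eucl N → ℝ} {G G' : Fin N → ℝ → Eucl N → ℝ}
    (hl : 0 < Real.exp (-s) - δ) (hlr : 1 - δ * Real.exp s ≤ r)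
    (hw : w s =ᵐ[volume.restrict (Metric.ball 0 r)] w' s)
    (hA : A s =ᵐ[volume.restrict (Metric.ball 0 r)] A' s)
    (hG : ∀ i, G i s =ᵐ[volume.restrict (Metric.ball 0 r)] G' i s) :
    rescEnergy N k p γ α δ Γ w A G s = rescEnergy N k p γ α δ Γ w' A' G' s := by
  have hl := one_sub_pos_of hl
  refine integral_congr_ae ?_
  filter_upwards [ae_comp_smul hl hlr hw, ae_comp_smul hl hlr hA,
    ae_all_iff.2 fun i => ae_comp_smul hl hlr (hG i)] with y h1 h2 h3
  simp only [rescV, resc, h1, h2, h3]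

/-- Change of variables for a function which is integrable over the unit ball. -/
lemma integrable_comp_smul_ballMeas (hα : 0 ≤ α) (hl : 0 < l) (hl1 : l ≤ 1) {u : Eucl N → ℝ}
    (hu : IntegrableOn u (unitBall N)) (hu0 : ∀ z, 0 ≤ u z) :
    Integrable (fun y => u (l • y)) (ballMeas N α) ∧
      ∫ y, u (l • y) ∂ballMeas N α ≤ (l ^ N)⁻¹ * ∫ z in unitBall N, u z := by
  have h0 : Integrable ((unitBall N).indicator u) := (integrable_indicator_iff measurableSet_unitBall).2 hu
  have h1 := h0.comp_smul hl.ne'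
  have hle := (ballMeas_le (N := N) hα).trans Measure.restrict_le_self
  have e : (fun y => u (l • y)) =ᵐ[ballMeas N α] fun y => (unitBall N).indicator u (l • y) := by
    filter_upwards [ae_ballMeas_mem α] with y hy
    rw [indicator_of_mem]
    rw [mem_unitBall] at hy ⊢
    rw [norm_smul, Real.norm_of_nonneg hl.le]
    nlinarith [norm_nonneg y]
  refine ⟨(h1.mono_measure hle).congr e.symm, ?_⟩
  rw [integral_congr_ae e]
  refine (integral_mono_measure hle (.of_forall fun y => indicator_nonneg (fun z _ => hu0 z) _) h1).trans ?_
  rw [Measure.integral_comp_smul_of_nonneg _ _ l (hR := hl.le), integral_indicator measurableSet_unitBall,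
    finrank_euclideanSpace_fin, smul_eq_mul]

/-- The quadratic part is nonnegative: the radial derivative is dominated by the gradient, and `η w
v` is absorbed by `½ v² + ½ k(k+1) w²` when `η² ≤ k(k+1)`. This holds near the vertex, where `η`
tends to `0`. -/
lemma energyDensity_nonneg_add {c w v : ℝ} {g : Fin N → ℝ} {y : Eucl N} {Γ : ℝ → ℝ}
    (hy : y ∈ unitBall N) (hc : (c ^ γ) ^ 2 ≤ k * (k + 1)) :
    -(Real.exp ((p + 3) / (2 * γ) * c ^ γ) * (c ^ (2 * (k + 1)) * Γ (c ^ (-k) * w))) ≤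
      energyDensity k p γ c Γ w v g y := by
  have h1 := sq_sum_coord_mul_le y g
  have h2 : ‖y‖ ^ 2 ≤ 1 := by linarith [one_sub_pos hy]
  have h3 : 0 ≤ ∑ i, g i ^ 2 := Finset.sum_nonneg fun i _ => sq_nonneg _
  have h4 : 0 ≤ linDensity (k * (k + 1)) w v g y - c ^ γ * (w * v) := by
    unfold linDensity
    nlinarith [sq_nonneg (v - c ^ γ * w), mul_le_mul_of_nonneg_right hc (sq_nonneg w),
      mul_le_mul_of_nonneg_right h2 h3]
  unfold energyDensity
  nlinarith [mul_nonneg (Real.exp_pos ((p + 3) / (2 * γ) * c ^ γ)).le h4]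

lemma abs_npot_le (hp : 1 < p) (hq₀ : 0 ≤ q) (hq : q < p) (hM : 0 < M)
    (hf : ∀ x, |f x| ≤ M * (1 + |x| ^ q)) (x : ℝ) :
    |npot p f x| ≤ (1 + 2 * M) * (1 + 2 * |x| ^ (p + 1)) := by
  have h1 := abs_integral_f_le hq₀ hM hf x
  have h2 := rpow_le_one_add_rpow (abs_nonneg x) zero_le_one (by linarith : 1 ≤ p + 1)
  have h3 := rpow_le_one_add_rpow (abs_nonneg x) (by linarith) (by linarith : q + 1 ≤ p + 1)
  rw [Real.rpow_one] at h2
  have h4 := Real.rpow_nonneg (abs_nonneg x) (p + 1)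
  have h5 : 1 / (p + 1) * |x| ^ (p + 1) ≤ 1 * |x| ^ (p + 1) := by
    refine mul_le_mul_of_nonneg_right ?_ h4
    rw [div_le_one (by linarith)]; linarith
  have h6 : 0 ≤ 1 / (p + 1) * |x| ^ (p + 1) := mul_nonneg (by positivity) h4
  have h7 := abs_add_le (1 / (p + 1) * |x| ^ (p + 1)) (∫ t in (0 : ℝ)..x, f t)
  rw [abs_of_nonneg h6] at h7
  unfold npot
  nlinarith [mul_le_mul_of_nonneg_left (add_le_add h2 h3) hM.le]

/-- A lower bound for the rescaled energy which vanishes as the vertex of the cone is approached. -/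
lemma rescEnergy_lower_bound (hα : 0 ≤ α) (hγ : 0 < γ) (hp : 1 < p) (hk : k = 2 / (p - 1)) (hq₀ : 0 ≤ q) (hq : q < p) (hM : 0 < M)
    (hf : ∀ x, |f x| ≤ M * (1 + |x| ^ q)) {w A : ℝ → Eucl N → ℝ} {G : Fin N → ℝ → Eucl N → ℝ}
    (hc : 0 < Real.exp (-s) - δ) (hδ : 0 ≤ δ) (hc1 : Real.exp (-s) - δ ≤ 1)
    (hck : ((Real.exp (-s) - δ) ^ γ) ^ 2 ≤ k * (k + 1))
    (hw : IntegrableOn (fun z => |w s z| ^ (p + 1)) (unitBall N)) :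
    -(Real.exp ((p + 3) / (2 * γ)) * (1 + 2 * M) * ((Real.exp (-s) - δ) ^ (2 * (k + 1)) *
      (ballMeas N α).real univ + 2 * ((1 - δ * Real.exp s) ^ (2 * (k + 1) - N) *
        ∫ z in unitBall N, |w s z| ^ (p + 1)))) ≤ rescEnergy N k p γ α δ (npot p f) w A G s := by
  have hfin := isFiniteMeasure_ballMeas (N := N) hα
  have hl := one_sub_pos_of hc
  set c := Real.exp (-s) - δ with hcd
  set l := 1 - δ * Real.exp s with hld
  have hl1 : l ≤ 1 := by rw [hld]; nlinarith [Real.exp_pos s]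
  have hk0 : 0 < k := by rw [hk]; exact div_pos two_pos (by linarith)
  have hkp : k * (p + 1) = 2 * (k + 1) := by
    have : p - 1 ≠ 0 := by linarith
    rw [hk]; field_simp; ring
  obtain ⟨hi, hle⟩ := integrable_comp_smul_ballMeas (α := α) hα hl hl1 hw fun z =>
    Real.rpow_nonneg (abs_nonneg _) _
  set Z := Real.exp ((p + 3) / (2 * γ)) * (1 + 2 * M) with hZ
  have hZ0 : 0 < Z := by positivity
  have hpt : ∀ y ∈ unitBall N, -(Z * (c ^ (2 * (k + 1)) + 2 * (l ^ (2 * (k + 1)) * |w s (l • y)| ^ (p + 1)))) ≤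
      energyDensity k p γ c (npot p f) (resc δ k w s y) (rescV k δ w A G s y)
        (fun i => resc δ (k + 1) (G i) s y) y := by
    intro y hy
    refine le_trans (neg_le_neg ?_) (energyDensity_nonneg_add hy hck)
    set X := c ^ (-k) * resc δ k w s y with hX
    have hm : 0 < c ^ (2 * (k + 1)) := Real.rpow_pos_of_pos hc _
    have hXp : c ^ (2 * (k + 1)) * |X| ^ (p + 1) = l ^ (2 * (k + 1)) * |w s (l • y)| ^ (p + 1) := by
      rw [hX, resc, ← hld, abs_mul, abs_mul, abs_of_pos (Real.rpow_pos_of_pos hc _),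
        abs_of_pos (Real.rpow_pos_of_pos hl _),
        Real.mul_rpow (by positivity) (by positivity), Real.mul_rpow (by positivity) (by positivity),
        ← Real.rpow_mul hc.le, ← Real.rpow_mul hl.le, neg_mul, hkp, ← mul_assoc, ← mul_assoc,
        ← Real.rpow_add hc, add_neg_cancel, Real.rpow_zero, one_mul]
    have hN := abs_npot_le hp hq₀ hq hM hf X
    have he : Real.exp ((p + 3) / (2 * γ) * c ^ γ) ≤ Real.exp ((p + 3) / (2 * γ)) := by
      refine Real.exp_le_exp.2 (mul_le_of_le_one_right (by positivity) (Real.rpow_le_one hc.le hc1 hγ.le))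
    calc _ ≤ Real.exp ((p + 3) / (2 * γ) * c ^ γ) * (c ^ (2 * (k + 1)) *
          ((1 + 2 * M) * (1 + 2 * |X| ^ (p + 1)))) := by
            gcongr; exact (le_abs_self _).trans hN
      _ ≤ Real.exp ((p + 3) / (2 * γ)) * (c ^ (2 * (k + 1)) *
          ((1 + 2 * M) * (1 + 2 * |X| ^ (p + 1)))) := by gcongr
      _ = _ := by rw [← hXp, hZ]; ring
  -- The gain `λ^{2(k+1)}` comes from the scaling of the potential and the loss `λ^{-N}` from the
  -- change of variables.
  have hpow : l ^ (2 * (k + 1)) * (l ^ N)⁻¹ = l ^ (2 * (k + 1) - N) := by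
    rw [Real.rpow_sub hl, Real.rpow_natCast, div_eq_mul_inv]
  have hlow : -(Z * (c ^ (2 * (k + 1)) * (ballMeas N α).real univ + 2 * (l ^ (2 * (k + 1) - N) *
        ∫ z in unitBall N, |w s z| ^ (p + 1)))) ≤
      ∫ y, -(Z * (c ^ (2 * (k + 1)) + 2 * (l ^ (2 * (k + 1)) * |w s (l • y)| ^ (p + 1)))) ∂ballMeas N α := by
    rw [integral_neg, integral_const_mul, integral_add (integrable_const _) ((hi.const_mul _).const_mul 2),
      integral_const_mul, integral_const_mul, integral_const, smul_eq_mul, ← hpow, mul_assoc (_ ^ _),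
      mul_comm ((ballMeas N α).real univ)]
    have := mul_le_mul_of_nonneg_left hle (Real.rpow_nonneg hl.le (2 * (k + 1)))
    gcongr
  -- If the density is not integrable, its integral is `0` by convention, and the bound holds
  -- because its left side is not positive.
  by_cases hint : Integrable (fun y => energyDensity k p γ c (npot p f) (resc δ k w s y)
      (rescV k δ w A G s y) (fun i => resc δ (k + 1) (G i) s y) y) (ballMeas N α)
  · refine hlow.trans (integral_mono_ae ?_ hint ?_)
    · exact (((integrable_const _).add ((hi.const_mul _).const_mul 2)).const_mul Z).neg
    · filter_upwards [ae_ballMeas_mem α] with y hy using hpt y hy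
  · rw [rescEnergy, integral_undef hint, neg_nonpos]
    have : 0 ≤ ∫ z in unitBall N, |w s z| ^ (p + 1) :=
      integral_nonneg fun z => Real.rpow_nonneg (abs_nonneg _) _
    positivity

end RescaledEnergy

/-! ### The rescaled energy in the original variables. -/

section VertexLimit

variable {N : ℕ} {p q γ k α δ r l s M : ℝ} {f : ℝ → ℝ}

/-- The energy density in the original variables, after a dilation with factor `l`, where `a = l^k`. -/
noncomputable def dilDensity (k a l η m w v g2 D P : ℝ) : ℝ :=
  1 / 2 * (a * (l * v - (1 - l) * (k * w + D))) ^ 2 + 1 / 2 * (a ^ 2 * (l ^ 2 * g2 - D ^ 2))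
    + 1 / 2 * (k * (k + 1)) * (a * w) ^ 2 - η * (a * w * (a * (l * v - (1 - l) * (k * w + D)))) - m * P

/-- For `|z| < λ` one has `(y·∇w)² ≤ λ²|∇w|²`, hence `(1-λ)²(y·∇w)² ≤ (1-λ²)|∇w|² ≤ |∇w|² -
(y·∇w)²`. So every gradient term, including the radial one created by the dilation, is bounded by
`|∇w|² - (y·∇w)²`. Convergence of the integral `E₀` supplies the integrability of that quantity; the
norm of `ℋ` controls only `(1-|y|²)|∇w|²`. -/
lemma abs_dilDensity_le {a η m w v g2 D P r2 : ℝ} (hk : 0 < k) (ha0 : 0 ≤ a) (ha : a ≤ 1) (hl0 : 0 ≤ l)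
    (hl : l ≤ 1) (hη0 : 0 ≤ η) (hη : η ≤ 1) (hm0 : 0 ≤ m) (hm : m ≤ 1) (hD : D ^ 2 ≤ r2 * g2)
    (hr : r2 ≤ l ^ 2) (hg : 0 ≤ g2) :
    |dilDensity k a l η m w v g2 D P| ≤
      (5 + 5 * k ^ 2 + k) * (w ^ 2 + v ^ 2 + (g2 - D ^ 2) + |P|) := by
  set V := a * (l * v - (1 - l) * (k * w + D)) with hV
  have hl2 : l ^ 2 ≤ 1 := pow_le_one₀ hl0 hl
  have ha2 : a ^ 2 ≤ 1 := pow_le_one₀ ha0 ha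
  have h1 : D ^ 2 ≤ l ^ 2 * g2 := hD.trans (mul_le_mul_of_nonneg_right hr hg)
  have h2 : l ^ 2 * g2 ≤ g2 := mul_le_of_le_one_left hg hl2
  have h3 : (1 - l) ^ 2 * D ^ 2 ≤ g2 - D ^ 2 := by
    have e : (1 - l) ^ 2 ≤ 1 - l ^ 2 := by nlinarith
    have e1 : (1 - l) ^ 2 * D ^ 2 ≤ (1 - l ^ 2) * g2 :=
      mul_le_mul e (h1.trans h2) (sq_nonneg _) (by linarith)
    linarith
  have hVle : V ^ 2 ≤ 2 * v ^ 2 + 4 * k ^ 2 * w ^ 2 + 4 * (g2 - D ^ 2) := by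
    have e1 : V ^ 2 ≤ (l * v - (1 - l) * (k * w + D)) ^ 2 := by
      rw [hV, mul_pow]; exact mul_le_of_le_one_left (sq_nonneg _) ha2
    have e2 : (l * v) ^ 2 ≤ v ^ 2 := by rw [mul_pow]; exact mul_le_of_le_one_left (sq_nonneg _) hl2
    have e3 : ((1 - l) * (k * w)) ^ 2 ≤ k ^ 2 * w ^ 2 := by
      rw [mul_pow, ← mul_pow k]
      exact mul_le_of_le_one_left (sq_nonneg _) (pow_le_one₀ (by linarith) (by linarith))
    nlinarith [sq_nonneg (l * v + (1 - l) * (k * w + D)), sq_nonneg ((1 - l) * (k * w) - (1 - l) * D)]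
  have haw : (a * w) ^ 2 ≤ w ^ 2 := by rw [mul_pow]; exact mul_le_of_le_one_left (sq_nonneg _) ha2
  have hx : |η * (a * w * V)| ≤ 1 / 2 * (w ^ 2 + V ^ 2) := by
    rw [abs_mul, abs_of_nonneg hη0]
    refine (mul_le_of_le_one_left (abs_nonneg _) hη).trans ?_
    rw [abs_le]
    constructor <;> nlinarith [sq_nonneg (a * w - V), sq_nonneg (a * w + V)]
  have hP : |m * P| ≤ |P| := by
    rw [abs_mul, abs_of_nonneg hm0]; exact mul_le_of_le_one_left (abs_nonneg _) hm
  have hG0 : 0 ≤ a ^ 2 * (l ^ 2 * g2 - D ^ 2) := mul_nonneg (sq_nonneg _) (by linarith)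
  have hG1 : a ^ 2 * (l ^ 2 * g2 - D ^ 2) ≤ g2 - D ^ 2 :=
    (mul_le_of_le_one_left (by linarith) ha2).trans (by linarith)
  have hkw : k * (k + 1) * (a * w) ^ 2 ≤ k * (k + 1) * w ^ 2 :=
    mul_le_mul_of_nonneg_left haw (by positivity)
  have hkw0 : 0 ≤ k * (k + 1) * (a * w) ^ 2 := by positivity
  have p1 := mul_nonneg (by positivity : 0 ≤ 5 * k ^ 2 + k) (sq_nonneg v)
  have p2 := mul_nonneg (by positivity : 0 ≤ 5 * k ^ 2 + k) (by linarith : 0 ≤ g2 - D ^ 2)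
  have p3 := mul_nonneg (by positivity : 0 ≤ 5 * k ^ 2 + k) (abs_nonneg P)
  have p4 := mul_nonneg (by positivity : 0 ≤ k ^ 2 + k) (sq_nonneg w)
  rw [abs_le] at hx hP
  have : dilDensity k a l η m w v g2 D P = 1 / 2 * V ^ 2 + 1 / 2 * (a ^ 2 * (l ^ 2 * g2 - D ^ 2))
    + 1 / 2 * (k * (k + 1) * (a * w) ^ 2) - η * (a * w * V) - m * P := by
    rw [dilDensity, hV]; ring
  have e : (5 + 5 * k ^ 2 + k) * (w ^ 2 + v ^ 2 + (g2 - D ^ 2) + |P|) =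
      5 * w ^ 2 + 5 * v ^ 2 + 5 * (g2 - D ^ 2) + 5 * |P| + (5 * k ^ 2 + k) * w ^ 2 +
      ((5 * k ^ 2 + k) * v ^ 2 + (5 * k ^ 2 + k) * (g2 - D ^ 2) + (5 * k ^ 2 + k) * |P|) := by ring
  have hw0 := sq_nonneg w
  have hv0 := sq_nonneg v
  have hP0 := abs_nonneg P
  have hV0 := sq_nonneg V
  rw [this, abs_le, e]
  constructor <;> linarith

open scoped Pointwise in
/-- The rescaled energy, as an integral in the original variables. -/
lemma rescEnergy_eq {Γ : ℝ → ℝ} {w v : ℝ → Eucl N → ℝ} {G : Fin N → ℝ → Eucl N → ℝ}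
    (hc : 0 < Real.exp (-s) - δ) (hδ : 0 ≤ δ) :
    rescEnergy N k p γ α δ Γ w (fun s z => v s z + k * w s z + ∑ i, z i * G i s z) G s =
      Real.exp ((p + 3) / (2 * γ) * (Real.exp (-s) - δ) ^ γ) * (((1 - δ * Real.exp s) ^ N)⁻¹ *
        ∫ z in unitBall N, (Metric.ball 0 (1 - δ * Real.exp s)).indicator (fun z =>
          dilDensity k ((1 - δ * Real.exp s) ^ k) (1 - δ * Real.exp s) ((Real.exp (-s) - δ) ^ γ)
            ((Real.exp (-s) - δ) ^ (2 * (k + 1))) (w s z) (v s z) (∑ i, G i s z ^ 2)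
            (∑ i, z i * G i s z) (Γ (Real.exp (k * s) * w s z)) *
            (1 - ‖z‖ ^ 2 / (1 - δ * Real.exp s) ^ 2) ^ α) z) := by
  have hl := one_sub_pos_of hc
  have hcl : Real.exp (-s) - δ = (1 - δ * Real.exp s) * Real.exp (-s) := by
    rw [one_sub_mul_exp, div_mul_cancel₀ _ (Real.exp_pos _).ne']
  set c := Real.exp (-s) - δ with hcd
  set l := 1 - δ * Real.exp s with hld
  have hl1 : l ≤ 1 := by rw [hld]; nlinarith [Real.exp_pos s]
  have hX : c ^ (-k) * l ^ k = Real.exp (k * s) := by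
    rw [hcl, Real.mul_rpow hl.le (Real.exp_pos _).le, Real.rpow_neg hl.le, ← Real.exp_mul]
    have := (Real.rpow_pos_of_pos hl k).ne'
    field_simp
  unfold rescEnergy energyDensity
  simp only [← hcd]
  rw [integral_const_mul, integral_ballMeas]
  congr 1
  set Φ : Eucl N → ℝ := fun z => dilDensity k (l ^ k) l (c ^ γ) (c ^ (2 * (k + 1))) (w s z) (v s z)
    (∑ i, G i s z ^ 2) (∑ i, z i * G i s z) (Γ (Real.exp (k * s) * w s z)) *
      (1 - ‖z‖ ^ 2 / l ^ 2) ^ α with hΦ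
  have e1 : ∀ y : Eucl N, (linDensity (k * (k + 1)) (resc δ k w s y)
      (rescV k δ w (fun s z => v s z + k * w s z + ∑ i, z i * G i s z) G s y)
      (fun i => resc δ (k + 1) (G i) s y) y - c ^ γ * (resc δ k w s y *
        rescV k δ w (fun s z => v s z + k * w s z + ∑ i, z i * G i s z) G s y)
      - c ^ (2 * (k + 1)) * Γ (c ^ (-k) * resc δ k w s y)) * (1 - ‖y‖ ^ 2) ^ α = Φ (l • y) := by
    intro y
    have h1 : ‖l • y‖ ^ 2 / l ^ 2 = ‖y‖ ^ 2 := by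
      rw [norm_smul, mul_pow, Real.norm_eq_abs, sq_abs]; field_simp
    have h2 : c ^ (-k) * resc δ k w s y = Real.exp (k * s) * w s (l • y) := by
      rw [resc, ← mul_assoc, hX]
    have h3 : ∑ i, (l • y) i * G i s (l • y) = l * ∑ i, y i * G i s (l • y) := by
      rw [Finset.mul_sum]
      exact Finset.sum_congr rfl fun i _ => by rw [PiLp.smul_apply, smul_eq_mul]; ring
    have h4 : ∑ i, y i * resc δ (k + 1) (G i) s y = l ^ k * (l * ∑ i, y i * G i s (l • y)) := by
      simp only [Finset.mul_sum, resc, ← hld, Real.rpow_add_one hl.ne']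
      exact Finset.sum_congr rfl fun i _ => by ring
    have h5 : ∑ i, resc δ (k + 1) (G i) s y ^ 2 = (l ^ k) ^ 2 * (l ^ 2 * ∑ i, G i s (l • y) ^ 2) := by
      simp only [Finset.mul_sum, resc, ← hld, Real.rpow_add_one hl.ne']
      exact Finset.sum_congr rfl fun i _ => by ring
    rw [h2]
    simp only [hΦ, h1]
    congr 1
    unfold linDensity dilDensity
    rw [rescV, h4, h5, h3]
    simp only [resc, ← hld, h3, Real.rpow_add_one hl.ne']
    ring
  have e2 : l • unitBall N = Metric.ball 0 l := by
    rw [unitBall, smul_ball hl.ne', smul_zero, Real.norm_of_nonneg hl.le, mul_one]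
  simp only [e1]
  rw [Measure.setIntegral_comp_smul_of_pos volume Φ _ hl, e2, finrank_euclideanSpace_fin, smul_eq_mul,
    setIntegral_indicator Metric.isOpen_ball.measurableSet, unitBall, inter_eq_right.2 (Metric.ball_subset_ball hl1)]

end VertexLimit

/-! ### Convergence of the cone energies as the vertex shift tends to zero. -/

section EnergyLimit

variable {N : ℕ} {p q s M : ℝ} {f : ℝ → ℝ} {w v : Eucl N → ℝ}

lemma sum_mul_eq_inner (y g : Eucl N) : ∑ i, y i * g i = inner ℝ y g := by
  rw [PiLp.inner_apply]
  exact Finset.sum_congr rfl fun i _ => by simp [mul_comm]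

lemma wRho_le_one (hα : 0 ≤ wAlpha N p) {y : Eucl N} (hy : y ∈ unitBall N) : wRho N p y ≤ 1 :=
  Real.rpow_le_one (one_sub_pos hy).le (by linarith [sq_nonneg ‖y‖]) hα

lemma MemH.integrableOn_sq (h : MemH N p w v) :
    IntegrableOn (fun y => w y ^ 2 * wRho N p y) (unitBall N) ∧
      IntegrableOn (fun y => v y ^ 2 * wRho N p y) (unitBall N) := by
  have hm : AEStronglyMeasurable (wRho N p) (volume.restrict (unitBall N)) :=
    (measurable_weight _).aestronglyMeasurable
  constructor
  · refine h.2.2.2.mono' ((h.1.pow 2).mul hm) ?_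
    filter_upwards [ae_restrict_mem measurableSet_unitBall] with y hy
    have h1 := wRho_pos (p := p) hy
    rw [Real.norm_of_nonneg (by positivity), hDensity]
    have := mul_nonneg (sq_nonneg ‖weakGrad N w y‖) (one_sub_pos hy).le
    exact mul_le_mul_of_nonneg_right (by nlinarith [sq_nonneg (v y)]) h1.le
  · refine h.2.2.2.mono' ((h.2.1.pow 2).mul hm) ?_
    filter_upwards [ae_restrict_mem measurableSet_unitBall] with y hy
    have h1 := wRho_pos (p := p) hy
    rw [Real.norm_of_nonneg (by positivity), hDensity]
    have := mul_nonneg (sq_nonneg ‖weakGrad N w y‖) (one_sub_pos hy).le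
    exact mul_le_mul_of_nonneg_right (by nlinarith [sq_nonneg (w y)]) h1.le

lemma MemH.integrableOn_mul (h : MemH N p w v) :
    IntegrableOn (fun y => w y * v y * wRho N p y) (unitBall N) := by
  refine (h.integrableOn_sq.1.add h.integrableOn_sq.2).mono'
    ((h.1.mul h.2.1).mul (measurable_weight _).aestronglyMeasurable) ?_
  filter_upwards [ae_restrict_mem measurableSet_unitBall] with y hy
  have h1 := wRho_pos (p := p) hy
  rw [Real.norm_eq_abs, abs_mul, abs_of_pos h1, Pi.add_apply, ← add_mul]
  refine mul_le_mul_of_nonneg_right ?_ h1.le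
  rw [abs_le]
  constructor <;> nlinarith [sq_nonneg (w y - v y), sq_nonneg (w y + v y)]

lemma IntegrableOn.mul_wRho (hα : 0 ≤ wAlpha N p) {u : Eucl N → ℝ} (hu : IntegrableOn u (unitBall N)) :
    IntegrableOn (fun y => u y * wRho N p y) (unitBall N) := by
  refine hu.norm.mono' (hu.1.mul (measurable_weight _).aestronglyMeasurable) ?_
  filter_upwards [ae_restrict_mem measurableSet_unitBall] with y hy
  rw [norm_mul, Real.norm_of_nonneg (wRho_pos hy).le]
  exact mul_le_of_le_one_right (norm_nonneg _) (wRho_le_one hα hy)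

lemma continuous_npot (hp : 1 < p) (hf : LocallyLipschitz f) : Continuous (npot p f) :=
  continuous_iff_continuousAt.2 fun x => (hasDerivAt_npot hp hf x).continuousAt

lemma integrableOn_npot (hp : 1 < p) (hq₀ : 0 ≤ q) (hq : q < p) (hM : 0 < M) (hf : LocallyLipschitz f)
    (hfb : ∀ x, |f x| ≤ M * (1 + |x| ^ q))
    (hw : AEStronglyMeasurable w (volume.restrict (unitBall N)))
    (hLp : IntegrableOn (fun y => |w y| ^ (p + 1)) (unitBall N)) (c : ℝ) :
    IntegrableOn (fun y => npot p f (c * w y)) (unitBall N) := by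
  have := isFiniteMeasure_unitBall (N := N)
  refine Integrable.mono' (((integrable_const 1).add ((hLp.const_mul (|c| ^ (p + 1))).const_mul 2)).const_mul
    (1 + 2 * M)) ((continuous_npot hp hf).comp_aestronglyMeasurable (hw.const_mul c)) (.of_forall fun y => ?_)
  refine (abs_npot_le hp hq₀ hq hM hfb _).trans_eq ?_
  rw [abs_mul, Real.mul_rpow (abs_nonneg _) (abs_nonneg _)]
  rfl

/-- The gradient part of the energy is integrable once the energy integral converges. -/
lemma integrableOn_gradPart (hα : 0 ≤ wAlpha N p) (h : MemH N p w v)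
    (hLp : IntegrableOn (fun y => |w y| ^ (p + 1)) (unitBall N))
    (hE : IntegrableOn (e0Density N p w v) (unitBall N)) :
    IntegrableOn (fun y => (‖weakGrad N w y‖ ^ 2 - (inner ℝ y (weakGrad N w y)) ^ 2) * wRho N p y)
      (unitBall N) := by
  have h1 := (((hE.sub (h.integrableOn_sq.2.const_mul (1 / 2))).sub
    (h.integrableOn_sq.1.const_mul ((p + 1) / (p - 1) ^ 2))).add
    ((IntegrableOn.mul_wRho hα hLp).const_mul (1 / (p + 1)))).const_mul 2
  refine Integrable.congr h1 (.of_forall fun y => ?_)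
  simp only [Pi.add_apply, Pi.sub_apply, e0Density]
  ring

/-- The sum of the energy integrals, as the integral of a single density. -/
lemma integral_limitDensity (hα : 0 ≤ wAlpha N p) (hp : 1 < p) (hq₀ : 0 ≤ q) (hq : q < p) (hM : 0 < M)
    (hf : LocallyLipschitz f) (hfb : ∀ x, |f x| ≤ M * (1 + |x| ^ q)) (h : MemH N p w v)
    (hLp : IntegrableOn (fun y => |w y| ^ (p + 1)) (unitBall N))
    (hE : IntegrableOn (e0Density N p w v) (unitBall N)) :
    ∫ y in unitBall N, dilDensity (2 / (p - 1)) 1 1 (Real.exp (-s) ^ wGamma p q)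
        (Real.exp (-s) ^ (2 * (2 / (p - 1) + 1))) (w y) (v y) (∑ i, weakGrad N w y i ^ 2)
        (∑ i, y i * weakGrad N w y i) (npot p f (Real.exp (2 / (p - 1) * s) * w y)) * wRho N p y =
      E0 N p w v + energyI N p f s w + energyJ N p q s w v := by
  have hp1 : p - 1 ≠ 0 := by linarith
  have hp2 : p + 1 ≠ 0 := by linarith
  set k := 2 / (p - 1) with hk
  have hkp : k * (p + 1) = 2 * (k + 1) := by rw [hk]; field_simp; ring
  have hκ : (p + 1) / (p - 1) ^ 2 = 1 / 2 * (k * (k + 1)) := by rw [hk]; field_simp; ring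
  set m := Real.exp (-s) ^ (2 * (k + 1)) with hm
  have e1 : Real.exp (-(2 * (p + 1) * s / (p - 1))) = m := by
    rw [hm, ← Real.exp_mul, hk]; congr 1; field_simp; ring
  have e2 : Real.exp (2 * s / (p - 1)) = Real.exp (k * s) := by
    rw [hk]; congr 1; ring
  have e3 : Real.exp (-(wGamma p q * s)) = Real.exp (-s) ^ wGamma p q := by
    rw [← Real.exp_mul]; congr 1; ring
  have e4 : m * Real.exp (k * s) ^ (p + 1) = 1 := by
    rw [hm, ← Real.exp_mul, ← Real.exp_mul, ← Real.exp_add, ← hkp]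
    convert! Real.exp_zero using 2; ring
  have hpow : ∀ x : ℝ, m * npot p f (Real.exp (k * s) * x) = 1 / (p + 1) * |x| ^ (p + 1)
      + m * ∫ t in (0 : ℝ)..Real.exp (k * s) * x, f t := by
    intro x
    rw [npot, abs_mul, abs_of_pos (Real.exp_pos _), Real.mul_rpow (Real.exp_pos _).le (abs_nonneg _)]
    linear_combination (1 / (p + 1) * |x| ^ (p + 1)) * e4
  have iF : IntegrableOn (fun y => (∫ t in (0 : ℝ)..Real.exp (k * s) * w y, f t) * wRho N p y)
      (unitBall N) := by
    refine IntegrableOn.mul_wRho hα ?_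
    refine Integrable.congr ((integrableOn_npot hp hq₀ hq hM hf hfb h.1 hLp (Real.exp (k * s))).sub
      (hLp.const_mul (1 / (p + 1) * Real.exp (k * s) ^ (p + 1)))) (.of_forall fun y => ?_)
    simp only [Pi.sub_apply, npot]
    rw [abs_mul, abs_of_pos (Real.exp_pos _), Real.mul_rpow (Real.exp_pos _).le (abs_nonneg _)]
    ring
  rw [E0, energyI, energyJ, e1, e2, e3, ← integral_const_mul, ← integral_const_mul,
    ← integral_add' hE (iF.const_mul _), ← integral_add' (hE.add (iF.const_mul _))
      (h.integrableOn_mul.const_mul _)]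
  refine integral_congr_ae (.of_forall fun y => ?_)
  simp only [Pi.add_apply, e0Density, dilDensity]
  rw [hpow, sum_mul_eq_inner, ← norm_sq_eq_sum, hκ]
  ring

set_option maxHeartbeats 600000 in
/-- As the vertex tends to infinity, the rescaled energies converge to the energy. -/
lemma rescEnergy_tendsto (hα : 0 < wAlpha N p) (hγ : 0 < wGamma p q) (hp : 1 < p) (hq₀ : 0 ≤ q)
    (hq : q < p) (hM : 0 < M) (hf : LocallyLipschitz f) (hfb : ∀ x, |f x| ≤ M * (1 + |x| ^ q))
    {w v : ℝ → Eucl N → ℝ} (hs : 0 ≤ s) (h : MemH N p (w s) (v s))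
    (hLp : IntegrableOn (fun y => |w s y| ^ (p + 1)) (unitBall N))
    (hE : IntegrableOn (e0Density N p (w s) (v s)) (unitBall N)) :
    Tendsto (fun δ => rescEnergy N (2 / (p - 1)) p (wGamma p q) (wAlpha N p) δ (npot p f) w
        (fun s z => v s z + 2 / (p - 1) * w s z + ∑ i, z i * weakGrad N (w s) z i)
        (fun i s z => weakGrad N (w s) z i) s) (𝓝[>] 0)
      (𝓝 ((E0 N p (w s) (v s) + energyI N p f s (w s) + energyJ N p q s (w s) (v s)) *
        Real.exp ((p + 3) / (2 * wGamma p q) * Real.exp (-(wGamma p q * s))))) := by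
  rw [← integral_limitDensity hα.le hp hq₀ hq hM hf hfb h hLp hE]
  set k := 2 / (p - 1) with hk
  have hk0 : 0 < k := div_pos two_pos (by linarith)
  set γ := wGamma p q
  set α := wAlpha N p
  have hle : 𝓝[>] (0 : ℝ) ≤ 𝓝 0 := nhdsWithin_le_nhds
  have tl : Tendsto (fun δ => 1 - δ * Real.exp s) (𝓝[>] 0) (𝓝 1) := by
    have : Continuous fun δ : ℝ => 1 - δ * Real.exp s := by fun_prop
    exact ((this.tendsto' 0 1 (by simp))).mono_left hle
  have tc : Tendsto (fun δ => Real.exp (-s) - δ) (𝓝[>] 0) (𝓝 (Real.exp (-s))) := by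
    have : Continuous fun δ : ℝ => Real.exp (-s) - δ := by fun_prop
    exact ((this.tendsto' 0 _ (by simp))).mono_left hle
  have tcp : ∀ j : ℝ, Tendsto (fun δ => (Real.exp (-s) - δ) ^ j) (𝓝[>] 0) (𝓝 (Real.exp (-s) ^ j)) :=
    fun j => tc.rpow_const (Or.inl (Real.exp_pos _).ne')
  have ta : Tendsto (fun δ => (1 - δ * Real.exp s) ^ k) (𝓝[>] 0) (𝓝 1) := by
    simpa using tl.rpow_const (p := k) (Or.inl one_ne_zero)
  have hev : ∀ᶠ δ in 𝓝[>] (0 : ℝ), 0 < δ ∧ 0 < Real.exp (-s) - δ :=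
    (eventually_mem_nhdsWithin.mono fun _ h => h).and (tc.eventually (lt_mem_nhds (Real.exp_pos _)))
  -- The majorant does not depend on `δ`: the dilated density is controlled by `abs_dilDensity_le`,
  -- and the dilated weight `(1 - |z|²/λ²)^α` is at most `ρ` inside the ball of radius `λ`.
  have hdens := tendsto_integral_filter_of_dominated_convergence (l := 𝓝[>] (0 : ℝ))
    (μ := volume.restrict (unitBall N))
    (F := fun δ => (Metric.ball 0 (1 - δ * Real.exp s)).indicator (fun z =>
          dilDensity k ((1 - δ * Real.exp s) ^ k) (1 - δ * Real.exp s) ((Real.exp (-s) - δ) ^ γ)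
            ((Real.exp (-s) - δ) ^ (2 * (k + 1))) (w s z) (v s z) (∑ i, weakGrad N (w s) z i ^ 2)
            (∑ i, z i * weakGrad N (w s) z i) (npot p f (Real.exp (k * s) * w s z)) *
            (1 - ‖z‖ ^ 2 / (1 - δ * Real.exp s) ^ 2) ^ α))
    (f := fun z => dilDensity k 1 1 (Real.exp (-s) ^ γ) (Real.exp (-s) ^ (2 * (k + 1))) (w s z) (v s z)
      (∑ i, weakGrad N (w s) z i ^ 2) (∑ i, z i * weakGrad N (w s) z i)
      (npot p f (Real.exp (k * s) * w s z)) * wRho N p z)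
    (fun z => (5 + 5 * k ^ 2 + k) * (w s z ^ 2 * wRho N p z + v s z ^ 2 * wRho N p z
      + (‖weakGrad N (w s) z‖ ^ 2 - (inner ℝ z (weakGrad N (w s) z)) ^ 2) * wRho N p z
      + |npot p f (Real.exp (k * s) * w s z)| * wRho N p z)) ?_ ?_ ?_ ?_
  · have h1 := (tl.pow N).inv₀ (by simp)
    have h2 := ((Real.continuous_exp.tendsto _).comp ((tcp γ).const_mul ((p + 3) / (2 * γ)))).mul
      (h1.mul hdens)
    rw [one_pow, inv_one, one_mul] at h2
    rw [show -(γ * s) = -s * γ by ring, Real.exp_mul (-s) γ,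
      mul_comm _ (Real.exp ((p + 3) / (2 * γ) * _))]
    refine h2.congr' ?_
    filter_upwards [hev] with δ hδ
    rw [rescEnergy_eq (G := fun i s z => weakGrad N (w s) z i) hδ.2 hδ.1.le]
    rfl
  · refine .of_forall fun δ => AEStronglyMeasurable.indicator (AEMeasurable.aestronglyMeasurable ?_)
      Metric.isOpen_ball.measurableSet
    obtain ⟨G, hG⟩ := h.2.2.1
    have mw := h.1.aemeasurable
    have mv := h.2.1.aemeasurable
    have mG := hG.weakGrad.aestronglyMeasurable.aemeasurable
    have mGi : ∀ i, AEMeasurable (fun z => weakGrad N (w s) z i) (volume.restrict (unitBall N)) :=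
      fun i => (by fun_prop : Measurable fun x : Eucl N => x i).comp_aemeasurable mG
    have m1 : AEMeasurable (fun z => ∑ i, weakGrad N (w s) z i ^ 2) (volume.restrict (unitBall N)) :=
      Finset.aemeasurable_fun_sum _ fun i _ => (mGi i).pow_const 2
    have m2 : AEMeasurable (fun z => ∑ i, z i * weakGrad N (w s) z i) (volume.restrict (unitBall N)) :=
      Finset.aemeasurable_fun_sum _ fun i _ =>
        (by fun_prop : Measurable fun x : Eucl N => x i).aemeasurable.mul (mGi i)
    have m3 : AEMeasurable (fun z => npot p f (Real.exp (k * s) * w s z)) (volume.restrict (unitBall N)) :=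
      (continuous_npot hp hf).measurable.comp_aemeasurable (mw.const_mul _)
    unfold dilDensity
    fun_prop
  · filter_upwards [hev] with δ hδ
    filter_upwards [ae_restrict_mem measurableSet_unitBall] with z hz
    have hl := one_sub_pos_of hδ.2
    set l := 1 - δ * Real.exp s with hl'
    have hl1 : l ≤ 1 := by rw [hl']; nlinarith [Real.exp_pos s, hδ.1]
    have hc1 : Real.exp (-s) - δ ≤ 1 := by
      have : Real.exp (-s) ≤ 1 := Real.exp_le_one_iff.2 (by linarith)
      linarith [hδ.1]
    have hR := wRho_pos (p := p) hz
    have hQ : (inner ℝ z (weakGrad N (w s) z)) ^ 2 ≤ ‖z‖ ^ 2 * ‖weakGrad N (w s) z‖ ^ 2 := by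
      rw [← mul_pow, ← sq_abs]
      exact pow_le_pow_left₀ (abs_nonneg _) (abs_real_inner_le_norm _ _) 2
    have hz1 := one_sub_pos hz
    simp only [← add_mul, sum_mul_eq_inner, ← norm_sq_eq_sum, ← mul_assoc]
    by_cases hzl : z ∈ Metric.ball (0 : Eucl N) l
    · rw [indicator_of_mem hzl, norm_mul, Real.norm_eq_abs, Real.norm_eq_abs]
      rw [mem_ball_zero_iff] at hzl
      have hz2 : ‖z‖ ^ 2 ≤ l ^ 2 := pow_le_pow_left₀ (norm_nonneg _) hzl.le 2
      have hz3 : ‖z‖ ^ 2 ≤ ‖z‖ ^ 2 / l ^ 2 :=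
        le_div_self (sq_nonneg _) (by positivity) (pow_le_one₀ hl.le hl1)
      have hz4 : ‖z‖ ^ 2 / l ^ 2 ≤ 1 := (div_le_one (by positivity)).2 hz2
      refine mul_le_mul (abs_dilDensity_le hk0 (Real.rpow_nonneg hl.le _)
        (Real.rpow_le_one hl.le hl1 hk0.le) hl.le hl1 (Real.rpow_nonneg hδ.2.le _)
        (Real.rpow_le_one hδ.2.le hc1 hγ.le) (Real.rpow_nonneg hδ.2.le _)
        (Real.rpow_le_one hδ.2.le hc1 (by positivity)) hQ hz2 (sq_nonneg _)) ?_ (abs_nonneg _) ?_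
      · rw [abs_of_nonneg (Real.rpow_nonneg (by linarith) _)]
        exact Real.rpow_le_rpow (by linarith) (by linarith) hα.le
      · have : 0 ≤ ‖weakGrad N (w s) z‖ ^ 2 - (inner ℝ z (weakGrad N (w s) z)) ^ 2 := by
          nlinarith [sq_nonneg ‖weakGrad N (w s) z‖]
        positivity
    · rw [indicator_of_notMem hzl, norm_zero]
      have : 0 ≤ ‖weakGrad N (w s) z‖ ^ 2 - (inner ℝ z (weakGrad N (w s) z)) ^ 2 := by
        nlinarith [sq_nonneg ‖weakGrad N (w s) z‖]
      positivity
  · exact (((h.integrableOn_sq.1.add h.integrableOn_sq.2).add (integrableOn_gradPart hα.le h hLp hE)).add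
      (IntegrableOn.mul_wRho hα.le (integrableOn_npot hp hq₀ hq hM hf hfb h.1 hLp _).abs)).const_mul _
  · filter_upwards [ae_restrict_mem measurableSet_unitBall] with z hz
    have hcont : Continuous fun x : ℝ × ℝ × ℝ × ℝ => dilDensity k x.1 x.2.1 x.2.2.1 x.2.2.2 (w s z) (v s z)
        (∑ i, weakGrad N (w s) z i ^ 2) (∑ i, z i * weakGrad N (w s) z i)
        (npot p f (Real.exp (k * s) * w s z)) := by
      unfold dilDensity; fun_prop
    have t1 := (hcont.tendsto (1, 1, Real.exp (-s) ^ γ, Real.exp (-s) ^ (2 * (k + 1)))).comp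
      (ta.prodMk_nhds (tl.prodMk_nhds ((tcp γ).prodMk_nhds (tcp (2 * (k + 1))))))
    have t2 : Tendsto (fun δ => (1 - ‖z‖ ^ 2 / (1 - δ * Real.exp s) ^ 2) ^ α) (𝓝[>] 0) (𝓝 (wRho N p z)) := by
      have := (((tendsto_const_nhds (x := ‖z‖ ^ 2)).div (tl.pow 2) (by simp)).const_sub 1).rpow_const (p := α)
        (Or.inr hα.le)
      rwa [one_pow, div_one] at this
    refine (t1.mul t2).congr' ?_
    rw [mem_unitBall] at hz
    -- A fixed point of the unit ball lies inside the ball of radius `λ` once `δ` is small, so the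
    -- indicator disappears in the limit.
    filter_upwards [tl.eventually (lt_mem_nhds hz)] with δ hδ
    rw [indicator_of_mem (mem_ball_zero_iff.2 hδ)]
    rfl

end EnergyLimit

/-! ### Monotonicity of the cone energy and the contradiction at the vertex. -/

section BlowUp

variable {N : ℕ} {p q M s₀ T a b δ θ : ℝ} {f g : ℝ → ℝ} {w v w' v' : ℝ → Eucl N → ℝ}

lemma LocBddLp.exists_integral_le (h : LocBddLp N p s₀ T w) (hp : 1 < p)
    (hm : ∀ s ∈ Ico s₀ T, MemH N p (w s) (v s)) (hb : b < T) :
    ∃ K, 0 ≤ K ∧ ∀ s ∈ Icc s₀ b, IntegrableOn (fun y => |w s y| ^ (p + 1)) (unitBall N) ∧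
      ∫ y in unitBall N, |w s y| ^ (p + 1) ≤ K := by
  obtain ⟨C, hC⟩ := h b hb
  have hp0 : 0 < p + 1 := by linarith
  refine ⟨(C : ℝ) ^ (p + 1), by positivity, fun s hs => ?_⟩
  have hmem : MemLp (w s) (ENNReal.ofReal (p + 1)) (volume.restrict (unitBall N)) :=
    ⟨(hm s ⟨hs.1, hs.2.trans_lt hb⟩).1, (hC s hs).trans_lt ENNReal.coe_lt_top⟩
  have h0 : ENNReal.ofReal (p + 1) ≠ 0 := by simpa using hp0
  have h1 := hmem.integrable_norm_rpow h0 ENNReal.ofReal_ne_top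
  have h2 := hmem.eLpNorm_eq_integral_rpow_norm h0 ENNReal.ofReal_ne_top
  rw [ENNReal.toReal_ofReal hp0.le] at h1 h2
  refine ⟨h1, ?_⟩
  set I := ∫ y in unitBall N, ‖w s y‖ ^ (p + 1) with hI
  have hI0 : 0 ≤ I := integral_nonneg fun _ => by positivity
  have h3 := hC s hs
  rw [h2, ENNReal.ofReal_le_iff_le_toReal ENNReal.coe_ne_top, ENNReal.coe_toReal] at h3
  have h4 := Real.rpow_le_rpow (by positivity) h3 hp0.le
  rwa [← Real.rpow_mul hI0, inv_mul_cancel₀ hp0.ne', Real.rpow_one] at h4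

/-- The energy in the slices of the backward cone with a shifted vertex, together with the
correction term. -/
noncomputable def coneEnergy (N : ℕ) (p q : ℝ) (f : ℝ → ℝ) (θ δ : ℝ) (w v : ℝ → Eucl N → ℝ) (s : ℝ) : ℝ :=
  rescEnergy N (2 / (p - 1)) p (wGamma p q) (wAlpha N p) δ (npot p f) w
    (fun s z => v s z + 2 / (p - 1) * w s z + ∑ i, z i * weakGrad N (w s) z i)
    (fun i s z => weakGrad N (w s) z i) s + θ * (Real.exp (-s) - δ) ^ (2 * wGamma p q)

lemma coneEnergy_congr {s : ℝ} (hc : 0 < Real.exp (-s) - δ) (hδ : 0 ≤ δ) (hm : MemH N p (w s) (v s))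
    (hw : w' s =ᵐ[volume.restrict (unitBall N)] w s) (hv : v' s =ᵐ[volume.restrict (unitBall N)] v s) :
    coneEnergy N p q f θ δ w' v' s = coneEnergy N p q f θ δ w v s := by
  obtain ⟨G, hG⟩ := hm.2.2.1
  have hg := hG.weakGrad_congr hw.symm
  unfold coneEnergy
  congr 1
  refine rescEnergy_congr (r := 1) hc (by nlinarith [Real.exp_pos s]) hw ?_ fun i => ?_
  · filter_upwards [hw, hv, hg] with y h1 h2 h3
    simp only [h1, h2, h3]
  · filter_upwards [hg] with y h3
    simp only [h3]

lemma integrable_resc_rpow {k α s : ℝ} {w : ℝ → Eucl N → ℝ} (hα : 0 ≤ α)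
    (hc : 0 < Real.exp (-s) - δ) (hδ : 0 ≤ δ)
    (hLp : IntegrableOn (fun y => |w s y| ^ (p + 1)) (unitBall N)) :
    Integrable (fun y => |resc δ k w s y| ^ (p + 1)) (ballMeas N α) := by
  have hl := one_sub_pos_of hc
  have h1 := (integrable_comp_smul_ballMeas hα hl (by nlinarith [Real.exp_pos s]) hLp fun z =>
    Real.rpow_nonneg (abs_nonneg _) _).1.const_mul (|(1 - δ * Real.exp s) ^ k| ^ (p + 1))
  refine h1.congr (.of_forall fun y => ?_)
  simp only [resc, abs_mul]
  rw [Real.mul_rpow (abs_nonneg _) (abs_nonneg _)]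

/-- The cone energy of a solution does not increase. -/
theorem IsSolution.coneEnergy_le {c₀ C₀ η₀ C η₁ : ℝ} (h : IsSolution N p f g s₀ T w v)
    (hLp : LocBddLp N p s₀ T w) (hα : 0 < wAlpha N p) (hγ : 0 < wGamma p q)
    (hst : StaticIneq N (wAlpha N p) (2 / (p - 1)) p (wGamma p q) c₀ C₀ η₀) (hp : 1 < p) (hq₀ : 0 ≤ q)
    (hq : q < p) (hM : 0 < M) (hf : LocallyLipschitz f) (hg : LocallyLipschitz g)
    (hfb : ∀ x, |f x| ≤ M * (1 + |x| ^ q)) (hgb : ∀ x, |g x| ≤ M * (1 + |x|)) (hC : 0 ≤ C)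
    (hdiss : ∀ c : ℝ, 0 < c → c ≤ 1 → c ^ wGamma p q ≤ η₁ →
      ∀ (w v : ℝ) (g : Fin N → ℝ) (S₂ : ℝ) (y : Eucl N), y ∈ unitBall N →
      |S₂| ≤ M * (c ^ (2 / (p - 1) + 2) + c * |v + 2 / (p - 1) * w + ∑ i, y i * g i|) →
      dissDensity (2 / (p - 1)) p (wGamma p q) c₀ C₀ c (npot p f) (nlin p f) w v g
        (c ^ (2 / (p - 1) + 2) * nlin p f (c ^ (-(2 / (p - 1))) * w)) S₂ y ≤ C * (c ^ wGamma p q) ^ 2)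
    (hθ : C * (ballMeas N (wAlpha N p)).real univ * Real.exp ((p + 3) / (2 * wGamma p q)) /
      (2 * wGamma p q) ≤ θ)
    (hδ : 0 < δ) (ha : s₀ ≤ a) (ha0 : 0 ≤ a) (hab : a ≤ b) (hb : b < T) (hc : 0 < Real.exp (-b) - δ)
    (hη₀ : Real.exp (-a) ^ wGamma p q ≤ η₀) (hη₁ : Real.exp (-a) ^ wGamma p q ≤ η₁) :
    coneEnergy N p q f θ δ w v b ≤ coneEnergy N p q f θ δ w v a := by
  have hmono : ∀ s ∈ Icc a b, Real.exp (-b) ≤ Real.exp (-s) ∧ Real.exp (-s) ≤ Real.exp (-a) := fun s hs =>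
    ⟨Real.exp_le_exp.2 (by linarith [hs.2]), Real.exp_le_exp.2 (by linarith [hs.1])⟩
  have hma := hmono a ⟨le_rfl, hab⟩
  have hea : Real.exp (-a) * Real.exp a = 1 := by rw [← Real.exp_add]; simp
  have hea1 : Real.exp (-a) ≤ 1 := Real.exp_le_one_iff.2 (by linarith)
  have hδa : δ * Real.exp a < 1 := by rw [← hea]; gcongr; linarith [hma.1]
  have hδa0 : 0 < δ * Real.exp a := by positivity
  -- The dilation factor `1 - δ e^s` decreases in `s`, so its largest value is the one at `a`; `r`
  -- lies strictly between that value and `1`. The system is thus needed only on a ball strictly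
  -- inside the unit ball.
  set r := 1 - δ * Real.exp a / 2 with hr
  have hr0 : 0 < r := by linarith
  have hr1 : r < 1 := by linarith
  obtain ⟨W, V, G, hV⟩ := h.cont.exists_isVersion hα hr0 hr1 ha hab hb
  obtain ⟨S₁, S₂, hW⟩ := h.exists_nonlinWave hp hq₀ hq hM hf hg hfb hgb hr1 ha hab hb hV
  obtain ⟨K, -, hK⟩ := hLp.exists_integral_le hp (fun s hs => (h.cont s hs).1) hb
  have hcs : ∀ s ∈ Icc a b, 0 < Real.exp (-s) - δ := fun s hs => by linarith [(hmono s hs).1]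
  have hlr : ∀ s ∈ Icc a b, 1 - δ * Real.exp s ≤ r := fun s hs => by
    have : δ * Real.exp a ≤ δ * Real.exp s := by gcongr; exact hs.1
    linarith
  have hcongr : ∀ s ∈ Icc a b, rescEnergy N (2 / (p - 1)) p (wGamma p q) (wAlpha N p) δ (npot p f) W
      (fun s z => V s z + 2 / (p - 1) * W s z + ∑ i, z i * G i s z) G s =
      rescEnergy N (2 / (p - 1)) p (wGamma p q) (wAlpha N p) δ (npot p f) w
        (fun s z => v s z + 2 / (p - 1) * w s z + ∑ i, z i * weakGrad N (w s) z i)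
        (fun i s z => weakGrad N (w s) z i) s := by
    intro s hs
    refine rescEnergy_congr (hcs s hs) (hlr s hs) (hV.eW s hs) ?_ fun i => hV.eG i s hs
    filter_upwards [hV.eW s hs, hV.eV s hs, ae_all_iff.2 fun i => hV.eG i s hs] with z h1 h2 h3
    simp only [h1, h2, h3]
  have hint : ∀ s ∈ Icc a b, Integrable (fun y => |resc δ (2 / (p - 1)) W s y| ^ (p + 1))
      (ballMeas N (wAlpha N p)) := by
    intro s hs
    refine (integrable_resc_rpow (k := 2 / (p - 1)) hα.le (hcs s hs) hδ.le (hK s ⟨ha.trans hs.1, hs.2⟩).1).congr ?_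
    filter_upwards [ae_comp_smul (one_sub_pos_of (hcs s hs)) (hlr s hs) (hV.eW s hs)] with y hy
    rw [resc, resc, hy]
  have hpw : ∀ s ∈ Icc a b, (Real.exp (-s) - δ) ^ wGamma p q ≤ Real.exp (-a) ^ wGamma p q :=
    fun s hs => Real.rpow_le_rpow (hcs s hs).le (by linarith [(hmono s hs).2]) hγ.le
  have key := hW.lyapunov_le hα hγ hst hp hq₀ hq hM hf hfb hC hdiss hθ
    (fun s hs => ⟨hcs s hs, by
      have : Real.exp (-s) * (δ * Real.exp a) ≤ δ := by
        calc _ ≤ Real.exp (-a) * (δ * Real.exp a) := by gcongr; exact hs.1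
          _ = δ * (Real.exp (-a) * Real.exp a) := by ring
          _ = δ := by rw [hea, mul_one]
      rw [hr]; linarith⟩)
    (fun s hs => by linarith [(hmono s hs).2])
    (fun s hs => ⟨(hpw s hs).trans hη₀, (hpw s hs).trans hη₁⟩)
    (hint a ⟨le_rfl, hab⟩) (hint b ⟨hab, le_rfl⟩)
  rwa [hcongr a ⟨le_rfl, hab⟩, hcongr b ⟨hab, le_rfl⟩] at key

/-- The cone energy is asymptotically nonnegative at the vertex of the cone. -/
lemma IsSolution.not_coneEnergy_le (h : IsSolution N p f g s₀ T w v)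
    (hLp : LocBddLp N p s₀ T w) (hα : 0 < wAlpha N p) (hγ : 0 < wGamma p q) (hp : 1 < p) (hq₀ : 0 ≤ q)
    (hq : q < p) (hM : 0 < M) (hfb : ∀ x, |f x| ≤ M * (1 + |x| ^ q)) (hδ : 0 < δ) (ha : s₀ ≤ a)
    (ha0 : 0 ≤ a) (haδ : 0 < Real.exp (-a) - δ) (hT : -Real.log δ < T) {ε : ℝ} (hε : 0 < ε) :
    ¬ ∀ s ∈ Ico a (-Real.log δ), coneEnergy N p q f θ δ w v s ≤ -ε := by
  intro hneg
  set S := -Real.log δ with hS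
  have heS : Real.exp (-S) = δ := by rw [hS, neg_neg, Real.exp_log hδ]
  have haS : a < S := by
    have : Real.exp (-S) < Real.exp (-a) := by rw [heS]; linarith
    linarith [Real.exp_lt_exp.1 this]
  obtain ⟨K, hK0, hK⟩ := hLp.exists_integral_le hp (fun s hs => (h.cont s hs).1) hT
  set k := 2 / (p - 1) with hk
  have hk0 : 0 < k := div_pos two_pos (by linarith)
  -- The condition `α > 0` says `2k > N - 1`, so this exponent even exceeds `1`.
  have hexp : 0 < 2 * (k + 1) - N := by
    have : wAlpha N p = k - ((N : ℝ) - 1) / 2 := rfl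
    linarith
  have tc : Tendsto (fun s => Real.exp (-s) - δ) (𝓝[<] S) (𝓝 0) := by
    have : Continuous fun s : ℝ => Real.exp (-s) - δ := by fun_prop
    exact (this.tendsto' S 0 (by rw [heS, sub_self])).mono_left nhdsWithin_le_nhds
  have tl : Tendsto (fun s => 1 - δ * Real.exp s) (𝓝[<] S) (𝓝 0) := by
    have : Continuous fun s : ℝ => 1 - δ * Real.exp s := by fun_prop
    exact (this.tendsto' S 0 (by rw [← heS, ← Real.exp_add]; simp)).mono_left nhdsWithin_le_nhds
  have tpow : ∀ {φ : ℝ → ℝ} {j : ℝ}, 0 < j → Tendsto φ (𝓝[<] S) (𝓝 0) →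
      Tendsto (fun s => φ s ^ j) (𝓝[<] S) (𝓝 0) := fun hj ht => by
    simpa [Real.zero_rpow hj.ne'] using ht.rpow_const (Or.inr hj.le)
  -- At the vertex both `c` and `λ` tend to zero while the `L^{p+1}` norm stays below `K`, because
  -- the solution exists past that time. The lower bound for the cone energy therefore tends to
  -- zero.
  have t1 : Tendsto (fun s => -(Real.exp ((p + 3) / (2 * wGamma p q)) * (1 + 2 * M) *
      ((Real.exp (-s) - δ) ^ (2 * (k + 1)) * (ballMeas N (wAlpha N p)).real univ +
        2 * ((1 - δ * Real.exp s) ^ (2 * (k + 1) - N) * K))) + θ * (Real.exp (-s) - δ) ^ (2 * wGamma p q))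
      (𝓝[<] S) (𝓝 0) := by
    have := ((((tpow (by positivity : 0 < 2 * (k + 1)) tc).mul_const
      ((ballMeas N (wAlpha N p)).real univ)).add (((tpow hexp tl).mul_const K).const_mul 2)).const_mul
      (Real.exp ((p + 3) / (2 * wGamma p q)) * (1 + 2 * M))).neg.add
      ((tpow (by positivity : 0 < 2 * wGamma p q) tc).const_mul θ)
    simpa using this
  have hκ : ∀ᶠ s in 𝓝[<] S, ((Real.exp (-s) - δ) ^ wGamma p q) ^ 2 ≤ k * (k + 1) := by
    have := (tpow hγ tc).pow 2
    rw [zero_pow two_ne_zero] at this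
    exact (this.eventually (gt_mem_nhds (by positivity))).mono fun _ h => h.le
  have hI : ∀ᶠ s in 𝓝[<] S, s ∈ Ico a S := by
    filter_upwards [Ioo_mem_nhdsLT haS] with s hs using ⟨hs.1.le, hs.2⟩
  refine absurd (le_of_tendsto t1 (b := -ε) ?_) (by linarith)
  filter_upwards [hκ, hI] with s hs1 hs2
  refine le_trans ?_ (hneg s hs2)
  have hc : 0 < Real.exp (-s) - δ := by
    rw [← heS, sub_pos]; exact Real.exp_lt_exp.2 (by linarith [hs2.2])
  have hc1 : Real.exp (-s) ≤ 1 := Real.exp_le_one_iff.2 (by linarith [hs2.1])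
  have hKs := hK s ⟨ha.trans hs2.1, hs2.2.le⟩
  have hl := Real.rpow_nonneg (one_sub_pos_of hc).le (2 * (k + 1) - N)
  refine add_le_add (le_trans (neg_le_neg ?_) (rescEnergy_lower_bound hα.le hγ hp hk hq₀ hq hM hfb hc hδ.le
    (by linarith) hs1 hKs.1)) le_rfl
  have := mul_le_mul_of_nonneg_left hKs.2 hl
  gcongr

end BlowUp

/-! ### The blow-up criterion. -/

theorem lemma2p3 (N : ℕ) (hN : 1 ≤ N) (p q M : ℝ) (hp : 1 < p)
    (hpc : 2 ≤ N → p < 1 + 4 / ((N : ℝ) - 1)) (hq₀ : 0 ≤ q) (hq : q < p) (hM : 0 < M) :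
    ∃ θ₀ : ℝ, ∀ S₀ : ℝ, ∃ S₃ : ℝ, S₀ ≤ S₃ ∧ ∀ θ : ℝ, θ₀ ≤ θ →
      ∀ f g : ℝ → ℝ, LocallyLipschitz f → LocallyLipschitz g →
        (∀ x, |f x| ≤ M * (1 + |x| ^ q)) → (∀ x, |g x| ≤ M * (1 + |x|)) →
      ∀ (s₀ T : ℝ) (w v : ℝ → Eucl N → ℝ),
        IsSolution N p f g s₀ T w v → LocBddLp N p s₀ T w →
      ∀ s₃ : ℝ, max S₃ s₀ ≤ s₃ → s₃ < T →
        IntegrableOn (e0Density N p (w s₃) (v s₃)) (unitBall N) →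
        lyapunovH N p q f θ s₃ (w s₃) (v s₃) < 0 →
        ∃ S : ℝ, s₃ < S ∧ BlowsUpAt N p f g s₀ T w v S := by
  have hp1 : 0 < p - 1 := by linarith
  have hk : 0 < 2 / (p - 1) := div_pos two_pos hp1
  have hα : 0 < wAlpha N p := by
    rw [wAlpha, sub_pos]
    rcases hN.lt_or_eq with h2 | h1
    · have hN1 : (0 : ℝ) < N - 1 := by
        have : (1 : ℝ) < N := by exact_mod_cast h2
        linarith
      have h3 : p - 1 < 4 / ((N : ℝ) - 1) := by linarith [hpc h2]
      rw [lt_div_iff₀ hN1] at h3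
      rw [div_lt_div_iff₀ two_pos hp1]
      linarith
    · rw [← h1]; simpa using hp
  have hNk : (N : ℝ) + 2 * wAlpha N p = 2 * (2 / (p - 1)) + 1 := by rw [wAlpha]; ring
  have hγ : 0 < wGamma p q := lt_min (by norm_num) (div_pos (by linarith) hp1)
  have hγ1 : wGamma p q ≤ 1 / 2 := min_le_left _ _
  have hγ2 : 2 * wGamma p q ≤ 2 / (p - 1) * (p - q) := by
    have : wGamma p q ≤ (p - q) / (p - 1) := min_le_right _ _
    calc _ ≤ 2 * ((p - q) / (p - 1)) := by linarith
      _ = _ := by ring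
  obtain ⟨c₀, hc₀, C₀, hC₀, η₀, hη₀, -, hst⟩ :=
    static_energy_inequality (γ := wGamma p q) hN hα hk hp hNk
  obtain ⟨η₁, hη₁, C, hC, hdiss⟩ := dissDensity_le (N := N) hp hq₀ hq hM rfl hγ hγ1 hγ2 hc₀ hC₀
  set η := min η₀ η₁ with hη
  have hη_pos : 0 < η := lt_min hη₀ hη₁
  -- The value `θ₀` is the threshold of the monotonicity statement. Beyond `S₃` one has `s ≥ 0`, so
  -- that `c ≤ 1`, and `e^{-γ s} ≤ min η₀ η₁`, so that both smallness conditions hold along the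
  -- cone. Neither constant depends on the particular `f`, `g` or on `w`.
  refine ⟨C * (ballMeas N (wAlpha N p)).real univ * Real.exp ((p + 3) / (2 * wGamma p q)) /
    (2 * wGamma p q), fun S₀ => ⟨max S₀ (max 0 (-Real.log η / wGamma p q)), le_max_left _ _, ?_⟩⟩
  intro θ hθ f g hf hg hfb hgb s₀ T w v h hLp s₃ hs hs₃ hE hH
  simp only [max_le_iff] at hs
  obtain ⟨⟨-, hs0, hsη⟩, hss⟩ := hs
  have hηs : Real.exp (-s₃) ^ wGamma p q ≤ η := by
    rw [← Real.exp_mul, ← Real.le_log_iff_exp_le hη_pos]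
    rw [div_le_iff₀ hγ] at hsη
    linarith
  have hmem := (h.cont s₃ ⟨hss, hs₃⟩).1
  obtain ⟨K, -, hK⟩ := hLp.exists_integral_le hp (fun s hs => (h.cont s hs).1) hs₃
  have tcone : Tendsto (fun δ => coneEnergy N p q f θ δ w v s₃) (𝓝[>] 0)
      (𝓝 (lyapunovH N p q f θ s₃ (w s₃) (v s₃))) := by
    refine (rescEnergy_tendsto hα hγ hp hq₀ hq hM hf hfb hs0 hmem (hK s₃ ⟨hss, le_rfl⟩).1 hE).add ?_
    rw [show -(2 * wGamma p q * s₃) = -s₃ * (2 * wGamma p q) by ring, Real.exp_mul]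
    have hc : Continuous fun δ : ℝ => Real.exp (-s₃) - δ := by fun_prop
    exact (((hc.tendsto' 0 _ (sub_zero _)).mono_left nhdsWithin_le_nhds).rpow_const
      (Or.inl (Real.exp_pos _).ne')).const_mul θ
  -- The strict inequality `H < 0` survives a small shift of the vertex; `δ < e^{-s₃}` keeps the
  -- shifted vertex later than `s₃`.
  obtain ⟨δ, hneg, hδ, hδs⟩ := ((tcone.eventually (gt_mem_nhds hH)).and
    (Ioo_mem_nhdsGT (Real.exp_pos (-s₃)))).exists
  set X := {T' : ℝ | T ≤ T' ∧ ∃ w' v' : ℝ → Eucl N → ℝ, IsSolution N p f g s₀ T' w' v' ∧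
    LocBddLp N p s₀ T' w' ∧ ∀ s ∈ Ico s₀ T, w' s =ᵐ[volume.restrict (unitBall N)] w s ∧
      v' s =ᵐ[volume.restrict (unitBall N)] v s} with hX
  have hTX : T ∈ X := ⟨le_rfl, w, v, h, hLp, fun s _ => ⟨EventuallyEq.rfl, EventuallyEq.rfl⟩⟩
  -- The same `δ` works for every extension, because the cone energy at `s₃` depends only on the
  -- almost everywhere class of the data there.
  have hbdd : ∀ T' ∈ X, T' ≤ -Real.log δ := by
    rintro T' ⟨hTT', w', v', h', hLp', hagree⟩
    by_contra! hlt
    have hcong := coneEnergy_congr (f := f) (q := q) (θ := θ) (sub_pos.2 hδs) hδ.le hmem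
      (hagree s₃ ⟨hss, hs₃⟩).1 (hagree s₃ ⟨hss, hs₃⟩).2
    refine h'.not_coneEnergy_le (θ := θ) hLp' hα hγ hp hq₀ hq hM hfb hδ hss hs0 (sub_pos.2 hδs) hlt
      (neg_pos.2 hneg) fun s hsI => ?_
    rw [neg_neg, ← hcong]
    refine h'.coneEnergy_le hLp' hα hγ hst hp hq₀ hq hM hf hg hfb hgb hC
      (fun c hc hc1 hcη => hdiss c hc hc1 hcη f hfb) hθ hδ hss hs0 hsI.1 (hsI.2.trans hlt) ?_
      (hηs.trans (min_le_left _ _)) (hηs.trans (min_le_right _ _))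
    rw [sub_pos, ← Real.log_lt_iff_lt_exp hδ]
    linarith [hsI.2]
  exact ⟨sSup X, hs₃.trans_le (le_csSup ⟨_, hbdd⟩ hTX), isLUB_csSup ⟨T, hTX⟩ ⟨_, hbdd⟩⟩
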